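/- **Setting.** Let $k$ be a field, let $\pi\colon E\to B$ be a Serre fibration with $B$ simply connected, let $b_0\in B$ and $F=\pi^{-1}(b_0)$. Let $C_*(-)$ be the normalized singular $k$-chains (singular chains modulo degenerate simplices), with the chain-level coproduct (diagonal followed by the Alexander–Whitney map) $$\triangle(\sigma)=\sum_{j=0}^{n}(\sigma\circ[0,\dots,j])\otimes(\sigma\circ[j,\dots,n])\qquad(\sigma\text{ an }n\text{-simplex}).$$ *Spectral sequence.* The Serre filtration $F^p\subseteq C=C_*(E)$ is spanned by the simplices $\alpha$ such that $\pi\circ\alpha=\beta\circ s$ for a codegeneracy $s\colon[n]\to[m]$ with $m\le p$. Write $F^p_n=F^p\cap C_n$ (and likewise for $C\otimes C$, filtered by $\sum_{a+b=p}F^a\otimes F^b$), and put $E^r_{p,q}=(Z^r_{p,q}+F^{p-1}_{p+q})/(B^{r-1}_{p,q}+F^{p-1}_{p+q})$ with $Z^r_{p,q}=F^p_{p+q}\cap\partial^{-1}(F^{p-r}_{p+q-1})$ and $B^r_{p,q}=F^p_{p+q}\cap\partial(F^{p+r}_{p+q+1})$. Let $E^r=\bigoplus_{p,q}E^r_{p,q}$.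 This is the homological Serre spectral sequence. *Identification of the $E^2$ page.* Let $H_*(B;H_*(F))$ be the homology of $C_*(B)\otimes H_*(F)$ with boundary $\partial\otimes 1$. Let $C_p(B;C_q(F))\subseteq C_q(E)\otimes C_p(B)$ be spanned by the $U\otimes V$ with $V\colon\Delta^p\to B$ and $U\colon\Delta^q\to\pi^{-1}(V(*))$, where $V(*)$ is the initial vertex of $V$. Its homology with respect to the boundary of the fibers is identified with $C_p(B)\otimes H_q(F)$ by sending $c\otimes V$, for a cycle $c$ of $\pi^{-1}(V(*))$, to $(-1)^{pq}\,V\otimes[c]$, where $[c]$ is transported to $H_q(F)$ along any path from $V(*)$ to $b_0$. There are maps $$\phi^{p,q}\colon C_{p+q}(E)\to C_q(E)\otimes C_p(B),\qquad \alpha\mapsto(\alpha\circ[0,\dots,q])\otimes(\pi\circ\alpha\circ[q,\dots,p+q]),$$ and, in the other direction, $$\psi\colon C_p(B;C_q(F))\to C_{p+q}(E),\qquad \psi(U\otimes V)=\sum_{(\mu,\sigma)}\operatorname{sgn}(\mu,\sigma)\;G_{U,V}\circ(\mu,\sigma),$$ the sum being over the $(q,p)$ shuffles of the Eilenberg–Zilber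 map, where the $G_{U,V}\colon\Delta^q\times\Delta^p\to E$ are any chosen maps, natural in $U$, with $\pi\circ G_{U,V}=V\circ\mathrm{pr}_2$ and $G_{U,V}(x,*)=U(x)$ (here $*$ is the initial vertex of $\Delta^p$). **Theorem.** 1. The Künneth maps $H_*(F)\otimes H_*(F)\to H(C_*(F)\otimes C_*(F))$, $H_*(B;H_*(F))^{\otimes2}\to H\big((C_*(B)\otimes H_*(F))^{\otimes2}\big)$ and $E^2\otimes E^2\to E^2(C\otimes C)$ are isomorphisms. By means of them $\triangle$ induces comultiplications $\triangle_F$ on $H_*(F)$ and $\triangle^2$ on $E^2$, and the chain map $$C_*(B)\otimes H_*(F)\xrightarrow{\ \triangle_B\otimes\triangle_F\ }C_*(B)^{\otimes2}\otimes H_*(F)^{\otimes2}\longrightarrow(C_*(B)\otimes H_*(F))^{\otimes2},$$ whose second arrow is $(a\otimes b)\otimes(c\otimes d)\mapsto(-1)^{|b||c|}(a\otimes c)\otimes(b\otimes d)$ and in which $\triangle_B$ is the chain-level coproduct of $C_*(B)$, induces a comultiplication $\triangle_B\mathbin{\widetilde\otimes}\triangle_F$ on $H_*(B;H_*(F))$.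 2. The maps $\phi^{p,q}$ induce an isomorphism $\Phi\colon E^2\to H_*(B;H_*(F))$. Choices of $G_{U,V}$ as above exist, and for every such choice $\psi$ induces the inverse map $\Psi\colon H_*(B;H_*(F))\to E^2$ of $\Phi$. 3. For every such choice, the comultiplication $\nabla^2=(\Phi\otimes\Phi)\circ\triangle^2\circ\Psi$ induced on the $E^2$ page by $\nabla^0=(\phi\otimes\phi)\circ\triangle\circ\psi$ agrees with the coproduct of $H_*(B;H_*(F))$: $$\nabla^2=\triangle_B\mathbin{\widetilde\otimes}\triangle_F .$$ -/

import Mathlib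

universe u v w w'

namespace SerreSS

open CategoryTheory Simplicial Opposite TensorProduct

/-! ### Differential graded modules -/

/-- A differential module with the sign operator `sgn` of its grading (`sgn x = (-1)ⁿ x` for `x` of
degree `n`), which is what the Koszul signs need. -/
structure DG (k : Type v) [Field k] (M : Type w) [AddCommGroup M] [Module k M] where
  d : M →ₗ[k] M
  sgn : M →ₗ[k] M
  d_d : ∀ x, d (d x) = 0
  sgn_sgn : ∀ x, sgn (sgn x) = x
  d_sgn : ∀ x, d (sgn x) = -sgn (d x)

section DG

variable {k : Type v} [Field k] {M : Type w} [AddCommGroup M] [Module k M]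
  {N : Type w'} [AddCommGroup N] [Module k N]

/-- The tensor product, with differential `d ⊗ 1 + (-1)^a (1 ⊗ d)` on elements of left degree `a`. -/
def DG.tensor (A : DG k M) (A' : DG k N) : DG k (M ⊗[k] N) where
  d := TensorProduct.map A.d LinearMap.id + TensorProduct.map A.sgn A'.d
  sgn := TensorProduct.map A.sgn A'.sgn
  d_d x := by
    induction x with
    | zero => simp
    | add x y hx hy => rw [map_add, map_add, hx, hy, add_zero]
    | tmul x y => simp [A.d_d, A'.d_d, A.d_sgn, TensorProduct.neg_tmul]
  sgn_sgn x := by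
    induction x with
    | zero => simp
    | add x y hx hy => rw [map_add, map_add, hx, hy]
    | tmul x y => simp [A.sgn_sgn, A'.sgn_sgn]
  d_sgn x := by
    induction x with
    | zero => simp
    | add x y hx hy => simp only [map_add, hx, hy, neg_add]
    | tmul x y =>
      simp [A.sgn_sgn, A.d_sgn, A'.d_sgn, TensorProduct.neg_tmul, TensorProduct.tmul_neg]
      abel

theorem DG.tensor_d_tmul (A : DG k M) (A' : DG k N) (x : M) (y : N) :
    (A.tensor A').d (x ⊗ₜ y) = A.d x ⊗ₜ y + A.sgn x ⊗ₜ A'.d y := rfl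

/-- The tensor product with a graded module `Γ` (with sign operator `s`) without differential:
the differential is `d ⊗ 1`. -/
def DG.coeff (A : DG k M) (s : N →ₗ[k] N) (hs : ∀ x, s (s x) = x) : DG k (M ⊗[k] N) where
  d := TensorProduct.map A.d LinearMap.id
  sgn := TensorProduct.map A.sgn s
  d_d x := by
    induction x with
    | zero => simp
    | add x y hx hy => rw [map_add, map_add, hx, hy, add_zero]
    | tmul x y => simp [A.d_d]
  sgn_sgn x := by
    induction x with
    | zero => simp
    | add x y hx hy => rw [map_add, map_add, hx, hy]
    | tmul x y => simp [A.sgn_sgn, hs]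
  d_sgn x := by
    induction x with
    | zero => simp
    | add x y hx hy => simp only [map_add, hx, hy, neg_add]
    | tmul x y => simp [A.d_sgn, TensorProduct.neg_tmul]

/-- The (total) homology: cycles modulo boundaries. -/
abbrev DG.Homology (A : DG k M) : Type w :=
  LinearMap.ker A.d ⧸ (LinearMap.range A.d).submoduleOf (LinearMap.ker A.d)

/-- The homology class of a cycle. -/
def DG.cls (A : DG k M) : LinearMap.ker A.d →ₗ[k] A.Homology := Submodule.mkQ _

/-- The sign operator on homology. -/
def DG.homologySgn (A : DG k M) : A.Homology →ₗ[k] A.Homology :=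
  Submodule.mapQ _ _
    (A.sgn.restrict (p := LinearMap.ker A.d) (q := LinearMap.ker A.d) (fun x hx => by
      rw [LinearMap.mem_ker] at hx ⊢
      rw [A.d_sgn, hx, map_zero, neg_zero]))
    (by
      rintro ⟨x, hx⟩ ⟨y, hy⟩
      refine ⟨-A.sgn y, ?_⟩
      change A.d y = x at hy
      change A.d (-A.sgn y) = A.sgn x
      rw [map_neg, A.d_sgn, neg_neg, hy])

theorem DG.homologySgn_sgn (A : DG k M) (x : A.Homology) :
    A.homologySgn (A.homologySgn x) = x := by
  obtain ⟨x, rfl⟩ := Submodule.mkQ_surjective _ x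
  change Submodule.Quotient.mk _ = Submodule.Quotient.mk _
  congr 1
  exact Subtype.ext (A.sgn_sgn x.1)

/-- The cross product of two cycles. -/
def DG.cycleCross (A : DG k M) (A' : DG k N) :
    LinearMap.ker A.d →ₗ[k] LinearMap.ker A'.d →ₗ[k] LinearMap.ker (A.tensor A').d :=
  LinearMap.mk₂ k (fun x y => ⟨x.1 ⊗ₜ y.1, by
      have hx := x.2
      have hy := y.2
      rw [LinearMap.mem_ker] at hx hy ⊢
      simp [DG.tensor, hx, hy]⟩)
    (fun _ _ _ => Subtype.ext (TensorProduct.add_tmul _ _ _))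
    (fun _ _ _ => Subtype.ext (TensorProduct.smul_tmul' _ _ _).symm)
    (fun _ _ _ => Subtype.ext (TensorProduct.tmul_add _ _ _))
    (fun _ _ _ => Subtype.ext (TensorProduct.tmul_smul _ _ _))

/-- The canonical map `H(A) ⊗ H(A') → H(A ⊗ A')`, `[x] ⊗ [y] ↦ [x ⊗ y]`, of the Künneth theorem. -/
def DG.homologyCross (A : DG k M) (A' : DG k N) :
    A.Homology ⊗[k] A'.Homology →ₗ[k] (A.tensor A').Homology :=
  TensorProduct.lift <|
    Submodule.liftQ _
      (LinearMap.flip <| Submodule.liftQ _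
        (((A.cycleCross A').compr₂ (A.tensor A').cls).flip)
        (by
          rintro ⟨y, hy⟩ ⟨z, hz⟩
          change A'.d z = y at hz
          ext ⟨x, hx⟩
          rw [LinearMap.mem_ker] at hx
          change Submodule.Quotient.mk _ = Submodule.Quotient.mk _
          rw [Submodule.Quotient.eq, sub_zero]
          refine ⟨A.sgn x ⊗ₜ z, ?_⟩
          change A.d (A.sgn x) ⊗ₜ[k] z + A.sgn (A.sgn x) ⊗ₜ[k] A'.d z = x ⊗ₜ[k] y
          rw [A.d_sgn, hx, A.sgn_sgn, hz, map_zero, neg_zero, TensorProduct.zero_tmul, zero_add]))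
      (by
        rintro ⟨x, hx⟩ ⟨z, hz⟩
        change A.d z = x at hz
        rw [LinearMap.mem_ker]
        refine LinearMap.ext fun y => ?_
        obtain ⟨⟨y, hy⟩, rfl⟩ := Submodule.mkQ_surjective _ y
        rw [LinearMap.mem_ker] at hy
        change Submodule.Quotient.mk _ = Submodule.Quotient.mk _
        rw [Submodule.Quotient.eq, sub_zero]
        refine ⟨z ⊗ₜ y, ?_⟩
        change A.d z ⊗ₜ[k] y + A.sgn z ⊗ₜ[k] A'.d y = x ⊗ₜ[k] y
        rw [hy, hz, TensorProduct.tmul_zero, add_zero])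

/-- `Δ` is the comultiplication on `H(A)` induced by the map `D : A → A ⊗ A`, i.e. the composition of
`H(D) : H(A) → H(A ⊗ A)` with the inverse of the Künneth isomorphism. -/
def DG.IsHomologyComult (A : DG k M) (D : M →ₗ[k] M ⊗[k] M)
    (Δ : A.Homology →ₗ[k] A.Homology ⊗[k] A.Homology) : Prop :=
  ∀ x : LinearMap.ker A.d, ∃ h : D x ∈ LinearMap.ker (A.tensor A).d,
    A.homologyCross A (Δ (A.cls x)) = (A.tensor A).cls ⟨D x, h⟩

end DG

/-! ### Filtered differential graded modules and their spectral sequences -/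

/-- A filtered differential graded module: submodules `gr n` of elements of degree `n` and an
increasing filtration `filt`. -/
structure FDG (k : Type v) [Field k] (M : Type w) [AddCommGroup M] [Module k M]
    extends DG k M where
  gr : ℤ → Submodule k M
  filt : ℤ → Submodule k M
  sgn_gr : ∀ n, ∀ x ∈ gr n, sgn x = (n.negOnePow : ℤ) • x
  d_gr : ∀ n, ∀ x ∈ gr n, d x ∈ gr (n - 1)
  d_filt : ∀ p, ∀ x ∈ filt p, d x ∈ filt p
  sgn_filt : ∀ p, ∀ x ∈ filt p, sgn x ∈ filt p
  filt_mono : Monotone filt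

section FDG

variable {k : Type v} [Field k] {M : Type w} [AddCommGroup M] [Module k M]
  {N : Type w'} [AddCommGroup N] [Module k N]

theorem tmul_mem_iSup {F : ℤ → Submodule k M} {G : ℤ → Submodule k N} {n : ℤ} (a b : ℤ)
    (h : a + b = n) {x : M} {y : N} (hx : x ∈ F a) (hy : y ∈ G b) :
    x ⊗ₜ[k] y ∈ ⨆ a : ℤ, Submodule.map₂ (TensorProduct.mk k M N) (F a) (G (n - a)) := by
  obtain rfl : b = n - a := by lia
  exact Submodule.mem_iSup_of_mem a (Submodule.apply_mem_map₂ _ hx hy)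

theorem iSup_map₂_induction {F : ℤ → Submodule k M} {G : ℤ → Submodule k N} {n : ℤ}
    {P : Submodule k (M ⊗[k] N)}
    (h : ∀ a, ∀ x ∈ F a, ∀ y ∈ G (n - a), x ⊗ₜ[k] y ∈ P) :
    (⨆ a : ℤ, Submodule.map₂ (TensorProduct.mk k M N) (F a) (G (n - a))) ≤ P :=
  iSup_le fun a => Submodule.map₂_le.2 fun x hx y hy => h a x hx y hy

/-- The tensor product: elements of degree `n` are sums of `x ⊗ y` with `deg x + deg y = n`, and the
`p`-th filtration step is `∑_{a + b = p} Fᵃ ⊗ Fᵇ`. -/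
def FDG.tensor (A : FDG k M) (A' : FDG k N) : FDG k (M ⊗[k] N) where
  toDG := A.toDG.tensor A'.toDG
  gr n := ⨆ a : ℤ, Submodule.map₂ (TensorProduct.mk k M N) (A.gr a) (A'.gr (n - a))
  filt p := ⨆ a : ℤ, Submodule.map₂ (TensorProduct.mk k M N) (A.filt a) (A'.filt (p - a))
  sgn_gr n x hx := by
    refine sub_eq_zero.1 (LinearMap.mem_ker.1 (iSup_map₂_induction
      (P := LinearMap.ker ((A.toDG.tensor A'.toDG).sgn - (n.negOnePow : ℤ) • LinearMap.id))
      (fun a x hx y hy => ?_) hx))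
    rw [LinearMap.mem_ker]
    change A.sgn x ⊗ₜ[k] A'.sgn y - (n.negOnePow : ℤ) • (x ⊗ₜ[k] y) = 0
    have e : n.negOnePow = (n - a).negOnePow * a.negOnePow := by
      rw [← Int.negOnePow_add]; congr 1; ring
    rw [A.sgn_gr a x hx, A'.sgn_gr _ y hy, e, Units.val_mul, mul_smul, sub_eq_zero,
      ← TensorProduct.smul_tmul, TensorProduct.smul_tmul', TensorProduct.smul_tmul']
  d_gr n x hx := by
    refine Submodule.mem_comap.1 (iSup_map₂_induction
      (P := Submodule.comap (A.toDG.tensor A'.toDG).d _) (fun a x hx y hy => ?_) hx)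
    rw [Submodule.mem_comap, DG.tensor_d_tmul]
    refine add_mem (tmul_mem_iSup (a - 1) (n - a) (by lia) (A.d_gr _ _ hx) hy)
      (tmul_mem_iSup a (n - a - 1) (by lia) ?_ (A'.d_gr _ _ hy))
    rw [A.sgn_gr a x hx]
    exact zsmul_mem hx _
  d_filt p x hx := by
    refine Submodule.mem_comap.1 (iSup_map₂_induction
      (P := Submodule.comap (A.toDG.tensor A'.toDG).d _) (fun a x hx y hy => ?_) hx)
    rw [Submodule.mem_comap, DG.tensor_d_tmul]
    exact add_mem (tmul_mem_iSup a (p - a) (by lia) (A.d_filt _ _ hx) hy)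
      (tmul_mem_iSup a (p - a) (by lia) (A.sgn_filt _ _ hx) (A'.d_filt _ _ hy))
  sgn_filt p x hx := by
    refine Submodule.mem_comap.1 (iSup_map₂_induction
      (P := Submodule.comap (A.toDG.tensor A'.toDG).sgn _) (fun a x hx y hy => ?_) hx)
    exact tmul_mem_iSup a (p - a) (by lia) (A.sgn_filt _ _ hx) (A'.sgn_filt _ _ hy)
  filt_mono p p' h := iSup_mono fun a =>
    Submodule.map₂_le_map₂_right (A'.filt_mono (by lia))

/-- `Fᵖₙ`: the elements of degree `n` in the `p`-th filtration step. -/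
def FDG.deg (A : FDG k M) (p n : ℤ) : Submodule k M := A.filt p ⊓ A.gr n

/-- `Zʳ_{p,q} = Fᵖ_{p+q} ∩ d⁻¹(Fᵖ⁻ʳ_{p+q-1})`. -/
def FDG.Z (A : FDG k M) (r : ℤ) (i : ℤ × ℤ) : Submodule k M :=
  A.deg i.1 (i.1 + i.2) ⊓ (A.deg (i.1 - r) (i.1 + i.2 - 1)).comap A.d

/-- `Bʳ_{p,q} = Fᵖ_{p+q} ∩ d(Fᵖ⁺ʳ_{p+q+1})`. -/
def FDG.B (A : FDG k M) (r : ℤ) (i : ℤ × ℤ) : Submodule k M :=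
  A.deg i.1 (i.1 + i.2) ⊓ (A.deg (i.1 + r) (i.1 + i.2 + 1)).map A.d

/-- `Zʳ_{p,q} + Fᵖ⁻¹_{p+q}`. -/
def FDG.num (A : FDG k M) (r : ℤ) (i : ℤ × ℤ) : Submodule k M :=
  A.Z r i ⊔ A.deg (i.1 - 1) (i.1 + i.2)

/-- `Bʳ⁻¹_{p,q} + Fᵖ⁻¹_{p+q}`. -/
def FDG.den (A : FDG k M) (r : ℤ) (i : ℤ × ℤ) : Submodule k M :=
  A.B (r - 1) i ⊔ A.deg (i.1 - 1) (i.1 + i.2)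

/-- The term `Eʳ_{p,q} = (Zʳ_{p,q} + Fᵖ⁻¹_{p+q}) / (Bʳ⁻¹_{p,q} + Fᵖ⁻¹_{p+q})`, for `i = (p, q)`, of the
spectral sequence. -/
abbrev FDG.page (A : FDG k M) (r : ℤ) (i : ℤ × ℤ) : Type w :=
  A.num r i ⧸ (A.den r i).submoduleOf (A.num r i)

/-- The whole `r`-th page `Eʳ = ⨁_{p,q} Eʳ_{p,q}`. -/
abbrev FDG.E (A : FDG k M) (r : ℤ) : Type w := DirectSum (ℤ × ℤ) (fun i => A.page r i)

/-- The class in the `r`-th page of an element of `Zʳ_{p,q} + Fᵖ⁻¹_{p+q}`. -/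
noncomputable def FDG.pageCls (A : FDG k M) (r : ℤ) (i : ℤ × ℤ) : A.num r i →ₗ[k] A.E r :=
  DirectSum.lof k (ℤ × ℤ) (fun i => A.page r i) i ∘ₗ Submodule.mkQ _

theorem FDG.tmul_mem_deg (A : FDG k M) (A' : FDG k N) {p p' n n' P m : ℤ} {x : M} {y : N}
    (hx : x ∈ A.deg p n) (hy : y ∈ A'.deg p' n') (hP : p + p' ≤ P) (hm : n + n' = m) :
    x ⊗ₜ[k] y ∈ (A.tensor A').deg P m :=
  ⟨(A.tensor A').filt_mono hP (tmul_mem_iSup p p' rfl hx.1 hy.1),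
    tmul_mem_iSup n n' hm hx.2 hy.2⟩

theorem FDG.sgn_mem_deg (A : FDG k M) {p n : ℤ} {x : M} (hx : x ∈ A.deg p n) :
    A.sgn x ∈ A.deg p n := by
  rw [A.sgn_gr n x hx.2]
  exact zsmul_mem hx _

theorem FDG.deg_mono (A : FDG k M) {p p' : ℤ} (n : ℤ) (h : p ≤ p') : A.deg p n ≤ A.deg p' n :=
  inf_le_inf_right _ (A.filt_mono h)

theorem FDG.num_le (A : FDG k M) (r : ℤ) (i : ℤ × ℤ) : A.num r i ≤ A.deg i.1 (i.1 + i.2) :=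
  sup_le inf_le_left (A.deg_mono _ (by lia))

theorem FDG.den_le (A : FDG k M) (r : ℤ) (i : ℤ × ℤ) : A.den r i ≤ A.deg i.1 (i.1 + i.2) :=
  sup_le inf_le_left (A.deg_mono _ (by lia))

theorem FDG.tmul_mem_num (A : FDG k M) (A' : FDG k N) (r : ℤ) (i j : ℤ × ℤ) {x : M} {y : N}
    (hx : x ∈ A.num r i) (hy : y ∈ A'.num r j) : x ⊗ₜ[k] y ∈ (A.tensor A').num r (i + j) := by
  have hy' := A'.num_le r j hy
  obtain ⟨x₀, hx₀, x₁, hx₁, rfl⟩ := Submodule.mem_sup.1 hx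
  obtain ⟨y₀, hy₀, y₁, hy₁, rfl⟩ := Submodule.mem_sup.1 hy
  have e : (x₀ + x₁) ⊗ₜ[k] (y₀ + y₁) = x₀ ⊗ₜ[k] y₀ + (x₀ ⊗ₜ[k] y₁ + x₁ ⊗ₜ[k] (y₀ + y₁)) := by
    rw [TensorProduct.add_tmul, TensorProduct.tmul_add x₀, add_assoc]
  rw [e]
  refine Submodule.add_mem_sup ⟨?_, ?_⟩ (add_mem ?_ ?_)
  · exact A.tmul_mem_deg A' hx₀.1 hy₀.1 (by dsimp; lia) (by dsimp; lia)
  · change A.d x₀ ⊗ₜ[k] y₀ + A.sgn x₀ ⊗ₜ[k] A'.d y₀ ∈ (A.tensor A').deg _ _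
    exact add_mem
      (A.tmul_mem_deg A' hx₀.2 hy₀.1 (by dsimp; lia) (by dsimp; lia))
      (A.tmul_mem_deg A' (A.sgn_mem_deg hx₀.1) hy₀.2 (by dsimp; lia) (by dsimp; lia))
  · exact A.tmul_mem_deg A' hx₀.1 hy₁ (by dsimp; lia) (by dsimp; lia)
  · exact A.tmul_mem_deg A' hx₁ hy' (by dsimp; lia) (by dsimp; lia)

theorem FDG.tmul_mem_den_left (A : FDG k M) (A' : FDG k N) (r : ℤ) (i j : ℤ × ℤ) {x : M} {y : N}
    (hx : x ∈ A.den r i) (hy : y ∈ A'.num r j) : x ⊗ₜ[k] y ∈ (A.tensor A').den r (i + j) := by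
  have hy' := A'.num_le r j hy
  obtain ⟨x₀, ⟨hx₀, w, hw, rfl⟩, x₁, hx₁, rfl⟩ := Submodule.mem_sup.1 hx
  obtain ⟨y₀, hy₀, y₁, hy₁, rfl⟩ := Submodule.mem_sup.1 hy
  have h₁ : A.sgn w ⊗ₜ[k] A'.d y₀ ∈ (A.tensor A').deg ((i + j).1 - 1) ((i + j).1 + (i + j).2) :=
    A.tmul_mem_deg A' (A.sgn_mem_deg hw) hy₀.2 (by dsimp; lia) (by dsimp; lia)
  have e : (A.d w + x₁) ⊗ₜ[k] (y₀ + y₁) = (A.tensor A').d (w ⊗ₜ[k] y₀) +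
      (-(A.sgn w ⊗ₜ[k] A'.d y₀) + (A.d w ⊗ₜ[k] y₁ + x₁ ⊗ₜ[k] (y₀ + y₁))) := by
    change _ = (A.d w ⊗ₜ[k] y₀ + A.sgn w ⊗ₜ[k] A'.d y₀) + _
    rw [TensorProduct.add_tmul, TensorProduct.tmul_add (A.d w)]
    abel
  rw [e]
  refine Submodule.add_mem_sup ⟨?_, ?_⟩ (add_mem (neg_mem h₁) (add_mem ?_ ?_))
  · change A.d w ⊗ₜ[k] y₀ + A.sgn w ⊗ₜ[k] A'.d y₀ ∈ (A.tensor A').deg _ _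
    exact add_mem (A.tmul_mem_deg A' hx₀ hy₀.1 (by dsimp; lia) (by dsimp; lia))
      (FDG.deg_mono _ _ (by lia) h₁)
  · exact Submodule.mem_map_of_mem
      (A.tmul_mem_deg A' hw hy₀.1 (by dsimp; lia) (by dsimp; lia))
  · exact A.tmul_mem_deg A' hx₀ hy₁ (by dsimp; lia) (by dsimp; lia)
  · exact A.tmul_mem_deg A' hx₁ hy' (by dsimp; lia) (by dsimp; lia)

theorem FDG.tmul_mem_den_right (A : FDG k M) (A' : FDG k N) (r : ℤ) (i j : ℤ × ℤ) {x : M} {y : N}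
    (hx : x ∈ A.num r i) (hy : y ∈ A'.den r j) : x ⊗ₜ[k] y ∈ (A.tensor A').den r (i + j) := by
  have hy' := A'.den_le r j hy
  obtain ⟨x₀, hx₀, x₁, hx₁, rfl⟩ := Submodule.mem_sup.1 hx
  obtain ⟨y₀, ⟨hy₀, w, hw, rfl⟩, y₁, hy₁, rfl⟩ := Submodule.mem_sup.1 hy
  have h₁ : A.d (A.sgn x₀) ⊗ₜ[k] w ∈
      (A.tensor A').deg ((i + j).1 - 1) ((i + j).1 + (i + j).2) := by
    rw [A.d_sgn]
    exact A.tmul_mem_deg A' (neg_mem (A.sgn_mem_deg hx₀.2)) hw (by dsimp; lia) (by dsimp; lia)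
  have e : (x₀ + x₁) ⊗ₜ[k] (A'.d w + y₁) = (A.tensor A').d (A.sgn x₀ ⊗ₜ[k] w) +
      (-(A.d (A.sgn x₀) ⊗ₜ[k] w) + (x₀ ⊗ₜ[k] y₁ + x₁ ⊗ₜ[k] (A'.d w + y₁))) := by
    change _ = (A.d (A.sgn x₀) ⊗ₜ[k] w + A.sgn (A.sgn x₀) ⊗ₜ[k] A'.d w) + _
    rw [TensorProduct.add_tmul, TensorProduct.tmul_add x₀, A.sgn_sgn]
    abel
  rw [e]
  refine Submodule.add_mem_sup ⟨?_, ?_⟩ (add_mem (neg_mem h₁) (add_mem ?_ ?_))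
  · change A.d (A.sgn x₀) ⊗ₜ[k] w + A.sgn (A.sgn x₀) ⊗ₜ[k] A'.d w ∈ (A.tensor A').deg _ _
    rw [A.sgn_sgn]
    exact add_mem (FDG.deg_mono _ _ (by lia) h₁)
      (A.tmul_mem_deg A' hx₀.1 hy₀ (by dsimp; lia) (by dsimp; lia))
  · exact Submodule.mem_map_of_mem
      (A.tmul_mem_deg A' (A.sgn_mem_deg hx₀.1) hw (by dsimp; lia) (by dsimp; lia))
  · exact A.tmul_mem_deg A' hx₀.1 hy₁ (by dsimp; lia) (by dsimp; lia)
  · exact A.tmul_mem_deg A' hx₁ hy' (by dsimp; lia) (by dsimp; lia)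

/-- The product `x, y ↦ x ⊗ y` on representatives. -/
def FDG.numCross (A : FDG k M) (A' : FDG k N) (r : ℤ) (i j : ℤ × ℤ) :
    A.num r i →ₗ[k] A'.num r j →ₗ[k] (A.tensor A').num r (i + j) :=
  LinearMap.mk₂ k (fun x y => ⟨x.1 ⊗ₜ y.1, A.tmul_mem_num A' r i j x.2 y.2⟩)
    (fun _ _ _ => Subtype.ext (TensorProduct.add_tmul _ _ _))
    (fun _ _ _ => Subtype.ext (TensorProduct.smul_tmul' _ _ _).symm)
    (fun _ _ _ => Subtype.ext (TensorProduct.tmul_add _ _ _))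
    (fun _ _ _ => Subtype.ext (TensorProduct.tmul_smul _ _ _))

/-- The product `[x], [y] ↦ [x ⊗ y]` on the terms of the `r`-th page. -/
def FDG.termCross (A : FDG k M) (A' : FDG k N) (r : ℤ) (i j : ℤ × ℤ) :
    A.page r i →ₗ[k] A'.page r j →ₗ[k] (A.tensor A').page r (i + j) :=
  Submodule.liftQ _
    (LinearMap.flip <| Submodule.liftQ _
      (((A.numCross A' r i j).compr₂ (Submodule.mkQ _)).flip)
      (by
        rintro ⟨y, hy⟩ hyd
        rw [LinearMap.mem_ker]
        refine LinearMap.ext fun x => ?_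
        change Submodule.Quotient.mk _ = Submodule.Quotient.mk _
        rw [Submodule.Quotient.eq, sub_zero]
        exact A.tmul_mem_den_right A' r i j x.2 hyd))
    (by
      rintro ⟨x, hx⟩ hxd
      rw [LinearMap.mem_ker]
      refine LinearMap.ext fun y => ?_
      obtain ⟨y, rfl⟩ := Submodule.mkQ_surjective _ y
      change Submodule.Quotient.mk _ = Submodule.Quotient.mk _
      rw [Submodule.Quotient.eq, sub_zero]
      exact A.tmul_mem_den_left A' r i j hxd y.2)

/-- The canonical map `Eʳ(A) ⊗ Eʳ(A') → Eʳ(A ⊗ A')`, `[x] ⊗ [y] ↦ [x ⊗ y]`. -/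
noncomputable def FDG.pageCross (A : FDG k M) (A' : FDG k N) (r : ℤ) :
    A.E r ⊗[k] A'.E r →ₗ[k] (A.tensor A').E r :=
  TensorProduct.lift <| DirectSum.toModule k (ℤ × ℤ) _ fun i =>
    LinearMap.flip <| DirectSum.toModule k (ℤ × ℤ) _ fun j =>
      ((A.termCross A' r i j).compr₂
        (DirectSum.lof k (ℤ × ℤ) (fun i => (A.tensor A').page r i) (i + j))).flip

/-- `Δ` is the comultiplication on the `r`-th page induced by the map `D : A → A ⊗ A`, i.e. the
composition of `Eʳ(D) : Eʳ(A) → Eʳ(A ⊗ A)` with the inverse of `Eʳ(A) ⊗ Eʳ(A) ≅ Eʳ(A ⊗ A)`. -/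
def FDG.IsPageComult (A : FDG k M) (r : ℤ) (D : M →ₗ[k] M ⊗[k] M)
    (Δ : A.E r →ₗ[k] A.E r ⊗[k] A.E r) : Prop :=
  ∀ (i : ℤ × ℤ) (x : A.num r i), ∃ h : D x ∈ (A.tensor A).num r i,
    A.pageCross A r (Δ (A.pageCls r i x)) = (A.tensor A).pageCls r i ⟨D x, h⟩

end FDG

/-! ### Normalized simplicial chains -/

section Chains

variable (k : Type v) [Field k]

/-- The normalized chains of a simplicial set (in all degrees): the quotient of the `k`-module on all
simplices by the degenerate ones, i.e. the `k`-module with basis the nondegenerate simplices. -/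
abbrev Chains (X : SSet.{u}) : Type (max u v) := (Σ n : ℕ, X.nonDegenerate n) →₀ k

variable {X Y : SSet.{u}}

open Classical in
/-- The class of a simplex in the normalized chains; it is `0` if the simplex is degenerate. -/
noncomputable def simplex {n : ℕ} (σ : X _⦋n⦌) : Chains k X :=
  if h : σ ∈ X.nonDegenerate n then Finsupp.single ⟨n, σ, h⟩ 1 else 0

/-- The alternating sum of the faces of a simplex. -/
noncomputable def faceSum (n : ℕ) : X _⦋n⦌ → Chains k X :=
  Nat.casesOn (motive := fun n => X _⦋n⦌ → Chains k X) n (fun _ => 0)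
    (fun n σ => ∑ i : Fin (n + 2), ((-1) ^ (i : ℕ) : ℤ) • simplex k (X.δ i σ))

theorem faceSum_zero (σ : X _⦋0⦌) : faceSum k 0 σ = 0 := rfl

theorem faceSum_succ (n : ℕ) (σ : X _⦋n + 1⦌) :
    faceSum k (n + 1) σ = ∑ i : Fin (n + 2), ((-1) ^ (i : ℕ) : ℤ) • simplex k (X.δ i σ) := rfl

/-- The boundary operator. -/
noncomputable def boundary (X : SSet.{u}) : Chains k X →ₗ[k] Chains k X :=
  Finsupp.linearCombination k fun s => faceSum k s.1 s.2.1

/-- The sign operator `c ↦ (-1)ⁿ c` on `n`-chains. -/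
noncomputable def chainSgn (X : SSet.{u}) : Chains k X →ₗ[k] Chains k X :=
  Finsupp.linearCombination k fun s => ((-1) ^ s.1 : ℤ) • Finsupp.single s 1

variable {k}

theorem simplex_of_nonDegenerate {n : ℕ} (σ : X.nonDegenerate n) :
    simplex k σ.1 = Finsupp.single ⟨n, σ⟩ 1 := dif_pos σ.2

theorem simplex_of_degenerate {n : ℕ} {σ : X _⦋n⦌} (h : σ ∈ X.degenerate n) :
    simplex k σ = 0 := dif_neg (fun h' => h' h)

theorem faceSum_of_degenerate {n : ℕ} {σ : X _⦋n⦌} (h : σ ∈ X.degenerate n) :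
    faceSum k n σ = 0 := by
  cases n with
  | zero => rfl
  | succ n =>
    rw [SSet.degenerate_eq_iUnion_range_σ] at h
    obtain ⟨j, τ, rfl⟩ := Set.mem_iUnion.1 h
    rw [faceSum_succ, Finset.sum_eq_add j.castSucc j.succ (Fin.castSucc_lt_succ.ne)]
    · have h₁ : X.δ j.castSucc (X.σ j τ) = τ :=
        ConcreteCategory.congr_hom (X.δ_comp_σ_self (i := j)) τ
      have h₂ : X.δ j.succ (X.σ j τ) = τ :=
        ConcreteCategory.congr_hom (X.δ_comp_σ_succ (i := j)) τ
      rw [h₁, h₂, ← add_smul, Fin.val_succ, Fin.val_castSucc, pow_succ, mul_neg_one,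
        add_neg_cancel, zero_smul]
    · rintro i - ⟨hi, hi'⟩
      rw [simplex_of_degenerate, smul_zero]
      cases n with
      | zero => exact absurd (by fin_cases i <;> fin_cases j <;> simp_all) not_false
      | succ n =>
        rw [SSet.degenerate_eq_iUnion_range_σ]
        obtain ⟨l, θ, hθ⟩ := SimplexCategory.eq_σ_comp_of_not_injective
          (SimplexCategory.δ i ≫ SimplexCategory.σ j) (by
            intro hinj
            have hm := SimplexCategory.mono_iff_injective.2 hinj
            have hid : ∀ x : Fin (n + 2),
                ((SimplexCategory.δ i ≫ SimplexCategory.σ j).toOrderHom x : ℕ) = x := by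
              intro x
              rw [SimplexCategory.eq_id_of_mono (SimplexCategory.δ i ≫ SimplexCategory.σ j)]
              rfl
            have hval : ∀ x : Fin (n + 2),
                ((SimplexCategory.δ i ≫ SimplexCategory.σ j).toOrderHom x : ℕ) =
                  ((j.predAbove (i.succAbove x) : Fin (n + 2)) : ℕ) := fun _ => rfl
            have hi : (i : ℕ) ≠ j := fun h => hi (Fin.ext h)
            have hi' : (i : ℕ) ≠ j + 1 := fun h => hi' (Fin.ext h)
            rcases Nat.lt_or_gt_of_ne hi with hlt | hlt
            · have h := (hval ⟨i, by lia⟩).symm.trans (hid ⟨i, by lia⟩)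
              rw [Fin.succAbove_of_le_castSucc i ⟨i, by lia⟩ (Fin.le_def.2 le_rfl),
                Fin.predAbove_of_le_castSucc j (Fin.succ ⟨i, by lia⟩)
                  (Fin.le_def.2 (show (i : ℕ) + 1 ≤ j by lia))] at h
              exact absurd h (Nat.succ_ne_self i)
            · have h := (hval ⟨i - 1, by lia⟩).symm.trans (hid ⟨i - 1, by lia⟩)
              rw [Fin.succAbove_of_castSucc_lt i ⟨i - 1, by lia⟩
                (Fin.lt_def.2 (show (i : ℕ) - 1 < i by lia)),
                Fin.predAbove_of_castSucc_lt j (Fin.castSucc ⟨i - 1, by lia⟩)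
                  (Fin.lt_def.2 (show (j : ℕ) < i - 1 by lia))] at h
              have h' : (i : ℕ) - 1 - 1 = i - 1 := h
              lia)
        refine Set.mem_iUnion.2 ⟨l, X.map θ.op τ, ?_⟩
        have h₁ : X.map (SimplexCategory.δ i ≫ SimplexCategory.σ j).op τ = X.δ i (X.σ j τ) := by
          rw [op_comp, X.map_comp]
          rfl
        rw [← h₁, hθ, op_comp, X.map_comp]
        rfl
    · exact fun h => absurd (Finset.mem_univ _) h
    · exact fun h => absurd (Finset.mem_univ _) h

theorem boundary_simplex {n : ℕ} (σ : X _⦋n⦌) : boundary k X (simplex k σ) = faceSum k n σ := by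
  by_cases h : σ ∈ X.nonDegenerate n
  · rw [simplex_of_nonDegenerate ⟨σ, h⟩, boundary, Finsupp.linearCombination_single, one_smul]
  · rw [simplex, dif_neg h, map_zero, faceSum_of_degenerate (by simpa [SSet.nonDegenerate] using h)]

theorem chainSgn_simplex {n : ℕ} (σ : X _⦋n⦌) :
    chainSgn k X (simplex k σ) = ((-1) ^ n : ℤ) • simplex k σ := by
  by_cases h : σ ∈ X.nonDegenerate n
  · rw [simplex_of_nonDegenerate ⟨σ, h⟩, chainSgn, Finsupp.linearCombination_single, one_smul]
  · rw [simplex, dif_neg h, map_zero, smul_zero]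

theorem boundary_boundary (c : Chains k X) : boundary k X (boundary k X c) = 0 := by
  suffices h : boundary k X ∘ₗ boundary k X = 0 from LinearMap.congr_fun h c
  refine Finsupp.lhom_ext' fun ⟨n, σ⟩ => LinearMap.ext_ring ?_
  change boundary k X (boundary k X (Finsupp.single ⟨n, σ⟩ 1)) = 0
  rw [← simplex_of_nonDegenerate, boundary_simplex]
  obtain ⟨σ, hσ⟩ := σ
  rcases n with _ | _ | n
  · exact map_zero _
  · simp only [faceSum_succ, faceSum_zero, map_sum, map_zsmul, boundary_simplex, smul_zero, Finset.sum_const_zero]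
  · simp only [faceSum_succ, map_sum, map_zsmul, boundary_simplex, Finset.smul_sum, smul_smul]
    rw [← Finset.sum_product']
    let P := Fin (n + 3) × Fin (n + 2)
    let S : Finset P := Finset.univ.filter fun ij : P => (ij.1 : ℕ) ≤ (ij.2 : ℕ)
    rw [Finset.univ_product_univ, ← Finset.sum_add_sum_compl S, ← eq_neg_iff_add_eq_zero,
      ← Finset.sum_neg_distrib]
    let φ : ∀ ij : P, ij ∈ S → P := fun ij hij =>
      (ij.2.succ, Fin.castLT ij.1 (lt_of_le_of_lt (Finset.mem_filter.mp hij).right (Fin.is_lt ij.2)))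
    apply Finset.sum_bij φ
    · intro ij hij
      simp_rw [S, φ, Finset.compl_filter, Finset.mem_filter_univ, Fin.val_succ,
        Fin.val_castLT] at hij ⊢
      lia
    · rintro ⟨i, j⟩ hij ⟨i', j'⟩ hij' h
      rw [Prod.mk_inj]
      exact ⟨Fin.ext (congrArg (fun x : P => (x.2 : ℕ)) h),
        Fin.succ_injective _ (congrArg Prod.fst h)⟩
    · rintro ⟨i', j'⟩ hij'
      simp_rw [S, Finset.compl_filter, Finset.mem_filter_univ, not_le] at hij'
      refine ⟨(Fin.castSucc j', i'.pred ?_), ?_, ?_⟩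
      · rintro rfl
        simp only [Fin.val_zero, not_lt_zero] at hij'
      · simpa [S] using! Nat.le_sub_one_of_lt hij'
      · simp only [φ, Fin.castLT_castSucc, Fin.succ_pred]
    · rintro ⟨i, j⟩ hij
      rw [← neg_smul]
      dsimp only [φ]
      have hij' : i ≤ j.castSucc := by simpa [S] using! hij
      have h := ConcreteCategory.congr_hom (X.δ_comp_δ'' hij') σ
      change X.δ (i.castLT _) (X.δ j.succ σ) = X.δ j (X.δ i σ) at h
      rw [← h, Fin.val_succ, Fin.val_castLT, pow_succ]
      congr 1
      ring

theorem boundary_chainSgn (c : Chains k X) :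
    boundary k X (chainSgn k X c) = -chainSgn k X (boundary k X c) := by
  suffices h : boundary k X ∘ₗ chainSgn k X = -(chainSgn k X ∘ₗ boundary k X) from
    LinearMap.congr_fun h c
  refine Finsupp.lhom_ext' fun ⟨n, σ⟩ => LinearMap.ext_ring ?_
  change boundary k X (chainSgn k X (Finsupp.single ⟨n, σ⟩ 1)) =
    -chainSgn k X (boundary k X (Finsupp.single ⟨n, σ⟩ 1))
  have h : chainSgn k X (Finsupp.single ⟨n, σ⟩ 1) =
      ((-1) ^ n : ℤ) • Finsupp.single ⟨n, σ⟩ 1 := by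
    rw [chainSgn, Finsupp.linearCombination_single, one_smul]
  rw [h, map_zsmul, ← simplex_of_nonDegenerate, boundary_simplex]
  obtain ⟨σ, hσ⟩ := σ
  rcases n with _ | n
  · simp [faceSum_zero]
  · simp only [faceSum_succ, map_sum, map_zsmul, chainSgn_simplex, Finset.smul_sum, smul_smul,
      ← Finset.sum_neg_distrib, ← neg_smul]
    refine Finset.sum_congr rfl fun i _ => ?_
    congr 1
    ring

theorem chainSgn_chainSgn (c : Chains k X) : chainSgn k X (chainSgn k X c) = c := by
  suffices h : chainSgn k X ∘ₗ chainSgn k X = LinearMap.id from LinearMap.congr_fun h c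
  refine Finsupp.lhom_ext' fun ⟨n, σ⟩ => LinearMap.ext_ring ?_
  change chainSgn k X (chainSgn k X (Finsupp.single ⟨n, σ⟩ 1)) = Finsupp.single ⟨n, σ⟩ 1
  rw [← simplex_of_nonDegenerate, chainSgn_simplex, map_zsmul, chainSgn_simplex, smul_smul,
    ← mul_pow, neg_one_mul, neg_neg, one_pow, one_smul]

variable (k)

/-- The normalized chain complex of a simplicial set. -/
noncomputable def chainDG (X : SSet.{u}) : DG k (Chains k X) where
  d := boundary k X
  sgn := chainSgn k X
  d_d := boundary_boundary
  sgn_sgn := chainSgn_chainSgn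
  d_sgn := boundary_chainSgn

/-- The `n`-chains. -/
def chainGr (X : SSet.{u}) (n : ℤ) : Submodule k (Chains k X) :=
  Finsupp.supported k k (Set.ofPred fun s => (s.1 : ℤ) = n)

/-- The map on normalized chains induced by a simplicial map. -/
noncomputable def chainMap (f : X ⟶ Y) : Chains k X →ₗ[k] Chains k Y :=
  Finsupp.linearCombination k fun s => simplex k (f.app (op ⦋s.1⦌) s.2.1)

/-- The face `σ ∘ [i, i + 1, …, i + l]` of an `n`-simplex `σ`. -/
def face {n : ℕ} (σ : X _⦋n⦌) (i l : ℕ) (h : i + l ≤ n) : X _⦋l⦌ :=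
  X.map (SimplexCategory.subinterval i l h).op σ

/-- The chain-level comultiplication: the diagonal followed by the Alexander--Whitney map,
`σ ↦ ∑ⱼ (σ ∘ [0, …, j]) ⊗ (σ ∘ [j, …, n])`. -/
noncomputable def chainComult (X : SSet.{u}) : Chains k X →ₗ[k] Chains k X ⊗[k] Chains k X :=
  Finsupp.linearCombination k fun s => ∑ j : Fin (s.1 + 1),
    simplex k (face s.2.1 0 j (by lia)) ⊗ₜ simplex k (face s.2.1 j (s.1 - j) (by lia))

/-! ### Homology with coefficients in a coalgebra -/

section Coefficients

variable {Γ : Type w} [AddCommGroup Γ] [Module k Γ]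

/-- The symmetry `b ⊗ c ↦ (-1)^(|b| |c|) c ⊗ b`, where `s` is the sign operator of the graded
module `Γ`. -/
noncomputable def signedSwap (X : SSet.{u}) (s : Γ →ₗ[k] Γ) :
    Chains k X ⊗[k] Γ →ₗ[k] Γ ⊗[k] Chains k X :=
  TensorProduct.lift <| Finsupp.linearCombination k fun b =>
    (TensorProduct.mk k Γ (Chains k X)).flip (Finsupp.single b 1) ∘ₗ s ^ b.1

/-- `(a ⊗ b) ⊗ (c ⊗ d) ↦ (-1)^(|b| |c|) (a ⊗ c) ⊗ (b ⊗ d)`. -/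
noncomputable def twist (X : SSet.{u}) (s : Γ →ₗ[k] Γ) :
    (Chains k X ⊗[k] Chains k X) ⊗[k] (Γ ⊗[k] Γ) →ₗ[k]
      (Chains k X ⊗[k] Γ) ⊗[k] (Chains k X ⊗[k] Γ) :=
  (TensorProduct.tensorTensorTensorAssoc k (Chains k X) Γ (Chains k X) Γ).symm.toLinearMap ∘ₗ
    (LinearMap.lTensor (Chains k X) (signedSwap k X s)).rTensor Γ ∘ₗ
    (TensorProduct.tensorTensorTensorAssoc k (Chains k X) (Chains k X) Γ Γ).toLinearMap

/-- The comultiplication on the chains of `X` with coefficients in a graded coalgebra `Γ`. -/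
noncomputable def coeffComult (X : SSet.{u}) (s : Γ →ₗ[k] Γ) (ΔΓ : Γ →ₗ[k] Γ ⊗[k] Γ) :
    Chains k X ⊗[k] Γ →ₗ[k] (Chains k X ⊗[k] Γ) ⊗[k] (Chains k X ⊗[k] Γ) :=
  twist k X s ∘ₗ TensorProduct.map (chainComult k X) ΔΓ

end Coefficients

/-! ### The Serre filtration -/

/-- `α` lies over the `p`-skeleton: `f ∘ α = β ∘ s` for a codegeneracy `s : [n] → [m]` with
`m ≤ p`. -/
def OverSkeleton (f : X ⟶ Y) (p : ℤ) {n : ℕ} (α : X _⦋n⦌) : Prop :=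
  ∃ (m : ℕ) (s : ⦋n⦌ ⟶ ⦋m⦌) (β : Y _⦋m⦌), Epi s ∧ (m : ℤ) ≤ p ∧
    f.app (op ⦋n⦌) α = Y.map s.op β

/-- The `p`-th step of the Serre filtration: the submodule generated by the simplices `α` of degree `n`
which are `(n - p)`-degenerate with respect to `f`. -/
def serreFilt (f : X ⟶ Y) (p : ℤ) : Submodule k (Chains k X) :=
  Finsupp.supported k k (Set.ofPred fun s => OverSkeleton f p s.2.1)

variable {k}

theorem OverSkeleton.map {f : X ⟶ Y} {p : ℤ} {n : ℕ} {α : X _⦋n⦌} (h : OverSkeleton f p α)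
    {l : ℕ} (θ : ⦋l⦌ ⟶ ⦋n⦌) : OverSkeleton f p (X.map θ.op α) := by
  obtain ⟨m, s, β, hs, hm, h⟩ := h
  refine ⟨(Limits.image (θ ≫ s)).len, Limits.factorThruImage (θ ≫ s),
    Y.map (Limits.image.ι (θ ≫ s)).op β, inferInstance, ?_, ?_⟩
  · have := SimplexCategory.len_le_of_mono (Limits.image.ι (θ ≫ s))
    exact le_trans (by exact_mod_cast this) hm
  · have h₁ : f.app (op ⦋l⦌) (X.map θ.op α) = Y.map θ.op (f.app (op ⦋n⦌) α) :=
      ConcreteCategory.congr_hom (f.naturality θ.op) α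
    have h₂ : Y.map (Limits.factorThruImage (θ ≫ s)).op (Y.map (Limits.image.ι (θ ≫ s)).op β) =
        Y.map (Limits.factorThruImage (θ ≫ s) ≫ Limits.image.ι (θ ≫ s)).op β := by
      rw [op_comp, Y.map_comp]; rfl
    have h₃ : Y.map θ.op (Y.map s.op β) = Y.map (θ ≫ s).op β := by
      rw [op_comp, Y.map_comp]; rfl
    rw [h₁, h, h₃]
    exact (h₂.trans (by rw [Limits.image.fac])).symm

theorem supported_induction {Q : (Σ n : ℕ, X.nonDegenerate n) → Prop}
    {P : Submodule k (Chains k X)} (T : Chains k X →ₗ[k] Chains k X)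
    (h : ∀ (n : ℕ) (σ : X.nonDegenerate n), Q ⟨n, σ⟩ → T (simplex k σ.1) ∈ P) :
    ∀ x ∈ Finsupp.supported k k (Set.ofPred Q), T x ∈ P := by
  intro x hx
  rw [Finsupp.supported_eq_span_single] at hx
  refine Submodule.span_le (p := P.comap T).2 ?_ hx
  rintro _ ⟨s, hs, rfl⟩
  have := h s.1 s.2 hs
  rwa [simplex_of_nonDegenerate] at this

theorem simplex_mem_supported {Q : (Σ n : ℕ, X.nonDegenerate n) → Prop} {n : ℕ} {σ : X _⦋n⦌}
    (h : ∀ hσ : σ ∈ X.nonDegenerate n, Q ⟨n, σ, hσ⟩) :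
    simplex k σ ∈ Finsupp.supported k k (Set.ofPred Q) := by
  by_cases hσ : σ ∈ X.nonDegenerate n
  · rw [simplex_of_nonDegenerate ⟨σ, hσ⟩, Finsupp.mem_supported]
    intro s hs
    have hs' : s = ⟨n, σ, hσ⟩ := Finset.mem_singleton.1 (Finsupp.support_single_subset hs)
    rw [hs']
    exact h hσ
  · rw [simplex, dif_neg hσ]
    exact zero_mem _

theorem simplex_mem_chainGr {n : ℕ} (σ : X _⦋n⦌) {m : ℤ} (h : (n : ℤ) = m) :
    simplex k σ ∈ chainGr k X m :=
  simplex_mem_supported (Q := fun s => (s.1 : ℤ) = m) fun _ => h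

theorem simplex_mem_serreFilt {f : X ⟶ Y} {n : ℕ} {σ : X _⦋n⦌} {p : ℤ} (h : OverSkeleton f p σ) :
    simplex k σ ∈ serreFilt k f p :=
  simplex_mem_supported (Q := fun s => OverSkeleton f p s.2.1) fun _ => h

theorem chainSgn_of_mem {n : ℤ} {x : Chains k X} (hx : x ∈ chainGr k X n) :
    chainSgn k X x = (n.negOnePow : ℤ) • x := by
  have h := supported_induction (Q := fun s => (s.1 : ℤ) = n) (P := ⊥)
    (chainSgn k X - (n.negOnePow : ℤ) • LinearMap.id) (fun m σ hs => by
      rw [Submodule.mem_bot, LinearMap.sub_apply, chainSgn_simplex, sub_eq_zero]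
      have e : (n.negOnePow : ℤ) = (-1) ^ m := by
        rw [← hs, Int.negOnePow_def, zpow_natCast, Units.val_pow_eq_pow_val, Units.val_neg,
          Units.val_one]
      rw [e]
      rfl) x hx
  exact sub_eq_zero.1 ((Submodule.mem_bot k).1 h)

theorem boundary_mem_chainGr {n : ℤ} {x : Chains k X} (hx : x ∈ chainGr k X n) :
    boundary k X x ∈ chainGr k X (n - 1) := by
  refine supported_induction (Q := fun s => (s.1 : ℤ) = n) (boundary k X) (fun m σ hs => ?_) x hx
  rw [boundary_simplex]
  obtain ⟨σ, hσ⟩ := σ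
  rcases m with _ | m
  · rw [faceSum_zero]
    exact zero_mem _
  · rw [faceSum_succ]
    refine Submodule.sum_mem _ fun i _ => zsmul_mem (simplex_mem_chainGr _ ?_) _
    rw [← hs]
    push_cast
    ring

theorem boundary_mem_serreFilt {f : X ⟶ Y} {p : ℤ} {x : Chains k X} (hx : x ∈ serreFilt k f p) :
    boundary k X x ∈ serreFilt k f p := by
  refine supported_induction (Q := fun s => OverSkeleton f p s.2.1) (boundary k X)
    (fun m σ hs => ?_) x hx
  rw [boundary_simplex]
  obtain ⟨σ, hσ⟩ := σ
  rcases m with _ | m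
  · rw [faceSum_zero]
    exact zero_mem _
  · rw [faceSum_succ]
    exact Submodule.sum_mem _ fun i _ => zsmul_mem (simplex_mem_serreFilt (hs.map _)) _

theorem chainSgn_mem_serreFilt {f : X ⟶ Y} {p : ℤ} {x : Chains k X} (hx : x ∈ serreFilt k f p) :
    chainSgn k X x ∈ serreFilt k f p := by
  refine supported_induction (Q := fun s => OverSkeleton f p s.2.1) (chainSgn k X)
    (fun m σ hs => ?_) x hx
  rw [chainSgn_simplex]
  exact zsmul_mem (simplex_mem_serreFilt hs) _

variable (k)

/-- The normalized chains of `X` with the Serre filtration with respect to `f : X ⟶ Y`. -/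
noncomputable def serreFDG (f : X ⟶ Y) : FDG k (Chains k X) where
  toDG := chainDG k X
  gr := chainGr k X
  filt := serreFilt k f
  sgn_gr _ _ hx := chainSgn_of_mem hx
  d_gr _ _ hx := boundary_mem_chainGr hx
  d_filt _ _ hx := boundary_mem_serreFilt hx
  sgn_filt _ _ hx := chainSgn_mem_serreFilt hx
  filt_mono p p' h := Finsupp.supported_mono (by
    rintro s ⟨m, e, β, he, hm, hs⟩
    exact ⟨m, e, β, he, hm.trans h, hs⟩)

/-- The map `φ`, `α ↦ (α ∘ [0, …, q]) ⊗ (f ∘ α ∘ [q, …, n])` on simplices `α` of dimension `n ≥ q`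
(and `0` on the others). -/
noncomputable def phi (f : X ⟶ Y) (q : ℕ) : Chains k X →ₗ[k] Chains k X ⊗[k] Chains k Y :=
  Finsupp.linearCombination k fun s =>
    if h : q ≤ s.1 then
      simplex k (face s.2.1 0 q (by lia)) ⊗ₜ
        simplex k (f.app (op ⦋s.1 - q⦌) (face s.2.1 q (s.1 - q) (by lia)))
    else 0

/-! ### The Eilenberg--Zilber map and `ψ` -/

/-- `(μ, σ)` is a `(q, p)` shuffle. -/
def IsShuffle {n q p : ℕ} (μ : ⦋n⦌ ⟶ ⦋q⦌) (σ : ⦋n⦌ ⟶ ⦋p⦌) : Prop :=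
  Function.Surjective μ.toOrderHom ∧ Function.Surjective σ.toOrderHom ∧
    ∀ j : Fin n,
      (μ.toOrderHom j.castSucc = μ.toOrderHom j.succ →
        (σ.toOrderHom j.succ : ℕ) = σ.toOrderHom j.castSucc + 1) ∧
      (σ.toOrderHom j.castSucc = σ.toOrderHom j.succ →
        (μ.toOrderHom j.succ : ℕ) = μ.toOrderHom j.castSucc + 1)

/-- The `(q, p)` shuffles. -/
abbrev Shuffle (q p : ℕ) : Type :=
  Subtype fun s : (⦋q + p⦌ ⟶ ⦋q⦌) × (⦋q + p⦌ ⟶ ⦋p⦌) => IsShuffle s.1 s.2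

noncomputable instance (q p : ℕ) : Fintype (Shuffle q p) := Fintype.ofFinite _

open Classical in
/-- The sign of a shuffle: the parity of the number of pairs `i < j` such that `σ` increases at step `i`
and `μ` increases at step `j`. -/
noncomputable def Shuffle.sign {q p : ℕ} (s : Shuffle q p) : ℤ :=
  (-1) ^ (Finset.univ.filter fun ij : Fin (q + p) × Fin (q + p) => ij.1 < ij.2 ∧
    s.1.2.toOrderHom ij.1.castSucc < s.1.2.toOrderHom ij.1.succ ∧
    s.1.1.toOrderHom ij.2.castSucc < s.1.1.toOrderHom ij.2.succ).card

/-- `U` lies in the fiber over the initial vertex `V(∗)` of `V`. -/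
def InFiber (f : X ⟶ Y) {q p : ℕ} (U : X _⦋q⦌) (V : Y _⦋p⦌) : Prop :=
  f.app (op ⦋q⦌) U = Y.map (SimplexCategory.const ⦋q⦌ ⦋p⦌ 0).op V

/-- A choice, for all simplices `V` of `Y` and `U` of the fiber over `V(∗)`, of a simplicial map
`G = G_{U,V} : Δ[q] × Δ[p] ⟶ X` with `f ∘ G = V ∘ pr₂` and `G(x, ∗) = U(x)`, natural in `U`. The value
of `G_{U,V}` on the simplex `(μ, σ)` of `Δ[q] × Δ[p]` is denoted `G V U _ μ σ`. (For the singular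
simplicial set of `E`, these are the continuous maps `Δ^q × Δ^p → E`.) -/
structure LiftSystem (f : X ⟶ Y) where
  G : ∀ {p q n : ℕ} (V : Y _⦋p⦌) (U : X _⦋q⦌), InFiber f U V →
    (⦋n⦌ ⟶ ⦋q⦌) → (⦋n⦌ ⟶ ⦋p⦌) → X _⦋n⦌
  map_G : ∀ {p q n m : ℕ} (V : Y _⦋p⦌) (U : X _⦋q⦌) (h : InFiber f U V) (μ : ⦋n⦌ ⟶ ⦋q⦌)
    (σ : ⦋n⦌ ⟶ ⦋p⦌) (θ : ⦋m⦌ ⟶ ⦋n⦌), X.map θ.op (G V U h μ σ) = G V U h (θ ≫ μ) (θ ≫ σ)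
  proj_G : ∀ {p q n : ℕ} (V : Y _⦋p⦌) (U : X _⦋q⦌) (h : InFiber f U V) (μ : ⦋n⦌ ⟶ ⦋q⦌)
    (σ : ⦋n⦌ ⟶ ⦋p⦌), f.app (op ⦋n⦌) (G V U h μ σ) = Y.map σ.op V
  initial_G : ∀ {p q n : ℕ} (V : Y _⦋p⦌) (U : X _⦋q⦌) (h : InFiber f U V) (μ : ⦋n⦌ ⟶ ⦋q⦌),
    G V U h μ (SimplexCategory.const ⦋n⦌ ⦋p⦌ 0) = X.map μ.op U
  natural_G : ∀ {p q q' n : ℕ} (V : Y _⦋p⦌) (U : X _⦋q⦌) (h : InFiber f U V) (θ : ⦋q'⦌ ⟶ ⦋q⦌)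
    (h' : InFiber f (X.map θ.op U) V) (μ : ⦋n⦌ ⟶ ⦋q'⦌) (σ : ⦋n⦌ ⟶ ⦋p⦌),
    G V (X.map θ.op U) h' μ σ = G V U h (μ ≫ θ) σ

open Classical in
/-- The map `ψ`: a generator `U ⊗ V`, with `U` in the fiber over `V(∗)`, is sent to the image under
`G_{U,V}` of the Eilenberg--Zilber product of the fundamental simplices of `Δ^q` and `Δ^p`, i.e. to
`∑ sgn(μ, σ) G_{U,V}(μ, σ)` over all `(q, p)` shuffles. -/
noncomputable def psi {f : X ⟶ Y} (L : LiftSystem f) :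
    Chains k X ⊗[k] Chains k Y →ₗ[k] Chains k X :=
  TensorProduct.lift <| Finsupp.linearCombination k fun U => Finsupp.linearCombination k fun V =>
    if h : InFiber f U.2.1 V.2.1 then
      ∑ s : Shuffle U.1 V.1, s.sign • simplex k (L.G V.2.1 U.2.1 h s.1.1 s.1.2)
    else 0

end Chains

/-! ### Fibrations -/

section Spaces

variable (k : Type v) [Field k] {E B : Type u} [TopologicalSpace E] [TopologicalSpace B]

/-- A Serre fibration: a map with the homotopy lifting property for all cubes `Iⁿ`. -/
def IsSerreFibration (π : C(E, B)) : Prop :=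
  ∀ (n : ℕ) (g : C(Fin n → unitInterval, E)) (H : C((Fin n → unitInterval) × unitInterval, B)),
    (∀ x, H (x, 0) = π (g x)) →
    ∃ H' : C((Fin n → unitInterval) × unitInterval, E),
      (∀ x, H' (x, 0) = g x) ∧ ∀ z, π (H' z) = H z

/-- The singular simplicial set. -/
noncomputable abbrev Sing (X : Type u) [TopologicalSpace X] : SSet.{u} :=
  TopCat.toSSet.obj (TopCat.of X)

/-- The map of singular simplicial sets induced by a continuous map. -/
noncomputable abbrev singMap {X Y : Type u} [TopologicalSpace X] [TopologicalSpace Y]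
    (f : C(X, Y)) : Sing X ⟶ Sing Y :=
  TopCat.toSSet.map (TopCat.ofHom f)

/-- The fiber of `π` over `b`. -/
abbrev Fiber (π : C(E, B)) (b : B) : Type u := Subtype fun e : E => π e = b

/-- The inclusion of the fiber. -/
def fiberIncl (π : C(E, B)) (b : B) : C(Fiber π b, E) := ⟨Subtype.val, continuous_subtype_val⟩

/-- The pullback of `π` along a path in the base. -/
abbrev PathPullback (π : C(E, B)) {b b' : B} (γ : Path b b') : Type u :=
  Subtype fun x : unitInterval × E => π x.2 = γ x.1

/-- The inclusion of the fiber over the source of the path. -/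
def sourceIncl (π : C(E, B)) {b b' : B} (γ : Path b b') : C(Fiber π b, PathPullback π γ) :=
  ⟨fun e => ⟨(0, e.1), by rw [e.2, γ.source]⟩, by fun_prop⟩

/-- The inclusion of the fiber over the target of the path. -/
def targetIncl (π : C(E, B)) {b b' : B} (γ : Path b b') : C(Fiber π b', PathPullback π γ) :=
  ⟨fun e => ⟨(1, e.1), by rw [e.2, γ.target]⟩, by fun_prop⟩

/-- The class of the cycle `c'` of the fiber over `b'` is the transport along `γ` of the class of the
cycle `c` of the fiber over `b`: their images in `H(γ^*E)` agree. -/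
def IsTransport (π : C(E, B)) {b b' : B} (γ : Path b b') (c : Chains k (Sing (Fiber π b)))
    (c' : Chains k (Sing (Fiber π b'))) : Prop :=
  ∃ w : Chains k (Sing (PathPullback π γ)), boundary k _ w =
    chainMap k (singMap (sourceIncl π γ)) c - chainMap k (singMap (targetIncl π γ)) c'

/-- The initial vertex `V(∗)` of a singular simplex. -/
noncomputable def initialVertex {p : ℕ} (V : (Sing B) _⦋p⦌) : B :=
  TopCat.toSSetObjEquiv (TopCat.of B) (op ⦋p⦌) V ⟨Pi.single 0 1, single_mem_stdSimplex ℝ 0⟩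

/-- The homology `H_*(F)` of the fiber over `b`. -/
abbrev FiberHomology (π : C(E, B)) (b : B) : Type (max u v) :=
  (chainDG k (Sing (Fiber π b))).Homology

/-- The sign operator of the graded module `H_*(F)`. -/
noncomputable abbrev fiberSgn (π : C(E, B)) (b : B) :
    FiberHomology k π b →ₗ[k] FiberHomology k π b :=
  (chainDG k (Sing (Fiber π b))).homologySgn

/-- The complex `C_*(B; H_*(F)) = C_*(B) ⊗ H_*(F)`. -/
noncomputable abbrev coeffDG (π : C(E, B)) (b : B) :
    DG k (Chains k (Sing B) ⊗[k] FiberHomology k π b) :=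
  (chainDG k (Sing B)).coeff (fiberSgn k π b) (chainDG k (Sing (Fiber π b))).homologySgn_sgn

/-- The identification of the homology of `C_p(B; C_q(F))`, with respect to the boundary operator of
the fibers, with `C_p(B; H_q(F))`, as a relation. Here `C_p(B; C_q(F)) ⊆ C_q(E) ⊗ C_p(B)` is generated
by the `U ⊗ V` with `U` in the fiber over `V(∗)`. A cycle `c` of this fiber gives `c ⊗ V`, and this is
identified with `(-1)^(pq) V ⊗ [c']`, the sign being that of the symmetry of the tensor product,
where `[c']` is the class in the homology of the fixed fiber over `b₀` to which `[c]` is transported. -/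
noncomputable def coeffRel (π : C(E, B)) (b₀ : B) (p q : ℕ) :
    Submodule k ((Chains k (Sing E) ⊗[k] Chains k (Sing B)) ×
      (Chains k (Sing B) ⊗[k] FiberHomology k π b₀)) :=
  Submodule.span k (Set.ofPred fun z => ∃ (V : (Sing B).nonDegenerate p)
    (γ : Path (initialVertex V.1) b₀)
    (c : LinearMap.ker (chainDG k (Sing (Fiber π (initialVertex V.1)))).d)
    (c' : LinearMap.ker (chainDG k (Sing (Fiber π b₀))).d),
    c.1 ∈ chainGr k _ q ∧ IsTransport k π γ c.1 c'.1 ∧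
    z = (chainMap k (singMap (fiberIncl π _)) c.1 ⊗ₜ simplex k V.1,
      ((-1) ^ (p * q) : ℤ) • (simplex k V.1 ⊗ₜ (chainDG k (Sing (Fiber π b₀))).cls c')))

/-- `Φ : E² → H_*(B; H_*(F))` is induced by the maps `φ^{p,q}`. -/
def IsInducedByPhi (π : C(E, B)) (b₀ : B)
    (Φ : (serreFDG k (singMap π)).E 2 →ₗ[k] (coeffDG k π b₀).Homology) : Prop :=
  ∀ (p q : ℕ) (x : (serreFDG k (singMap π)).num 2 (p, q)),
    (∃ ξ, (phi k (singMap π) q x, ξ) ∈ coeffRel k π b₀ p q) ∧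
    ∀ ξ, (phi k (singMap π) q x, ξ) ∈ coeffRel k π b₀ p q →
      ∃ h : ξ ∈ LinearMap.ker (coeffDG k π b₀).d,
        Φ ((serreFDG k (singMap π)).pageCls 2 (p, q) x) = (coeffDG k π b₀).cls ⟨ξ, h⟩

/-- `Ψ : H_*(B; H_*(F)) → E²` is induced by the map `ψ`. -/
def IsInducedByPsi (π : C(E, B)) (b₀ : B) (L : LiftSystem (singMap π))
    (Ψ : (coeffDG k π b₀).Homology →ₗ[k] (serreFDG k (singMap π)).E 2) : Prop :=
  ∀ (p q : ℕ) z ξ, (z, ξ) ∈ coeffRel k π b₀ p q →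
    ∀ h : ξ ∈ LinearMap.ker (coeffDG k π b₀).d,
      ∃ h' : psi k L z ∈ (serreFDG k (singMap π)).num 2 (p, q),
        Ψ ((coeffDG k π b₀).cls ⟨ξ, h⟩) = (serreFDG k (singMap π)).pageCls 2 (p, q) ⟨_, h'⟩

end Spaces

end SerreSS

open SerreSS
open scoped TensorProduct

namespace SerreSS

open CategoryTheory Simplicial Opposite TensorProduct

/-! ### The Künneth theorem over a field -/

section Kunneth

variable {k : Type v} [Field k] {M : Type w} [AddCommGroup M] [Module k M]
  {N : Type w'} [AddCommGroup N] [Module k N]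

theorem exists_generalized_inverse (T : M →ₗ[k] N) : ∃ S : N →ₗ[k] M, ∀ x, T (S (T x)) = T x := by
  obtain ⟨s, hs⟩ := T.rangeRestrict.exists_rightInverse_of_surjective T.range_rangeRestrict
  obtain ⟨P, hP⟩ := Submodule.exists_isCompl (LinearMap.range T)
  obtain ⟨r, hr⟩ := (LinearMap.range T).subtype.exists_leftInverse_of_injective (Submodule.ker_subtype _)
  refine ⟨s ∘ₗ r, fun x => ?_⟩
  have h₁ : r (T x) = T.rangeRestrict x := LinearMap.congr_fun hr (T.rangeRestrict x)
  have h₂ := congrArg Subtype.val (LinearMap.congr_fun hs (T.rangeRestrict x))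
  rw [LinearMap.comp_apply, h₁]
  exact h₂

namespace DG

variable (A : DG k M) (A' : DG k N)

/-- A generalized inverse of the differential. -/
noncomputable def inv : M →ₗ[k] M := (exists_generalized_inverse A.d).choose

theorem d_inv_d (x : M) : A.d (A.inv (A.d x)) = A.d x :=
  (exists_generalized_inverse A.d).choose_spec x

/-- The projection to cycles representing the homology. -/
noncomputable def proj : M →ₗ[k] M := LinearMap.id - A.d ∘ₗ A.inv - A.inv ∘ₗ A.d

theorem proj_apply (x : M) : A.proj x = x - A.d (A.inv x) - A.inv (A.d x) := rfl

theorem d_proj (x : M) : A.d (A.proj x) = 0 := by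
  rw [proj_apply, map_sub, map_sub, A.d_d, A.d_inv_d, sub_zero, sub_self]

theorem proj_d (x : M) : A.proj (A.d x) = 0 := by
  rw [proj_apply, A.d_d, map_zero, A.d_inv_d, sub_self, sub_zero]

/-- An extension to all elements of the map from cycles to homology classes; it vanishes on the
boundaries. -/
noncomputable def toHomology : M →ₗ[k] A.Homology :=
  A.cls ∘ₗ A.proj.codRestrict _ A.d_proj

theorem cls_eq_zero_iff (x : LinearMap.ker A.d) : A.cls x = 0 ↔ ∃ y, A.d y = x.1 :=
  (Submodule.Quotient.mk_eq_zero _).trans Iff.rfl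

theorem cls_eq_iff (x y : LinearMap.ker A.d) : A.cls x = A.cls y ↔ ∃ z, A.d z = x.1 - y.1 := by
  rw [← sub_eq_zero, ← map_sub, cls_eq_zero_iff]
  rfl

theorem cls_surjective : Function.Surjective A.cls := Submodule.mkQ_surjective _

theorem toHomology_cycle (x : LinearMap.ker A.d) : A.toHomology x.1 = A.cls x := by
  refine (A.cls_eq_iff _ _).2 ⟨-A.inv x.1, ?_⟩
  change _ = A.proj x.1 - x.1
  rw [proj_apply, LinearMap.mem_ker.1 x.2, map_neg, map_zero]
  abel

theorem toHomology_d (x : M) : A.toHomology (A.d x) = 0 := by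
  rw [A.toHomology_cycle ⟨A.d x, A.d_d x⟩, cls_eq_zero_iff]
  exact ⟨x, rfl⟩

theorem homologyCross_cls (x : LinearMap.ker A.d) (y : LinearMap.ker A'.d) :
    A.homologyCross A' (A.cls x ⊗ₜ A'.cls y) = (A.tensor A').cls (A.cycleCross A' x y) := rfl

theorem toHomology_tensor_d (z : M ⊗[k] N) :
    TensorProduct.map A.toHomology A'.toHomology ((A.tensor A').d z) = 0 := by
  induction z with
  | zero => simp
  | add x y hx hy => rw [map_add, map_add, hx, hy, add_zero]
  | tmul x y => simp [tensor_d_tmul, toHomology_d]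

/-- The inverse of the Künneth map. -/
noncomputable def homologySplit : (A.tensor A').Homology →ₗ[k] A.Homology ⊗[k] A'.Homology :=
  Submodule.liftQ _ (TensorProduct.map A.toHomology A'.toHomology ∘ₗ
      (LinearMap.ker (A.tensor A').d).subtype) (by
    rintro ⟨x, hx⟩ ⟨y, rfl⟩
    exact A.toHomology_tensor_d A' y)

theorem homologySplit_cls (z : LinearMap.ker (A.tensor A').d) :
    A.homologySplit A' ((A.tensor A').cls z) =
      TensorProduct.map A.toHomology A'.toHomology z.1 := rfl

theorem homologySplit_cross (z : A.Homology ⊗[k] A'.Homology) :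
    A.homologySplit A' (A.homologyCross A' z) = z := by
  induction z with
  | zero => simp
  | add x y hx hy => rw [map_add, map_add, hx, hy]
  | tmul x y =>
    obtain ⟨x, rfl⟩ := A.cls_surjective x
    obtain ⟨y, rfl⟩ := A'.cls_surjective y
    rw [homologyCross_cls, homologySplit_cls]
    change A.toHomology x.1 ⊗ₜ A'.toHomology y.1 = _
    rw [toHomology_cycle, toHomology_cycle]

theorem proj_tensor_homotopy (z : M ⊗[k] N) :
    z - TensorProduct.map A.proj A'.proj z =
      (A.tensor A').d (TensorProduct.map A.sgn A'.inv z + TensorProduct.map A.inv A'.proj z) +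
      (TensorProduct.map A.sgn A'.inv ((A.tensor A').d z) +
        TensorProduct.map A.inv LinearMap.id
          (TensorProduct.map LinearMap.id A'.proj ((A.tensor A').d z))) := by
  induction z with
  | zero => simp
  | add x y hx hy =>
    simp only [map_add] at hx hy ⊢
    rw [add_sub_add_comm, hx, hy]
    abel
  | tmul x y =>
    simp only [TensorProduct.map_tmul, tensor_d_tmul, map_add, LinearMap.id_apply, A.sgn_sgn,
      A.d_sgn, d_proj, proj_d, TensorProduct.tmul_zero, add_zero]
    have e : x = A.proj x + A.d (A.inv x) + A.inv (A.d x) := by rw [proj_apply]; abel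
    have e' : y = A'.proj y + A'.d (A'.inv y) + A'.inv (A'.d y) := by rw [proj_apply]; abel
    have h : x ⊗ₜ[k] y = x ⊗ₜ[k] (A'.d (A'.inv y)) + x ⊗ₜ[k] A'.inv (A'.d y) +
        (A.proj x ⊗ₜ[k] A'.proj y + A.d (A.inv x) ⊗ₜ[k] A'.proj y +
          A.inv (A.d x) ⊗ₜ[k] A'.proj y) := by
      rw [← TensorProduct.add_tmul, ← TensorProduct.add_tmul, ← e, ← TensorProduct.tmul_add,
        ← TensorProduct.tmul_add]
      congr 1
      exact e'.trans (by abel)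
    rw [h, TensorProduct.neg_tmul]
    have h₂ : A.sgn (A.d x) ⊗ₜ[k] A'.inv y = -(A.d (A.sgn x) ⊗ₜ[k] A'.inv y) := by
      rw [A.d_sgn, TensorProduct.neg_tmul, neg_neg]
    abel

theorem homologyCross_split (z : (A.tensor A').Homology) :
    A.homologyCross A' (A.homologySplit A' z) = z := by
  obtain ⟨z, rfl⟩ := (A.tensor A').cls_surjective z
  rw [homologySplit_cls]
  have h : ∀ w : M ⊗[k] N, ∃ h,
      A.homologyCross A' (TensorProduct.map A.toHomology A'.toHomology w) =
        (A.tensor A').cls ⟨TensorProduct.map A.proj A'.proj w, h⟩ := by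
    intro w
    induction w with
    | zero => exact ⟨by simp, by simp [map_zero]; rfl⟩
    | add x y hx hy =>
      obtain ⟨h₁, e₁⟩ := hx
      obtain ⟨h₂, e₂⟩ := hy
      refine ⟨by rw [map_add]; exact add_mem h₁ h₂, ?_⟩
      rw [map_add, map_add, e₁, e₂, ← map_add]
      congr 1
      exact Subtype.ext (map_add _ _ _).symm
    | tmul x y => exact ⟨_, rfl⟩
  obtain ⟨h₁, e₁⟩ := h z.1
  rw [e₁]
  have e := A.proj_tensor_homotopy A' z.1
  rw [LinearMap.mem_ker.1 z.2, map_zero, map_zero, map_zero, add_zero, add_zero] at e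
  refine ((A.tensor A').cls_eq_iff _ _).2 ⟨-(TensorProduct.map A.sgn A'.inv z.1 +
    TensorProduct.map A.inv A'.proj z.1), ?_⟩
  rw [map_neg, ← e, neg_sub]

theorem homologyCross_bijective : Function.Bijective (A.homologyCross A') :=
  Function.bijective_iff_has_inverse.2
    ⟨A.homologySplit A', A.homologySplit_cross A', A.homologyCross_split A'⟩

/-- The comultiplication on homology induced by a map compatible with the differentials. -/
theorem exists_isHomologyComult (D : M →ₗ[k] M ⊗[k] M)
    (hD : ∀ x, (A.tensor A).d (D x) = D (A.d x)) :
    ∃ Δ : A.Homology →ₗ[k] A.Homology ⊗[k] A.Homology, A.IsHomologyComult D Δ ∧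
      ∀ x : LinearMap.ker A.d, Δ (A.cls x) =
        TensorProduct.map A.toHomology A.toHomology (D x.1) := by
  refine ⟨Submodule.liftQ _ (TensorProduct.map A.toHomology A.toHomology ∘ₗ D ∘ₗ
      (LinearMap.ker A.d).subtype) ?_, fun x => ?_, fun x => rfl⟩
  · rintro ⟨x, hx⟩ ⟨y, rfl⟩
    change TensorProduct.map A.toHomology A.toHomology (D (A.d y)) = 0
    rw [← hD, toHomology_tensor_d]
  · have h : D x ∈ LinearMap.ker (A.tensor A).d := by
      rw [LinearMap.mem_ker, hD, LinearMap.mem_ker.1 x.2, map_zero]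
    refine ⟨h, ?_⟩
    exact A.homologyCross_split A ((A.tensor A).cls ⟨D x, h⟩)

end DG

end Kunneth

end SerreSS

namespace SerreSS

open CategoryTheory Simplicial Opposite TensorProduct

/-! ### The Künneth theorem for the pages of a spectral sequence -/

section PageKunneth

variable {k : Type v} [Field k] {M : Type w} [AddCommGroup M] [Module k M]
  {N : Type w'} [AddCommGroup N] [Module k N]

namespace FDG

/-- A homotopy from the identity to a map `1 - dh - hd` of filtered modules, raising the filtration
by at most `r - 1`, and such that the differential of the elements `x - dhx - hdx` lowers the filtration
by `r`. -/
structure Contraction (A : FDG k M) (r : ℤ) where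
  h : M →ₗ[k] M
  h_mem : ∀ {p n : ℤ} {x : M}, x ∈ A.deg p n → h x ∈ A.deg (p + r - 1) (n + 1)
  proj_mem' : ∀ {p n : ℤ} {x : M}, x ∈ A.deg p n → x - A.d (h x) - h (A.d x) ∈ A.deg p n
  d_proj_mem' : ∀ {p n : ℤ} {x : M}, x ∈ A.deg p n →
    A.d (x - A.d (h x) - h (A.d x)) ∈ A.deg (p - r) (n - 1)

theorem d_mem_deg (A : FDG k M) {p n : ℤ} {x : M} (hx : x ∈ A.deg p n) :
    A.d x ∈ A.deg p (n - 1) := ⟨A.d_filt _ _ hx.1, A.d_gr _ _ hx.2⟩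

theorem d_mem_deg' (A : FDG k M) {p n m : ℤ} {x : M} (hx : x ∈ A.deg p n) (h : m = n - 1) :
    A.d x ∈ A.deg p m := h ▸ A.d_mem_deg hx

theorem deg_le (A : FDG k M) {p p' n n' : ℤ} (h : p ≤ p') (hn : n = n') :
    A.deg p n ≤ A.deg p' n' := hn ▸ A.deg_mono n h

namespace Contraction

variable {A : FDG k M} {r : ℤ} (c : A.Contraction r)

/-- The map `1 - dh - hd`. -/
def proj : M →ₗ[k] M := LinearMap.id - A.d ∘ₗ c.h - c.h ∘ₗ A.d

theorem proj_apply (x : M) : c.proj x = x - A.d (c.h x) - c.h (A.d x) := rfl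

theorem proj_mem {p n : ℤ} {x : M} (hx : x ∈ A.deg p n) : c.proj x ∈ A.deg p n := c.proj_mem' hx

theorem d_proj_mem {p n : ℤ} {x : M} (hx : x ∈ A.deg p n) :
    A.d (c.proj x) ∈ A.deg (p - r) (n - 1) := c.d_proj_mem' hx

theorem d_proj (x : M) : A.d (c.proj x) = c.proj (A.d x) := by
  simp only [proj_apply, map_sub, A.d_d, map_zero, sub_zero]

theorem proj_mem_Z (i : ℤ × ℤ) {x : M} (hx : x ∈ A.deg i.1 (i.1 + i.2)) : c.proj x ∈ A.Z r i :=
  ⟨c.proj_mem hx, c.d_proj_mem hx⟩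

theorem proj_mem_num (i : ℤ × ℤ) {x : M} (hx : x ∈ A.deg i.1 (i.1 + i.2)) : c.proj x ∈ A.num r i :=
  Submodule.mem_sup_left (c.proj_mem_Z i hx)

theorem sub_proj_mem_den (i : ℤ × ℤ) {x : M} (hx : x ∈ A.num r i) : x - c.proj x ∈ A.den r i := by
  obtain ⟨x, hxZ, y, hy, rfl⟩ := Submodule.mem_sup.1 hx
  clear hx
  obtain ⟨hx, hdx⟩ := hxZ
  have hdx : A.d x ∈ A.deg (i.1 - r) (i.1 + i.2 - 1) := hdx
  rw [map_add, add_sub_add_comm]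
  refine add_mem ?_ (Submodule.mem_sup_right (sub_mem hy (c.proj_mem hy)))
  have e : x - c.proj x = A.d (c.h x) + c.h (A.d x) := by rw [proj_apply]; abel
  have h₁ : c.h (A.d x) ∈ A.deg (i.1 - 1) (i.1 + i.2) :=
    A.deg_le (by lia) (by lia) (c.h_mem hdx)
  rw [e]
  refine Submodule.add_mem_sup ⟨?_, ?_⟩ h₁
  · have e' : A.d (c.h x) = x - c.proj x - c.h (A.d x) := by rw [e]; abel
    rw [e']
    exact sub_mem (sub_mem hx (c.proj_mem hx)) (A.deg_le (by lia) rfl h₁)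
  · exact Submodule.mem_map_of_mem (A.deg_le (by lia) rfl (c.h_mem hx))

theorem proj_mem_of_mem_den (i : ℤ × ℤ) {x : M} (hx : x ∈ A.den r i) :
    c.proj x ∈ A.deg (i.1 - 1) (i.1 + i.2) := by
  obtain ⟨_, ⟨-, w, hw, rfl⟩, y, hy, rfl⟩ := Submodule.mem_sup.1 hx
  rw [map_add]
  refine add_mem ?_ (c.proj_mem hy)
  rw [← d_proj]
  exact A.deg_le (by lia) (by lia) (c.d_proj_mem hw)

end Contraction

/-- The map `1 - dh - hd`. -/
def homotopyProj (A : FDG k M) (h : M →ₗ[k] M) : M →ₗ[k] M := LinearMap.id - A.d ∘ₗ h - h ∘ₗ A.d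

theorem pageCls_eq_zero (A : FDG k M) {r : ℤ} {i : ℤ × ℤ} {x : A.num r i} (hx : x.1 ∈ A.den r i) :
    A.pageCls r i x = 0 := by
  have h : Submodule.mkQ ((A.den r i).submoduleOf (A.num r i)) x = 0 :=
    (Submodule.Quotient.mk_eq_zero _).2 hx
  rw [pageCls, LinearMap.comp_apply, h, map_zero]

theorem pageCls_eq (A : FDG k M) {r : ℤ} {i : ℤ × ℤ} {x y : A.num r i}
    (hx : x.1 - y.1 ∈ A.den r i) : A.pageCls r i x = A.pageCls r i y := by
  have h := (A.pageCls r i).map_add (x - y) y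
  rwa [sub_add_cancel, A.pageCls_eq_zero (x := x - y) hx, zero_add] at h

theorem pageCross_cls (A : FDG k M) (A' : FDG k N) {r : ℤ} {i j l : ℤ × ℤ} (x : A.num r i)
    (y : A'.num r j) (hl : i + j = l) (h : x.1 ⊗ₜ[k] y.1 ∈ (A.tensor A').num r l) :
    A.pageCross A' r (A.pageCls r i x ⊗ₜ A'.pageCls r j y) =
      (A.tensor A').pageCls r l ⟨x.1 ⊗ₜ y.1, h⟩ := by
  subst hl
  simp only [pageCross, pageCls, LinearMap.comp_apply, TensorProduct.lift.tmul,
    DirectSum.toModule_lof, LinearMap.flip_apply, LinearMap.compr₂_apply]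
  rfl

theorem pageCls_induction (A : FDG k M) {r : ℤ} {P : A.E r → Prop} (x : A.E r) (h0 : P 0)
    (hcls : ∀ i x, P (A.pageCls r i x)) (hadd : ∀ x y, P x → P y → P (x + y)) : P x := by
  classical
  induction x using DirectSum.induction_on with
  | zero => exact h0
  | add x y hx hy => exact hadd _ _ hx hy
  | of i x =>
    obtain ⟨x, rfl⟩ := Submodule.mkQ_surjective _ x
    exact hcls i x

/-- Maps out of a page can be defined on representatives. -/
theorem exists_page_lift (A : FDG k M) (r : ℤ) {Q : Type*} [AddCommGroup Q] [Module k Q]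
    (F : ∀ i, A.num r i →ₗ[k] Q) (hF : ∀ i x, x.1 ∈ A.den r i → F i x = 0) :
    ∃ Λ : A.E r →ₗ[k] Q, ∀ i x, Λ (A.pageCls r i x) = F i x := by
  refine ⟨DirectSum.toModule k (ℤ × ℤ) _ fun i => Submodule.liftQ _ (F i) (hF i), fun i x => ?_⟩
  rw [pageCls, LinearMap.comp_apply, DirectSum.toModule_lof]
  rfl

variable {ι : Type w} {κ : Type w'}

/-- The degree and the filtration are given by functions on a basis. -/
structure IsBased (A : FDG k (ι →₀ k)) (wt dg : ι → ℤ) : Prop where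
  gr_eq : ∀ n, A.gr n = Finsupp.supported k k (Set.ofPred fun s => dg s = n)
  filt_eq : ∀ p, A.filt p = Finsupp.supported k k (Set.ofPred fun s => wt s ≤ p)

open Classical in
/-- The component of filtration `p` and degree `n`. -/
noncomputable def part (k : Type v) [Field k] (wt dg : ι → ℤ) (p n : ℤ) : (ι →₀ k) →ₗ[k] ι →₀ k :=
  Finsupp.linearCombination k fun s => if wt s = p ∧ dg s = n then Finsupp.single s 1 else 0

theorem part_single {wt dg : ι → ℤ} {p n : ℤ} {s : ι} (h : wt s = p ∧ dg s = n) :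
    part k wt dg p n (Finsupp.single s (1 : k)) = Finsupp.single s 1 := by
  rw [part, Finsupp.linearCombination_single, if_pos h, one_smul]

theorem part_single_of_not {wt dg : ι → ℤ} {p n : ℤ} {s : ι} (h : ¬ (wt s = p ∧ dg s = n)) :
    part k wt dg p n (Finsupp.single s (1 : k)) = 0 := by
  rw [part, Finsupp.linearCombination_single, if_neg h, smul_zero]

theorem mem_of_supported {Q : Type*} [AddCommMonoid Q] [Module k Q] {S : Set ι}
    {T : (ι →₀ k) →ₗ[k] Q} {P : Submodule k Q}
    (h : ∀ s ∈ S, T (Finsupp.single s 1) ∈ P) {x : ι →₀ k} (hx : x ∈ Finsupp.supported k k S) :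
    T x ∈ P := by
  rw [Finsupp.supported_eq_span_single] at hx
  refine Submodule.span_le (p := P.comap T).2 ?_ hx
  rintro _ ⟨s, hs, rfl⟩
  exact h s hs

theorem eq_of_supported {Q : Type*} [AddCommMonoid Q] [Module k Q] {S : Set ι}
    {T T' : (ι →₀ k) →ₗ[k] Q}
    (h : ∀ s ∈ S, T (Finsupp.single s 1) = T' (Finsupp.single s 1)) {x : ι →₀ k}
    (hx : x ∈ Finsupp.supported k k S) : T x = T' x := by
  rw [Finsupp.supported_eq_span_single] at hx
  refine LinearMap.eqOn_span (f := T) (g := T') ?_ hx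
  rintro _ ⟨s, hs, rfl⟩
  exact h s hs

theorem part_part (wt dg : ι → ℤ) (p n : ℤ) (x : ι →₀ k) :
    part k wt dg p n (part k wt dg p n x) =
    part k wt dg p n x := by
  refine eq_of_supported (S := Set.univ) 
    (T := part k wt dg p n ∘ₗ part k wt dg p n) (fun s _ => ?_) (by simp)
  rw [LinearMap.comp_apply]
  by_cases h : wt s = p ∧ dg s = n
  · rw [part_single h, part_single h]
  · rw [part_single_of_not h, map_zero]

namespace IsBased

variable {A : FDG k (ι →₀ k)} {wt dg : ι → ℤ} (hA : A.IsBased wt dg)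

include hA

theorem deg_eq (p n : ℤ) :
    A.deg p n = Finsupp.supported k k (Set.ofPred fun s => wt s ≤ p ∧ dg s = n) := by
  rw [deg, hA.gr_eq, hA.filt_eq, ← Finsupp.supported_inter]
  rfl

theorem single_mem {s : ι} {p n : ℤ} (hp : wt s ≤ p) (hn : dg s = n) (c : k) :
    Finsupp.single s c ∈ A.deg p n := by
  rw [hA.deg_eq]
  exact Finsupp.single_mem_supported k c ⟨hp, hn⟩

theorem mem_of_deg {T : (ι →₀ k) →ₗ[k] N} {P : Submodule k N} {p n : ℤ}
    (h : ∀ s, wt s ≤ p → dg s = n → T (Finsupp.single s 1) ∈ P) {x : ι →₀ k}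
    (hx : x ∈ A.deg p n) : T x ∈ P :=
  mem_of_supported (fun s hs => h s hs.1 hs.2) (hA.deg_eq p n ▸ hx)

theorem sub_part_mem {p n : ℤ} {x : ι →₀ k} (hx : x ∈ A.deg p n) :
    x - part k wt dg p n x ∈ A.deg (p - 1) n := by
  refine hA.mem_of_deg (T := LinearMap.id - part k wt dg p n)
    (fun s hs hs' => ?_) hx
  rw [LinearMap.sub_apply, LinearMap.id_apply]
  by_cases h : wt s = p ∧ dg s = n
  · rw [part_single h, sub_self]
    exact zero_mem _
  · rw [part_single_of_not h, sub_zero]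
    refine hA.single_mem ?_ hs' _
    by_contra h'
    exact h ⟨by lia, hs'⟩

theorem part_mem (p n p' n' : ℤ) (hp : p ≤ p') (hn : n = n') (x : ι →₀ k) :
    part k wt dg p n x ∈ A.deg p' n' := by
  refine mem_of_supported (S := Set.univ) (fun s _ => ?_) (by simp)
  by_cases h : wt s = p ∧ dg s = n
  · rw [part_single h]
    exact hA.single_mem (by lia) (by lia) _
  · rw [part_single_of_not h]
    exact zero_mem _

theorem part_eq_zero {p p' n n' : ℤ} {x : ι →₀ k} (hx : x ∈ A.deg p' n') (h : p' < p) :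
    part k wt dg p n x = 0 := by
  refine (Submodule.mem_bot k).1 (hA.mem_of_deg (fun s hs _ => ?_) hx)
  rw [part_single_of_not (by lia), Submodule.mem_bot]

theorem exists_generalized_inverse (r : ℤ) (δ : (ι →₀ k) →ₗ[k] (ι →₀ k)) :
    ∃ K : (ι →₀ k) →ₗ[k] (ι →₀ k), (∀ {p n x}, x ∈ A.deg p n → K x ∈ A.deg (p + r) (n + 1)) ∧
      ∀ p n y, part k wt dg p n y = y →
        part k wt dg (p - r) (n - 1) (δ (K (part k wt dg (p - r) (n - 1) (δ y)))) =
          part k wt dg (p - r) (n - 1) (δ y) := by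
  choose S hS using fun p n => SerreSS.exists_generalized_inverse
    (part k wt dg (p - r) (n - 1) ∘ₗ δ ∘ₗ part k wt dg p n)
  refine ⟨Finsupp.linearCombination k fun s => part k wt dg (wt s + r) (dg s + 1)
    (S (wt s + r) (dg s + 1) (Finsupp.single s 1)), fun {p n x} hx => ?_, fun p n y hy => ?_⟩
  · refine hA.mem_of_deg (fun s hs hs' => ?_) hx
    rw [Finsupp.linearCombination_single, one_smul]
    exact hA.part_mem _ _ _ _ (by lia) (by lia) _
  · have hKP : ∀ x, Finsupp.linearCombination k (fun s => part k wt dg (wt s + r) (dg s + 1)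
        (S (wt s + r) (dg s + 1) (Finsupp.single s 1))) (part k wt dg (p - r) (n - 1) x) =
        part k wt dg p n (S p n (part k wt dg (p - r) (n - 1) x)) := by
      intro x
      refine eq_of_supported (S := Set.univ) (T := Finsupp.linearCombination k
          (fun s => part k wt dg (wt s + r) (dg s + 1)
            (S (wt s + r) (dg s + 1) (Finsupp.single s 1))) ∘ₗ part k wt dg (p - r) (n - 1))
        (T' := part k wt dg p n ∘ₗ S p n ∘ₗ part k wt dg (p - r) (n - 1)) (fun s _ => ?_) (by simp)
      simp only [LinearMap.comp_apply]
      by_cases h : wt s = p - r ∧ dg s = n - 1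
      · rw [part_single h, Finsupp.linearCombination_single, one_smul]
        have e₁ : wt s + r = p := by lia
        have e₂ : dg s + 1 = n := by lia
        rw [e₁, e₂]
      · rw [part_single_of_not h, map_zero, map_zero, map_zero]
    have h := hS p n y
    simp only [LinearMap.comp_apply, hy] at h
    rw [hKP, h]

theorem sub_mem_of_generalized_inverse {r : ℤ} {δ K : (ι →₀ k) →ₗ[k] (ι →₀ k)}
    (hδ : ∀ {p n x}, x ∈ A.deg p n → δ x ∈ A.deg (p - r) (n - 1))
    (hK : ∀ {p n x}, x ∈ A.deg p n → K x ∈ A.deg (p + r) (n + 1))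
    (hKδ : ∀ p n y, part k wt dg p n y = y →
        part k wt dg (p - r) (n - 1) (δ (K (part k wt dg (p - r) (n - 1) (δ y)))) =
          part k wt dg (p - r) (n - 1) (δ y)) {p n : ℤ} {x : ι →₀ k} (hx : x ∈ A.deg p n) :
    δ x - δ (K (δ x)) ∈ A.deg (p - r - 1) (n - 1) := by
  obtain ⟨y, hy⟩ : ∃ y, y = part k wt dg p n x := ⟨_, rfl⟩
  have h₁ : x - y ∈ A.deg (p - 1) n := hy ▸ hA.sub_part_mem hx
  have hy' : y ∈ A.deg p n := hy ▸ hA.part_mem _ _ _ _ le_rfl rfl _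
  obtain ⟨z, hz⟩ : ∃ z, z = part k wt dg (p - r) (n - 1) (δ y) := ⟨_, rfl⟩
  have h₂ : δ x - z ∈ A.deg (p - r - 1) (n - 1) := by
    have := add_mem (A.deg_le (by lia) rfl (hδ h₁)) (hA.sub_part_mem (hδ hy'))
    rwa [map_sub, sub_add_sub_cancel, ← hz] at this
  have h₃ : δ (K (δ x - z)) ∈ A.deg (p - r - 1) (n - 1) :=
    A.deg_le (by lia) (by lia) (hδ (hK h₂))
  have hzS : part k wt dg (p - r) (n - 1) (δ (K z)) = z := by
    have h := hKδ p n y (hy ▸ part_part wt dg p n x)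
    rwa [← hz] at h
  have hKz : K z ∈ A.deg p n :=
    A.deg_le (by lia) (by lia) (hK (hz ▸ hA.part_mem (p - r) (n - 1) _ _ le_rfl rfl (δ y)))
  have h₄ : δ (K z) - z ∈ A.deg (p - r - 1) (n - 1) := by
    have h := hA.sub_part_mem (hδ hKz)
    rwa [hzS] at h
  have e : δ x - δ (K (δ x)) = (δ x - z) - δ (K (δ x - z)) - (δ (K z) - z) := by
    rw [map_sub, map_sub]; abel
  rw [e]
  exact sub_mem (sub_mem h₂ h₃) h₄

theorem exists_contraction_succ {r : ℤ} (c : A.Contraction r) :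
    Nonempty (A.Contraction (r + 1)) := by
  obtain ⟨K, hK, hK'⟩ := hA.exists_generalized_inverse r (A.d ∘ₗ c.proj)
  have hδ : ∀ {p n x}, x ∈ A.deg p n → (A.d ∘ₗ c.proj) x ∈ A.deg (p - r) (n - 1) :=
    fun hx => c.d_proj_mem hx
  have hπ : ∀ x, x - A.d ((c.h + c.proj ∘ₗ K ∘ₗ c.proj) x) - (c.h + c.proj ∘ₗ K ∘ₗ c.proj) (A.d x) =
      c.proj x - (A.d ∘ₗ c.proj) (K (c.proj x)) - c.proj (K ((A.d ∘ₗ c.proj) x)) := fun x => by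
    simp only [LinearMap.add_apply, LinearMap.comp_apply, map_add, ← c.d_proj]
    rw [c.proj_apply x]
    abel
  refine ⟨⟨c.h + c.proj ∘ₗ K ∘ₗ c.proj, fun {p n x} hx => ?_, fun {p n x} hx => ?_,
    fun {p n x} hx => ?_⟩⟩
  · exact add_mem (A.deg_le (by lia) rfl (c.h_mem hx))
      (A.deg_le (by lia) rfl (c.proj_mem (hK (c.proj_mem hx))))
  · rw [hπ]
    exact sub_mem (sub_mem (c.proj_mem hx) (A.deg_le (by lia) (by lia) (hδ (hK (c.proj_mem hx)))))
      (A.deg_le (by lia) (by lia) (c.proj_mem (hK (hδ hx))))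
  · rw [hπ]
    have e : A.d (c.proj x - (A.d ∘ₗ c.proj) (K (c.proj x)) - c.proj (K ((A.d ∘ₗ c.proj) x))) =
        (A.d ∘ₗ c.proj) x - (A.d ∘ₗ c.proj) (K ((A.d ∘ₗ c.proj) x)) := by
      simp only [map_sub, LinearMap.comp_apply, A.d_d, sub_zero]
    rw [e]
    exact A.deg_le (by lia) rfl (hA.sub_mem_of_generalized_inverse hδ hK hK' hx)

theorem exists_contraction (r : ℕ) : Nonempty (A.Contraction r) := by
  induction r with
  | zero =>
    refine ⟨⟨0, fun _ => zero_mem _, fun hx => ?_, fun {p n x} hx => ?_⟩⟩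
    · simpa using hx
    · simp only [LinearMap.zero_apply, map_zero, sub_zero]
      exact A.deg_le (by simp) rfl (A.d_mem_deg hx)
  | succ r ih =>
    obtain ⟨c⟩ := ih
    exact_mod_cast hA.exists_contraction_succ c

end IsBased

end FDG

end PageKunneth

end SerreSS

namespace SerreSS

open CategoryTheory Simplicial Opposite TensorProduct

section PageKunneth

variable {k : Type v} [Field k]

namespace FDG

variable {ι : Type w} {κ : Type w'} {A : FDG k (ι →₀ k)} {A' : FDG k (κ →₀ k)} {wt dg : ι → ℤ}
  {wt' dg' : κ → ℤ}

theorem finsupp_tmul_mem_supported {F : ℤ → Submodule k (ι →₀ k)} {G : ℤ → Submodule k (κ →₀ k)}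
    {R : ℤ → ι → Prop} {R' : ℤ → κ → Prop} {Q : ι × κ → Prop} {n : ℤ}
    (hF : ∀ a, F a ≤ Finsupp.supported k k (Set.ofPred (R a)))
    (hG : ∀ a, G a ≤ Finsupp.supported k k (Set.ofPred (R' a)))
    (hQ : ∀ a s t, R a s → R' (n - a) t → Q (s, t))
    {z : (ι →₀ k) ⊗[k] (κ →₀ k)}
    (hz : z ∈ ⨆ a : ℤ, Submodule.map₂ (TensorProduct.mk k _ _) (F a) (G (n - a))) :
    finsuppTensorFinsupp' k ι κ z ∈ Finsupp.supported k k (Set.ofPred Q) := by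
  refine Submodule.mem_comap.1 (iSup_map₂_induction (P := Submodule.comap
    (finsuppTensorFinsupp' k ι κ).toLinearMap (Finsupp.supported k k (Set.ofPred Q)))
    (fun a x hx y hy => ?_) hz)
  rw [Submodule.mem_comap, Finsupp.mem_supported]
  rintro ⟨s, t⟩ hst
  rw [Finset.mem_coe, Finsupp.mem_support_iff] at hst
  have e : finsuppTensorFinsupp' k ι κ (x ⊗ₜ y) (s, t) = x s * y t :=
    finsuppTensorFinsupp'_apply_apply ..
  replace hst : x s * y t ≠ 0 := e ▸ hst
  exact hQ a s t (hF a hx (Finsupp.mem_support_iff.2 (left_ne_zero_of_mul hst)))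
    (hG _ hy (Finsupp.mem_support_iff.2 (right_ne_zero_of_mul hst)))

theorem IsBased.tensor_mem_of_deg (hA : A.IsBased wt dg) (hA' : A'.IsBased wt' dg') {p n : ℤ}
    {Q : Type*} [AddCommMonoid Q] [Module k Q] {T : (ι →₀ k) ⊗[k] (κ →₀ k) →ₗ[k] Q}
    {P : Submodule k Q}
    (h : ∀ a m x y, x ∈ A.deg a m → y ∈ A'.deg (p - a) (n - m) → T (x ⊗ₜ y) ∈ P)
    {z : (ι →₀ k) ⊗[k] (κ →₀ k)} (hz : z ∈ (A.tensor A').deg p n) : T z ∈ P := by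
  obtain ⟨hz₁, hz₂⟩ := hz
  have h₁ := finsupp_tmul_mem_supported (R := fun a s => wt s ≤ a) (R' := fun a s => wt' s ≤ a)
    (Q := fun st => wt st.1 + wt' st.2 ≤ p) (fun a => (hA.filt_eq a).le)
    (fun a => (hA'.filt_eq a).le) (fun a s t h h' => by dsimp only; lia) hz₁
  have h₂ := finsupp_tmul_mem_supported (R := fun a s => dg s = a) (R' := fun a s => dg' s = a)
    (Q := fun st => dg st.1 + dg' st.2 = n) (fun a => (hA.gr_eq a).le)
    (fun a => (hA'.gr_eq a).le) (fun a s t h h' => by dsimp only; lia) hz₂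
  have h₃ : finsuppTensorFinsupp' k ι κ z ∈ Finsupp.supported k k
      (Set.ofPred fun st : ι × κ => wt st.1 + wt' st.2 ≤ p ∧ dg st.1 + dg' st.2 = n) := by
    have := Submodule.mem_inf.2 ⟨h₁, h₂⟩
    rwa [← Finsupp.supported_inter] at this
  have h₄ := mem_of_supported (T := T ∘ₗ (finsuppTensorFinsupp' k ι κ).symm.toLinearMap) (P := P)
    (fun st hst => ?_) h₃
  · simpa using h₄
  · have e : (finsuppTensorFinsupp' k ι κ).symm (Finsupp.single st 1) =
        Finsupp.single st.1 1 ⊗ₜ Finsupp.single st.2 1 := by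
      rw [LinearEquiv.symm_apply_eq, finsuppTensorFinsupp'_single_tmul_single, one_mul]
    change T ((finsuppTensorFinsupp' k ι κ).symm (Finsupp.single st 1)) ∈ P
    rw [e]
    have hp := hst.1
    have hn := hst.2
    exact h (wt st.1) (dg st.1) _ _ (hA.single_mem le_rfl rfl _)
      (hA'.single_mem (by lia) (by lia) _)

theorem IsBased.tensor_eq_of_deg (hA : A.IsBased wt dg) (hA' : A'.IsBased wt' dg') {p n : ℤ}
    {Q : Type*} [AddCommMonoid Q] [Module k Q] {T T' : (ι →₀ k) ⊗[k] (κ →₀ k) →ₗ[k] Q}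
    (h : ∀ a m x y, x ∈ A.deg a m → y ∈ A'.deg (p - a) (n - m) → T (x ⊗ₜ y) = T' (x ⊗ₜ y))
    {z : (ι →₀ k) ⊗[k] (κ →₀ k)} (hz : z ∈ (A.tensor A').deg p n) : T z = T' z :=
  LinearMap.mem_eqLocus.1 (hA.tensor_mem_of_deg hA' (T := LinearMap.id)
    (P := LinearMap.eqLocus T T') (fun a m x y hx hy => LinearMap.mem_eqLocus.2 (h a m x y hx hy)) hz)

theorem Contraction.sgn_h {r : ℤ} (c : A.Contraction r) {p n : ℤ} {x : ι →₀ k}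
    (hx : x ∈ A.deg p n) : A.sgn (c.h x) = -c.h (A.sgn x) := by
  rw [A.sgn_gr _ _ hx.2, A.sgn_gr _ _ (c.h_mem hx).2, map_zsmul, Int.negOnePow_succ,
    Units.val_neg, neg_smul]

/-- The homotopy on a tensor product. -/
noncomputable def Contraction.tensorH {r : ℤ} (c : A.Contraction r) (c' : A'.Contraction r) :
    (ι →₀ k) ⊗[k] (κ →₀ k) →ₗ[k] (ι →₀ k) ⊗[k] (κ →₀ k) :=
  TensorProduct.map A.sgn c'.h + TensorProduct.map c.h c'.proj

theorem Contraction.tensorH_tmul {r : ℤ} (c : A.Contraction r) (c' : A'.Contraction r)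
    (x : ι →₀ k) (y : κ →₀ k) :
    c.tensorH c' (x ⊗ₜ y) = A.sgn x ⊗ₜ c'.h y + c.h x ⊗ₜ c'.proj y := rfl

theorem tensor_d_tmul' (x : ι →₀ k) (y : κ →₀ k) :
    (A.tensor A').d (x ⊗ₜ y) = A.d x ⊗ₜ y + A.sgn x ⊗ₜ A'.d y := rfl

/-- The projection `1 - dh - hd` on a tensor product. -/
noncomputable def Contraction.tensorProj {r : ℤ} (c : A.Contraction r) (c' : A'.Contraction r) :
    (ι →₀ k) ⊗[k] (κ →₀ k) →ₗ[k] (ι →₀ k) ⊗[k] (κ →₀ k) :=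
  (A.tensor A').homotopyProj (c.tensorH c')

theorem Contraction.tensorProj_tmul {r : ℤ} (c : A.Contraction r) (c' : A'.Contraction r) {p n : ℤ}
    {x : ι →₀ k} (y : κ →₀ k) (hx : x ∈ A.deg p n) :
    c.tensorProj c' (x ⊗ₜ y) = c.proj x ⊗ₜ c'.proj y := by
  have e : c.tensorProj c' (x ⊗ₜ y) = x ⊗ₜ y - (A.tensor A').d (c.tensorH c' (x ⊗ₜ y)) -
    c.tensorH c' ((A.tensor A').d (x ⊗ₜ y)) := rfl
  simp only [e, tensorH_tmul, tensor_d_tmul', map_add, A.sgn_sgn,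
    A.d_sgn, TensorProduct.neg_tmul, ← c'.d_proj, c.sgn_h hx]
  have h : x ⊗ₜ[k] c'.proj y =
      x ⊗ₜ[k] y - x ⊗ₜ[k] A'.d (c'.h y) - x ⊗ₜ[k] c'.h (A'.d y) := by
    rw [c'.proj_apply, TensorProduct.tmul_sub, TensorProduct.tmul_sub]
  rw [c.proj_apply x, TensorProduct.sub_tmul, TensorProduct.sub_tmul, h]
  abel

/-- The tensor product of contractions. -/
noncomputable def Contraction.tensor {r : ℤ} (c : A.Contraction r) (c' : A'.Contraction r)
    (hA : A.IsBased wt dg) (hA' : A'.IsBased wt' dg') : (A.tensor A').Contraction r where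
  h := c.tensorH c'
  h_mem {p n z} hz := by
    refine hA.tensor_mem_of_deg hA' (fun a m x y hx hy => ?_) hz
    rw [tensorH_tmul]
    exact add_mem (A.tmul_mem_deg A' (A.sgn_mem_deg hx) (c'.h_mem hy) (by lia) (by lia))
      (A.tmul_mem_deg A' (c.h_mem hx) (c'.proj_mem hy) (by lia) (by lia))
  proj_mem' {p n z} hz := by
    refine hA.tensor_mem_of_deg hA' (T := c.tensorProj c') (fun a m x y hx hy => ?_) hz
    rw [c.tensorProj_tmul c' y hx]
    exact A.tmul_mem_deg A' (c.proj_mem hx) (c'.proj_mem hy) (by lia) (by lia)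
  d_proj_mem' {p n z} hz := by
    refine hA.tensor_mem_of_deg hA' (T := (A.tensor A').d ∘ₗ c.tensorProj c')
      (fun a m x y hx hy => ?_) hz
    rw [LinearMap.comp_apply, c.tensorProj_tmul c' y hx, tensor_d_tmul']
    exact add_mem (A.tmul_mem_deg A' (c.d_proj_mem hx) (c'.proj_mem hy) (by lia) (by lia))
      (A.tmul_mem_deg A' (A.sgn_mem_deg (c.proj_mem hx)) (c'.d_proj_mem hy) (by lia) (by lia))

variable {r : ℤ} (hA : A.IsBased wt dg) (hA' : A'.IsBased wt' dg') (c : A.Contraction r)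
  (c' : A'.Contraction r)

theorem Contraction.tensor_proj_tmul (c : A.Contraction r) (c' : A'.Contraction r)
    (hA : A.IsBased wt dg) (hA' : A'.IsBased wt' dg') {p n : ℤ} {x : ι →₀ k} (y : κ →₀ k) (hx : x ∈ A.deg p n) :
    (c.tensor c' hA hA').proj (x ⊗ₜ y) = c.proj x ⊗ₜ c'.proj y := c.tensorProj_tmul c' y hx

include hA hA' in
/-- Up to elements representing zero, an element representing a class of a page of the tensor product
is a sum of products. -/
theorem exists_sub_mem_den (r : ℕ) {l : ℤ × ℤ} {z : (ι →₀ k) ⊗[k] (κ →₀ k)}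
    (hz : z ∈ (A.tensor A').num r l) :
    ∃ z' ∈ Submodule.span k (Set.ofPred fun z' => ∃ i j : ℤ × ℤ, i + j = l ∧
      ∃ x ∈ A.Z r i, ∃ y ∈ A'.Z r j, z' = x ⊗ₜ[k] y), z - z' ∈ (A.tensor A').den r l := by
  obtain ⟨c⟩ := hA.exists_contraction r
  obtain ⟨c'⟩ := hA'.exists_contraction r
  refine ⟨(c.tensor c' hA hA').proj z, ?_, (c.tensor c' hA hA').sub_proj_mem_den _ hz⟩
  refine hA.tensor_mem_of_deg hA' (T := (c.tensor c' hA hA').proj)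
    (fun a m x y hx hy => ?_) ((A.tensor A').num_le _ _ hz)
  rw [c.tensor_proj_tmul c' hA hA' y hx]
  refine Submodule.subset_span ⟨(a, m - a), (l.1 - a, l.1 + l.2 - m - (l.1 - a)),
    Prod.ext (by simp) (by dsimp; ring), _, c.proj_mem_Z _ ?_, _, c'.proj_mem_Z _ ?_, rfl⟩
  · simpa using hx
  · simpa using hy

include hA hA' in
theorem pageCross_surjective (r : ℕ) : Function.Surjective (A.pageCross A' r) := by
  intro z
  induction z using pageCls_induction with
  | h0 => exact ⟨0, map_zero _⟩
  | hadd x y hx hy =>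
    obtain ⟨x, rfl⟩ := hx
    obtain ⟨y, rfl⟩ := hy
    exact ⟨x + y, map_add _ _ _⟩
  | hcls l z =>
    obtain ⟨z', hz', hzz'⟩ := exists_sub_mem_den hA hA' r z.2
    have h : ∃ (h : z' ∈ (A.tensor A').num r l), ∃ w, A.pageCross A' r w =
        (A.tensor A').pageCls r l ⟨z', h⟩ := by
      clear hzz'
      induction hz' using Submodule.span_induction with
      | mem z' hz' =>
        obtain ⟨i, j, rfl, x, hx, y, hy, rfl⟩ := hz'
        have hx' : x ∈ A.num r i := Submodule.mem_sup_left hx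
        have hy' : y ∈ A'.num r j := Submodule.mem_sup_left hy
        exact ⟨A.tmul_mem_num A' r i j hx' hy',
          A.pageCls r i ⟨x, hx'⟩ ⊗ₜ A'.pageCls r j ⟨y, hy'⟩, pageCross_cls _ _ _ _ rfl _⟩
      | zero => exact ⟨zero_mem _, 0, by rw [map_zero]; exact (map_zero _).symm⟩
      | add x y _ _ hx hy =>
        obtain ⟨hx, w, hw⟩ := hx
        obtain ⟨hy, w', hw'⟩ := hy
        exact ⟨add_mem hx hy, w + w', by rw [map_add, hw, hw', ← map_add]; rfl⟩
      | smul a x _ hx =>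
        obtain ⟨hx, w, hw⟩ := hx
        exact ⟨Submodule.smul_mem _ a hx, a • w, by rw [map_smul, hw, ← map_smul]; rfl⟩
    obtain ⟨h, w, hw⟩ := h
    exact ⟨w, hw.trans (((A.tensor A').pageCls_eq hzz').symm)⟩

/-- The extension of two maps to the part of a tensor product of filtration `p`. -/
noncomputable def topMap {Q Q' : Type*} [AddCommGroup Q] [Module k Q] [AddCommGroup Q']
    [Module k Q'] (wt : ι → ℤ) (wt' : κ → ℤ) (G : ι → Q) (G' : κ → Q') (p : ℤ) :
    (ι →₀ k) ⊗[k] (κ →₀ k) →ₗ[k] Q ⊗[k] Q' := by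
  classical exact TensorProduct.lift <| Finsupp.linearCombination k fun s =>
    Finsupp.linearCombination k fun t => if wt s + wt' t = p then G s ⊗ₜ G' t else 0

section topMap

variable {Q Q' : Type*} [AddCommGroup Q] [Module k Q] [AddCommGroup Q'] [Module k Q']
  {G : ι → Q} {G' : κ → Q'}

theorem topMap_single (s : ι) (t : κ) (p : ℤ) (h : wt s + wt' t = p) :
    topMap (k := k) wt wt' G G' p (Finsupp.single s 1 ⊗ₜ Finsupp.single t 1) = G s ⊗ₜ G' t := by
  simp [topMap, h]

theorem topMap_single_of_ne (s : ι) (t : κ) (p : ℤ) (h : wt s + wt' t ≠ p) :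
    topMap (k := k) wt wt' G G' p (Finsupp.single s 1 ⊗ₜ Finsupp.single t 1) = 0 := by
  simp [topMap, h]

include hA hA' in
theorem topMap_tmul {a b m m' : ℤ} {F : (ι →₀ k) →ₗ[k] Q} {F' : (κ →₀ k) →ₗ[k] Q'}
    (hF : ∀ s, wt s = a → dg s = m → F (Finsupp.single s 1) = G s)
    (hF' : ∀ s, wt' s = b → dg' s = m' → F' (Finsupp.single s 1) = G' s)
    (hF0 : ∀ x ∈ A.deg (a - 1) m, F x = 0) (hF0' : ∀ x ∈ A'.deg (b - 1) m', F' x = 0)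
    {x : ι →₀ k} {y : κ →₀ k} (hx : x ∈ A.deg a m) (hy : y ∈ A'.deg b m') :
    topMap wt wt' G G' (a + b) (x ⊗ₜ y) = F x ⊗ₜ F' y := by
  rw [hA.deg_eq] at hx
  rw [hA'.deg_eq] at hy
  refine eq_of_supported (T := (TensorProduct.mk k _ _).flip y |> (topMap wt wt' G G' (a + b)).comp)
    (T' := ((TensorProduct.mk k _ _).flip (F' y)).comp F) (fun s hs => ?_) hx
  refine eq_of_supported (T := (topMap wt wt' G G' (a + b)).comp
      (TensorProduct.mk k _ _ (Finsupp.single s 1)))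
    (T' := (TensorProduct.mk k _ _ (F (Finsupp.single s 1))).comp F') (fun t ht => ?_) hy
  simp only [LinearMap.comp_apply, TensorProduct.mk_apply]
  obtain ⟨hs, hs'⟩ := hs
  obtain ⟨ht, ht'⟩ := ht
  by_cases h : wt s + wt' t = a + b
  · rw [topMap_single s t _ h, hF s (by lia) hs', hF' t (by lia) ht']
  · rw [topMap_single_of_ne s t _ h]
    by_cases h' : wt s = a
    · rw [hF0' _ (hA'.single_mem (by lia) ht' _), TensorProduct.tmul_zero]
    · rw [hF0 _ (hA.single_mem (by lia) hs' _), TensorProduct.zero_tmul]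

include hA hA' in
theorem topMap_eq_zero {p n : ℤ} {z : (ι →₀ k) ⊗[k] (κ →₀ k)}
    (hz : z ∈ (A.tensor A').deg (p - 1) n) : topMap wt wt' G G' p z = 0 := by
  refine (Submodule.mem_bot k).1 (hA.tensor_mem_of_deg hA' (fun a m x y hx hy => ?_) hz)
  rw [hA.deg_eq] at hx
  rw [hA'.deg_eq] at hy
  refine mem_of_supported (T := (topMap wt wt' G G' p).comp
    ((TensorProduct.mk k _ _).flip y)) (fun s hs => ?_) hx
  refine mem_of_supported (T := (topMap wt wt' G G' p).comp
    (TensorProduct.mk k _ _ (Finsupp.single s 1))) (fun t ht => ?_) hy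
  obtain ⟨hs, hs'⟩ := hs
  obtain ⟨ht, ht'⟩ := ht
  exact (Submodule.mem_bot k).2 (topMap_single_of_ne s t _ (by lia))

end topMap

/-- The class in a page of the component of an element. -/
noncomputable def partCls (hA : A.IsBased wt dg) (c : A.Contraction r) (i : ℤ × ℤ) :
    (ι →₀ k) →ₗ[k] A.E r :=
  A.pageCls r i ∘ₗ LinearMap.codRestrict (A.num r i) (c.proj ∘ₗ part k wt dg i.1 (i.1 + i.2))
    fun x => c.proj_mem_num i (hA.part_mem _ _ _ _ le_rfl rfl x)

theorem partCls_num (i : ℤ × ℤ) (x : A.num r i) : partCls hA c i x.1 = A.pageCls r i x := by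
  refine A.pageCls_eq ?_
  change c.proj (part k wt dg i.1 (i.1 + i.2) x.1) - x.1 ∈ _
  have h₁ := c.sub_proj_mem_den i x.2
  have h₂ : c.proj (x.1 - part k wt dg i.1 (i.1 + i.2) x.1) ∈ A.den r i :=
    Submodule.mem_sup_right (c.proj_mem (hA.sub_part_mem (A.num_le _ _ x.2)))
  have := neg_mem (add_mem h₁ h₂)
  rw [map_sub] at this
  convert this using 1
  abel

theorem partCls_proj (i : ℤ × ℤ) {x : ι →₀ k} (hx : x ∈ A.deg i.1 (i.1 + i.2)) :
    partCls hA c i (c.proj x) = partCls hA c i x := by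
  rw [partCls_num hA c i ⟨c.proj x, c.proj_mem_num i hx⟩]
  refine A.pageCls_eq ?_
  change c.proj x - c.proj (part k wt dg i.1 (i.1 + i.2) x) ∈ _
  rw [← map_sub]
  exact Submodule.mem_sup_right (c.proj_mem (hA.sub_part_mem hx))

theorem partCls_eq_zero (i : ℤ × ℤ) {x : ι →₀ k} (hx : x ∈ A.deg (i.1 - 1) (i.1 + i.2)) :
    partCls hA c i x = 0 := by
  refine A.pageCls_eq_zero ?_
  change c.proj (part k wt dg i.1 (i.1 + i.2) x) ∈ _
  rw [hA.part_eq_zero hx (by lia), map_zero]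
  exact zero_mem _

/-- The left inverse of the Künneth map on representatives. -/
noncomputable def pageSplit (p : ℤ) : (ι →₀ k) ⊗[k] (κ →₀ k) →ₗ[k] A.E r ⊗[k] A'.E r :=
  topMap wt wt' (fun s => partCls hA c (wt s, dg s - wt s) (Finsupp.single s 1))
    (fun s => partCls hA' c' (wt' s, dg' s - wt' s) (Finsupp.single s 1)) p

theorem pageSplit_tmul {i j : ℤ × ℤ} {x : ι →₀ k} {y : κ →₀ k}
    (hx : x ∈ A.deg i.1 (i.1 + i.2)) (hy : y ∈ A'.deg j.1 (j.1 + j.2)) :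
    pageSplit hA hA' c c' (i.1 + j.1) (x ⊗ₜ y) = partCls hA c i x ⊗ₜ partCls hA' c' j y := by
  refine topMap_tmul hA hA' (fun s hs hs' => ?_) (fun s hs hs' => ?_)
    (fun x hx => partCls_eq_zero hA c i hx) (fun x hx => partCls_eq_zero hA' c' j hx) hx hy
  · have : i = (wt s, dg s - wt s) := Prod.ext hs.symm (by dsimp only; lia)
    rw [this]
  · have : j = (wt' s, dg' s - wt' s) := Prod.ext hs.symm (by dsimp only; lia)
    rw [this]

theorem pageSplit_proj {p n : ℤ} {z : (ι →₀ k) ⊗[k] (κ →₀ k)} (hz : z ∈ (A.tensor A').deg p n) :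
    pageSplit hA hA' c c' p ((c.tensor c' hA hA').proj z) = pageSplit hA hA' c c' p z := by
  refine hA.tensor_eq_of_deg hA'
    (T := pageSplit hA hA' c c' p ∘ₗ (c.tensor c' hA hA').proj) (fun a m x y hx hy => ?_) hz
  rw [LinearMap.comp_apply, c.tensor_proj_tmul c' hA hA' y hx]
  have hx' : x ∈ A.deg (a, m - a).1 ((a, m - a).1 + (a, m - a).2) := by simpa using hx
  have hy' : y ∈ A'.deg (p - a, n - m - (p - a)).1
      ((p - a, n - m - (p - a)).1 + (p - a, n - m - (p - a)).2) := by simpa using hy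
  have h₁ := pageSplit_tmul hA hA' c c' (c.proj_mem hx') (c'.proj_mem hy')
  have h₂ := pageSplit_tmul hA hA' c c' hx' hy'
  rw [add_sub_cancel] at h₁ h₂
  rw [h₁, h₂, partCls_proj _ _ _ hx', partCls_proj _ _ _ hy']

theorem pageSplit_den {l : ℤ × ℤ} {z : (ι →₀ k) ⊗[k] (κ →₀ k)} (hz : z ∈ (A.tensor A').den r l) :
    pageSplit hA hA' c c' l.1 z = 0 := by
  rw [← pageSplit_proj hA hA' c c' ((A.tensor A').den_le _ _ hz)]
  exact topMap_eq_zero hA hA' ((c.tensor c' hA hA').proj_mem_of_mem_den l hz)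

include hA hA' in
theorem pageCross_injective (r : ℕ) : Function.Injective (A.pageCross A' r) := by
  obtain ⟨c⟩ := hA.exists_contraction r
  obtain ⟨c'⟩ := hA'.exists_contraction r
  let _ : AddCommGroup (A.E r ⊗[k] A'.E r) := @TensorProduct.addCommGroup k _ (A.E r) (A'.E r) _ _ _ _
  obtain ⟨Λ, hΛ⟩ := (A.tensor A').exists_page_lift r
    (fun l => pageSplit hA hA' c c' l.1 ∘ₗ Submodule.subtype _)
    fun l z hz => pageSplit_den hA hA' c c' hz
  refine Function.LeftInverse.injective (g := Λ) fun z => ?_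
  induction z with
  | zero => simp
  | add x y hx hy => rw [map_add, map_add, hx, hy]
  | tmul x y =>
    induction x using pageCls_induction with
    | h0 => simp
    | hadd x x' hx hx' => rw [TensorProduct.add_tmul, map_add, map_add, hx, hx']
    | hcls i x =>
      induction y using pageCls_induction with
      | h0 => simp
      | hadd y y' hy hy' => rw [TensorProduct.tmul_add, map_add, map_add, hy, hy']
      | hcls j y =>
        rw [pageCross_cls A A' x y rfl (A.tmul_mem_num A' r i j x.2 y.2), hΛ]
        refine (pageSplit_tmul hA hA' c c' (A.num_le _ _ x.2) (A'.num_le _ _ y.2)).trans ?_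
        rw [partCls_num, partCls_num]

include hA hA' in
theorem pageCross_bijective (r : ℕ) : Function.Bijective (A.pageCross A' r) :=
  ⟨pageCross_injective hA hA' r, pageCross_surjective hA hA' r⟩

end FDG

end PageKunneth

end SerreSS

namespace SerreSS

open CategoryTheory Simplicial Opposite TensorProduct

section Comparison

variable {k : Type v} [Field k] {M : Type w} [AddCommGroup M] [Module k M]
  {N : Type w'} [AddCommGroup N] [Module k N]

/-- Maps identifying the first page of the spectral sequence of `A` with the bigraded complex `W`. -/
structure Comparison (A : FDG k M) (W : DG k N) where
  e : ℤ × ℤ → N →ₗ[k] N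
  θ : ℤ × ℤ → M →ₗ[k] N
  e_ne : ∀ i j x, i ≠ j → e i (e j x) = 0
  e_sum : ∀ x, ∃ S : Finset (ℤ × ℤ), ∑ i ∈ S, e i x = x
  d_e : ∀ p q x, W.d (e (p, q) x) = e (p - 1, q) (W.d x)
  θ_lower : ∀ i x, x ∈ A.deg (i.1 - 1) (i.1 + i.2) → θ i x = 0
  θ_d : ∀ i x, x ∈ A.deg i.1 (i.1 + i.2 + 1) → θ i (A.d x) = 0
  e_θ : ∀ i x, x ∈ A.Z 1 i → e i (θ i x) = θ i x
  θ_d_Z : ∀ p q x, x ∈ A.Z 1 (p, q) → θ (p - 1, q) (A.d x) = W.d (θ (p, q) x)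
  θ_sgn : ∀ i x, x ∈ A.Z 1 i → θ i (A.sgn x) = W.sgn (θ i x)
  θ_injective : ∀ i x, x ∈ A.Z 1 i → θ i x = 0 →
    ∃ y ∈ A.deg i.1 (i.1 + i.2 + 1), x - A.d y ∈ A.deg (i.1 - 1) (i.1 + i.2)
  θ_surjective : ∀ i x, ∃ y ∈ A.Z 1 i, θ i y = e i x

theorem FDG.d_d_mem_comap (A : FDG k M) (x : M) (S : Submodule k M) : A.d x ∈ S.comap A.d := by
  rw [Submodule.mem_comap, A.d_d]
  exact zero_mem _

theorem FDG.exists_sum_pageCls (A : FDG k M) {r : ℤ} (y : A.E r) :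
    ∃ (S : Finset (ℤ × ℤ)) (x : ∀ i, A.num r i), y = ∑ i ∈ S, A.pageCls r i (x i) := by
  classical
  choose x hx using fun i => Submodule.mkQ_surjective _ (y i)
  refine ⟨DFinsupp.support y, x, ?_⟩
  conv_lhs => rw [← DirectSum.sum_support_of y]
  refine Finset.sum_congr rfl fun i _ => ?_
  rw [pageCls, LinearMap.comp_apply, hx]
  rfl

namespace Comparison

variable {A : FDG k M} {W : DG k N} (c : Comparison A W)

theorem Z_two_le (i : ℤ × ℤ) : A.Z 2 i ≤ A.Z 1 i :=
  inf_le_inf_left _ (Submodule.comap_mono (A.deg_mono _ (by lia)))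

theorem θ_num (i : ℤ × ℤ) {x : M} (hx : x ∈ A.num 2 i) :
    ∃ y ∈ A.Z 2 i, c.θ i x = c.θ i y ∧ x - y ∈ A.deg (i.1 - 1) (i.1 + i.2) := by
  obtain ⟨y, hy, z, hz, rfl⟩ := Submodule.mem_sup.1 hx
  exact ⟨y, hy, by rw [map_add, c.θ_lower i z hz, add_zero], by rwa [add_sub_cancel_left]⟩

theorem d_θ (i : ℤ × ℤ) {x : M} (hx : x ∈ A.num 2 i) : W.d (c.θ i x) = 0 := by
  obtain ⟨y, hy, e, -⟩ := c.θ_num i hx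
  rw [e, ← c.θ_d_Z i.1 i.2 y (Z_two_le i hy)]
  exact c.θ_lower _ _ (A.deg_le (by dsimp; lia) (by dsimp; lia) hy.2)

theorem e_θ' (i : ℤ × ℤ) {x : M} (hx : x ∈ A.num 2 i) : c.e i (c.θ i x) = c.θ i x := by
  obtain ⟨y, hy, e, -⟩ := c.θ_num i hx
  rw [e, c.e_θ i y (Z_two_le i hy)]

theorem e_θ_ne {i j : ℤ × ℤ} (hij : i ≠ j) {x : M} (hx : x ∈ A.num 2 j) : c.e i (c.θ j x) = 0 := by
  rw [← c.e_θ' j hx, c.e_ne i j _ hij]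

theorem θ_den (i : ℤ × ℤ) {x : M} (hx : x ∈ A.den 2 i) : ∃ y, W.d y = c.θ i x := by
  obtain ⟨_, ⟨hw', w, hw, rfl⟩, y, hy, rfl⟩ := Submodule.mem_sup.1 hx
  have hw : w ∈ A.deg (i.1 + 1) (i.1 + i.2 + 1) := hw
  have h := c.θ_d_Z (i.1 + 1) i.2 w
    ⟨A.deg_le (by dsimp; lia) (by dsimp; lia) hw, A.deg_le (by dsimp; lia) (by dsimp; lia) hw'⟩
  rw [add_sub_cancel_right] at h
  exact ⟨c.θ (i.1 + 1, i.2) w, by rw [← h, map_add, c.θ_lower i y hy, add_zero]⟩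

theorem mem_num_of_d_θ (i : ℤ × ℤ) {x : M} (hx : x ∈ A.Z 1 i) (h : W.d (c.θ i x) = 0) :
    x ∈ A.num 2 i := by
  rw [← c.θ_d_Z i.1 i.2 x hx] at h
  have hdx : A.d x ∈ A.deg (i.1 - 1) (i.1 + i.2 - 1) := hx.2
  obtain ⟨w, hw, hxw⟩ := c.θ_injective (i.1 - 1, i.2) (A.d x)
    ⟨A.deg_le (by dsimp; lia) (by dsimp; lia) hdx, A.d_d_mem_comap x _⟩ h
  have hw : w ∈ A.deg (i.1 - 1) (i.1 + i.2) := A.deg_le (by dsimp; lia) (by dsimp; lia) hw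
  rw [← sub_add_cancel x w]
  refine Submodule.add_mem_sup ⟨sub_mem hx.1 (A.deg_le (by lia) rfl hw), Submodule.mem_comap.2 ?_⟩ hw
  rw [map_sub]
  exact A.deg_le (by dsimp; lia) (by dsimp; lia) hxw

theorem exists_lift :
    ∃ Φ : A.E 2 →ₗ[k] W.Homology, ∀ i (x : A.num 2 i),
      Φ (A.pageCls 2 i x) = W.cls ⟨c.θ i x.1, c.d_θ i x.2⟩ :=
  A.exists_page_lift 2
    (fun i => W.cls ∘ₗ LinearMap.codRestrict _ (c.θ i ∘ₗ (A.num 2 i).subtype) fun x => c.d_θ i x.2)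
    fun i _ hx => (W.cls_eq_zero_iff _).2 (c.θ_den i hx)

theorem exists_equiv :
    ∃ Φ : A.E 2 ≃ₗ[k] W.Homology, ∀ i (x : A.num 2 i),
      Φ (A.pageCls 2 i x) = W.cls ⟨c.θ i x.1, c.d_θ i x.2⟩ := by
  obtain ⟨Φ, hΦ⟩ := c.exists_lift
  refine ⟨LinearEquiv.ofBijective Φ ⟨?_, fun y => ?_⟩, hΦ⟩
  · let _ : AddCommGroup (A.E 2) := Module.addCommMonoidToAddCommGroup k
    refine (injective_iff_map_eq_zero Φ).2 fun y hy => ?_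
    obtain ⟨S, x, rfl⟩ := A.exists_sum_pageCls y
    rw [map_sum, Finset.sum_congr rfl fun i _ => hΦ i (x i), ← map_sum, W.cls_eq_zero_iff] at hy
    obtain ⟨η, hη⟩ := hy
    rw [AddSubmonoidClass.coe_finsetSum] at hη
    refine Finset.sum_eq_zero fun j hj => A.pageCls_eq_zero ?_
    have h₁ : W.d (c.e (j.1 + 1, j.2) η) = c.θ j (x j) := by
      rw [c.d_e, hη, map_sum, add_sub_cancel_right, Finset.sum_eq_single_of_mem j hj
        fun i _ hij => c.e_θ_ne hij.symm (x i).2, c.e_θ' j (x j).2]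
    obtain ⟨y, hy, hyη⟩ := c.θ_surjective (j.1 + 1, j.2) η
    have hy₁ : A.d y ∈ A.deg j.1 (j.1 + j.2) := A.deg_le (by dsimp; lia) (by dsimp; lia) hy.2
    have hy₂ := c.θ_d_Z _ _ y hy
    rw [add_sub_cancel_right, hyη, h₁] at hy₂
    obtain ⟨x', hx', e, hxx'⟩ := c.θ_num j (x j).2
    obtain ⟨w, hw, hw'⟩ := c.θ_injective j (x' - A.d y)
      (sub_mem (Z_two_le j hx') ⟨hy₁, A.d_d_mem_comap y _⟩)
      (by rw [map_sub, ← e, hy₂, sub_self])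
    have e : (x j).1 = A.d (y + w) + ((x' - A.d y - A.d w) + ((x j).1 - x')) := by
      rw [map_add]; abel
    rw [e]
    refine Submodule.add_mem_sup ⟨?_, Submodule.mem_map_of_mem ?_⟩ (add_mem hw' hxx')
    · rw [map_add]
      exact add_mem hy₁ (A.d_mem_deg' hw (by lia))
    · exact add_mem (A.deg_le (by dsimp; lia) (by dsimp; lia) hy.1) (A.deg_le (by lia) (by lia) hw)
  · obtain ⟨y, rfl⟩ := W.cls_surjective y
    obtain ⟨S, hS⟩ := c.e_sum y.1
    choose x hx hxy using fun i => c.θ_surjective i y.1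
    have hd : ∀ i, W.d (c.θ i (x i)) = 0 := fun i => by
      rw [hxy i, ← Prod.mk.eta (p := i), c.d_e, LinearMap.mem_ker.1 y.2, map_zero]
    refine ⟨∑ i ∈ S, A.pageCls 2 i ⟨x i, c.mem_num_of_d_θ i (hx i) (hd i)⟩, ?_⟩
    rw [map_sum, Finset.sum_congr rfl fun i _ => hΦ i _, ← map_sum]
    congr 1
    refine Subtype.ext ?_
    rw [AddSubmonoidClass.coe_finsetSum]
    exact (Finset.sum_congr rfl fun i _ => hxy i).trans hS

end Comparison

theorem FDG.exists_isPageComult {A : FDG k M} (r : ℤ) (hK : Function.Bijective (A.pageCross A r))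
    (D : M →ₗ[k] M ⊗[k] M) (hD : ∀ x, (A.tensor A).d (D x) = D (A.d x))
    (hdeg : ∀ p n x, x ∈ A.deg p n → D x ∈ (A.tensor A).deg p n) :
    ∃ Δ : A.E r →ₗ[k] A.E r ⊗[k] A.E r, A.IsPageComult r D Δ := by
  have hZ : ∀ i x, x ∈ A.num r i → D x ∈ (A.tensor A).num r i := fun i x hx => by
    obtain ⟨x, ⟨hx', hdx⟩, y, hy, rfl⟩ := Submodule.mem_sup.1 hx
    rw [map_add]
    refine Submodule.add_mem_sup ⟨hdeg _ _ _ hx', Submodule.mem_comap.2 ?_⟩ (hdeg _ _ _ hy)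
    rw [hD]
    exact hdeg _ _ _ hdx
  have hB : ∀ i x, x ∈ A.den r i → D x ∈ (A.tensor A).den r i := fun i x hx => by
    obtain ⟨_, ⟨hw', w, hw, rfl⟩, y, hy, rfl⟩ := Submodule.mem_sup.1 hx
    rw [map_add]
    refine Submodule.add_mem_sup ⟨hdeg _ _ _ hw', ?_⟩ (hdeg _ _ _ hy)
    rw [← hD]
    exact Submodule.mem_map_of_mem (hdeg _ _ _ hw)
  let G : ∀ i, A.num r i →ₗ[k] (A.tensor A).num r i := fun i =>
    LinearMap.codRestrict _ (D ∘ₗ (A.num r i).subtype) fun x => hZ i x x.2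
  let F : A.E r →ₗ[k] (A.tensor A).E r := DirectSum.toModule k (ℤ × ℤ) _ fun i =>
    DirectSum.lof k (ℤ × ℤ) (fun i => (A.tensor A).page r i) i ∘ₗ
      Submodule.mapQ _ _ (G i) fun x hx => hB i x.1 hx
  have hF : ∀ i x, F (A.pageCls r i x) = (A.tensor A).pageCls r i (G i x) := fun i x => by
    simp only [F, FDG.pageCls, LinearMap.comp_apply, DirectSum.toModule_lof]
    rfl
  refine ⟨(LinearEquiv.ofBijective _ hK).symm.toLinearMap ∘ₗ F, fun i x => ⟨hZ i x x.2, ?_⟩⟩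
  rw [LinearMap.comp_apply, hF]
  exact (LinearEquiv.ofBijective _ hK).apply_symm_apply _

end Comparison

end SerreSS

namespace SerreSS

open CategoryTheory Simplicial Opposite TensorProduct

section ComparisonTop

open FDG

variable {k : Type v} [Field k] {ι : Type w} {N : Type w'} [AddCommGroup N] [Module k N]
  {A : FDG k (ι →₀ k)} {W : DG k N} (c : Comparison A W) {wt dg : ι → ℤ} (hA : A.IsBased wt dg)

namespace Comparison

/-- The map induced by the comparison maps on the tensor products of elements of total filtration
degree `p`. -/
noncomputable def topMap (wt dg : ι → ℤ) (p : ℤ) : (ι →₀ k) ⊗[k] (ι →₀ k) →ₗ[k] N ⊗[k] N :=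
  FDG.topMap wt wt (fun s => c.θ (wt s, dg s - wt s) (Finsupp.single s 1))
    (fun s => c.θ (wt s, dg s - wt s) (Finsupp.single s 1)) p

include hA in
theorem top_tmul {p : ℤ} (i j : ℤ × ℤ) (hp : i.1 + j.1 = p) {x y : ι →₀ k}
    (hx : x ∈ A.deg i.1 (i.1 + i.2)) (hy : y ∈ A.deg j.1 (j.1 + j.2)) :
    c.topMap wt dg p (x ⊗ₜ y) = c.θ i x ⊗ₜ c.θ j y := by
  subst hp
  have key : ∀ (i : ℤ × ℤ) s, wt s = i.1 → dg s = i.1 + i.2 →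
      c.θ i (Finsupp.single s 1) = c.θ (wt s, dg s - wt s) (Finsupp.single s 1) :=
    fun i s h h' => by
      have : i = (wt s, dg s - wt s) := Prod.ext h.symm (by dsimp only; lia)
      rw [this]
  exact topMap_tmul hA hA (key i) (key j) (c.θ_lower i) (c.θ_lower j) hx hy

include hA in
theorem top_d_eq_zero {p n : ℤ} {z : (ι →₀ k) ⊗[k] (ι →₀ k)}
    (hz : z ∈ (A.tensor A).deg p n) : c.topMap wt dg p ((A.tensor A).d z) = 0 := by
  refine (Submodule.mem_bot k).1 (hA.tensor_mem_of_deg hA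
    (T := c.topMap wt dg p ∘ₗ (A.tensor A).d) (fun a m x y hx hy => ?_) hz)
  rw [Submodule.mem_bot, LinearMap.comp_apply, tensor_d_tmul', map_add,
    c.top_tmul hA (a, m - 1 - a) (p - a, n - m - (p - a)) (by dsimp; lia)
      (A.deg_le (by dsimp; lia) (by dsimp; lia) (A.d_mem_deg hx))
      (A.deg_le (by dsimp; lia) (by dsimp; lia) hy),
    c.top_tmul hA (a, m - a) (p - a, n - m - 1 - (p - a)) (by dsimp; lia)
      (A.deg_le (by dsimp; lia) (by dsimp; lia) (A.sgn_mem_deg hx))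
      (A.deg_le (by dsimp; lia) (by dsimp; lia) (A.d_mem_deg hy)),
    c.θ_d _ x (A.deg_le (by dsimp; lia) (by dsimp; lia) hx),
    c.θ_d _ y (A.deg_le (by dsimp; lia) (by dsimp; lia) hy), TensorProduct.zero_tmul,
    TensorProduct.tmul_zero, add_zero]

include hA in
theorem top_d_span {p : ℤ} {l : ℤ × ℤ} (hl : l.1 = p + 1) {z : (ι →₀ k) ⊗[k] (ι →₀ k)}
    (hz : z ∈ Submodule.span k (Set.ofPred fun z' => ∃ i j : ℤ × ℤ, i + j = l ∧
      ∃ x ∈ A.Z 1 i, ∃ y ∈ A.Z 1 j, z' = x ⊗ₜ[k] y)) :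
    c.topMap wt dg p ((A.tensor A).d z) ∈ LinearMap.range (W.tensor W).d := by
  refine Submodule.mem_comap.1 (Submodule.span_le
    (p := (LinearMap.range (W.tensor W).d).comap (c.topMap wt dg p ∘ₗ (A.tensor A).d)).2 ?_ hz)
  rintro _ ⟨i, j, h, x, hx, y, hy, rfl⟩
  have h₁ : i.1 + j.1 = p + 1 := by rw [← hl, ← h]; rfl
  refine ⟨c.θ i x ⊗ₜ c.θ j y, ?_⟩
  rw [LinearMap.comp_apply, tensor_d_tmul', map_add, DG.tensor_d_tmul,
    c.top_tmul hA (i.1 - 1, i.2) j (by dsimp; lia)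
      (A.deg_le (by dsimp; lia) (by dsimp; lia) hx.2) hy.1,
    c.top_tmul hA i (j.1 - 1, j.2) (by dsimp; lia) (A.sgn_mem_deg hx.1)
      (A.deg_le (by dsimp; lia) (by dsimp; lia) hy.2),
    c.θ_d_Z i.1 i.2 x hx, c.θ_d_Z j.1 j.2 y hy, c.θ_sgn i x hx]

include hA in
theorem top_den {l : ℤ × ℤ} {z : (ι →₀ k) ⊗[k] (ι →₀ k)} (hz : z ∈ (A.tensor A).den 2 l) :
    c.topMap wt dg l.1 z ∈ LinearMap.range (W.tensor W).d := by
  obtain ⟨_, ⟨hw', w, hw, rfl⟩, y, hy, rfl⟩ := Submodule.mem_sup.1 hz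
  have hw₁ : w ∈ (A.tensor A).num 1 (l.1 + 1, l.2) := Submodule.mem_sup_left
    ⟨FDG.deg_le _ (by dsimp; lia) (by dsimp; lia) hw,
      FDG.deg_le _ (by dsimp; lia) (by dsimp; lia) hw'⟩
  obtain ⟨w', hspan, hden⟩ := exists_sub_mem_den hA hA 1 hw₁
  obtain ⟨_, ⟨-, w₂, -, rfl⟩, w₃, hw₃, hsum⟩ := Submodule.mem_sup.1 hden
  have e : (A.tensor A).d w = (A.tensor A).d w' + (A.tensor A).d w₃ := by
    have h := congrArg (A.tensor A).d (sub_eq_iff_eq_add'.1 hsum.symm)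
    rwa [map_add, map_add, (A.tensor A).d_d, zero_add] at h
  rw [map_add, show c.topMap wt dg l.1 y = 0 from topMap_eq_zero hA hA hy, add_zero, e, map_add,
    c.top_d_eq_zero hA (FDG.deg_le _ (by dsimp; lia) rfl hw₃), add_zero]
  exact c.top_d_span hA rfl hspan

include hA in
/-- The comparison of a class of the second page of the tensor product, given by an element `z`, is the
homology class of the image of `z`. -/
theorem homologyCross_map {Φ : A.E 2 →ₗ[k] W.Homology}
    (hΦ : ∀ i (x : A.num 2 i), Φ (A.pageCls 2 i x) = W.cls ⟨c.θ i x.1, c.d_θ i x.2⟩) (l : ℤ × ℤ)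
    (z : (A.tensor A).num 2 l) (w : A.E 2 ⊗[k] A.E 2)
    (hw : A.pageCross A 2 w = (A.tensor A).pageCls 2 l z) :
    ∃ h, W.homologyCross W (TensorProduct.map Φ Φ w) =
      (W.tensor W).cls ⟨c.topMap wt dg l.1 z.1, h⟩ := by
  obtain ⟨z', hz', hden⟩ := exists_sub_mem_den hA hA 2 z.2
  have key : ∃ w', (∃ h, A.pageCross A 2 w' = (A.tensor A).pageCls 2 l ⟨z', h⟩) ∧
      ∃ h, W.homologyCross W (TensorProduct.map Φ Φ w') =
        (W.tensor W).cls ⟨c.topMap wt dg l.1 z', h⟩ := by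
    clear hden
    induction hz' using Submodule.span_induction with
    | mem _ h =>
      obtain ⟨i, j, h, x, hx, y, hy, rfl⟩ := h
      have hx' : x ∈ A.num 2 i := Submodule.mem_sup_left hx
      have hy' : y ∈ A.num 2 j := Submodule.mem_sup_left hy
      have e := c.top_tmul hA i j (p := l.1) (by rw [← h]; rfl) hx.1 hy.1
      refine ⟨A.pageCls 2 i ⟨x, hx'⟩ ⊗ₜ A.pageCls 2 j ⟨y, hy'⟩,
        ⟨?_, A.pageCross_cls A ⟨x, hx'⟩ ⟨y, hy'⟩ h _⟩, ?_⟩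
      · rw [← h]; exact A.tmul_mem_num A 2 i j hx' hy'
      · rw [TensorProduct.map_tmul, hΦ, hΦ, DG.homologyCross_cls]
        refine ⟨?_, ?_⟩
        · rw [e]
          exact (W.cycleCross W ⟨c.θ i x, c.d_θ i hx'⟩ ⟨c.θ j y, c.d_θ j hy'⟩).2
        · congr 1
          exact Subtype.ext e.symm
    | zero =>
      refine ⟨0, ⟨zero_mem _, ?_⟩, by rw [map_zero]; exact zero_mem _, ?_⟩
      · rw [map_zero]; exact (map_zero _).symm
      · rw [map_zero, map_zero]
        exact ((W.tensor W).cls_eq_zero_iff _).2 ⟨0, by simp⟩ |>.symm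
    | add x y _ _ hx hy =>
      obtain ⟨w₁, ⟨h₁, e₁⟩, h₁', e₁'⟩ := hx
      obtain ⟨w₂, ⟨h₂, e₂⟩, h₂', e₂'⟩ := hy
      refine ⟨w₁ + w₂, ⟨add_mem h₁ h₂, ?_⟩, by rw [map_add]; exact add_mem h₁' h₂', ?_⟩
      · rw [map_add, e₁, e₂, ← map_add]; rfl
      · rw [map_add, map_add, e₁', e₂', ← map_add]
        congr 1
        exact Subtype.ext (map_add _ _ _).symm
    | smul a x _ hx =>
      obtain ⟨w₁, ⟨h₁, e₁⟩, h₁', e₁'⟩ := hx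
      refine ⟨a • w₁, ⟨Submodule.smul_mem _ a h₁, ?_⟩,
        by rw [map_smul]; exact Submodule.smul_mem _ a h₁', ?_⟩
      · rw [map_smul, e₁, ← map_smul]; rfl
      · rw [map_smul, map_smul, e₁', ← map_smul]
        congr 1
        exact Subtype.ext (map_smul _ _ _).symm
  obtain ⟨w', ⟨h, e⟩, h', e'⟩ := key
  obtain ⟨η, hη⟩ := c.top_den hA hden
  rw [map_sub] at hη
  have hww' : w = w' := (pageCross_bijective hA hA 2).1 (by
    exact hw.trans ((FDG.pageCls_eq _ hden).trans e.symm))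
  have hker : c.topMap wt dg l.1 z.1 ∈ LinearMap.ker (W.tensor W).d := by
    rw [← sub_add_cancel (c.topMap wt dg l.1 z.1) (c.topMap wt dg l.1 z'), ← hη]
    exact add_mem (LinearMap.mem_ker.2 ((W.tensor W).d_d η)) h'
  refine ⟨hker, ?_⟩
  rw [hww', e']
  exact (((W.tensor W).cls_eq_iff _ _).2 ⟨η, hη⟩).symm

end Comparison

end ComparisonTop

end SerreSS

namespace SerreSS

open CategoryTheory Simplicial Opposite TensorProduct

/-! ### Chains of a preorder -/

section Lists

variable (k : Type v) [Field k] {P : Type w}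

/-- Prepending an element to lists. -/
noncomputable def listCons (v : P) : (List P →₀ k) →ₗ[k] List P →₀ k :=
  Finsupp.lmapDomain k k (List.cons v)

/-- The alternating sum of the lists obtained by deleting one element. -/
noncomputable def listBoundary (P : Type w) : (List P →₀ k) →ₗ[k] List P →₀ k :=
  Finsupp.linearCombination k fun l =>
    ∑ i ∈ Finset.range l.length, ((-1) ^ i : ℤ) • Finsupp.single (l.eraseIdx i) 1

/-- The sign `(-1)^(n+1)` on lists of length `n`. -/
noncomputable def listSgn (P : Type w) : (List P →₀ k) →ₗ[k] List P →₀ k :=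
  Finsupp.linearCombination k fun l => ((-1) ^ (l.length + 1) : ℤ) • Finsupp.single l 1

/-- The Alexander--Whitney diagonal on lists. -/
noncomputable def listComult (P : Type w) :
    (List P →₀ k) →ₗ[k] (List P →₀ k) ⊗[k] (List P →₀ k) :=
  Finsupp.linearCombination k fun l =>
    ∑ j ∈ Finset.range l.length, Finsupp.single (l.take (j + 1)) 1 ⊗ₜ Finsupp.single (l.drop j) 1

variable {k}

theorem listCons_single (v : P) (l : List P) :
    listCons k v (Finsupp.single l 1) = Finsupp.single (v :: l) 1 := Finsupp.mapDomain_single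

theorem listBoundary_single (l : List P) :
    listBoundary k P (Finsupp.single l 1) =
      ∑ i ∈ Finset.range l.length, ((-1) ^ i : ℤ) • Finsupp.single (l.eraseIdx i) 1 := by
  rw [listBoundary, Finsupp.linearCombination_single, one_smul]

theorem listSgn_single (l : List P) :
    listSgn k P (Finsupp.single l 1) = ((-1) ^ (l.length + 1) : ℤ) • Finsupp.single l 1 := by
  rw [listSgn, Finsupp.linearCombination_single, one_smul]

theorem listComult_single (l : List P) :
    listComult k P (Finsupp.single l 1) = ∑ j ∈ Finset.range l.length,
      Finsupp.single (l.take (j + 1)) 1 ⊗ₜ Finsupp.single (l.drop j) 1 := by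
  rw [listComult, Finsupp.linearCombination_single, one_smul]

theorem list_lhom_ext {Q : Type*} [AddCommMonoid Q] [Module k Q] {f g : (List P →₀ k) →ₗ[k] Q}
    (h : ∀ l, f (Finsupp.single l 1) = g (Finsupp.single l 1)) (x : List P →₀ k) : f x = g x :=
  LinearMap.congr_fun (Finsupp.lhom_ext' fun l => LinearMap.ext_ring (h l)) x

theorem listBoundary_cons (v : P) (x : List P →₀ k) :
    listBoundary k P (listCons k v x) = x - listCons k v (listBoundary k P x) := by
  refine list_lhom_ext (f := listBoundary k P ∘ₗ listCons k v)
    (g := LinearMap.id - listCons k v ∘ₗ listBoundary k P) (fun l => ?_) x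
  simp only [LinearMap.comp_apply, LinearMap.sub_apply, LinearMap.id_apply, listCons_single,
    listBoundary_single, List.length_cons, Finset.sum_range_succ', map_sum, map_zsmul]
  simp [pow_succ, add_comm, sub_eq_add_neg]

theorem listSgn_cons (v : P) (x : List P →₀ k) :
    listSgn k P (listCons k v x) = -listCons k v (listSgn k P x) := by
  refine list_lhom_ext (f := listSgn k P ∘ₗ listCons k v)
    (g := -(listCons k v ∘ₗ listSgn k P)) (fun l => ?_) x
  simp only [LinearMap.comp_apply, LinearMap.neg_apply, listCons_single,
    listSgn_single, List.length_cons, map_zsmul]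
  simp [pow_succ]

theorem listComult_cons (v : P) (x : List P →₀ k) :
    listComult k P (listCons k v x) = Finsupp.single [v] 1 ⊗ₜ listCons k v x +
      (listCons k v).rTensor _ (listComult k P x) := by
  refine list_lhom_ext (f := listComult k P ∘ₗ listCons k v)
    (g := TensorProduct.mk k _ _ (Finsupp.single [v] 1) ∘ₗ listCons k v +
      (listCons k v).rTensor _ ∘ₗ listComult k P) (fun l => ?_) x
  simp only [LinearMap.comp_apply, LinearMap.add_apply, listCons_single, TensorProduct.mk_apply,
    listComult_single, List.length_cons, Finset.sum_range_succ', map_sum, LinearMap.rTensor_tmul]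
  rw [add_comm]
  rfl

theorem listComult_boundary_cons_aux (v : P) (z : (List P →₀ k) ⊗[k] (List P →₀ k)) :
    TensorProduct.map (listBoundary k P) LinearMap.id ((listCons k v).rTensor _ z) +
      TensorProduct.map (listSgn k P) (listBoundary k P) ((listCons k v).rTensor _ z) =
    z - (listCons k v).rTensor _ (TensorProduct.map (listBoundary k P) LinearMap.id z +
      TensorProduct.map (listSgn k P) (listBoundary k P) z) := by
  induction z with
  | zero => simp
  | add x y hx hy =>
    simp only [map_add] at hx hy ⊢
    rw [add_add_add_comm, hx, hy]
    abel
  | tmul x y =>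
    simp only [LinearMap.rTensor_tmul, TensorProduct.map_tmul, listBoundary_cons, listSgn_cons,
      TensorProduct.sub_tmul, TensorProduct.neg_tmul, map_add, LinearMap.id_apply]
    abel

theorem listComult_boundary_single (l : List P) :
    TensorProduct.map (listBoundary k P) LinearMap.id (listComult k P (Finsupp.single l 1)) +
      TensorProduct.map (listSgn k P) (listBoundary k P) (listComult k P (Finsupp.single l 1)) =
    listComult k P (listBoundary k P (Finsupp.single l 1)) +
      (Finsupp.single [] 1 ⊗ₜ Finsupp.single l 1 +
        ((-1) ^ (l.length + 1) : ℤ) • (Finsupp.single l 1 ⊗ₜ Finsupp.single [] 1)) := by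
  induction l with
  | nil => simp [listComult_single, listBoundary_single]
  | cons v l ih =>
    rw [← listCons_single, listComult_cons, listBoundary_cons]
    simp only [map_add, map_sub, listComult_cons]
    rw [add_add_add_comm, listComult_boundary_cons_aux, ih]
    have h₁ : listBoundary k P (Finsupp.single [v] 1) = Finsupp.single [] 1 := by
      simp [listBoundary_single]
    have h₂ : listSgn k P (Finsupp.single [v] 1) = Finsupp.single [v] 1 := by
      simp [listSgn_single]
    have h₃ : listCons k v (Finsupp.single [] 1) = Finsupp.single [v] 1 := listCons_single _ _
    simp only [TensorProduct.map_tmul, h₁, h₂, h₃, listBoundary_cons, LinearMap.id_apply, map_add,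
      LinearMap.rTensor_tmul, map_zsmul, List.length_cons, TensorProduct.tmul_sub,
      pow_succ _ (l.length + 1), mul_neg_one, neg_smul]
    abel

end Lists

/-! ### Families of simplices indexed by chains of a preorder -/

/-- A natural family of simplices of `X` indexed by the finite chains of `P`, i.e. a simplicial map from
the nerve of `P` to `X`. -/
structure ChainFamily (P : Type w) [Preorder P] (X : SSet.{u}) where
  app : ∀ {n : ℕ}, (Fin (n + 1) →o P) → X _⦋n⦌
  map_app : ∀ {n m : ℕ} (θ : ⦋m⦌ ⟶ ⦋n⦌) (c : Fin (n + 1) →o P),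
    X.map θ.op (app c) = app (c.comp θ.toOrderHom)

namespace ChainFamily

variable (k : Type v) [Field k] {P : Type w} [Preorder P] {X Y : SSet.{u}} (e : ChainFamily P X)

open Classical in
/-- The chain of `X` given by a list; it is `0` if the list is empty or not monotone. -/
noncomputable def evList (l : List P) : Chains k X :=
  match l with
  | [] => 0
  | v :: l => if h : Monotone (v :: l).get then
      simplex k (e.app (n := l.length) ⟨(v :: l).get, h⟩) else 0

/-- The linear map to the chains of `X`. -/
noncomputable def ev : (List P →₀ k) →ₗ[k] Chains k X := Finsupp.linearCombination k (e.evList k)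

variable {k}

theorem ev_single (l : List P) : e.ev k (Finsupp.single l 1) = e.evList k l := by
  rw [ev, Finsupp.linearCombination_single, one_smul]

theorem evList_nil : e.evList k [] = 0 := rfl

theorem evList_ofFn {n : ℕ} (c : Fin (n + 1) →o P) :
    e.evList k (List.ofFn c) = simplex k (e.app c) := by
  have key : ∀ (l : List P) (v : P) (hn : l.length = n),
      (∀ i : Fin (n + 1), (v :: l).get (i.cast (by rw [List.length_cons, hn])) = c i) →
      e.evList k (v :: l) = simplex k (e.app c) := by
    intro l v hn h
    subst hn
    have hc : (v :: l).get = c := funext h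
    have hm : Monotone (v :: l).get := hc ▸ c.monotone
    rw [evList, dif_pos hm]
    congr 2
    exact OrderHom.ext _ _ hc
  rw [List.ofFn_succ]
  refine key _ _ (by simp) fun i => ?_
  rw [List.get_eq_getElem]
  refine i.cases ?_ fun j => ?_
  · rfl
  · simp

theorem exists_ofFn {l : List P} (hl : l ≠ []) (h : l.Pairwise (· ≤ ·)) :
    ∃ (n : ℕ) (c : Fin (n + 1) →o P), l = List.ofFn c := by
  obtain ⟨v, l, rfl⟩ := List.exists_cons_of_ne_nil hl
  refine ⟨l.length, ⟨(v :: l).get, fun i j hij => ?_⟩, (List.ofFn_get _).symm⟩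
  rcases hij.eq_or_lt with rfl | hij
  · exact le_rfl
  · exact List.pairwise_iff_get.1 h _ _ hij

theorem _root_.SerreSS.eraseIdx_ofFn {P : Type*} {n : ℕ} (c : Fin (n + 1) → P) (i : Fin (n + 1)) :
    (List.ofFn c).eraseIdx i = List.ofFn fun j => c (i.succAbove j) := by
  refine List.ext_getElem (by simp [List.length_eraseIdx, i.is_le]) fun j h h' => ?_
  rw [List.getElem_eraseIdx]
  split_ifs with hj
  · simp [Fin.succAbove, Fin.lt_def, hj, -List.ofFn_succ]
  · simp [Fin.succAbove, Fin.lt_def, hj, -List.ofFn_succ]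

theorem boundary_ev_single {l : List P} (h : l.Pairwise (· ≤ ·)) :
    boundary k X (e.ev k (Finsupp.single l 1)) = e.ev k (listBoundary k P (Finsupp.single l 1)) := by
  by_cases hl : l = []
  · subst hl
    simp [ev_single, evList_nil, listBoundary_single]
  obtain ⟨n, c, rfl⟩ := exists_ofFn hl h
  rw [ev_single, evList_ofFn, boundary_simplex, listBoundary_single, map_sum, List.length_ofFn,
    ← Fin.sum_univ_eq_sum_range (fun i => e.ev k (((-1) ^ i : ℤ) •
      Finsupp.single ((List.ofFn c).eraseIdx i) 1)) (n + 1)]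
  rcases n with _ | n
  · simp [faceSum_zero, ev_single, evList_nil]
  · rw [faceSum_succ]
    refine Finset.sum_congr rfl fun i _ => ?_
    rw [map_zsmul, ev_single, eraseIdx_ofFn]
    congr 1
    rw [show X.δ i (e.app c) = e.app (c.comp (SimplexCategory.δ i).toOrderHom) from
      e.map_app (SimplexCategory.δ i) c, ← evList_ofFn]
    rfl

theorem boundary_ev {x : List P →₀ k}
    (hx : x ∈ Finsupp.supported k k (Set.ofPred fun l : List P => l.Pairwise (· ≤ ·))) :
    boundary k X (e.ev k x) = e.ev k (listBoundary k P x) :=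
  FDG.eq_of_supported (T := boundary k X ∘ₗ e.ev k) (T' := e.ev k ∘ₗ listBoundary k P)
    (fun _ h => e.boundary_ev_single h) hx

theorem app_mem_degenerate {n : ℕ} (c : Fin (n + 1) →o P) (i : ℕ) (hi : i + 1 < n + 1)
    (h : c ⟨i, by lia⟩ = c ⟨i + 1, hi⟩) : e.app c ∈ X.degenerate n := by
  obtain ⟨m, rfl⟩ : ∃ m, n = m + 1 := ⟨n - 1, by lia⟩
  let f : Fin (m + 1 + 1) →o Fin (m + 1) :=
    ⟨fun j => ⟨if (j : ℕ) ≤ i then j else j - 1, by split_ifs <;> lia⟩, fun a b hab => by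
      rw [Fin.mk_le_mk]; rw [Fin.le_def] at hab; split_ifs <;> lia⟩
  let g : Fin (m + 1) →o Fin (m + 1 + 1) :=
    ⟨fun j => ⟨if (j : ℕ) ≤ i then j else j + 1, by split_ifs <;> lia⟩, fun a b hab => by
      rw [Fin.mk_le_mk]; rw [Fin.le_def] at hab; split_ifs <;> lia⟩
  refine ⟨m, by lia, SimplexCategory.mkHom f, e.app (c.comp g), ?_⟩
  rw [e.map_app]
  congr 1
  refine OrderHom.ext _ _ (funext fun j => ?_)
  change c (g (f j)) = c j
  by_cases hj : (j : ℕ) = i + 1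
  · have h₁ : g (f j) = ⟨i, by lia⟩ := Fin.ext (by
      change (if (if (j : ℕ) ≤ i then (j : ℕ) else j - 1) ≤ i then
        (if (j : ℕ) ≤ i then (j : ℕ) else j - 1) else (if (j : ℕ) ≤ i then (j : ℕ) else j - 1) + 1) = i
      split_ifs <;> lia)
    rw [h₁, h]
    congr 1
    exact Fin.ext hj.symm
  · congr 1
    exact Fin.ext (by
      change (if (if (j : ℕ) ≤ i then (j : ℕ) else j - 1) ≤ i then
        (if (j : ℕ) ≤ i then (j : ℕ) else j - 1) else (if (j : ℕ) ≤ i then (j : ℕ) else j - 1) + 1) = j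
      split_ifs <;> lia)

end ChainFamily

end SerreSS

namespace SerreSS

open CategoryTheory Simplicial Opposite TensorProduct

theorem take_ofFn {P : Type*} {n : ℕ} (c : Fin (n + 1) → P) (j : Fin (n + 1)) :
    (List.ofFn c).take (j + 1) = List.ofFn fun i : Fin (j + 1) => c ⟨i, by lia⟩ :=
  List.ext_getElem (by simp [j.is_le]) fun i h h' => by simp [-List.ofFn_succ]

theorem drop_ofFn {P : Type*} {n : ℕ} (c : Fin (n + 1) → P) (j : Fin (n + 1)) :
    (List.ofFn c).drop j = List.ofFn fun i : Fin (n - j + 1) => c ⟨i + j, by lia⟩ :=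
  List.ext_getElem (by simp; lia) fun i h h' => by simp [-List.ofFn_succ, add_comm]

namespace ChainFamily

variable {k : Type v} [Field k] {P : Type w} {X Y : SSet.{u}}

theorem mem_degenerate_of_le [PartialOrder P] (e : ChainFamily P X) {n : ℕ} (c : Fin (n + 1) →o P)
    (i j : Fin (n + 1)) (hij : i < j) (h : c i = c j) : e.app c ∈ X.degenerate n := by
  refine e.app_mem_degenerate c i (by lia) (le_antisymm (c.monotone ?_) ?_)
  · rw [Fin.le_def]; dsimp; lia
  · exact (c.monotone (show _ ≤ j by rw [Fin.le_def]; dsimp; lia)).trans h.symm.le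

/-- The family of all the faces and degeneracies of a simplex. -/
def ofSimplex {n : ℕ} (σ : X _⦋n⦌) : ChainFamily (Fin (n + 1)) X where
  app c := X.map (SimplexCategory.mkHom c).op σ
  map_app θ c := by
    change (X.map _ ≫ X.map _) σ = _
    rw [← X.map_comp, ← op_comp]
    rfl

theorem ofSimplex_app_id {n : ℕ} (σ : X _⦋n⦌) : (ofSimplex σ).app OrderHom.id = σ :=
  ConcreteCategory.congr_hom (X.map_id (op ⦋n⦌)) σ

variable [Preorder P] (e : ChainFamily P X)

theorem face_app {n : ℕ} (c : Fin (n + 1) →o P) (i l : ℕ) (h : i + l ≤ n) :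
    face (e.app c) i l h = e.app (c.comp (SimplexCategory.subinterval i l h).toOrderHom) :=
  e.map_app _ c

theorem chainSgn_ev (x : List P →₀ k) : chainSgn k X (e.ev k x) = e.ev k (listSgn k P x) := by
  refine list_lhom_ext (f := chainSgn k X ∘ₗ e.ev k) (g := e.ev k ∘ₗ listSgn k P) (fun l => ?_) x
  rw [LinearMap.comp_apply, LinearMap.comp_apply, listSgn_single, map_zsmul, ev_single]
  rcases l with _ | ⟨v, l⟩
  · rw [evList_nil, map_zero, smul_zero]
  · rw [evList]
    split_ifs
    · rw [chainSgn_simplex, List.length_cons, pow_succ, pow_succ, mul_assoc, neg_one_mul, neg_neg, mul_one]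
    · rw [map_zero, smul_zero]

end ChainFamily

section Comult

variable {k : Type v} [Field k] {X Y : SSet.{u}}

theorem chainComult_simplex {n : ℕ} (σ : X _⦋n⦌) : chainComult k X (simplex k σ) =
    ∑ j : Fin (n + 1), simplex k (face σ 0 j (by lia)) ⊗ₜ
      simplex k (face σ j (n - j) (by lia)) := by
  by_cases h : σ ∈ X.nonDegenerate n
  · rw [simplex_of_nonDegenerate ⟨σ, h⟩, chainComult, Finsupp.linearCombination_single, one_smul]
  · replace h := (X.mem_degenerate_iff_notMem_nonDegenerate σ).2 h
    rw [simplex_of_degenerate h, map_zero]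
    symm
    obtain ⟨m, hm, f, τ, rfl⟩ := h
    obtain ⟨i, hi⟩ : ∃ i : ℕ, ∃ hi : i < n, f.toOrderHom ⟨i, by lia⟩ = f.toOrderHom ⟨i + 1, by lia⟩ := by
      by_contra! hne
      have : ∀ (i : ℕ) (hi : i < n + 1), i ≤ f.toOrderHom ⟨i, hi⟩ := by
        intro i
        induction i with
        | zero => simp
        | succ i ih =>
          intro hi
          have h₁ := f.toOrderHom.monotone
            (show (⟨i, by lia⟩ : Fin (⦋n⦌.len + 1)) ≤ ⟨i + 1, hi⟩ by rw [Fin.mk_le_mk]; lia)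
          have h₂ := lt_of_le_of_ne h₁ (hne i (by lia))
          rw [Fin.lt_def] at h₂
          have h₃ := ih (by lia)
          lia
      have h₁ := this n (by lia)
      have h₂ := (f.toOrderHom ⟨n, by change n < n + 1; lia⟩).is_le
      change _ ≤ m at h₂
      lia
    obtain ⟨hi, hfi⟩ := hi
    have hτ : X.map f.op τ = (ChainFamily.ofSimplex τ).app f.toOrderHom := rfl
    refine Finset.sum_eq_zero fun j _ => ?_
    rw [hτ, ChainFamily.face_app, ChainFamily.face_app]
    rcases lt_or_ge i j with hij | hij
    · rw [simplex_of_degenerate (σ := (ChainFamily.ofSimplex τ).app (f.toOrderHom.comp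
          (SimplexCategory.subinterval 0 j (by lia)).toOrderHom))
        (ChainFamily.app_mem_degenerate _ _ i (by lia) hfi), TensorProduct.zero_tmul]
    · rw [simplex_of_degenerate (σ := (ChainFamily.ofSimplex τ).app (f.toOrderHom.comp
          (SimplexCategory.subinterval j (n - j) (by lia)).toOrderHom))
        (ChainFamily.app_mem_degenerate _ _ (i - j) (by lia) ?_), TensorProduct.tmul_zero]
      have e₁ : (SimplexCategory.subinterval (n := n) j (n - j) (by lia)).toOrderHom ⟨i - j, by lia⟩ =
          ⟨i, by lia⟩ := Fin.ext (by change i - j + j = i; lia)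
      have e₂ : (SimplexCategory.subinterval (n := n) j (n - j) (by lia)).toOrderHom ⟨i - j + 1, by lia⟩ =
          ⟨i + 1, by lia⟩ := Fin.ext (by change i - j + 1 + j = i + 1; lia)
      change f.toOrderHom (SimplexCategory.Hom.toOrderHom _ _) = f.toOrderHom (SimplexCategory.Hom.toOrderHom _ _)
      rw [e₁, e₂, hfi]

theorem ChainFamily.chainComult_ev_single {P : Type w} [Preorder P] (e : ChainFamily P X)
    {l : List P} (h : l.Pairwise (· ≤ ·)) :
    chainComult k X (e.ev k (Finsupp.single l 1)) =
      TensorProduct.map (e.ev k) (e.ev k) (listComult k P (Finsupp.single l 1)) := by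
  by_cases hl : l = []
  · subst hl
    simp [ev_single, evList_nil, listComult_single]
  obtain ⟨n, c, rfl⟩ := exists_ofFn hl h
  rw [ev_single, evList_ofFn, chainComult_simplex, listComult_single, map_sum, List.length_ofFn,
    ← Fin.sum_univ_eq_sum_range (fun j => TensorProduct.map (e.ev k) (e.ev k)
      (Finsupp.single ((List.ofFn c).take (j + 1)) 1 ⊗ₜ Finsupp.single ((List.ofFn c).drop j) 1)) (n + 1)]
  refine Finset.sum_congr rfl fun j _ => ?_
  rw [TensorProduct.map_tmul, ev_single, ev_single, take_ofFn, drop_ofFn, face_app, face_app,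
    ← evList_ofFn, ← evList_ofFn]
  rfl

theorem ChainFamily.chainComult_ev {P : Type w} [Preorder P] (e : ChainFamily P X) {x : List P →₀ k}
    (hx : x ∈ Finsupp.supported k k (Set.ofPred fun l : List P => l.Pairwise (· ≤ ·))) :
    chainComult k X (e.ev k x) = TensorProduct.map (e.ev k) (e.ev k) (listComult k P x) :=
  FDG.eq_of_supported (T := chainComult k X ∘ₗ e.ev k)
    (T' := TensorProduct.map (e.ev k) (e.ev k) ∘ₗ listComult k P)
    (fun _ h => e.chainComult_ev_single h) hx

theorem chains_lhom_ext {Q : Type*} [AddCommMonoid Q] [Module k Q] {f g : Chains k X →ₗ[k] Q}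
    (h : ∀ (n : ℕ) (σ : X.nonDegenerate n), f (simplex k σ.1) = g (simplex k σ.1)) (x : Chains k X) :
    f x = g x :=
  LinearMap.congr_fun (Finsupp.lhom_ext' fun ⟨n, σ⟩ => LinearMap.ext_ring (by
    simpa [simplex_of_nonDegenerate] using h n σ)) x

theorem eq_of_mem_map₂ {M N Q : Type*} [AddCommMonoid M] [Module k M] [AddCommMonoid N] [Module k N]
    [AddCommMonoid Q] [Module k Q] {S : Submodule k M} {S' : Submodule k N} {T T' : M ⊗[k] N →ₗ[k] Q}
    (h : ∀ x ∈ S, ∀ y ∈ S', T (x ⊗ₜ y) = T' (x ⊗ₜ y)) {z : M ⊗[k] N}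
    (hz : z ∈ Submodule.map₂ (TensorProduct.mk k M N) S S') : T z = T' z := by
  have key : Submodule.map₂ (TensorProduct.mk k M N) S S' ≤ LinearMap.eqLocus T T' :=
    Submodule.map₂_le.2 fun x hx y hy => LinearMap.mem_eqLocus.2 (h x hx y hy)
  exact LinearMap.mem_eqLocus.1 (key hz)

theorem tensor_d_map_ev {P : Type w} [Preorder P] (e : ChainFamily P X)
    {z : (List P →₀ k) ⊗[k] (List P →₀ k)}
    (hz : z ∈ Submodule.map₂ (TensorProduct.mk k _ _)
      (Finsupp.supported k k (Set.ofPred fun l : List P => l.Pairwise (· ≤ ·)))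
      (Finsupp.supported k k (Set.ofPred fun l : List P => l.Pairwise (· ≤ ·)))) :
    ((chainDG k X).tensor (chainDG k X)).d (TensorProduct.map (e.ev k) (e.ev k) z) =
      TensorProduct.map (e.ev k) (e.ev k) (TensorProduct.map (listBoundary k P) LinearMap.id z +
        TensorProduct.map (listSgn k P) (listBoundary k P) z) := by
  refine eq_of_mem_map₂ (T := ((chainDG k X).tensor (chainDG k X)).d ∘ₗ
      TensorProduct.map (e.ev k) (e.ev k)) (T' := TensorProduct.map (e.ev k) (e.ev k) ∘ₗ
        (TensorProduct.map (listBoundary k P) LinearMap.id +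
          TensorProduct.map (listSgn k P) (listBoundary k P))) (fun x hx y hy => ?_) hz
  simp only [LinearMap.comp_apply, LinearMap.add_apply,
    TensorProduct.map_tmul, map_add, DG.tensor_d_tmul, LinearMap.id_apply]
  rw [← e.boundary_ev hx, ← e.boundary_ev hy, ← e.chainSgn_ev]
  rfl

theorem tensor_d_chainComult (x : Chains k X) :
    ((chainDG k X).tensor (chainDG k X)).d (chainComult k X x) = chainComult k X (boundary k X x) := by
  refine chains_lhom_ext (f := ((chainDG k X).tensor (chainDG k X)).d ∘ₗ chainComult k X)
    (g := chainComult k X ∘ₗ boundary k X) (fun n σ => ?_) x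
  rw [LinearMap.comp_apply, LinearMap.comp_apply, ← ChainFamily.ofSimplex_app_id σ.1]
  set e := ChainFamily.ofSimplex σ.1
  rw [← ChainFamily.evList_ofFn, ← ChainFamily.ev_single]
  set l := List.ofFn (OrderHom.id : Fin (n + 1) →o Fin (n + 1))
  have hl : l.Pairwise (· ≤ ·) := List.pairwise_ofFn.2 fun _ _ h => h.le
  rw [e.chainComult_ev_single hl, e.boundary_ev_single hl, e.chainComult_ev, tensor_d_map_ev,
    listComult_boundary_single]
  · simp [ChainFamily.ev_single, ChainFamily.evList_nil]
  · rw [listComult_single]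
    refine Submodule.sum_mem _ fun j _ => Submodule.apply_mem_map₂ _ ?_ ?_
    · exact Finsupp.single_mem_supported k _ (hl.sublist (List.take_sublist _ _))
    · exact Finsupp.single_mem_supported k _ (hl.sublist (List.drop_sublist _ _))
  · rw [listBoundary_single]
    exact Submodule.sum_mem _ fun j _ => zsmul_mem
      (Finsupp.single_mem_supported k _ (hl.sublist (List.eraseIdx_sublist _ _))) _

theorem chainMap_simplex (f : X ⟶ Y) {n : ℕ} (σ : X _⦋n⦌) :
    chainMap k f (simplex k σ) = simplex k (f.app (op ⦋n⦌) σ) := by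
  by_cases h : σ ∈ X.nonDegenerate n
  · rw [simplex_of_nonDegenerate ⟨σ, h⟩, chainMap, Finsupp.linearCombination_single, one_smul]
  · obtain ⟨m, hm, θ, τ, rfl⟩ := (X.mem_degenerate_iff_notMem_nonDegenerate σ).2 h
    rw [simplex_of_degenerate ⟨m, hm, θ, τ, rfl⟩, map_zero, simplex_of_degenerate]
    exact ⟨m, hm, θ, f.app _ τ, (ConcreteCategory.congr_hom (f.naturality θ.op) τ).symm⟩

theorem app_map (f : X ⟶ Y) {n m : ℕ} (θ : ⦋m⦌ ⟶ ⦋n⦌) (σ : X _⦋n⦌) :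
    f.app (op ⦋m⦌) (X.map θ.op σ) = Y.map θ.op (f.app (op ⦋n⦌) σ) :=
  ConcreteCategory.congr_hom (f.naturality θ.op) σ

theorem app_face (f : X ⟶ Y) {n : ℕ} (σ : X _⦋n⦌) (i l : ℕ) (h : i + l ≤ n) :
    f.app (op ⦋l⦌) (face σ i l h) = face (f.app (op ⦋n⦌) σ) i l h := app_map f _ σ

theorem boundary_chainMap (f : X ⟶ Y) (x : Chains k X) :
    boundary k Y (chainMap k f x) = chainMap k f (boundary k X x) := by
  refine chains_lhom_ext (f := boundary k Y ∘ₗ chainMap k f) (g := chainMap k f ∘ₗ boundary k X)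
    (fun n σ => ?_) x
  obtain ⟨σ, -⟩ := σ
  rw [LinearMap.comp_apply, LinearMap.comp_apply, chainMap_simplex, boundary_simplex,
    boundary_simplex]
  rcases n with _ | n
  · rw [faceSum_zero, faceSum_zero, map_zero]
  · rw [faceSum_succ, faceSum_succ, map_sum]
    refine Finset.sum_congr rfl fun i _ => ?_
    rw [map_zsmul, chainMap_simplex]
    congr 2
    exact (app_map f (SimplexCategory.δ i) σ).symm

theorem chainSgn_chainMap (f : X ⟶ Y) (x : Chains k X) :
    chainSgn k Y (chainMap k f x) = chainMap k f (chainSgn k X x) := by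
  refine chains_lhom_ext (f := chainSgn k Y ∘ₗ chainMap k f) (g := chainMap k f ∘ₗ chainSgn k X)
    (fun n σ => ?_) x
  rw [LinearMap.comp_apply, LinearMap.comp_apply, chainMap_simplex, chainSgn_simplex,
    chainSgn_simplex, map_zsmul, chainMap_simplex]

theorem chainComult_chainMap (f : X ⟶ Y) (x : Chains k X) :
    chainComult k Y (chainMap k f x) =
      TensorProduct.map (chainMap k f) (chainMap k f) (chainComult k X x) := by
  refine chains_lhom_ext (f := chainComult k Y ∘ₗ chainMap k f)
    (g := TensorProduct.map (chainMap k f) (chainMap k f) ∘ₗ chainComult k X) (fun n σ => ?_) x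
  rw [LinearMap.comp_apply, LinearMap.comp_apply, chainMap_simplex, chainComult_simplex,
    chainComult_simplex, map_sum]
  refine Finset.sum_congr rfl fun j _ => ?_
  rw [TensorProduct.map_tmul, chainMap_simplex, chainMap_simplex, app_face, app_face]

theorem chainMap_comp {Z : SSet.{u}} (f : X ⟶ Y) (g : Y ⟶ Z) (x : Chains k X) :
    chainMap k (f ≫ g) x = chainMap k g (chainMap k f x) := by
  refine chains_lhom_ext (f := chainMap k (f ≫ g)) (g := chainMap k g ∘ₗ chainMap k f)
    (fun n σ => ?_) x
  rw [LinearMap.comp_apply, chainMap_simplex, chainMap_simplex, chainMap_simplex]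
  rfl

theorem chainMap_id (x : Chains k X) : chainMap k (𝟙 X) x = x :=
  chains_lhom_ext (f := chainMap k (𝟙 X)) (g := LinearMap.id) (fun _ _ => chainMap_simplex _ _) x

theorem chainMap_mem_chainGr (f : X ⟶ Y) {n : ℤ} {x : Chains k X} (hx : x ∈ chainGr k X n) :
    chainMap k f x ∈ chainGr k Y n :=
  FDG.mem_of_supported (T := chainMap k f) (fun s hs => by
    have := simplex_mem_chainGr (k := k) (f.app (op ⦋s.1⦌) s.2.1) hs
    rwa [← chainMap_simplex, simplex_of_nonDegenerate] at this) hx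

end Comult

end SerreSS

namespace SerreSS

open TensorProduct

/-! ### The Eilenberg--Zilber lists -/

section ListMap

variable (k : Type v) [Field k] {P : Type w} {P' : Type w'}

/-- The map on lists induced by a map of sets. -/
noncomputable def listMap (f : P → P') : (List P →₀ k) →ₗ[k] List P' →₀ k :=
  Finsupp.lmapDomain k k (List.map f)

variable {k}

theorem listMap_single (f : P → P') (l : List P) :
    listMap k f (Finsupp.single l 1) = Finsupp.single (l.map f) 1 := Finsupp.mapDomain_single

theorem listMap_cons (f : P → P') (v : P) (x : List P →₀ k) :
    listMap k f (listCons k v x) = listCons k (f v) (listMap k f x) :=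
  list_lhom_ext (f := listMap k f ∘ₗ listCons k v) (g := listCons k (f v) ∘ₗ listMap k f)
    (fun l => by simp only [LinearMap.comp_apply, listCons_single, listMap_single, List.map_cons]) x

end ListMap

section EZ

variable (k : Type v) [Field k]

/-- The signed sum of the lattice paths from `(a, b)` to `(a + q, b + p)`. -/
noncomputable def ezList (q p a b : ℕ) : List (ℕ × ℕ) →₀ k :=
  match q, p with
  | 0, 0 => Finsupp.single [(a, b)] 1
  | q + 1, 0 => listCons k (a, b) (ezList q 0 (a + 1) b)
  | 0, p + 1 => listCons k (a, b) (ezList 0 p a (b + 1))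
  | q + 1, p + 1 => listCons k (a, b)
      (ezList q (p + 1) (a + 1) b + ((-1) ^ (q + 1) : ℤ) • ezList (q + 1) p a (b + 1))

/-- Lattice paths with `q` steps in the first direction and `p` in the second one, starting at a given
point; `ε` is the sign of the path. -/
inductive IsPath : ℕ → ℕ → ℕ → ℕ → List (ℕ × ℕ) → ℤ → Prop where
  | nil (a b : ℕ) : IsPath 0 0 a b [(a, b)] 1
  | right {q p a b : ℕ} {l : List (ℕ × ℕ)} {ε : ℤ} : IsPath q p (a + 1) b l ε →
      IsPath (q + 1) p a b ((a, b) :: l) ε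
  | up {q p a b : ℕ} {l : List (ℕ × ℕ)} {ε : ℤ} : IsPath q p a (b + 1) l ε →
      IsPath q (p + 1) a b ((a, b) :: l) ((-1) ^ q * ε)

namespace IsPath

variable {q p a b : ℕ} {l : List (ℕ × ℕ)} {ε : ℤ}

theorem bounds (h : IsPath q p a b l ε) :
    ∀ v ∈ l, a ≤ v.1 ∧ v.1 ≤ a + q ∧ b ≤ v.2 ∧ v.2 ≤ b + p := by
  induction h with
  | nil a b => simp
  | right h ih =>
    intro v hv
    rcases List.mem_cons.1 hv with rfl | hv
    · simp
    · have := ih v hv; lia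
  | up h ih =>
    intro v hv
    rcases List.mem_cons.1 hv with rfl | hv
    · simp
    · have := ih v hv; lia

theorem pairwise (h : IsPath q p a b l ε) : l.Pairwise (· ≤ ·) := by
  induction h with
  | nil a b => simp
  | right h ih =>
    refine List.pairwise_cons.2 ⟨fun v hv => ?_, ih⟩
    have := h.bounds v hv
    exact Prod.mk_le_mk.2 ⟨by lia, by lia⟩
  | up h ih =>
    refine List.pairwise_cons.2 ⟨fun v hv => ?_, ih⟩
    have := h.bounds v hv
    exact Prod.mk_le_mk.2 ⟨by lia, by lia⟩

theorem length_eq (h : IsPath q p a b l ε) : l.length = q + p + 1 := by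
  induction h with
  | nil a b => rfl
  | right h ih => rw [List.length_cons, ih]; lia
  | up h ih => rw [List.length_cons, ih]; lia

theorem start_mem (h : IsPath q p a b l ε) : (a, b) ∈ l := by
  cases h <;> simp

theorem head_eq (h : IsPath q p a b l ε) : ∃ l', l = (a, b) :: l' := by
  cases h <;> exact ⟨_, rfl⟩

theorem step_mem (h : IsPath q p a b l ε) {j : ℕ} (hj : a ≤ j) (hj' : j < a + q) :
    ∃ b', (j, b') ∈ l ∧ (j + 1, b') ∈ l := by
  induction h with
  | nil a b => lia
  | @right q p a b l ε h ih =>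
    rcases hj.eq_or_lt with rfl | hj
    · exact ⟨b, by simp, List.mem_cons_of_mem _ h.start_mem⟩
    · obtain ⟨b', h₁, h₂⟩ := ih hj (by lia)
      exact ⟨b', List.mem_cons_of_mem _ h₁, List.mem_cons_of_mem _ h₂⟩
  | up h ih =>
    obtain ⟨b', h₁, h₂⟩ := ih hj (by lia)
    exact ⟨b', List.mem_cons_of_mem _ h₁, List.mem_cons_of_mem _ h₂⟩

theorem step_mem_snd (h : IsPath q p a b l ε) {j : ℕ} (hj : b ≤ j) (hj' : j < b + p) :
    ∃ a', (a', j) ∈ l ∧ (a', j + 1) ∈ l := by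
  induction h with
  | nil a b => lia
  | @up q p a b l ε h ih =>
    rcases hj.eq_or_lt with rfl | hj
    · exact ⟨a, by simp, List.mem_cons_of_mem _ h.start_mem⟩
    · obtain ⟨b', h₁, h₂⟩ := ih hj (by lia)
      exact ⟨b', List.mem_cons_of_mem _ h₁, List.mem_cons_of_mem _ h₂⟩
  | right h ih =>
    obtain ⟨b', h₁, h₂⟩ := ih hj (by lia)
    exact ⟨b', List.mem_cons_of_mem _ h₁, List.mem_cons_of_mem _ h₂⟩

end IsPath

variable {k}

theorem listCons_mem_supported {P : Type w} {S S' : List P → Prop} (v : P) {x : List P →₀ k}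
    (hx : x ∈ Finsupp.supported k k (Set.ofPred S)) (h : ∀ l, S l → S' (v :: l)) :
    listCons k v x ∈ Finsupp.supported k k (Set.ofPred S') :=
  FDG.mem_of_supported (T := listCons k v) (fun l hl => by
    rw [listCons_single]
    exact Finsupp.single_mem_supported k _ (h l hl)) hx

theorem ezList_mem (q p a b : ℕ) : ezList k q p a b ∈
    Finsupp.supported k k (Set.ofPred fun l => ∃ ε, IsPath q p a b l ε) := by
  fun_induction ezList k q p a b with
  | case1 a b => exact Finsupp.single_mem_supported k _ ⟨1, .nil a b⟩
  | case2 a b q ih => exact listCons_mem_supported _ ih fun l ⟨ε, h⟩ => ⟨_, .right h⟩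
  | case3 a b p ih => exact listCons_mem_supported _ ih fun l ⟨ε, h⟩ => ⟨_, .up h⟩
  | case4 a b q p ih₁ ih₂ =>
    rw [map_add, map_zsmul]
    exact add_mem (listCons_mem_supported _ ih₁ fun l ⟨ε, h⟩ => ⟨_, .right h⟩)
      (zsmul_mem (listCons_mem_supported _ ih₂ fun l ⟨ε, h⟩ => ⟨_, .up h⟩) _)

theorem listCons_apply_cons {P : Type w} (v : P) (l : List P) (x : List P →₀ k) :
    listCons k v x (v :: l) = x l :=
  Finsupp.mapDomain_apply (fun _ _ h => (List.cons.inj h).2) _ _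

theorem ezList_apply_eq_zero {q p a b : ℕ} {l : List (ℕ × ℕ)} (h : ¬ ∃ ε, IsPath q p a b l ε) :
    ezList k q p a b l = 0 := by
  by_contra hne
  exact h ((Finsupp.mem_supported k _).1 (ezList_mem (k := k) q p a b) (Finsupp.mem_support_iff.2 hne))

theorem ezList_apply {q p a b : ℕ} {l : List (ℕ × ℕ)} {ε : ℤ} (h : IsPath q p a b l ε) :
    ezList k q p a b l = ε := by
  induction h with
  | nil a b => simp [ezList]
  | @right q p a b l ε h ih =>
    rcases p with _ | p
    · rw [ezList, listCons_apply_cons, ih]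
    · rw [ezList, listCons_apply_cons, Finsupp.add_apply, ih, Finsupp.smul_apply,
        ezList_apply_eq_zero, smul_zero, add_zero]
      rintro ⟨ε', h'⟩
      obtain ⟨l', rfl⟩ := h.head_eq
      obtain ⟨l'', h''⟩ := h'.head_eq
      simp at h''
  | @up q p a b l ε h ih =>
    rcases q with _ | q
    · rw [ezList, listCons_apply_cons, ih]; simp
    · rw [ezList, listCons_apply_cons, Finsupp.add_apply, Finsupp.smul_apply, ih,
        ezList_apply_eq_zero, zero_add, zsmul_eq_mul, Int.cast_mul]
      rintro ⟨ε', h'⟩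
      obtain ⟨l', rfl⟩ := h.head_eq
      obtain ⟨l'', h''⟩ := h'.head_eq
      simp at h''

theorem listMap_ezList {f : ℕ × ℕ → ℕ × ℕ} (q p a b a' b' : ℕ)
    (h : ∀ i ≤ q, ∀ j ≤ p, f (a + i, b + j) = (a' + i, b' + j)) :
    listMap k f (ezList k q p a b) = ezList k q p a' b' := by
  fun_induction ezList k q p a b generalizing a' b' with
  | case1 a b =>
    rw [listMap_single, List.map_singleton, ezList,
      show f (a, b) = (a', b') from h 0 (by lia) 0 (by lia)]
  | case2 a b q ih =>
    rw [listMap_cons, ih (a' + 1) b' (fun i hi j hj => by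
      rw [add_assoc, add_assoc, add_comm 1]; exact h _ (by lia) _ hj), ezList,
      show f (a, b) = (a', b') from h 0 (by lia) 0 (by lia)]
  | case3 a b p ih =>
    rw [listMap_cons, ih a' (b' + 1) (fun i hi j hj => by
      rw [add_assoc, add_assoc b', add_comm 1]; exact h _ hi _ (by lia)), ezList,
      show f (a, b) = (a', b') from h 0 (by lia) 0 (by lia)]
  | case4 a b q p ih₁ ih₂ =>
    rw [listMap_cons, map_add, map_zsmul, ih₁ (a' + 1) b' (fun i hi j hj => by
      rw [add_assoc, add_assoc, add_comm 1]; exact h _ (by lia) _ hj),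
      ih₂ a' (b' + 1) (fun i hi j hj => by
      rw [add_assoc, add_assoc b', add_comm 1]; exact h _ hi _ (by lia)), ezList,
      show f (a, b) = (a', b') from h 0 (by lia) 0 (by lia)]

/-- The map omitting the value `i`. -/
def skip (i j : ℕ) : ℕ := if j < i then j else j + 1

theorem skip_mono (i : ℕ) : Monotone (skip i) := fun a b h => by
  unfold skip; split_ifs <;> lia

variable (k)

/-- The alternating sum of `n` maps `skip i` in the first coordinate, for `i = a, a + 1, …`. -/
noncomputable def skipFst (n a : ℕ) : (List (ℕ × ℕ) →₀ k) →ₗ[k] List (ℕ × ℕ) →₀ k :=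
  ∑ i ∈ Finset.range n, ((-1) ^ i : ℤ) • listMap k (Prod.map (skip (a + i)) id)

/-- The alternating sum of `n` maps `skip j` in the second coordinate, for `j = b, b + 1, …`. -/
noncomputable def skipSnd (n b : ℕ) : (List (ℕ × ℕ) →₀ k) →ₗ[k] List (ℕ × ℕ) →₀ k :=
  ∑ i ∈ Finset.range n, ((-1) ^ i : ℤ) • listMap k (Prod.map id (skip (b + i)))

variable {k}

theorem skipFst_succ (n a : ℕ) (x : List (ℕ × ℕ) →₀ k) : skipFst k (n + 1) a x =
    listMap k (Prod.map (skip a) id) x - skipFst k n (a + 1) x := by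
  simp only [skipFst, Finset.sum_range_succ', LinearMap.add_apply, LinearMap.sum_apply, pow_zero,
    one_smul, add_zero, pow_succ, mul_neg_one, neg_smul, add_assoc,
    Finset.sum_neg_distrib, add_comm 1, LinearMap.smul_apply]
  rw [add_comm, sub_eq_add_neg]

theorem skipSnd_succ (n a : ℕ) (x : List (ℕ × ℕ) →₀ k) : skipSnd k (n + 1) a x =
    listMap k (Prod.map id (skip a)) x - skipSnd k n (a + 1) x := by
  simp only [skipSnd, Finset.sum_range_succ', LinearMap.add_apply, LinearMap.sum_apply, pow_zero,
    one_smul, add_zero, pow_succ, mul_neg_one, neg_smul, add_assoc,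
    Finset.sum_neg_distrib, add_comm 1, LinearMap.smul_apply]
  rw [add_comm, sub_eq_add_neg]

theorem skipFst_cons (n a b : ℕ) (x : List (ℕ × ℕ) →₀ k) :
    skipFst k n (a + 1) (listCons k (a, b) x) = listCons k (a, b) (skipFst k n (a + 1) x) := by
  simp only [skipFst, LinearMap.sum_apply, LinearMap.smul_apply, listMap_cons, map_sum, map_zsmul]
  refine Finset.sum_congr rfl fun i _ => ?_
  simp [skip, show a < a + 1 + i by lia]

theorem skipSnd_cons (n a b : ℕ) (x : List (ℕ × ℕ) →₀ k) :
    skipSnd k n (b + 1) (listCons k (a, b) x) = listCons k (a, b) (skipSnd k n (b + 1) x) := by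
  simp only [skipSnd, LinearMap.sum_apply, LinearMap.smul_apply, listMap_cons, map_sum, map_zsmul]
  refine Finset.sum_congr rfl fun i _ => ?_
  simp [skip, show b < b + 1 + i by lia]

theorem listMap_skip_fst (q p a b : ℕ) :
    listMap k (Prod.map (skip a) id) (ezList k q p a b) = ezList k q p (a + 1) b :=
  listMap_ezList q p a b _ _ fun i _ j _ => by simp [skip]; lia

theorem listMap_skip_snd (q p a b : ℕ) :
    listMap k (Prod.map id (skip b)) (ezList k q p a b) = ezList k q p a (b + 1) :=
  listMap_ezList q p a b _ _ fun i _ j _ => by simp [skip]; lia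

variable (k)

/-- The lists with one step less in the first direction. -/
noncomputable def ezListL (q p a b : ℕ) : List (ℕ × ℕ) →₀ k :=
  match q with
  | 0 => 0
  | q + 1 => ezList k q p a b

/-- The lists with one step less in the second direction. -/
noncomputable def ezListR (q p a b : ℕ) : List (ℕ × ℕ) →₀ k :=
  match p with
  | 0 => 0
  | p + 1 => ezList k q p a b

/-- The empty list if `n = 0`. -/
noncomputable def nilIf (n : ℕ) : List (ℕ × ℕ) →₀ k := if n = 0 then Finsupp.single [] 1 else 0

variable {k}

theorem ezList_eq (q p a b : ℕ) : ezList k q p a b = listCons k (a, b)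
    (ezListL k q p (a + 1) b + ((-1) ^ q : ℤ) • ezListR k q p a (b + 1) + nilIf k (q + p)) := by
  rcases q with _ | q <;> rcases p with _ | p <;>
    simp [ezList, ezListL, ezListR, nilIf, listCons_single]

theorem skipFst_nilIf (n a : ℕ) : skipFst k (n + 1) a (nilIf k n) = nilIf k n := by
  rcases n with _ | n <;> simp [nilIf, skipFst, listMap_single]

theorem skipSnd_nilIf (n a : ℕ) : skipSnd k (n + 1) a (nilIf k n) = nilIf k n := by
  rcases n with _ | n <;> simp [nilIf, skipSnd, listMap_single]

theorem listBoundary_ezList (q p a b : ℕ) : listBoundary k _ (ezList k q p a b) =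
    skipFst k (q + 1) a (ezListL k q p a b) +
      ((-1) ^ q : ℤ) • skipSnd k (p + 1) b (ezListR k q p a b) + nilIf k (q + p) := by
  fun_induction ezList k q p a b with
  | case1 a b => simp [ezListL, ezListR, nilIf, listBoundary_single]
  | case2 a b q ih =>
    rw [listBoundary_cons, ih, skipFst_succ (q + 1) a, show ezListL k q.succ 0 a b = ezList k q 0 a b from rfl,
      listMap_skip_fst, ezList_eq q 0 a b, skipFst_cons]
    simp [ezListR, skipFst_nilIf]
    exact (if_neg (Nat.succ_ne_zero q))
  | case3 a b p ih =>
    rw [listBoundary_cons, ih, skipSnd_succ (p + 1) b, show ezListR k 0 p.succ a b = ezList k 0 p a b from rfl,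
      listMap_skip_snd, ezList_eq 0 p a b, skipSnd_cons]
    simp [ezListL, skipSnd_nilIf]
    exact (if_neg (Nat.succ_ne_zero p))
  | case4 a b q p ih₁ ih₂ =>
    have n₁ : nilIf k (q + (p + 1)) = 0 := if_neg (by lia)
    have n₂ : nilIf k (q + 1 + p) = 0 := if_neg (by lia)
    have n₃ : nilIf k (q.succ + p.succ) = 0 := if_neg (by lia)
    rw [listBoundary_cons, map_add, map_zsmul, ih₁, ih₂, skipFst_succ (q + 1) a,
      skipSnd_succ (p + 1) b, n₁, n₂, n₃, show ezListL k q.succ p.succ a b = ezList k q p.succ a b from rfl,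
      show ezListR k q.succ p.succ a b = ezList k q.succ p a b from rfl,
      show ezListL k (q + 1) p a (b + 1) = ezList k q p a (b + 1) from rfl,
      show ezListR k q (p + 1) (a + 1) b = ezList k q p (a + 1) b from rfl, skipFst_succ (q + 1) a,
      skipSnd_succ (p + 1) b, listMap_skip_fst, listMap_skip_snd, listMap_skip_fst, listMap_skip_snd,
      ezList_eq q p.succ a b, ezList_eq q.succ p a b, skipFst_cons, skipSnd_cons,
      show ezListR k q p.succ a (b + 1) = ezList k q p a (b + 1) from rfl,
      show ezListL k q.succ p (a + 1) b = ezList k q p (a + 1) b from rfl,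
      show nilIf k (q + p.succ) = 0 from n₁, show nilIf k (q.succ + p) = 0 from n₂]
    simp only [map_add, map_sub, map_zsmul, smul_add, smul_sub, add_zero, pow_succ,
      mul_neg_one, neg_smul, Nat.succ_eq_add_one, smul_neg, map_neg, smul_smul]
    abel

theorem listComult_ezList (q p a b : ℕ) : listComult k _ (ezList k q p a b) =
    ∑ i ∈ Finset.HasAntidiagonal.antidiagonal q, ∑ j ∈ Finset.HasAntidiagonal.antidiagonal p,
      ((-1) ^ (j.1 * i.2) : ℤ) • (ezList k i.1 j.1 a b ⊗ₜ ezList k i.2 j.2 (a + i.1) (b + j.1)) := by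
  fun_induction ezList k q p a b with
  | case1 a b => simp [listComult_single, ezList]
  | case2 a b q ih =>
    rw [listComult_cons, ih, Finset.Nat.sum_antidiagonal_succ]
    simp [ezList, add_assoc, add_comm 1]
  | case3 a b p ih =>
    rw [listComult_cons, ih]
    simp [ezList, add_assoc, add_comm 1, Finset.Nat.sum_antidiagonal_succ]
  | case4 a b q p ih₁ ih₂ =>
    rw [listComult_cons, map_add (listComult k (ℕ × ℕ)), map_zsmul (listComult k (ℕ × ℕ)), ih₁, ih₂]
    simp only [Nat.succ_eq_add_one, Finset.Nat.sum_antidiagonal_succ, Finset.sum_add_distrib, map_add, map_sum, map_zsmul,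
      LinearMap.rTensor_tmul]
    have key : ∀ i ∈ Finset.HasAntidiagonal.antidiagonal q, ∀ j : ℕ × ℕ,
        ((-1) ^ ((j.1 + 1) * i.2) : ℤ) • (ezList k (i.1 + 1) (j.1 + 1) a b ⊗ₜ[k]
          ezList k i.2 j.2 (a + (i.1 + 1)) (b + (j.1 + 1))) =
        ((-1) ^ ((j.1 + 1) * i.2) : ℤ) • (listCons k (a, b) (ezList k i.1 (j.1 + 1) (a + 1) b) ⊗ₜ[k]
          ezList k i.2 j.2 (a + 1 + i.1) (b + (j.1 + 1))) +
        ((-1) ^ (q + 1) : ℤ) • ((-1) ^ (j.1 * i.2) : ℤ) •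
          (listCons k (a, b) (ezList k (i.1 + 1) j.1 a (b + 1)) ⊗ₜ[k]
          ezList k i.2 j.2 (a + (i.1 + 1)) (b + 1 + j.1)) := fun i hi j => by
      have hq : q = i.1 + i.2 := (Finset.HasAntidiagonal.mem_antidiagonal.1 hi).symm
      rw [ezList, map_add, map_zsmul, TensorProduct.add_tmul, smul_add, ← TensorProduct.smul_tmul',
        smul_smul, smul_smul, ← pow_add, ← pow_add, add_assoc a 1, add_comm 1, add_assoc b 1,
        add_comm 1 j.1, show (j.1 + 1) * i.2 + (i.1 + 1) = q + 1 + j.1 * i.2 by rw [hq]; ring]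
    rw [Finset.sum_congr rfl fun i hi => Finset.sum_congr rfl fun j _ => key i hi j]
    simp only [Finset.sum_add_distrib, ezList, Finset.smul_sum, smul_add, zero_mul, pow_zero,
      one_smul, add_zero, add_assoc, add_comm 1, map_add, map_zsmul, smul_smul (_ : ℤ) (_ : ℤ), ← pow_add,
      add_mul, one_mul, add_comm (q + 1)]
    abel

end EZ

end SerreSS

namespace SerreSS

open CategoryTheory Simplicial Opposite TensorProduct

/-! ### The Eilenberg--Zilber map of a parametrized family -/

theorem exists_apply_eq_succ {n m : ℕ} (hm : m < n) (f : Fin (n + 1) →o Fin (m + 1)) :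
    ∃ i : ℕ, ∃ hi : i < n, f ⟨i, by lia⟩ = f ⟨i + 1, by lia⟩ := by
  by_contra! hne
  have : ∀ (i : ℕ) (hi : i < n + 1), i ≤ f ⟨i, hi⟩ := by
    intro i
    induction i with
    | zero => simp
    | succ i ih =>
      intro hi
      have h₁ := f.monotone (show (⟨i, by lia⟩ : Fin (n + 1)) ≤ ⟨i + 1, hi⟩ by rw [Fin.mk_le_mk]; lia)
      have h₂ := lt_of_le_of_ne h₁ (hne i (by lia))
      rw [Fin.lt_def] at h₂
      have h₃ := ih (by lia)
      lia
  have h₁ := this n (by lia)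
  lia

namespace ChainFamily

variable {k : Type v} [Field k] {P : Type w} [Preorder P] {P' : Type w'} [Preorder P'] {X Y : SSet.{u}}

/-- The family obtained by composition with a monotone map. -/
def comap (e : ChainFamily P' X) (f : P →o P') : ChainFamily P X where
  app c := e.app (f.comp c)
  map_app θ _ := e.map_app θ _

/-- The image of a family under a simplicial map. -/
def map (e : ChainFamily P X) (f : X ⟶ Y) : ChainFamily P Y where
  app c := f.app _ (e.app c)
  map_app θ _ := by rw [← app_map, e.map_app]

theorem chainMap_ev (e : ChainFamily P X) (f : X ⟶ Y) (x : List P →₀ k) :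
    chainMap k f (e.ev k x) = (e.map f).ev k x := by
  refine list_lhom_ext (f := chainMap k f ∘ₗ e.ev k) (g := (e.map f).ev k) (fun l => ?_) x
  rw [LinearMap.comp_apply, ev_single, ev_single]
  rcases l with _ | ⟨v, l⟩
  · rw [evList_nil, evList_nil, map_zero]
  · rw [evList, evList]
    split_ifs
    · exact chainMap_simplex f _
    · rw [map_zero]

theorem ev_listMap (e : ChainFamily P X) (e' : ChainFamily P' X) (f : P →o P') {S : P → Prop}
    (h : ∀ (n : ℕ) (c : Fin (n + 1) →o P), (∀ i, S (c i)) → e'.app (f.comp c) = e.app c)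
    {x : List P →₀ k} (hx : x ∈ Finsupp.supported k k
      (Set.ofPred fun l : List P => l.Pairwise (· ≤ ·) ∧ ∀ v ∈ l, S v)) :
    e'.ev k (listMap k f x) = e.ev k x := by
  refine FDG.eq_of_supported (T := e'.ev k ∘ₗ listMap k f) (T' := e.ev k) (fun l hl => ?_) hx
  rw [LinearMap.comp_apply, listMap_single, ev_single, ev_single]
  by_cases hne : l = []
  · subst hne; rfl
  obtain ⟨hl, hS⟩ := hl
  obtain ⟨n, c, rfl⟩ := exists_ofFn hne hl
  rw [evList_ofFn, ← h n c fun i => hS _ (List.mem_ofFn.2 ⟨i, rfl⟩), ← evList_ofFn, List.map_ofFn]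
  rfl

theorem ev_eq_zero (e : ChainFamily P X) {S : List P → Prop}
    (h : ∀ (n : ℕ) (c : Fin (n + 1) →o P), S (List.ofFn c) → e.app c ∈ X.degenerate n)
    {x : List P →₀ k} (hx : x ∈ Finsupp.supported k k
      (Set.ofPred fun l : List P => l.Pairwise (· ≤ ·) ∧ S l)) : e.ev k x = 0 := by
  refine FDG.eq_of_supported (T := e.ev k) (T' := 0) (fun l hl => ?_) hx
  rw [ev_single, LinearMap.zero_apply]
  by_cases hne : l = []
  · subst hne; rfl
  obtain ⟨hl, hS⟩ := hl
  obtain ⟨n, c, rfl⟩ := exists_ofFn hne hl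
  rw [evList_ofFn, simplex_of_degenerate (h n c hS)]

theorem ev_mem_chainGr (e : ChainFamily P X) {m : ℕ} {x : List P →₀ k}
    (hx : x ∈ Finsupp.supported k k
      (Set.ofPred fun l : List P => l.Pairwise (· ≤ ·) ∧ l.length = m + 1)) :
    e.ev k x ∈ chainGr k X m := by
  refine FDG.mem_of_supported (T := e.ev k) (fun l hl => ?_) hx
  obtain ⟨hl, hm⟩ := hl
  obtain ⟨n, c, rfl⟩ := exists_ofFn (by rintro rfl; simp at hm) hl
  rw [ev_single, evList_ofFn]
  exact simplex_mem_chainGr _ (by simpa using hm)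

end ChainFamily

section EZMem

variable {k : Type v} [Field k]

theorem ezList_mem_of {q p a b : ℕ} {S : List (ℕ × ℕ) → Prop}
    (h : ∀ l ε, IsPath q p a b l ε → S l) :
    ezList k q p a b ∈ Finsupp.supported k k (Set.ofPred S) :=
  Finsupp.supported_mono (fun l hl => by obtain ⟨ε, hl⟩ := hl; exact h l ε hl) (ezList_mem q p a b)

theorem ezList_mem_pairwise (q p a b : ℕ) : ezList k q p a b ∈
    Finsupp.supported k k (Set.ofPred fun l => l.Pairwise (· ≤ ·)) :=
  ezList_mem_of fun _ _ h => h.pairwise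

theorem ezList_zero_right (q a b : ℕ) :
    ezList k q 0 a b = Finsupp.single (List.ofFn fun i : Fin (q + 1) => (a + (i : ℕ), b)) 1 := by
  induction q generalizing a with
  | zero => simp [ezList]
  | succ q ih =>
    rw [ezList, ih, listCons_single, List.ofFn_succ (n := q + 1)]
    simp [add_assoc, add_comm 1]

theorem ezList_zero_left (p a b : ℕ) :
    ezList k 0 p a b = Finsupp.single (List.ofFn fun i : Fin (p + 1) => (a, b + (i : ℕ))) 1 := by
  induction p generalizing b with
  | zero => simp [ezList]
  | succ q ih =>
    rw [ezList, ih, listCons_single, List.ofFn_succ (n := q + 1)]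
    simp [add_assoc, add_comm 1]

end EZMem

/-- A simplicial map `A × Δ[p] ⟶ X`. -/
@[ext]
structure Param (A X : SSet.{u}) (p : ℕ) where
  app : ∀ {n : ℕ}, A _⦋n⦌ → (⦋n⦌ ⟶ ⦋p⦌) → X _⦋n⦌
  map_app : ∀ {n m : ℕ} (θ : ⦋m⦌ ⟶ ⦋n⦌) (U : A _⦋n⦌) (σ : ⦋n⦌ ⟶ ⦋p⦌),
    X.map θ.op (app U σ) = app (A.map θ.op U) (θ ≫ σ)

/-- Truncation at `n`. -/
def clamp (n : ℕ) : ℕ →o Fin (n + 1) :=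
  ⟨fun i => ⟨min i n, by lia⟩, fun i j h => by rw [Fin.mk_le_mk]; lia⟩

theorem clamp_of_le {n i : ℕ} (h : i ≤ n) : clamp n i = ⟨i, by lia⟩ := Fin.ext (min_eq_left h)

namespace Param

variable {k : Type v} [Field k] {A X Y : SSet.{u}} {p p' : ℕ} (H : Param A X p)

theorem app_congr {n q : ℕ} (U : A _⦋q⦌) {θ θ' : ⦋n⦌ ⟶ ⦋q⦌} {σ σ' : ⦋n⦌ ⟶ ⦋p⦌}
    (hθ : ∀ i, θ.toOrderHom i = θ'.toOrderHom i) (hσ : ∀ i, σ.toOrderHom i = σ'.toOrderHom i) :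
    H.app (A.map θ.op U) σ = H.app (A.map θ'.op U) σ' := by
  rw [SimplexCategory.Hom.ext _ _ (OrderHom.ext _ _ (funext hθ)),
    SimplexCategory.Hom.ext _ _ (OrderHom.ext _ _ (funext hσ))]

/-- The composition with a map `Δ[p'] ⟶ Δ[p]`. -/
def restrict (η : ⦋p'⦌ ⟶ ⦋p⦌) : Param A X p' where
  app U σ := H.app U (σ ≫ η)
  map_app θ U σ := by rw [H.map_app, Category.assoc]

/-- The composition with a simplicial map. -/
def map (f : X ⟶ Y) : Param A Y p where
  app U σ := f.app _ (H.app U σ)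
  map_app θ U σ := by rw [← app_map, H.map_app]

/-- The family of the images of the simplices of `{U} × Δ[p]`. -/
def grid {q : ℕ} (U : A _⦋q⦌) : ChainFamily (Fin (q + 1) × Fin (p + 1)) X where
  app c := H.app (A.map (SimplexCategory.mkHom (OrderHom.fst.comp c)).op U)
    (SimplexCategory.mkHom (OrderHom.snd.comp c))
  map_app θ c := by
    rw [H.map_app]
    congr 1
    change (A.map _ ≫ A.map _) U = _
    rw [← A.map_comp, ← op_comp]
    rfl

/-- The family of the images of the simplices of `{U} × Δ[p]`. -/
def family {q : ℕ} (U : A _⦋q⦌) : ChainFamily (ℕ × ℕ) X :=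
  (H.grid U).comap (OrderHom.prodMap (clamp q) (clamp p))

variable (k) in
/-- The composition of the Eilenberg--Zilber map with a simplicial map `A × Δ[p] ⟶ X`, i.e. the cross
product with the fundamental simplex of `Δ[p]`. -/
noncomputable def ez : Chains k A →ₗ[k] Chains k X :=
  Finsupp.linearCombination k fun U => (H.family U.2.1).ev k (ezList k U.1 p 0 0)

theorem ez_simplex {q : ℕ} (U : A _⦋q⦌) :
    H.ez k (simplex k U) = (H.family U).ev k (ezList k q p 0 0) := by
  by_cases h : U ∈ A.nonDegenerate q
  · rw [simplex_of_nonDegenerate ⟨U, h⟩, ez, Finsupp.linearCombination_single, one_smul]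
  · replace h := (A.mem_degenerate_iff_notMem_nonDegenerate U).2 h
    rw [simplex_of_degenerate h, map_zero]
    obtain ⟨m, hm, f, τ, rfl⟩ := h
    obtain ⟨i, hi, hfi⟩ := exists_apply_eq_succ hm f.toOrderHom
    symm
    refine ChainFamily.ev_eq_zero _ (S := fun l => ∃ ε, IsPath q p 0 0 l ε) (fun n c hc => ?_)
      (ezList_mem_of fun _ ε h => ⟨h.pairwise, ε, h⟩)
    obtain ⟨ε, hc⟩ := hc
    obtain ⟨b, h₁, h₂⟩ := hc.step_mem (j := i) (by lia) (by lia)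
    obtain ⟨s, hs⟩ := List.mem_ofFn.1 h₁
    obtain ⟨t, ht⟩ := List.mem_ofFn.1 h₂
    have hst : s < t := by
      by_contra! hle
      have := c.monotone hle
      rw [hs, ht] at this
      have := (Prod.mk_le_mk.1 this).1
      lia
    have e : (H.family (A.map f.op τ)).app c = (H.grid τ).app
        ((OrderHom.prodMap (f.toOrderHom.comp (clamp q)) (clamp p)).comp c) := by
      change H.app ((A.map _ ≫ A.map _) τ) _ = _
      rw [← A.map_comp, ← op_comp]
      rfl
    rw [e]
    refine ChainFamily.mem_degenerate_of_le _ _ s t hst ?_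
    change Prod.map (f.toOrderHom.comp (clamp q)) (clamp p) (c s) =
      Prod.map (f.toOrderHom.comp (clamp q)) (clamp p) (c t)
    rw [hs, ht]
    refine Prod.ext ?_ rfl
    change f.toOrderHom (clamp q i) = f.toOrderHom (clamp q (i + 1))
    rw [clamp_of_le (by lia), clamp_of_le (by lia)]
    exact hfi

theorem ez_mem_chainGr {q : ℕ} (U : A _⦋q⦌) :
    H.ez k (simplex k U) ∈ chainGr k X (q + p : ℕ) := by
  rw [ez_simplex]
  exact ChainFamily.ev_mem_chainGr _ (ezList_mem_of fun _ _ h => ⟨h.pairwise, h.length_eq⟩)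

theorem chainMap_ez (f : X ⟶ Y) (x : Chains k A) : chainMap k f (H.ez k x) = (H.map f).ez k x := by
  refine chains_lhom_ext (f := chainMap k f ∘ₗ H.ez k) (g := (H.map f).ez k) (fun n σ => ?_) x
  rw [LinearMap.comp_apply, ez_simplex, ez_simplex, ChainFamily.chainMap_ev]
  rfl

theorem ev_family_listMap {q q' : ℕ} (U : A _⦋q⦌) (θ : ⦋q'⦌ ⟶ ⦋q⦌) (η : ⦋p'⦌ ⟶ ⦋p⦌)
    (f : ℕ × ℕ →o ℕ × ℕ) (hf : ∀ i j, ∀ (hi : i < q' + 1) (hj : j < p' + 1),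
      f (i, j) = ((θ.toOrderHom ⟨i, hi⟩ : ℕ), (η.toOrderHom ⟨j, hj⟩ : ℕ))) :
    (H.family U).ev k (listMap k f (ezList k q' p' 0 0)) =
      (H.restrict η).ez k (simplex k (A.map θ.op U)) := by
  rw [ez_simplex]
  refine ChainFamily.ev_listMap (S := fun v => v.1 ≤ q' ∧ v.2 ≤ p') _ _ f (fun n c hc => ?_)
    (ezList_mem_of fun _ _ h => ⟨h.pairwise, fun v hv => by have := h.bounds v hv; lia⟩)
  change H.app _ _ = H.app ((A.map _ ≫ A.map _) U) (_ ≫ η)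
  rw [← A.map_comp, ← op_comp]
  have key : ∀ i, f (c i) = ((θ.toOrderHom (clamp q' (c i).1) : ℕ), (η.toOrderHom (clamp p' (c i).2) : ℕ)) :=
    fun i => by
      rw [clamp_of_le (hc i).1, clamp_of_le (hc i).2]
      exact hf _ _ _ _
  refine H.app_congr U (fun i => Fin.ext ?_) (fun i => Fin.ext ?_)
  · change ((clamp q (f (c i)).1 : Fin _) : ℕ) = _
    rw [key, clamp_of_le (Fin.is_le _)]
    rfl
  · change ((clamp p (f (c i)).2 : Fin _) : ℕ) = _
    rw [key, clamp_of_le (Fin.is_le _)]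
    rfl

theorem restrict_id : H.restrict (𝟙 _) = H := by
  ext n U σ
  change H.app U (σ ≫ 𝟙 _) = _
  rw [Category.comp_id]

theorem map_id_apply {q : ℕ} (U : A _⦋q⦌) : A.map (𝟙 ⦋q⦌).op U = U :=
  ConcreteCategory.congr_hom (A.map_id (op ⦋q⦌)) U

theorem skip_eq_succAbove {n : ℕ} (i : Fin (n + 2)) (j : Fin (n + 1)) :
    skip i j = ((SimplexCategory.δ i).toOrderHom j : ℕ) := by
  change _ = ((i.succAbove j : Fin _) : ℕ)
  simp only [skip, Fin.succAbove, Fin.lt_def, Fin.val_castSucc]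
  split_ifs <;> rfl

theorem ev_skipFst {q : ℕ} (U : A _⦋q⦌) :
    (H.family U).ev k (skipFst k (q + 1) 0 (ezListL k q p 0 0)) = H.ez k (faceSum k q U) := by
  rcases q with _ | q
  · rw [ezListL, map_zero, map_zero, faceSum_zero, map_zero]
  · rw [faceSum_succ, skipFst, LinearMap.sum_apply, map_sum, map_sum, ← Fin.sum_univ_eq_sum_range
      (fun i => (H.family U).ev k ((((-1) ^ i : ℤ) • listMap k (Prod.map (skip (0 + i)) id))
        (ezListL k (q + 1) p 0 0))) (q + 1 + 1)]
    refine Finset.sum_congr rfl fun i _ => ?_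
    rw [LinearMap.smul_apply, map_zsmul, map_zsmul]
    congr 1
    have := H.ev_family_listMap (k := k) U (SimplexCategory.δ i) (𝟙 _)
      (OrderHom.prodMap ⟨_, skip_mono i⟩ OrderHom.id) (fun a b ha hb => by
        refine Prod.ext ?_ rfl
        exact skip_eq_succAbove i ⟨a, ha⟩)
    rw [restrict_id] at this
    rw [zero_add]
    exact this

/-- The face `A × ∂ⱼ Δ[p + 1] ⟶ X`. -/
def face {p : ℕ} (H : Param A X (p + 1)) (j : Fin (p + 2)) : Param A X p :=
  H.restrict (SimplexCategory.δ j)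

theorem ev_skipSnd {q p : ℕ} (H : Param A X (p + 1)) (U : A _⦋q⦌) :
    (H.family U).ev k (skipSnd k (p + 2) 0 (ezListR k q (p + 1) 0 0)) =
      ∑ j : Fin (p + 2), ((-1) ^ (j : ℕ) : ℤ) • (H.face j).ez k (simplex k U) := by
  rw [skipSnd, LinearMap.sum_apply, map_sum, ← Fin.sum_univ_eq_sum_range
      (fun i => (H.family U).ev k ((((-1) ^ i : ℤ) • listMap k (Prod.map id (skip (0 + i))))
        (ezListR k q (p + 1) 0 0))) (p + 2)]
  refine Finset.sum_congr rfl fun i _ => ?_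
  rw [LinearMap.smul_apply, map_zsmul]
  congr 1
  have := H.ev_family_listMap (k := k) U (𝟙 _) (SimplexCategory.δ i)
    (OrderHom.prodMap OrderHom.id ⟨_, skip_mono i⟩) (fun a b ha hb => by
      refine Prod.ext rfl ?_
      exact skip_eq_succAbove i ⟨b, hb⟩)
  rw [map_id_apply] at this
  rw [zero_add]
  exact this

theorem boundary_ez_zero (H : Param A X 0) (x : Chains k A) :
    boundary k X (H.ez k x) = H.ez k (boundary k A x) := by
  refine chains_lhom_ext (f := boundary k X ∘ₗ H.ez k) (g := H.ez k ∘ₗ boundary k A)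
    (fun n σ => ?_) x
  rw [LinearMap.comp_apply, LinearMap.comp_apply, ez_simplex, boundary_simplex,
    ChainFamily.boundary_ev _ (ezList_mem_pairwise _ _ _ _), listBoundary_ezList, map_add, map_add,
    ev_skipFst, ezListR, map_zero, smul_zero, map_zero, add_zero, nilIf]
  split_ifs
  · rw [ChainFamily.ev_single, ChainFamily.evList_nil, add_zero]
  · rw [map_zero, add_zero]

theorem boundary_ez {p : ℕ} (H : Param A X (p + 1)) (x : Chains k A) :
    boundary k X (H.ez k x) = H.ez k (boundary k A x) +
      ∑ j : Fin (p + 2), ((-1) ^ (j : ℕ) : ℤ) • (H.face j).ez k (chainSgn k A x) := by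
  have := chains_lhom_ext (f := boundary k X ∘ₗ H.ez k) (g := H.ez k ∘ₗ boundary k A +
      ∑ j : Fin (p + 2), ((-1) ^ (j : ℕ) : ℤ) • ((H.face j).ez k ∘ₗ chainSgn k A))
    (fun n σ => ?_) x
  · simpa only [LinearMap.add_apply, LinearMap.sum_apply, LinearMap.comp_apply, LinearMap.smul_apply]
      using this
  · simp only [LinearMap.add_apply, LinearMap.sum_apply, LinearMap.comp_apply, LinearMap.smul_apply]
    rw [ez_simplex, boundary_simplex, ChainFamily.boundary_ev _ (ezList_mem_pairwise _ _ _ _),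
      listBoundary_ezList, map_add, map_add, ev_skipFst, map_zsmul, ev_skipSnd, chainSgn_simplex,
      show nilIf k (n + (p + 1)) = 0 from if_neg (by lia), map_zero, add_zero, Finset.smul_sum]
    congr 1
    refine Finset.sum_congr rfl fun j _ => ?_
    rw [map_zsmul, smul_comm]

theorem chainComult_ez {q : ℕ} (U : A _⦋q⦌) : chainComult k X (H.ez k (simplex k U)) =
    ∑ i : Finset.HasAntidiagonal.antidiagonal q, ∑ j : Finset.HasAntidiagonal.antidiagonal p,
      ((-1) ^ (j.1.1 * i.1.2) : ℤ) •
        ((H.restrict (SimplexCategory.subinterval 0 j.1.1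
          (by have := Finset.HasAntidiagonal.mem_antidiagonal.1 j.2; lia))).ez k
          (simplex k (SerreSS.face U 0 i.1.1
            (by have := Finset.HasAntidiagonal.mem_antidiagonal.1 i.2; lia))) ⊗ₜ
        (H.restrict (SimplexCategory.subinterval j.1.1 j.1.2
          (by have := Finset.HasAntidiagonal.mem_antidiagonal.1 j.2; lia))).ez k
          (simplex k (SerreSS.face U i.1.1 i.1.2
            (by have := Finset.HasAntidiagonal.mem_antidiagonal.1 i.2; lia)))) := by
  rw [ez_simplex, ChainFamily.chainComult_ev _ (ezList_mem_pairwise _ _ _ _), listComult_ezList,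
    map_sum, ← Finset.sum_coe_sort]
  refine Finset.sum_congr rfl fun i _ => ?_
  rw [map_sum, ← Finset.sum_coe_sort]
  refine Finset.sum_congr rfl fun j _ => ?_
  rw [map_zsmul, TensorProduct.map_tmul]
  congr 2
  · rw [← listMap_ezList (f := (OrderHom.prodMap ⟨fun a => a + 0, fun a b h => h⟩
      ⟨fun a => a + 0, fun a b h => h⟩ : ℕ × ℕ →o ℕ × ℕ)) i.1.1 j.1.1 0 0 0 0 (fun a _ b _ => rfl)]
    exact H.ev_family_listMap U _ _ _ fun a b ha hb => rfl
  · rw [← listMap_ezList (f := (OrderHom.prodMap ⟨fun a => a + i.1.1, fun a b h => by simpa using h⟩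
      ⟨fun a => a + j.1.1, fun a b h => by simpa using h⟩ : ℕ × ℕ →o ℕ × ℕ)) i.1.2 j.1.2 0 0 (0 + i.1.1)
      (0 + j.1.1) (fun a _ b _ => Prod.ext (by change 0 + a + _ = _; lia) (by change 0 + b + _ = _; lia))]
    exact H.ev_family_listMap U _ _ _ fun a b ha hb => rfl

/-- The restriction to `A × {a}`. -/
def vertex (a : Fin (p + 1)) : A ⟶ X where
  app n := TypeCat.ofHom fun U => H.app (n := n.unop.len) U (SimplexCategory.const _ ⦋p⦌ a)
  naturality n m θ := by
    ext U
    exact (H.map_app (n := n.unop.len) (m := m.unop.len) θ.unop U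
      (SimplexCategory.const _ ⦋p⦌ a)).symm

theorem vertex_app (a : Fin (p + 1)) {n : ℕ} (U : A _⦋n⦌) :
    (H.vertex a).app (op ⦋n⦌) U = H.app U (SimplexCategory.const _ ⦋p⦌ a) := rfl

theorem ez_zero (H : Param A X 0) (x : Chains k A) : H.ez k x = chainMap k (H.vertex 0) x := by
  refine chains_lhom_ext (fun n σ => ?_) x
  rw [chainMap_simplex, ez_simplex, ezList_zero_right, ChainFamily.ev_single, vertex_app]
  have := (H.family σ.1).evList_ofFn (k := k) (n := n)
    ⟨fun i => (0 + (i : ℕ), 0), fun i j h => Prod.mk_le_mk.2 ⟨by simpa using h, le_rfl⟩⟩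
  refine this.trans ?_
  congr 1
  conv_rhs => rw [← map_id_apply σ.1]
  refine H.app_congr σ.1 (fun i => Fin.ext ?_) (fun i => Subsingleton.elim (α := Fin 1) _ _)
  change min (0 + (i : ℕ)) n = i
  have := i.is_le
  simp only [SimplexCategory.len_mk] at this
  lia

end Param

end SerreSS

namespace SerreSS

open CategoryTheory Simplicial Opposite TensorProduct

/-! ### The maps `φ` and `ψ` on Eilenberg--Zilber products -/

section Phi

variable {k : Type v} [Field k] {A X Y : SSet.{u}} {p : ℕ}

variable (k) in
/-- The projection to the chains of degree `q`. -/
noncomputable def chainPart (X : SSet.{u}) (q : ℤ) : Chains k X →ₗ[k] Chains k X :=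
  Finsupp.linearCombination k fun s => if (s.1 : ℤ) = q then Finsupp.single s 1 else 0

theorem chainPart_simplex {n : ℕ} (q : ℤ) (σ : X _⦋n⦌) :
    chainPart k X q (simplex k σ) = if (n : ℤ) = q then simplex k σ else 0 := by
  by_cases h : σ ∈ X.nonDegenerate n
  · rw [simplex_of_nonDegenerate ⟨σ, h⟩, chainPart, Finsupp.linearCombination_single, one_smul]
  · rw [simplex, dif_neg h, map_zero, ite_self]

theorem chainPart_of_mem {n q : ℤ} {x : Chains k X} (hx : x ∈ chainGr k X n) :
    chainPart k X q x = if n = q then x else 0 := by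
  have := FDG.eq_of_supported (T := chainPart k X q) (T' := if n = q then LinearMap.id else 0)
    (fun s hs => by
      obtain ⟨m, σ⟩ := s
      obtain rfl : (m : ℤ) = n := hs
      rw [← simplex_of_nonDegenerate, chainPart_simplex]
      split_ifs <;> rfl) hx
  rw [this]
  split_ifs <;> rfl

theorem phi_eq (f : X ⟶ Y) (q : ℕ) (x : Chains k X) : phi k f q x =
    TensorProduct.map (chainPart k X q) (chainMap k f) (chainComult k X x) := by
  refine chains_lhom_ext (f := phi k f q) (g := TensorProduct.map (chainPart k X q) (chainMap k f) ∘ₗ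
    chainComult k X) (fun n σ => ?_) x
  rw [LinearMap.comp_apply, chainComult_simplex, map_sum, simplex_of_nonDegenerate, phi,
    Finsupp.linearCombination_single, one_smul]
  simp only [TensorProduct.map_tmul, chainPart_simplex, chainMap_simplex, Nat.cast_inj]
  split_ifs with h
  · rw [Finset.sum_eq_single (⟨q, by lia⟩ : Fin (n + 1)), if_pos rfl]
    · intro j _ hj
      rw [if_neg (fun h => hj (Fin.ext h)), TensorProduct.zero_tmul]
    · exact fun h => absurd (Finset.mem_univ _) h
  · refine (Finset.sum_eq_zero fun j _ => ?_).symm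
    rw [if_neg (by have := j.is_le; lia), TensorProduct.zero_tmul]

theorem face_zero_self {n : ℕ} (σ : X _⦋n⦌) : face σ 0 n (by lia) = σ := Param.map_id_apply σ

namespace Param

theorem ez_const (H : Param A Y p) {V : Y _⦋p⦌}
    (hH : ∀ {n : ℕ} (U : A _⦋n⦌) (σ : ⦋n⦌ ⟶ ⦋p⦌), H.app U σ = Y.map σ.op V) {q : ℕ} (U : A _⦋q⦌) :
    H.ez k (simplex k U) = if q = 0 then simplex k V else 0 := by
  rw [ez_simplex]
  split_ifs with hq
  · subst hq
    rw [ezList_zero_left, ChainFamily.ev_single]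
    have := (H.family U).evList_ofFn (k := k) (n := p)
      ⟨fun i => (0, 0 + (i : ℕ)), fun i j h => Prod.mk_le_mk.2 ⟨le_rfl, by simpa using h⟩⟩
    refine this.trans ?_
    congr 1
    refine (hH _ _).trans ?_
    conv_rhs => rw [← map_id_apply V]
    congr 3
    refine congrArg Quiver.Hom.op
      (SimplexCategory.Hom.ext _ _ (OrderHom.ext _ _ (funext fun i => Fin.ext ?_)))
    change min (0 + (i : ℕ)) p = i
    have := i.is_le
    simp only [SimplexCategory.len_mk] at this
    lia
  · refine ChainFamily.ev_eq_zero _ (S := fun l => ∃ ε, IsPath q p 0 0 l ε) (fun n c hc => ?_)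
      (ezList_mem_of fun _ ε h => ⟨h.pairwise, ε, h⟩)
    obtain ⟨ε, hc⟩ := hc
    obtain ⟨b, h₁, h₂⟩ := hc.step_mem (j := 0) (by lia) (by lia)
    obtain ⟨s, hs⟩ := List.mem_ofFn.1 h₁
    obtain ⟨t, ht⟩ := List.mem_ofFn.1 h₂
    have hst : s < t := by
      by_contra! hle
      have := c.monotone hle
      rw [hs, ht] at this
      have := (Prod.mk_le_mk.1 this).1
      lia
    have e : (H.family U).app c = (ChainFamily.ofSimplex V).app
        (((clamp p).comp OrderHom.snd).comp c) := hH _ _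
    rw [e]
    refine ChainFamily.mem_degenerate_of_le _ _ s t hst ?_
    change clamp p (c s).2 = clamp p (c t).2
    rw [hs, ht]

theorem phi_ez_simplex (H : Param A X p) (f : X ⟶ Y) {V : Y _⦋p⦌}
    (hH : ∀ {n : ℕ} (U : A _⦋n⦌) (σ : ⦋n⦌ ⟶ ⦋p⦌), f.app (op ⦋n⦌) (H.app U σ) = Y.map σ.op V)
    {q : ℕ} (U : A _⦋q⦌) :
    phi k f q (H.ez k (simplex k U)) = chainMap k (H.vertex 0) (simplex k U) ⊗ₜ simplex k V := by
  rw [phi_eq, chainComult_ez, map_sum]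
  have key : ∀ {p' : ℕ} (η : ⦋p'⦌ ⟶ ⦋p⦌) {n : ℕ} (U : A _⦋n⦌),
      chainMap k f ((H.restrict η).ez k (simplex k U)) =
        if n = 0 then simplex k (Y.map η.op V) else 0 := fun η n U => by
    rw [chainMap_ez]
    refine ez_const _ (fun U σ => ?_) U
    change f.app _ (H.app U (σ ≫ η)) = (Y.map _ ≫ Y.map _) V
    rw [hH, ← Y.map_comp, ← op_comp]
  have hpart : ∀ {p' : ℕ} (η : ⦋p'⦌ ⟶ ⦋p⦌) {n : ℕ} (U : A _⦋n⦌),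
      chainPart k X q ((H.restrict η).ez k (simplex k U)) =
        if n + p' = q then (H.restrict η).ez k (simplex k U) else 0 := fun η n U =>
    (chainPart_of_mem (ez_mem_chainGr _ U)).trans (by simp only [Nat.cast_inj])
  rw [Finset.sum_eq_single (⟨(q, 0), by simp⟩ : Finset.HasAntidiagonal.antidiagonal q), map_sum,
    Finset.sum_eq_single (⟨(0, p), by simp⟩ : Finset.HasAntidiagonal.antidiagonal p), map_zsmul,
    TensorProduct.map_tmul, key, hpart, if_pos rfl, if_pos (by rfl), zero_mul, pow_zero, one_smul]
  · dsimp only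
    congr 1
    · rw [ez_zero, chainMap_simplex, chainMap_simplex, face_zero_self, vertex_app, vertex_app]
      congr 1
    · congr 1
      exact map_id_apply V
  · intro j _ hj
    rw [map_zsmul, TensorProduct.map_tmul, hpart, if_neg, TensorProduct.zero_tmul, smul_zero]
    intro h
    have := Finset.HasAntidiagonal.mem_antidiagonal.1 j.2
    exact hj (Subtype.ext (Prod.ext (by dsimp only at h ⊢; lia) (by dsimp only at h ⊢; lia)))
  · exact fun h => absurd (Finset.mem_univ _) h
  · intro i _ hi
    rw [map_sum]
    refine Finset.sum_eq_zero fun j _ => ?_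
    rw [map_zsmul, TensorProduct.map_tmul, key, if_neg, TensorProduct.tmul_zero, smul_zero]
    intro h
    have := Finset.HasAntidiagonal.mem_antidiagonal.1 i.2
    exact hi (Subtype.ext (Prod.ext (by dsimp only; lia) h))
  · exact fun h => absurd (Finset.mem_univ _) h

theorem phi_ez (H : Param A X p) (f : X ⟶ Y) {V : Y _⦋p⦌}
    (hH : ∀ {n : ℕ} (U : A _⦋n⦌) (σ : ⦋n⦌ ⟶ ⦋p⦌), f.app (op ⦋n⦌) (H.app U σ) = Y.map σ.op V)
    {q : ℕ} {c : Chains k A} (hc : c ∈ chainGr k A q) :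
    phi k f q (H.ez k c) = chainMap k (H.vertex 0) c ⊗ₜ simplex k V :=
  FDG.eq_of_supported (T := phi k f q ∘ₗ H.ez k)
    (T' := (TensorProduct.mk k _ _).flip (simplex k V) ∘ₗ chainMap k (H.vertex 0)) (fun s hs => by
      obtain ⟨m, σ⟩ := s
      obtain rfl : m = q := by exact_mod_cast hs
      rw [← simplex_of_nonDegenerate]
      exact H.phi_ez_simplex f hH σ.1) hc

end Param

end Phi

end SerreSS

namespace SerreSS

open CategoryTheory Opposite TensorProduct

/-! ### Shuffles as lattice paths -/

theorem IsPath.isChain {q p a b : ℕ} {l : List (ℕ × ℕ)} {ε : ℤ} (h : IsPath q p a b l ε) :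
    l.IsChain fun v w => w = (v.1 + 1, v.2) ∨ w = (v.1, v.2 + 1) := by
  induction h with
  | nil a b => simp
  | right h ih =>
    obtain ⟨l', rfl⟩ := h.head_eq
    exact List.isChain_cons_cons.2 ⟨Or.inl rfl, ih⟩
  | up h ih =>
    obtain ⟨l', rfl⟩ := h.head_eq
    exact List.isChain_cons_cons.2 ⟨Or.inr rfl, ih⟩

/-- The `j`-th step of a path in `ℕ × ℕ` is one of the two unit steps. -/
def UnitStep (m s : ℕ → ℕ) (j : ℕ) : Prop :=
  (m (j + 1) = m j + 1 ∧ s (j + 1) = s j) ∨ (m (j + 1) = m j ∧ s (j + 1) = s j + 1)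

theorem UnitStep.le {m s : ℕ → ℕ} {n : ℕ} (h : ∀ j < n, UnitStep m s j) {i j : ℕ} (hij : i ≤ j)
    (hj : j ≤ n) : m i ≤ m j ∧ s i ≤ s j := by
  induction j, hij using Nat.le_induction with
  | base => exact ⟨le_rfl, le_rfl⟩
  | succ j hij ih =>
    have h₁ := ih (by lia)
    have h₂ := h j (by lia)
    unfold UnitStep at h₂
    lia

theorem isPath_of_unitStep (n : ℕ) (m s : ℕ → ℕ) (h : ∀ j < n, UnitStep m s j) (q p : ℕ)
    (hq : m n = m 0 + q) (hp : s n = s 0 + p) :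
    IsPath q p (m 0) (s 0) ((List.range (n + 1)).map fun j => (m j, s j))
      (∏ j ∈ Finset.range n, if s j < s (j + 1) then (-1) ^ (m n - m j) else 1) := by
  induction n generalizing m s q p with
  | zero =>
    obtain rfl : q = 0 := by lia
    obtain rfl : p = 0 := by lia
    simpa using IsPath.nil (m 0) (s 0)
  | succ n ih =>
    have hle := UnitStep.le h (i := 1) (j := n + 1) (by lia) le_rfl
    have ih' := ih (fun j => m (j + 1)) (fun j => s (j + 1)) (fun j hj => h (j + 1) (by lia))
    rw [List.range_succ_eq_map, List.map_cons, List.map_map, Finset.prod_range_succ', mul_comm]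
    rcases h 0 (by lia) with ⟨h₁, h₂⟩ | ⟨h₁, h₂⟩
    · obtain ⟨q, rfl⟩ : ∃ q', q = q' + 1 := ⟨q - 1, by lia⟩
      rw [if_neg (by rw [h₂]; lia), one_mul]
      have := ih' q p (by rw [zero_add] at *; lia) (by rw [zero_add] at *; lia)
      rw [zero_add] at this h₁ h₂
      rw [h₁, h₂] at this
      exact IsPath.right this
    · obtain ⟨p, rfl⟩ : ∃ q', p = q' + 1 := ⟨p - 1, by lia⟩
      have := ih' q p (by rw [zero_add] at *; lia) (by rw [zero_add] at *; lia)
      rw [if_pos (by lia), hq, Nat.add_sub_cancel_left]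
      rw [zero_add] at this h₁ h₂
      rw [h₁, h₂, hq] at this
      exact IsPath.up this

theorem card_steps {m s : ℕ → ℕ} {n i N : ℕ} (h : ∀ j < n, UnitStep m s j) (hN : N ≤ n) :
    (∑ j ∈ Finset.range N, if i < j ∧ m j < m (j + 1) then 1 else 0) = m N - m (min (i + 1) N) := by
  induction N with
  | zero => simp
  | succ N ih =>
    rw [Finset.sum_range_succ, ih (by lia)]
    have h₁ := h N (by lia)
    unfold UnitStep at h₁
    rcases lt_or_ge i N with hi | hi
    · rw [min_eq_left (by lia), min_eq_left (by lia)]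
      have := (UnitStep.le h (i := i + 1) (j := N) (by lia) (by lia)).1
      split_ifs <;> lia
    · rw [min_eq_right (by lia), min_eq_right (by lia)]
      split_ifs <;> lia

namespace Shuffle

variable {q p : ℕ} (s : Shuffle q p)

/-- The first coordinate of the path of a shuffle. -/
def fst (j : ℕ) : ℕ := s.1.1.toOrderHom (clamp (q + p) j)

/-- The second coordinate of the path of a shuffle. -/
def snd (j : ℕ) : ℕ := s.1.2.toOrderHom (clamp (q + p) j)

theorem fst_mono : Monotone s.fst := s.1.1.toOrderHom.monotone.comp (clamp (q + p)).monotone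

theorem snd_mono : Monotone s.snd := s.1.2.toOrderHom.monotone.comp (clamp (q + p)).monotone

theorem exists_fst_eq (a : ℕ) (ha : a ≤ q) : ∃ j ≤ q + p, s.fst j = a := by
  obtain ⟨i, hi⟩ := s.2.1 ⟨a, by change a < q + 1; lia⟩
  refine ⟨i, i.is_le, ?_⟩
  rw [fst, clamp_of_le i.is_le]
  exact congrArg Fin.val hi

theorem exists_snd_eq (a : ℕ) (ha : a ≤ p) : ∃ j ≤ q + p, s.snd j = a := by
  obtain ⟨i, hi⟩ := s.2.2.1 ⟨a, by change a < p + 1; lia⟩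
  refine ⟨i, i.is_le, ?_⟩
  rw [snd, clamp_of_le i.is_le]
  exact congrArg Fin.val hi

theorem fst_zero : s.fst 0 = 0 := by
  obtain ⟨j, -, h⟩ := s.exists_fst_eq 0 (by lia)
  have := s.fst_mono (Nat.zero_le j)
  lia

theorem snd_zero : s.snd 0 = 0 := by
  obtain ⟨j, -, h⟩ := s.exists_snd_eq 0 (by lia)
  have := s.snd_mono (Nat.zero_le j)
  lia

theorem fst_last : s.fst (q + p) = q := by
  obtain ⟨j, hj, h⟩ := s.exists_fst_eq q le_rfl
  have h₁ := s.fst_mono hj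
  have h₂ : s.fst (q + p) ≤ q := Fin.is_le _
  lia

theorem snd_last : s.snd (q + p) = p := by
  obtain ⟨j, hj, h⟩ := s.exists_snd_eq p le_rfl
  have h₁ := s.snd_mono hj
  have h₂ : s.snd (q + p) ≤ p := Fin.is_le _
  lia

theorem step (j : ℕ) (hj : j < q + p) : (s.fst j = s.fst (j + 1) → s.snd (j + 1) = s.snd j + 1) ∧
    (s.snd j = s.snd (j + 1) → s.fst (j + 1) = s.fst j + 1) := by
  have := s.2.2.2 ⟨j, hj⟩
  have e₁ : clamp (q + p) j = Fin.castSucc ⟨j, hj⟩ := clamp_of_le (by lia)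
  have e₂ : clamp (q + p) (j + 1) = Fin.succ ⟨j, hj⟩ := clamp_of_le (by lia)
  unfold fst snd
  rw [e₁, e₂]
  exact ⟨fun h => this.1 (Fin.ext h), fun h => this.2 (Fin.ext h)⟩

theorem fst_add_snd (j : ℕ) (hj : j ≤ q + p) : s.fst j + s.snd j = j := by
  have key : ∀ i j, i ≤ j → j ≤ q + p → s.fst i + s.snd i + (j - i) ≤ s.fst j + s.snd j := by
    intro i j hij hj
    induction j, hij using Nat.le_induction with
    | base => lia
    | succ j hij ih =>
      have h₁ := ih (by lia)
      have h₂ := s.step j (by lia)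
      have h₃ := s.fst_mono (show j ≤ j + 1 by lia)
      have h₄ := s.snd_mono (show j ≤ j + 1 by lia)
      lia
  have h₁ := key 0 j (by lia) hj
  have h₂ := key j (q + p) hj le_rfl
  rw [fst_zero, snd_zero] at h₁
  rw [fst_last, snd_last] at h₂
  lia

theorem unitStep (j : ℕ) (hj : j < q + p) : UnitStep s.fst s.snd j := by
  have h₁ := s.fst_add_snd j (by lia)
  have h₂ := s.fst_add_snd (j + 1) (by lia)
  have h₃ := s.fst_mono (show j ≤ j + 1 by lia)
  have h₄ := s.snd_mono (show j ≤ j + 1 by lia)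
  unfold UnitStep
  lia

theorem sign_eq : s.sign = ∏ j ∈ Finset.range (q + p),
    if s.snd j < s.snd (j + 1) then (-1) ^ (s.fst (q + p) - s.fst j) else 1 := by
  classical
  have e : ∀ j : Fin (q + p), clamp (q + p) j = j.castSucc := fun j => clamp_of_le (by lia)
  have e' : ∀ j : Fin (q + p), clamp (q + p) (j + 1) = j.succ := fun j => clamp_of_le (by lia)
  have h₁ : ∀ j : Fin (q + p), (s.1.1.toOrderHom j.castSucc < s.1.1.toOrderHom j.succ ↔
      s.fst j < s.fst (j + 1)) := fun j => by
    rw [fst, fst, e, e']; rfl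
  have h₂ : ∀ j : Fin (q + p), (s.1.2.toOrderHom j.castSucc < s.1.2.toOrderHom j.succ ↔
      s.snd j < s.snd (j + 1)) := fun j => by
    rw [snd, snd, e, e']; rfl
  rw [sign, Finset.card_filter, Fintype.sum_prod_type, ← Finset.prod_pow_eq_pow_sum,
    ← Fin.prod_univ_eq_prod_range (fun j => if s.snd j < s.snd (j + 1) then
      (-1 : ℤ) ^ (s.fst (q + p) - s.fst j) else 1) (q + p)]
  refine Finset.prod_congr rfl fun i _ => ?_
  simp only [h₁, h₂]
  split_ifs with hi
  · simp only [hi, true_and, Fin.lt_def]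
    congr 1
    rw [Fin.sum_univ_eq_sum_range (fun j => if (i : ℕ) < j ∧ s.fst j < s.fst (j + 1) then 1 else 0) (q + p),
      card_steps s.unitStep le_rfl, min_eq_left (by lia)]
    have := s.unitStep i (by lia)
    unfold UnitStep at this
    lia
  · simp [hi]

/-- The lattice path of a shuffle. -/
def path : List (ℕ × ℕ) := (List.range (q + p + 1)).map fun j => (s.fst j, s.snd j)

theorem isPath_path : IsPath q p 0 0 s.path s.sign := by
  have := isPath_of_unitStep (q + p) s.fst s.snd s.unitStep q p
    (by rw [fst_last, fst_zero, zero_add]) (by rw [snd_last, snd_zero, zero_add])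
  rw [fst_zero, snd_zero] at this
  rw [sign_eq]
  exact this

theorem path_injective : Function.Injective (path : Shuffle q p → _) := by
  intro s t h
  have key : ∀ j : Fin (q + p + 1), s.fst j = t.fst j ∧ s.snd j = t.snd j := fun j => by
    have := List.map_inj_left.1 h j (List.mem_range.2 (by lia))
    exact ⟨congrArg Prod.fst this, congrArg Prod.snd this⟩
  have e : ∀ j : Fin (q + p + 1), clamp (q + p) j = j := fun j => clamp_of_le (by lia)
  refine Subtype.ext (Prod.ext ?_ ?_)
  · refine SimplexCategory.Hom.ext _ _ (OrderHom.ext _ _ (funext fun j => Fin.ext ?_))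
    have := (key j).1
    rwa [fst, fst, e] at this
  · refine SimplexCategory.Hom.ext _ _ (OrderHom.ext _ _ (funext fun j => Fin.ext ?_))
    have := (key j).2
    rwa [snd, snd, e] at this

end Shuffle

theorem IsPath.exists_shuffle {q p : ℕ} {l : List (ℕ × ℕ)} {ε : ℤ} (h : IsPath q p 0 0 l ε) :
    ∃ s : Shuffle q p, s.path = l := by
  have hlen := h.length_eq
  have hb : ∀ (i : ℕ) (hi : i < l.length), l[i].1 ≤ q ∧ l[i].2 ≤ p := fun i hi => by
    have := h.bounds _ (List.getElem_mem hi); lia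
  have hmono : ∀ (i j : ℕ) (hi : i < l.length) (hj : j < l.length), i ≤ j → l[i] ≤ l[j] :=
    fun i j hi hj hij => by
      rcases hij.eq_or_lt with rfl | hij
      · exact le_rfl
      · exact List.pairwise_iff_getElem.1 h.pairwise i j hi hj hij
  let μ : Fin (q + p + 1) →o Fin (q + 1) := ⟨fun i => ⟨l[i].1, by have := hb i (by lia); simp; lia⟩,
    fun i j hij => (Prod.mk_le_mk.1 (hmono i j (by lia) (by lia) hij)).1⟩
  let σ : Fin (q + p + 1) →o Fin (p + 1) := ⟨fun i => ⟨l[i].2, by have := hb i (by lia); simp; lia⟩,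
    fun i j hij => (Prod.mk_le_mk.1 (hmono i j (by lia) (by lia) hij)).2⟩
  refine ⟨⟨(SimplexCategory.mkHom μ, SimplexCategory.mkHom σ), ?_, ?_, ?_⟩, ?_⟩
  · rintro ⟨a, ha⟩
    obtain ⟨v, hv, rfl⟩ : ∃ v ∈ l, v.1 = a := by
      rcases a with _ | a
      · exact ⟨_, h.start_mem, rfl⟩
      · obtain ⟨b', -, h₂⟩ := h.step_mem (j := a) (by lia) (by
          have : a + 1 < q + 1 := ha
          lia)
        exact ⟨_, h₂, rfl⟩
    obtain ⟨i, hi, rfl⟩ := List.mem_iff_getElem.1 hv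
    exact ⟨⟨i, by change i < q + p + 1; lia⟩, rfl⟩
  · rintro ⟨a, ha⟩
    obtain ⟨v, hv, rfl⟩ : ∃ v ∈ l, v.2 = a := by
      rcases a with _ | a
      · exact ⟨_, h.start_mem, rfl⟩
      · obtain ⟨b', -, h₂⟩ := h.step_mem_snd (j := a) (by lia) (by
          have : a + 1 < p + 1 := ha
          lia)
        exact ⟨_, h₂, rfl⟩
    obtain ⟨i, hi, rfl⟩ := List.mem_iff_getElem.1 hv
    exact ⟨⟨i, by change i < q + p + 1; lia⟩, rfl⟩
  · intro j
    have hj := List.isChain_iff_getElem.1 h.isChain j (by lia)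
    have key : ∀ (c d : ℕ × ℕ), (d = (c.1 + 1, c.2) ∨ d = (c.1, c.2 + 1)) →
        (c.1 = d.1 → d.2 = c.2 + 1) ∧ (c.2 = d.2 → d.1 = c.1 + 1) := by
      rintro ⟨_, _⟩ _ (rfl | rfl) <;> simp
    have := key _ _ hj
    exact ⟨fun e => this.1 (congrArg Fin.val e), fun e => this.2 (congrArg Fin.val e)⟩
  · refine List.ext_getElem (by simp [Shuffle.path, hlen]) fun i hi hi' => ?_
    simp only [Shuffle.path, List.getElem_map, List.getElem_range, Shuffle.fst, Shuffle.snd]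
    rw [clamp_of_le (show i ≤ q + p by lia)]
    rfl

theorem sum_shuffle {k : Type v} [Field k] (q p : ℕ) :
    ∑ s : Shuffle q p, s.sign • Finsupp.single s.path (1 : k) = ezList k q p 0 0 := by
  classical
  ext l
  rw [Finsupp.finsetSum_apply]
  by_cases h : ∃ ε, IsPath q p 0 0 l ε
  · obtain ⟨ε, h⟩ := h
    obtain ⟨s, rfl⟩ := h.exists_shuffle
    rw [ezList_apply s.isPath_path, Finset.sum_eq_single s]
    · simp
    · intro t _ ht
      rw [Finsupp.smul_apply, Finsupp.single_eq_of_ne, smul_zero]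
      exact fun h => ht (Shuffle.path_injective h).symm
    · exact fun h => absurd (Finset.mem_univ _) h
  · rw [ezList_apply_eq_zero h]
    refine Finset.sum_eq_zero fun s _ => ?_
    rw [Finsupp.smul_apply, Finsupp.single_eq_of_ne, smul_zero]
    rintro rfl
    exact h ⟨_, s.isPath_path⟩

end SerreSS

namespace SerreSS

open CategoryTheory Simplicial Opposite TensorProduct

theorem Shuffle.path_eq_ofFn {q p : ℕ} (s : Shuffle q p) :
    s.path = List.ofFn fun i : Fin (q + p + 1) => (s.fst i, s.snd i) :=
  List.ext_getElem (by simp [Shuffle.path]) fun i hi hi' => by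
    simp [Shuffle.path, -List.ofFn_succ]

namespace LiftSystem

variable {k : Type v} [Field k] {A X Y : SSet.{u}} {f : X ⟶ Y} (L : LiftSystem f) {p : ℕ}

theorem G_congr (V : Y _⦋p⦌) {q n : ℕ} {U U' : X _⦋q⦌} (h : InFiber f U V) (hU : U = U')
    (μ : ⦋n⦌ ⟶ ⦋q⦌) (σ : ⦋n⦌ ⟶ ⦋p⦌) : L.G V U h μ σ = L.G V U' (hU ▸ h) μ σ := by
  subst hU
  rfl

theorem inFiber_map {V : Y _⦋p⦌} {q n : ℕ} {U : X _⦋q⦌} (h : InFiber f U V) (θ : ⦋n⦌ ⟶ ⦋q⦌) :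
    InFiber f (X.map θ.op U) V := by
  unfold InFiber at h ⊢
  rw [app_map, h]
  change (Y.map _ ≫ Y.map _) V = _
  rw [← Y.map_comp, ← op_comp]
  rfl

/-- The map `A × Δ[p] ⟶ X` given by a lift system for a map `A ⟶ X` to the fiber over `V(∗)`. -/
def param (V : Y _⦋p⦌) (a : A ⟶ X)
    (ha : ∀ {n : ℕ} (U : A _⦋n⦌), InFiber f (a.app (op ⦋n⦌) U) V) : Param A X p where
  app U σ := L.G V (a.app _ U) (ha U) (𝟙 _) σ
  map_app θ U σ := by
    rw [L.map_G, L.G_congr V (ha _) (app_map a θ U), L.natural_G _ _ (ha U), Category.id_comp,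
      Category.comp_id]

variable {L} {V : Y _⦋p⦌} {a : A ⟶ X}
  {ha : ∀ {n : ℕ} (U : A _⦋n⦌), InFiber f (a.app (op ⦋n⦌) U) V}

theorem vertex_param : (L.param V a ha).vertex 0 = a := by
  ext n U
  refine (L.initial_G V (a.app _ U) (ha (n := n.unop.len) U) (𝟙 _)).trans ?_
  exact Param.map_id_apply (A := X) (q := n.unop.len) _

theorem param_app_map {n q : ℕ} (U : A _⦋q⦌) (μ : ⦋n⦌ ⟶ ⦋q⦌) (σ : ⦋n⦌ ⟶ ⦋p⦌) :
    (L.param V a ha).app (A.map μ.op U) σ = L.G V (a.app _ U) (ha U) μ σ := by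
  change L.G V (a.app _ (A.map μ.op U)) (ha _) (𝟙 _) σ = _
  rw [L.G_congr V (ha _) (app_map a μ U), L.natural_G _ _ (ha U), Category.id_comp]

theorem psi_eq_ez [Mono a] (hV : V ∈ Y.nonDegenerate p) (c : Chains k A) :
    psi k L (chainMap k a c ⊗ₜ simplex k V) = (L.param V a ha).ez k c := by
  refine chains_lhom_ext (f := psi k L ∘ₗ (TensorProduct.mk k _ _).flip (simplex k V) ∘ₗ chainMap k a)
    (g := (L.param V a ha).ez k) (fun q U => ?_) c
  have hU : a.app _ U.1 ∈ X.nonDegenerate q := (SSet.nonDegenerate_iff_of_mono a U.1).2 U.2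
  rw [LinearMap.comp_apply, LinearMap.comp_apply, chainMap_simplex, simplex_of_nonDegenerate ⟨_, hU⟩,
    simplex_of_nonDegenerate ⟨V, hV⟩, LinearMap.flip_apply, TensorProduct.mk_apply, psi,
    TensorProduct.lift.tmul, Finsupp.linearCombination_single, one_smul,
    Finsupp.linearCombination_single, one_smul, dif_pos (ha U.1), Param.ez_simplex, ← sum_shuffle,
    map_sum]
  refine Finset.sum_congr rfl fun s _ => ?_
  rw [map_zsmul, ChainFamily.ev_single, s.path_eq_ofFn]
  congr 1
  have := ((L.param V a ha).family U.1).evList_ofFn (k := k) (n := q + p)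
    ⟨fun i => (s.fst i, s.snd i), fun i j h => Prod.mk_le_mk.2 ⟨s.fst_mono h, s.snd_mono h⟩⟩
  refine Eq.trans ?_ this.symm
  congr 1
  refine (param_app_map (ha := ha) U.1 s.1.1 s.1.2).symm.trans ?_
  refine Param.app_congr _ U.1 (fun i => ?_) (fun i => ?_)
  · have e : clamp (q + p) (i : ℕ) = i := clamp_of_le i.is_le
    refine Eq.trans ?_ (clamp_of_le (Fin.is_le (s.1.1.toOrderHom (clamp (q + p) i)))).symm
    rw [e]
  · have e : clamp (q + p) (i : ℕ) = i := clamp_of_le i.is_le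
    refine Eq.trans ?_ (clamp_of_le (Fin.is_le (s.1.2.toOrderHom (clamp (q + p) i)))).symm
    rw [e]

end LiftSystem

end SerreSS

namespace SerreSS

open Topology

section Lifting

variable {E B : Type u} [TopologicalSpace E] [TopologicalSpace B] {π : C(E, B)}

/-- The simplex is a retract of the cube. -/
theorem exists_retraction_cube (n : ℕ) :
    ∃ (r : C(Fin (n + 1) → unitInterval, stdSimplex ℝ (Fin (n + 1))))
      (s : C(stdSimplex ℝ (Fin (n + 1)), Fin (n + 1) → unitInterval)), ∀ x, r (s x) = x := by
  have hm : ∀ y : Fin (n + 1) → unitInterval, 0 < max 1 (∑ i, (y i : ℝ)) := fun y =>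
    lt_of_lt_of_le one_pos (le_max_left _ _)
  have hc : Continuous fun y : Fin (n + 1) → unitInterval => ∑ i, (y i : ℝ) := by fun_prop
  refine ⟨⟨fun y => ⟨fun j => y j / max 1 (∑ i, (y i : ℝ)) +
    if j = 0 then 1 - (∑ i, (y i : ℝ)) / max 1 (∑ i, (y i : ℝ)) else 0, ⟨fun j => ?_, ?_⟩⟩, ?_⟩,
    ⟨fun x i => ⟨x i, x.2.1 i, stdSimplex.le_one x i⟩, ?_⟩, fun x => ?_⟩
  · refine add_nonneg (div_nonneg (y j).2.1 (hm y).le) ?_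
    split_ifs
    · exact sub_nonneg.2 ((div_le_one (hm y)).2 (le_max_right _ _))
    · exact le_rfl
  · rw [Finset.sum_add_distrib, Finset.sum_ite_eq' Finset.univ (0 : Fin (n + 1)),
      if_pos (Finset.mem_univ _), ← Finset.sum_div]
    ring
  · refine Continuous.subtype_mk (continuous_pi fun j => ?_) _
    refine ((continuous_subtype_val.comp (continuous_apply j)).div
      (continuous_const.max hc) fun y => (hm y).ne').add ?_
    split_ifs
    · exact continuous_const.sub (hc.div (continuous_const.max hc) fun y => (hm y).ne')
    · exact continuous_const
  · exact continuous_pi fun i => Continuous.subtype_mk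
      ((continuous_apply i).comp continuous_subtype_val) _
  · have h : ∑ i, x i = 1 := stdSimplex.sum_eq_one x
    refine stdSimplex.ext (funext fun j => ?_)
    change x j / max 1 (∑ i, x i) + (if j = 0 then 1 - (∑ i, x i) / max 1 (∑ i, x i) else 0) = x j
    rw [h]
    simp

theorem IsSerreFibration.exists_lift_stdSimplex (hπ : IsSerreFibration π) {n : ℕ}
    (g : C(stdSimplex ℝ (Fin (n + 1)), E)) (H : C(stdSimplex ℝ (Fin (n + 1)) × unitInterval, B))
    (h : ∀ x, H (x, 0) = π (g x)) :
    ∃ H' : C(stdSimplex ℝ (Fin (n + 1)) × unitInterval, E),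
      (∀ x, H' (x, 0) = g x) ∧ ∀ z, π (H' z) = H z := by
  obtain ⟨r, s, hrs⟩ := exists_retraction_cube n
  obtain ⟨H', h₀, h₁⟩ := hπ (n + 1) (g.comp r) (H.comp (r.prodMap (ContinuousMap.id _)))
    (fun y => h (r y))
  refine ⟨H'.comp (s.prodMap (ContinuousMap.id _)), fun x => ?_, fun z => ?_⟩
  · exact (h₀ (s x)).trans (congrArg g (hrs x))
  · refine (h₁ (s z.1, z.2)).trans ?_
    change H (r (s z.1), z.2) = H z
    rw [hrs]

/-- The smallest barycentric coordinate different from the `i`-th. -/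
noncomputable def minCoord {n : ℕ} (i : Fin (n + 2)) (x : stdSimplex ℝ (Fin (n + 2))) : ℝ :=
  (Finset.univ.erase i).inf' (Finset.univ_nontrivial.erase_nonempty) fun j => x j

theorem minCoord_le {n : ℕ} {i j : Fin (n + 2)} (h : j ≠ i) (x : stdSimplex ℝ (Fin (n + 2))) :
    minCoord i x ≤ x j :=
  Finset.inf'_le _ (Finset.mem_erase.2 ⟨h, Finset.mem_univ _⟩)

theorem minCoord_nonneg {n : ℕ} (i : Fin (n + 2)) (x : stdSimplex ℝ (Fin (n + 2))) :
    0 ≤ minCoord i x :=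
  Finset.le_inf' _ _ fun j _ => x.2.1 j

theorem exists_minCoord {n : ℕ} (i : Fin (n + 2)) (x : stdSimplex ℝ (Fin (n + 2))) :
    ∃ j ≠ i, minCoord i x = x j := by
  obtain ⟨j, hj, h⟩ := Finset.exists_mem_eq_inf' (Finset.univ_nontrivial.erase_nonempty (a := i))
    fun j => x j
  exact ⟨j, (Finset.mem_erase.1 hj).1, h⟩

theorem continuous_coord {n : ℕ} (j : Fin n) :
    Continuous fun x : stdSimplex ℝ (Fin n) => x j :=
  (continuous_apply j).comp continuous_subtype_val

theorem continuous_minCoord {n : ℕ} (i : Fin (n + 2)) : Continuous (minCoord i) :=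
  Continuous.finset_inf'_apply _ fun j _ => continuous_coord j

/-- The deformation of the simplex away from its `i`-th horn: the point `x`, moved towards the `i`-th
horn until the least coordinate is at most `t`. -/
noncomputable def hornPush {n : ℕ} (i : Fin (n + 2)) :
    C(stdSimplex ℝ (Fin (n + 2)) × unitInterval, stdSimplex ℝ (Fin (n + 2))) where
  toFun z := ⟨fun j => z.1 j - (minCoord i z.1 - min (z.2 : ℝ) (minCoord i z.1)) *
      (1 - if j = i then (n + 2 : ℝ) else 0), by
    have hc : 0 ≤ minCoord i z.1 - min (z.2 : ℝ) (minCoord i z.1) := sub_nonneg.2 (min_le_right _ _)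
    refine ⟨fun j => ?_, ?_⟩
    · have hj : 0 ≤ z.1 j := z.1.2.1 j
      dsimp only
      split_ifs with h
      · have hn : (0 : ℝ) ≤ n := Nat.cast_nonneg n
        have := mul_nonneg hc (by linarith : (0 : ℝ) ≤ (n + 2) - 1)
        linarith
      · have h₁ := minCoord_le h z.1
        have h₂ : (0 : ℝ) ≤ min (z.2 : ℝ) (minCoord i z.1) := le_min z.2.2.1 (minCoord_nonneg i z.1)
        linarith
    · have h := stdSimplex.sum_eq_one z.1
      rw [Finset.sum_sub_distrib, ← Finset.mul_sum, Finset.sum_sub_distrib,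
        Finset.sum_ite_eq' Finset.univ i, if_pos (Finset.mem_univ _), h]
      simp⟩
  continuous_toFun := by
    have hm : Continuous fun z : stdSimplex ℝ (Fin (n + 2)) × unitInterval => minCoord i z.1 :=
      (continuous_minCoord i).comp continuous_fst
    refine Continuous.subtype_mk (continuous_pi fun j => ?_) _
    exact ((continuous_coord j).comp continuous_fst).sub
      ((hm.sub ((continuous_subtype_val.comp continuous_snd).min hm)).mul continuous_const)

theorem hornPush_apply {n : ℕ} (i j : Fin (n + 2))
    (z : stdSimplex ℝ (Fin (n + 2)) × unitInterval) :
    hornPush i z j = z.1 j - (minCoord i z.1 - min (z.2 : ℝ) (minCoord i z.1)) *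
      (1 - if j = i then (n + 2 : ℝ) else 0) := rfl

theorem hornPush_of_le {n : ℕ} (i : Fin (n + 2)) {x : stdSimplex ℝ (Fin (n + 2))}
    {t : unitInterval} (h : minCoord i x ≤ t) : hornPush i (x, t) = x := by
  refine stdSimplex.ext (funext fun j => ?_)
  rw [hornPush_apply, min_eq_right h, sub_self, zero_mul, sub_zero]

theorem hornPush_zero {n : ℕ} {i j : Fin (n + 2)} (h : j ≠ i) {x : stdSimplex ℝ (Fin (n + 2))}
    (hx : minCoord i x = x j) : hornPush i (x, 0) j = 0 := by
  rw [hornPush_apply, if_neg h]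
  change x j - (minCoord i x - min 0 (minCoord i x)) * (1 - 0) = 0
  rw [min_eq_left (minCoord_nonneg i x), hx]
  ring

/-- A Serre fibration has the lifting property with respect to the inclusions of the horns. -/
theorem IsSerreFibration.exists_lift_horn (hπ : IsSerreFibration π) {n : ℕ} (i : Fin (n + 2))
    (K : C(stdSimplex ℝ (Fin (n + 2)), B)) (G : stdSimplex ℝ (Fin (n + 2)) → E)
    (hG : ∀ j ≠ i, ContinuousOn G {x | x j = 0})
    (hK : ∀ j ≠ i, ∀ x, x j = 0 → π (G x) = K x) :
    ∃ L : C(stdSimplex ℝ (Fin (n + 2)), E), (∀ x, π (L x) = K x) ∧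
      ∀ j ≠ i, ∀ x, x j = 0 → L x = G x := by
  have hp : Continuous fun x : stdSimplex ℝ (Fin (n + 2)) => hornPush i (x, 0) :=
    (hornPush i).continuous.comp (by fun_prop)
  have hg : Continuous fun x => G (hornPush i (x, 0)) := by
    refine LocallyFinite.continuous
      (f := fun j : {j // j ≠ i} => {x : stdSimplex ℝ (Fin (n + 2)) | minCoord i x = x j.1})
      (locallyFinite_of_finite _) (Set.eq_univ_of_forall fun x => ?_) (fun j => ?_) fun j => ?_
    · obtain ⟨j, hj, h⟩ := exists_minCoord i x
      exact Set.mem_iUnion.2 ⟨⟨j, hj⟩, h⟩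
    · exact isClosed_eq (continuous_minCoord i) (continuous_coord j.1)
    · exact (hG j.1 j.2).comp hp.continuousOn fun x hx => hornPush_zero j.2 hx
  obtain ⟨H', h₀, h₁⟩ := hπ.exists_lift_stdSimplex ⟨_, hg⟩ (K.comp (hornPush i)) (fun x => by
    obtain ⟨j, hj, h⟩ := exists_minCoord i x
    exact (hK j hj _ (hornPush_zero hj h)).symm)
  have hm : ∀ x, minCoord i x ∈ unitInterval := fun x => by
    obtain ⟨j, -, h⟩ := exists_minCoord i x
    exact ⟨minCoord_nonneg i x, h.trans_le (stdSimplex.le_one x j)⟩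
  refine ⟨H'.comp ⟨fun x => (x, ⟨minCoord i x, hm x⟩), ?_⟩, fun x => ?_, fun j hj x hx => ?_⟩
  · exact continuous_id.prodMk (Continuous.subtype_mk (continuous_minCoord i) _)
  · exact (h₁ _).trans (congrArg K (hornPush_of_le i le_rfl))
  · have h : minCoord i x = 0 :=
      le_antisymm ((minCoord_le hj x).trans hx.le) (minCoord_nonneg i x)
    have h' : (⟨minCoord i x, hm x⟩ : unitInterval) = 0 := Subtype.ext h
    change H' (x, ⟨minCoord i x, hm x⟩) = G x
    rw [h', h₀]
    exact congrArg G (hornPush_of_le i h.le)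

end Lifting

end SerreSS

namespace SerreSS

open CategoryTheory Opposite Simplicial

section Glue

theorem stdSimplex_map_apply {n m : ℕ} (f : Fin (n + 1) → Fin (m + 1))
    (x : stdSimplex ℝ (Fin (n + 1))) (j : Fin (m + 1)) :
    stdSimplex.map f x j = ∑ l with f l = j, x l :=
  FunOnFinite.linearMap_apply_apply _ _ _ _ _

theorem stdSimplex_map_eq_zero {n m : ℕ} {f : Fin (n + 1) → Fin (m + 1)} {j : Fin (m + 1)}
    (hj : ∀ l, f l ≠ j) (x : stdSimplex ℝ (Fin (n + 1))) : stdSimplex.map f x j = 0 := by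
  rw [stdSimplex_map_apply, Finset.sum_eq_zero]
  exact fun l hl => absurd (Finset.mem_filter.1 hl).2 (hj l)

theorem stdSimplex_map_ne_zero {n m : ℕ} (f : Fin (n + 1) → Fin (m + 1))
    {x : stdSimplex ℝ (Fin (n + 1))} {l : Fin (n + 1)} (h : x l ≠ 0) :
    stdSimplex.map f x (f l) ≠ 0 := by
  rw [stdSimplex_map_apply]
  exact (lt_of_lt_of_le (lt_of_le_of_ne (x.2.1 l) (Ne.symm h)) (Finset.single_le_sum
    (f := fun l => x l) (fun l _ => x.2.1 l)
    (show l ∈ Finset.univ.filter fun a => f a = f l from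
      Finset.mem_filter.2 ⟨Finset.mem_univ l, rfl⟩))).ne'

theorem stdSimplex_map_eq_self {n : ℕ} {f : Fin (n + 1) → Fin (n + 1)}
    {x : stdSimplex ℝ (Fin (n + 1))} (h : ∀ l, x l ≠ 0 → f l = l) : stdSimplex.map f x = x := by
  refine stdSimplex.ext (funext fun j => ?_)
  rw [stdSimplex_map_apply, Finset.sum_filter, Finset.sum_eq_single j]
  · split_ifs with hj
    · rfl
    · by_contra h'
      exact hj (h j (Ne.symm h'))
  · intro l _ hl
    split_ifs with hj
    · by_contra h'
      exact hl ((h l h').symm.trans hj)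
    · rfl
  · exact fun h => absurd (Finset.mem_univ _) h

theorem exists_monotone_retraction {n : ℕ} {S : Finset (Fin (n + 1))} (hS : S.Nonempty) :
    ∃ r : ⦋n⦌ ⟶ ⦋n⦌, (∀ j, r.toOrderHom j ∈ S) ∧ ∀ j ∈ S, r.toOrderHom j = j := by
  have hne : ∀ j, (S.filter (· ≤ max j (S.min' hS))).Nonempty := fun j =>
    ⟨S.min' hS, Finset.mem_filter.2 ⟨S.min'_mem hS, le_max_right _ _⟩⟩
  refine ⟨SimplexCategory.Hom.mk ⟨fun j => (S.filter (· ≤ max j (S.min' hS))).max' (hne j),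
    fun j l h => Finset.max'_subset _ fun s hs => ?_⟩, fun j => ?_, fun j hj => ?_⟩
  · obtain ⟨hs, hs'⟩ := Finset.mem_filter.1 hs
    exact Finset.mem_filter.2 ⟨hs, hs'.trans (max_le_max_right _ h)⟩
  · exact (Finset.mem_filter.1 (Finset.max'_mem _ (hne j))).1
  · refine le_antisymm (Finset.max'_le _ (hne j) _ fun s hs => ?_) (Finset.le_max' _ _ ?_)
    · exact (Finset.mem_filter.1 hs).2.trans_eq (max_eq_left (S.min'_le j hj))
    · exact Finset.mem_filter.2 ⟨hj, le_max_left _ _⟩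

/-- The simplices of a simplex which lie in the `i`-th horn. -/
def InHorn {n m : ℕ} (i : Fin (n + 2)) (s : ⦋m⦌ ⟶ ⦋n + 1⦌) : Prop :=
  ∃ j ≠ i, ∀ l, s.toOrderHom l ≠ j

theorem InHorn.comp {n m l : ℕ} {i : Fin (n + 2)} {s : ⦋m⦌ ⟶ ⦋n + 1⦌} (h : InHorn i s)
    (θ : ⦋l⦌ ⟶ ⦋m⦌) : InHorn i (θ ≫ s) := by
  obtain ⟨j, hj, h⟩ := h
  exact ⟨j, hj, fun l => h _⟩

theorem exists_support {n : ℕ} (x : stdSimplex ℝ (Fin (n + 1))) :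
    (Finset.univ.filter fun j => x j ≠ 0).Nonempty := by
  by_contra h
  have h' : ∀ j, x j = 0 := fun j => by
    by_contra hj
    exact h ⟨j, Finset.mem_filter.2 ⟨Finset.mem_univ j, hj⟩⟩
  have := stdSimplex.sum_eq_one x
  simp [h'] at this

/-- A compatible family of maps on the simplices in a horn comes from a map which is continuous on each
face of the horn. -/
theorem exists_glue {E : Type u} [TopologicalSpace E] {n : ℕ} (i : Fin (n + 2))
    (h : ∀ {m : ℕ} (s : ⦋m⦌ ⟶ ⦋n + 1⦌), InHorn i s → C(stdSimplex ℝ (Fin (m + 1)), E))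
    (hh : ∀ {m l : ℕ} (s : ⦋m⦌ ⟶ ⦋n + 1⦌) (hs : InHorn i s) (θ : ⦋l⦌ ⟶ ⦋m⦌) y,
      h (θ ≫ s) (hs.comp θ) y = h s hs (stdSimplex.map θ.toOrderHom y)) :
    ∃ G : stdSimplex ℝ (Fin (n + 2)) → E,
      (∀ {m : ℕ} (s : ⦋m⦌ ⟶ ⦋n + 1⦌) (hs : InHorn i s) y,
        h s hs y = G (stdSimplex.map s.toOrderHom y)) ∧
      ∀ j ≠ i, ContinuousOn G {x | x j = 0} := by
  classical
  choose r hr hr' using fun S : {S : Finset (Fin (n + 2)) // S.Nonempty} =>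
    exists_monotone_retraction S.2
  have hS : ∀ S j, j ≠ i → j ∉ S.1 → InHorn i (r S) := fun S j hj hjS =>
    ⟨j, hj, fun l hl => hjS (hl ▸ hr S l)⟩
  let S₀ : {S : Finset (Fin (n + 2)) // S.Nonempty} := ⟨{i}, Finset.singleton_nonempty i⟩
  have h₀ : InHorn i (r S₀) := by
    obtain ⟨j, hj⟩ := exists_ne i
    exact hS S₀ j hj (by simpa [S₀] using hj)
  let G : stdSimplex ℝ (Fin (n + 2)) → E := fun x =>
    if hx : InHorn i (r ⟨_, exists_support x⟩) then h _ hx x else h _ h₀ x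
  have hG : ∀ {m : ℕ} (s : ⦋m⦌ ⟶ ⦋n + 1⦌) (hs : InHorn i s) y,
      h s hs y = G (stdSimplex.map s.toOrderHom y) := by
    intro m s hs y
    set x : stdSimplex ℝ (Fin (n + 2)) := stdSimplex.map s.toOrderHom y with hx
    obtain ⟨j, hj, hsj⟩ := hs
    have hx' : InHorn i (r ⟨_, exists_support x⟩) := hS _ j hj fun h =>
      (Finset.mem_filter.1 h).2 (stdSimplex_map_eq_zero hsj y)
    obtain ⟨ρ, hρ, hρ'⟩ := exists_monotone_retraction (exists_support y)
    have hy : stdSimplex.map ρ.toOrderHom y = y := stdSimplex_map_eq_self fun l hl =>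
      hρ' l (Finset.mem_filter.2 ⟨Finset.mem_univ l, hl⟩)
    have e : ρ ≫ s ≫ r ⟨_, exists_support x⟩ = ρ ≫ s := by
      refine SimplexCategory.Hom.ext _ _ (OrderHom.ext _ _ (funext fun l => ?_))
      exact hr' ⟨_, exists_support x⟩ (s.toOrderHom (ρ.toOrderHom l)) (Finset.mem_filter.2
        ⟨Finset.mem_univ _, stdSimplex_map_ne_zero _ (Finset.mem_filter.1 (hρ l)).2⟩)
    have e₁ : ∀ (θ θ' : ⦋m⦌ ⟶ ⦋n + 1⦌) (hθ : InHorn i θ) (hθ' : InHorn i θ'), θ = θ' →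
        h θ hθ y = h θ' hθ' y := by
      rintro θ _ hθ hθ' rfl
      rfl
    have hs : InHorn i s := ⟨j, hj, hsj⟩
    calc h s hs y = h s hs (stdSimplex.map ρ.toOrderHom y) := by rw [hy]
      _ = h (ρ ≫ s) (hs.comp ρ) y := (hh s hs ρ y).symm
      _ = h (ρ ≫ s ≫ r ⟨_, exists_support x⟩) ((hx'.comp s).comp ρ) y := e₁ _ _ _ _ e.symm
      _ = h (s ≫ r ⟨_, exists_support x⟩) (hx'.comp s) y := by rw [hh, hy]
      _ = h _ hx' x := hh _ hx' s y
      _ = G x := by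
        simp only [G]
        rw [dif_pos hx']
  refine ⟨G, hG, fun j hj => ?_⟩
  have hne : ({j}ᶜ : Finset (Fin (n + 2))).Nonempty := by
    obtain ⟨l, hl⟩ := exists_ne j
    exact ⟨l, by simpa using hl⟩
  have hj' : InHorn i (r ⟨_, hne⟩) := hS _ j hj (by simp)
  refine (h _ hj').continuous.continuousOn.congr fun x (hx : x j = 0) => ?_
  rw [hG _ hj', stdSimplex_map_eq_self fun l hl => hr' ⟨_, hne⟩ l ?_]
  simp only [Finset.mem_compl, Finset.mem_singleton]
  rintro rfl
  exact hl hx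

end Glue

section Fibration

open HomotopicalAlgebra SSet.modelCategoryQuillen

variable {E B : Type u} [TopologicalSpace E] [TopologicalSpace B] {π : C(E, B)}

theorem inHorn_iff {n m : ℕ} (i : Fin (n + 2)) (s : ⦋m⦌ ⟶ ⦋n + 1⦌) :
    InHorn i s ↔ (SSet.stdSimplex.objEquiv.{u}.symm s) ∈ (SSet.horn.{u} (n + 1) i).obj (op ⦋m⦌) := by
  rw [SSet.mem_horn_iff_notMem_range]
  constructor
  · rintro ⟨j, hj, h⟩
    refine ⟨j, hj, ?_⟩
    rintro ⟨l, hl⟩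
    exact h l hl
  · rintro ⟨j, hj, h⟩
    exact ⟨j, hj, fun l hl => h ⟨l, hl⟩⟩

theorem IsSerreFibration.hasLiftingProperty (hπ : IsSerreFibration π) {n : ℕ} (i : Fin (n + 2)) :
    HasLiftingProperty (SSet.horn.{u} (n + 1) i).ι (singMap π) := by
  refine ⟨fun {t b} sq => ?_⟩
  obtain ⟨G, hG, hGc⟩ := exists_glue i (fun {m} s hs =>
      TopCat.toSSetObjEquiv (TopCat.of E) (op ⦋m⦌)
        (t.app (op ⦋m⦌) ⟨SSet.stdSimplex.objEquiv.symm s, (inHorn_iff i s).1 hs⟩))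
    (fun {m l} s hs θ y => by
      have := ConcreteCategory.congr_hom (t.naturality θ.op)
        ⟨SSet.stdSimplex.objEquiv.symm s, (inHorn_iff i s).1 hs⟩
      exact congrArg (fun z => TopCat.toSSetObjEquiv (TopCat.of E) (op ⦋l⦌) z y) this)
  let K : C(stdSimplex ℝ (Fin (n + 2)), B) :=
    TopCat.toSSetObjEquiv (TopCat.of B) (op ⦋n + 1⦌) (SSet.yonedaEquiv b)
  have hb : ∀ {m : ℕ} (s : ⦋m⦌ ⟶ ⦋n + 1⦌), b.app (op ⦋m⦌) (SSet.stdSimplex.objEquiv.symm s) =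
      (Sing B).map s.op (SSet.yonedaEquiv b) := fun s => by
    conv_lhs => rw [← SSet.yonedaEquiv.symm_apply_apply b]
    rfl
  have hK : ∀ {m : ℕ} (s : ⦋m⦌ ⟶ ⦋n + 1⦌) (hs : InHorn i s) y,
      π (G (stdSimplex.map s.toOrderHom y)) = K (stdSimplex.map s.toOrderHom y) := by
    intro m s hs y
    rw [← hG s hs y]
    have := ConcreteCategory.congr_hom (NatTrans.congr_app sq.w (op ⦋m⦌))
      ⟨SSet.stdSimplex.objEquiv.symm s, (inHorn_iff i s).1 hs⟩
    exact congrArg (fun z => TopCat.toSSetObjEquiv (TopCat.of B) (op ⦋m⦌) z y) (this.trans (hb s))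
  obtain ⟨L, hL, hL'⟩ := hπ.exists_lift_horn i K G hGc fun j hj x hx => by
    obtain ⟨r, hr, hr'⟩ := exists_monotone_retraction (S := ({j}ᶜ : Finset (Fin (n + 2)))) (by
      obtain ⟨l, hl⟩ := exists_ne j
      exact ⟨l, by simpa using hl⟩)
    have := hK r ⟨j, hj, fun l hl => by simpa [hl] using hr l⟩ x
    rwa [stdSimplex_map_eq_self fun l hl => hr' l (by
      simp only [Finset.mem_compl, Finset.mem_singleton]
      rintro rfl
      exact hl hx)] at this
  refine ⟨⟨⟨SSet.yonedaEquiv.symm ((TopCat.toSSetObjEquiv (TopCat.of E) (op ⦋n + 1⦌)).symm L),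
    ?_, ?_⟩⟩⟩
  · ext m ⟨s, hs⟩
    induction m using Opposite.rec with | op m
    induction m using SimplexCategory.rec with | _ m
    obtain ⟨s, rfl⟩ := SSet.stdSimplex.objEquiv.symm.surjective s
    obtain ⟨j, hj, hs'⟩ := (inHorn_iff i s).2 hs
    refine (TopCat.toSSetObjEquiv (TopCat.of E) (op ⦋m⦌)).injective (ContinuousMap.ext fun y => ?_)
    refine (hL' j hj _ (stdSimplex_map_eq_zero hs' y)).trans ?_
    exact (hG s ⟨j, hj, hs'⟩ y).symm
  · refine SSet.yonedaEquiv.injective ?_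
    refine (TopCat.toSSetObjEquiv (TopCat.of B) (op ⦋n + 1⦌)).injective
      (ContinuousMap.ext fun y => ?_)
    rw [SSet.yonedaEquiv_symm_comp, Equiv.apply_symm_apply]
    exact hL y

theorem IsSerreFibration.fibration (hπ : IsSerreFibration π) : Fibration (singMap π) := by
  rw [SSet.modelCategoryQuillen.fibration_iff]
  intro _ _ _ h
  simp only [J, MorphismProperty.iSup_iff] at h
  obtain ⟨n, ⟨i⟩⟩ := h
  exact hπ.hasLiftingProperty i

end Fibration

end SerreSS

namespace SerreSS

open CategoryTheory Opposite Simplicial MonoidalCategory HomotopicalAlgebra SSet.modelCategoryQuillen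

namespace Param

variable {A X Y : SSet.{u}} {p : ℕ}

/-- The contraction of `Δ[p]` to its initial vertex. -/
def contract {n p : ℕ} (σ : ⦋n⦌ ⟶ ⦋p⦌) (τ : ⦋n⦌ ⟶ ⦋1⦌) : ⦋n⦌ ⟶ ⦋p⦌ :=
  SimplexCategory.Hom.mk ⟨fun l => if τ.toOrderHom l = 0 then 0 else σ.toOrderHom l, fun l m h => by
    dsimp only
    by_cases h₁ : τ.toOrderHom l = 0
    · rw [if_pos h₁]
      exact Fin.zero_le _
    · rw [if_neg h₁, if_neg fun h₂ =>
        h₁ (le_antisymm ((τ.toOrderHom.monotone h).trans h₂.le) (Fin.zero_le _))]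
      exact σ.toOrderHom.monotone h⟩

theorem contract_of_eq_zero {n p : ℕ} (σ : ⦋n⦌ ⟶ ⦋p⦌) (τ : ⦋n⦌ ⟶ ⦋1⦌)
    (h : (∀ l, τ.toOrderHom l = 0) ∨ ∀ l, σ.toOrderHom l = 0) :
    contract σ τ = SimplexCategory.const ⦋n⦌ ⦋p⦌ 0 := by
  refine SimplexCategory.Hom.ext _ _ (OrderHom.ext _ _ (funext fun l => ?_))
  change (if τ.toOrderHom l = 0 then 0 else σ.toOrderHom l) = 0
  split_ifs with hτ
  · rfl
  · exact h.elim (fun h => absurd (h l) hτ) fun h => h l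

theorem contract_one {n p : ℕ} (σ : ⦋n⦌ ⟶ ⦋p⦌) :
    contract σ (SimplexCategory.const ⦋n⦌ ⦋1⦌ 1) = σ := by
  refine SimplexCategory.Hom.ext _ _ (OrderHom.ext _ _ (funext fun l => ?_))
  change (if (1 : Fin 2) = 0 then (0 : Fin (p + 1)) else _) = _
  exact if_neg (by decide)

/-- Lifting along a fibration, starting with a lift on `A × {0}`. -/
theorem exists_lift {f : X ⟶ Y} [hf : Fibration f] (a : A ⟶ X) (P : Param A Y p)
    (h : a ≫ f = P.vertex 0) : ∃ H : Param A X p, H.map f = P ∧ H.vertex 0 = a := by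
  let S : (Δ[p] : SSet.{u}).Subcomplex := SSet.stdSimplex.face {0}
  let T : (Δ[1] : SSet.{u}).Subcomplex := SSet.horn (0 + 1) 0
  have hS : ∀ {n : ℕ} (σ : ⦋n⦌ ⟶ ⦋p⦌), SSet.stdSimplex.objEquiv.{u}.symm σ ∈ S.obj (op ⦋n⦌) ↔
      ∀ l, σ.toOrderHom l = 0 := fun σ => by
    rw [SSet.stdSimplex.mem_face_iff]
    exact forall_congr' fun l => Finset.mem_singleton
  have hT : ∀ {n : ℕ} (τ : ⦋n⦌ ⟶ ⦋1⦌), SSet.stdSimplex.objEquiv.{u}.symm τ ∈ T.obj (op ⦋n⦌) →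
      ∀ l, τ.toOrderHom l = 0 := fun {n} τ hτ l => by
    obtain ⟨j, hj, hτ⟩ := (inHorn_iff (n := 0) 0 τ).2 hτ
    have hτl := hτ l
    have hj' : j = 1 := by
      change Fin 2 at j
      revert hj
      fin_cases j <;> simp
    subst hj'
    generalize τ.toOrderHom l = b at hτl
    change Fin 2 at b
    fin_cases b
    · rfl
    · exact absurd rfl hτl
  have hanod : SSet.anodyneExtensions (S.unionProd T).ι :=
    SSet.anodyneExtensions_unionProd_ι S T (SSet.anodyneExtensions.horn_ι (n := 0 + 1) 0)
  have hl : HasLiftingProperty (A ◁ (S.unionProd T).ι) f :=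
    (hanod.whiskerLeft A) f (by rwa [← HomotopicalAlgebra.fibration_iff])
  let top : A ⊗ (S.unionProd T : SSet.{u}) ⟶ X := SemiCartesianMonoidalCategory.fst _ _ ≫ a
  let bot : A ⊗ (Δ[p] ⊗ Δ[1]) ⟶ Y :=
    { app n := TypeCat.ofHom fun z => P.app (n := n.unop.len) z.1
        (contract (SSet.stdSimplex.objEquiv z.2.1) (SSet.stdSimplex.objEquiv z.2.2))
      naturality n m θ := by
        ext z
        exact (P.map_app (n := n.unop.len) (m := m.unop.len) θ.unop z.1
          (contract (SSet.stdSimplex.objEquiv z.2.1) (SSet.stdSimplex.objEquiv z.2.2))).symm }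
  have sq : CommSq top (A ◁ (S.unionProd T).ι) f bot := ⟨by
    ext n ⟨U, ⟨⟨σ, τ⟩, hστ⟩⟩
    induction n using Opposite.rec with | op n
    induction n using SimplexCategory.rec with | _ n
    obtain ⟨σ, rfl⟩ := SSet.stdSimplex.objEquiv.symm.surjective σ
    obtain ⟨τ, rfl⟩ := SSet.stdSimplex.objEquiv.symm.surjective τ
    have h₀ := (SSet.Subcomplex.mem_unionProd_iff S T _).1 hστ
    refine (ConcreteCategory.congr_hom (NatTrans.congr_app h (op ⦋n⦌)) U).trans ?_
    change P.app U _ = P.app U (contract σ τ)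
    rw [contract_of_eq_zero σ τ (h₀.imp (hT τ) (hS σ).1)]⟩
  refine ⟨⟨fun {n} U σ => sq.lift.app (op ⦋n⦌) (U, (SSet.stdSimplex.objEquiv.symm σ,
    SSet.stdSimplex.objEquiv.symm (SimplexCategory.const ⦋n⦌ ⦋1⦌ 1))), fun {n m} θ U σ => ?_⟩, ?_, ?_⟩
  · exact (ConcreteCategory.congr_hom (sq.lift.naturality θ.op) _).symm
  · refine Param.ext (funext fun n => funext fun U => funext fun σ => ?_)
    refine (ConcreteCategory.congr_hom (NatTrans.congr_app sq.fac_right (op ⦋n⦌)) _).trans ?_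
    change P.app U (contract σ (SimplexCategory.const ⦋n⦌ ⦋1⦌ 1)) = _
    rw [contract_one]
  · ext n U
    induction n using Opposite.rec with | op n
    induction n using SimplexCategory.rec with | _ n
    let z : (Δ[p] ⊗ Δ[1] : SSet.{u}).obj (op ⦋n⦌) :=
      (SSet.stdSimplex.objEquiv.symm (SimplexCategory.const ⦋n⦌ ⦋p⦌ 0),
        SSet.stdSimplex.objEquiv.symm (SimplexCategory.const ⦋n⦌ ⦋1⦌ 1))
    let z' : (A ⊗ (S.unionProd T : SSet.{u})).obj (op ⦋n⦌) :=
      (U, ⟨z, (SSet.Subcomplex.mem_unionProd_iff S T z).2 (Or.inr ((hS _).2 fun _ => rfl))⟩)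
    exact ConcreteCategory.congr_hom (NatTrans.congr_app sq.fac_left (op ⦋n⦌)) z'

end Param

/-- The fiber over the initial vertex `V(∗)`. -/
def fiberSubcomplex {X Y : SSet.{u}} (f : X ⟶ Y) {p : ℕ} (V : Y _⦋p⦌) : X.Subcomplex where
  obj n := Set.ofPred fun U : X.obj n => InFiber f (q := n.unop.len) U V
  map {n m} θ _ h := LiftSystem.inFiber_map (q := n.unop.len) (n := m.unop.len) h θ.unop

theorem nonempty_liftSystem {X Y : SSet.{u}} (f : X ⟶ Y) [Fibration f] :
    Nonempty (LiftSystem f) := by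
  have h : ∀ {p : ℕ} (V : Y _⦋p⦌), ∃ H : Param (fiberSubcomplex f V : SSet.{u}) X p,
      (∀ {n : ℕ} (U : (fiberSubcomplex f V : SSet.{u}) _⦋n⦌) (σ : ⦋n⦌ ⟶ ⦋p⦌),
        f.app (op ⦋n⦌) (H.app U σ) = Y.map σ.op V) ∧
      ∀ {n : ℕ} (U : (fiberSubcomplex f V : SSet.{u}) _⦋n⦌),
        H.app U (SimplexCategory.const ⦋n⦌ ⦋p⦌ 0) = U.1 := fun {p} V => by
    obtain ⟨H, h₁, h₂⟩ := Param.exists_lift (f := f) (fiberSubcomplex f V).ι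
      (⟨fun _ σ => Y.map σ.op V, fun θ _ σ => by
        rw [op_comp, Y.map_comp]
        rfl⟩ : Param _ Y p) (by
          ext n ⟨U, hU⟩
          exact hU)
    refine ⟨H, fun {n} U σ => ?_, fun {n} U => ?_⟩
    · exact congrArg (fun P : Param (fiberSubcomplex f V : SSet.{u}) Y p => P.app U σ) h₁
    · exact ConcreteCategory.congr_hom (NatTrans.congr_app h₂ (op ⦋n⦌)) U
  choose H h₁ h₂ using @h
  refine ⟨⟨fun V U hU μ σ => (H V).app ⟨X.map μ.op U, LiftSystem.inFiber_map hU μ⟩ σ,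
    fun V U hU μ σ θ => ?_, fun V U hU μ σ => h₁ V _ σ, fun V U hU μ => h₂ V _,
    fun V U hU θ hU' μ σ => ?_⟩⟩
  · refine ((H V).map_app θ _ σ).trans (congrArg (fun z => (H V).app z (θ ≫ σ)) (Subtype.ext ?_))
    change (X.map _ ≫ X.map _) U = _
    rw [← X.map_comp, ← op_comp]
  · refine congrArg (fun z => (H V).app z σ) (Subtype.ext ?_)
    change (X.map _ ≫ X.map _) U = _
    rw [← X.map_comp, ← op_comp]

end SerreSS

namespace SerreSS

open CategoryTheory Opposite Simplicial TensorProduct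

section HomologyMap

variable (k : Type v) [Field k] {X Y Z : SSet.{u}}

/-- The map on homology induced by a simplicial map. -/
noncomputable def homologyMap (f : X ⟶ Y) :
    (chainDG k X).Homology →ₗ[k] (chainDG k Y).Homology :=
  Submodule.mapQ _ _
    ((chainMap k f).restrict (p := LinearMap.ker (chainDG k X).d) (q := LinearMap.ker (chainDG k Y).d)
      fun x (hx : boundary k X x = 0) => by
        change boundary k Y (chainMap k f x) = 0
        rw [boundary_chainMap, hx, map_zero])
    (by
      rintro ⟨x, hx⟩ ⟨y, hy⟩
      change boundary k X y = x at hy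
      refine ⟨chainMap k f y, ?_⟩
      change boundary k Y (chainMap k f y) = chainMap k f x
      rw [boundary_chainMap, hy])

variable {k}

theorem chainMap_mem_ker (f : X ⟶ Y) {x : Chains k X} (hx : x ∈ LinearMap.ker (chainDG k X).d) :
    chainMap k f x ∈ LinearMap.ker (chainDG k Y).d := by
  change boundary k Y (chainMap k f x) = 0
  rw [boundary_chainMap, show boundary k X x = 0 from hx, map_zero]

theorem homologyMap_cls (f : X ⟶ Y) (x : LinearMap.ker (chainDG k X).d) :
    homologyMap k f ((chainDG k X).cls x) =
      (chainDG k Y).cls ⟨chainMap k f x.1, chainMap_mem_ker f x.2⟩ := rfl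

theorem homologyMap_comp (f : X ⟶ Y) (g : Y ⟶ Z) (x : (chainDG k X).Homology) :
    homologyMap k (f ≫ g) x = homologyMap k g (homologyMap k f x) := by
  obtain ⟨x, rfl⟩ := (chainDG k X).cls_surjective x
  rw [homologyMap_cls, homologyMap_cls, homologyMap_cls]
  congr 1
  exact Subtype.ext (chainMap_comp f g x.1)

theorem homologyMap_id (x : (chainDG k X).Homology) : homologyMap k (𝟙 X) x = x := by
  obtain ⟨x, rfl⟩ := (chainDG k X).cls_surjective x
  rw [homologyMap_cls]
  congr 1
  exact Subtype.ext (chainMap_id x.1)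

/-- The boundary formula for a homotopy. -/
theorem Param.boundary_ez_one {A : SSet.{u}} (H : Param A X 1) (x : Chains k A) :
    boundary k X (H.ez k (chainSgn k A x)) = -H.ez k (chainSgn k A (boundary k A x)) +
      (chainMap k (H.vertex 1) x - chainMap k (H.vertex 0) x) := by
  have h₀ : (H.face 0).vertex 0 = H.vertex 1 := by
    ext n U
    change H.app (n := n.unop.len) U _ = H.app (n := n.unop.len) U _
    congr 1
  have h₁ : (H.face 1).vertex 0 = H.vertex 0 := by
    ext n U
    change H.app (n := n.unop.len) U _ = H.app (n := n.unop.len) U _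
    congr 1
  rw [H.boundary_ez, boundary_chainSgn, map_neg, chainSgn_chainSgn, Fin.sum_univ_two, ez_zero, ez_zero,
    h₀, h₁, Fin.val_zero, Fin.val_one, pow_zero, pow_one, one_smul, neg_one_smul, sub_eq_add_neg]

theorem Param.homologyMap_vertex_one {A : SSet.{u}} (H : Param A X 1) :
    homologyMap k (H.vertex 1) = homologyMap k (H.vertex 0) := by
  refine LinearMap.ext fun x => ?_
  obtain ⟨x, rfl⟩ := (chainDG k A).cls_surjective x
  rw [homologyMap_cls, homologyMap_cls, DG.cls_eq_iff]
  refine ⟨H.ez k (chainSgn k A x.1), ?_⟩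
  refine (H.boundary_ez_one x.1).trans ?_
  rw [show boundary k A x.1 = 0 from x.2, map_zero, map_zero, neg_zero, zero_add]

theorem Param.homologyMap_vertex {A : SSet.{u}} {p : ℕ} (H : Param A X p) (a : Fin (p + 1)) :
    homologyMap k (H.vertex a) = homologyMap k (H.vertex 0) := by
  let η : ⦋1⦌ ⟶ ⦋p⦌ := SimplexCategory.mkHom ⟨fun i => if i = 0 then 0 else a, fun i j h => by
    change Fin 2 at i j
    fin_cases i <;> fin_cases j <;> simp at h ⊢⟩
  have h := (H.restrict η).homologyMap_vertex_one (k := k)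
  have h₁ : (H.restrict η).vertex 1 = H.vertex a := by
    ext n U
    change H.app (n := n.unop.len) U _ = H.app (n := n.unop.len) U _
    congr 1
  have h₀ : (H.restrict η).vertex 0 = H.vertex 0 := by
    ext n U
    change H.app (n := n.unop.len) U _ = H.app (n := n.unop.len) U _
    congr 1
  rwa [h₁, h₀] at h

theorem toHomology_chainMap (f : X ⟶ Y) (z : Chains k X) (hz : boundary k X z = 0) :
    (chainDG k Y).toHomology (chainMap k f z) = homologyMap k f ((chainDG k X).toHomology z) := by
  have h := (chainDG k X).toHomology_cycle ⟨z, hz⟩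
  have h' := (chainDG k Y).toHomology_cycle ⟨chainMap k f z, chainMap_mem_ker f hz⟩
  rw [h', h, homologyMap_cls]

end HomologyMap

end SerreSS

namespace SerreSS

open CategoryTheory Opposite Simplicial TensorProduct HomotopicalAlgebra SSet.modelCategoryQuillen

section CoalgebraMap

variable {k : Type v} [Field k] {M : Type w} [AddCommGroup M] [Module k M]
  {N : Type w'} [AddCommGroup N] [Module k N]

/-- The cycles of a tensor product are generated by products of cycles and boundaries. -/
theorem DG.eq_zero_of_tensor_cycle (A : DG k M) (A' : DG k N) {P : Type*} [AddCommGroup P] [Module k P]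
    (T : M ⊗[k] N →ₗ[k] P) (hd : ∀ w, T ((A.tensor A').d w) = 0)
    (h : ∀ x ∈ LinearMap.ker A.d, ∀ y ∈ LinearMap.ker A'.d, T (x ⊗ₜ y) = 0)
    {w : M ⊗[k] N} (hw : w ∈ LinearMap.ker (A.tensor A').d) : T w = 0 := by
  obtain ⟨z, hz⟩ := (A.homologyCross_bijective A').2 ((A.tensor A').cls ⟨w, hw⟩)
  suffices H : ∀ z (w : LinearMap.ker (A.tensor A').d), A.homologyCross A' z = (A.tensor A').cls w →
      T w.1 = 0 from H z ⟨w, hw⟩ hz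
  clear! z w
  intro z
  induction z with
  | zero =>
    intro w hw
    rw [map_zero, eq_comm, DG.cls_eq_zero_iff] at hw
    obtain ⟨y, hy⟩ := hw
    rw [← hy, hd]
  | tmul x y =>
    intro w hw
    obtain ⟨x, rfl⟩ := A.cls_surjective x
    obtain ⟨y, rfl⟩ := A'.cls_surjective y
    rw [DG.homologyCross_cls, DG.cls_eq_iff] at hw
    obtain ⟨z, hz⟩ := hw
    have e : w.1 = x.1 ⊗ₜ y.1 - (A.tensor A').d z := by
      rw [hz]
      exact (sub_sub_cancel _ _).symm
    rw [e, map_sub, hd, h x.1 x.2 y.1 y.2, sub_zero]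
  | add z z' hz hz' =>
    intro w hw
    obtain ⟨u, hu⟩ := (A.tensor A').cls_surjective (A.homologyCross A' z)
    have e : A.homologyCross A' z' = (A.tensor A').cls (w - u) := by
      rw [map_sub, hu, ← hw, map_add, add_sub_cancel_left]
    have h₁ := hz' _ e
    rw [← sub_add_cancel w u, Submodule.coe_add, map_add, h₁, hz u hu.symm, zero_add]

variable {X Y : SSet.{u}}

theorem tensor_d_map_chainMap (f : X ⟶ Y) (w : Chains k X ⊗[k] Chains k X) :
    ((chainDG k Y).tensor (chainDG k Y)).d (TensorProduct.map (chainMap k f) (chainMap k f) w) =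
      TensorProduct.map (chainMap k f) (chainMap k f) (((chainDG k X).tensor (chainDG k X)).d w) := by
  induction w with
  | zero => simp only [map_zero]
  | add x y hx hy => rw [map_add, map_add, map_add, map_add, hx, hy]
  | tmul x y =>
    rw [TensorProduct.map_tmul, DG.tensor_d_tmul, DG.tensor_d_tmul, map_add, TensorProduct.map_tmul,
      TensorProduct.map_tmul]
    change boundary k Y _ ⊗ₜ _ + chainSgn k Y _ ⊗ₜ boundary k Y _ = chainMap k f (boundary k X x) ⊗ₜ _ +
      chainMap k f (chainSgn k X x) ⊗ₜ chainMap k f (boundary k X y)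
    rw [boundary_chainMap, boundary_chainMap, chainSgn_chainMap]

/-- A simplicial map induces a map of coalgebras on homology. -/
theorem toHomology_chainComult_chainMap (f : X ⟶ Y) {z : Chains k X} (hz : boundary k X z = 0) :
    TensorProduct.map (chainDG k Y).toHomology (chainDG k Y).toHomology
        (chainComult k Y (chainMap k f z)) =
      TensorProduct.map (homologyMap k f) (homologyMap k f)
        (TensorProduct.map (chainDG k X).toHomology (chainDG k X).toHomology (chainComult k X z)) := by
  rw [chainComult_chainMap]
  refine sub_eq_zero.1 ((chainDG k X).eq_zero_of_tensor_cycle (chainDG k X)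
    (TensorProduct.map (chainDG k Y).toHomology (chainDG k Y).toHomology ∘ₗ
        TensorProduct.map (chainMap k f) (chainMap k f) -
      TensorProduct.map (homologyMap k f) (homologyMap k f) ∘ₗ
        TensorProduct.map (chainDG k X).toHomology (chainDG k X).toHomology)
    (fun w => ?_) (fun x hx y hy => ?_) (w := chainComult k X z) ?_)
  · rw [LinearMap.sub_apply, LinearMap.comp_apply, LinearMap.comp_apply, ← tensor_d_map_chainMap,
      DG.toHomology_tensor_d, DG.toHomology_tensor_d, map_zero, sub_zero]
  · rw [LinearMap.sub_apply, LinearMap.comp_apply, LinearMap.comp_apply, TensorProduct.map_tmul,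
      TensorProduct.map_tmul, TensorProduct.map_tmul, TensorProduct.map_tmul,
      toHomology_chainMap f x hx, toHomology_chainMap f y hy, sub_self]
  · rw [LinearMap.mem_ker, tensor_d_chainComult, hz, map_zero]

end CoalgebraMap

section SingularSimplices

variable {X Z : Type u} [TopologicalSpace X] [TopologicalSpace Z]

/-- The continuous map underlying a singular simplex. -/
noncomputable def singEv {n : ℕ} (U : (Sing X) _⦋n⦌) : C(stdSimplex ℝ (Fin (n + 1)), X) :=
  TopCat.toSSetObjEquiv (TopCat.of X) (op ⦋n⦌) U

/-- The singular simplex given by a continuous map. -/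
noncomputable def singMk {n : ℕ} (g : C(stdSimplex ℝ (Fin (n + 1)), X)) : (Sing X) _⦋n⦌ :=
  (TopCat.toSSetObjEquiv (TopCat.of X) (op ⦋n⦌)).symm g

theorem singEv_mk {n : ℕ} (g : C(stdSimplex ℝ (Fin (n + 1)), X)) : singEv (singMk g) = g :=
  Equiv.apply_symm_apply _ _

theorem sing_ext {n : ℕ} {U U' : (Sing X) _⦋n⦌} (h : ∀ y, singEv U y = singEv U' y) : U = U' :=
  (TopCat.toSSetObjEquiv (TopCat.of X) (op ⦋n⦌)).injective (ContinuousMap.ext h)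

theorem singEv_map {n m : ℕ} (θ : ⦋m⦌ ⟶ ⦋n⦌) (U : (Sing X) _⦋n⦌) (y : stdSimplex ℝ (Fin (m + 1))) :
    singEv ((Sing X).map θ.op U) y = singEv U (stdSimplex.map θ.toOrderHom y) := rfl

theorem singMap_comp {W : Type u} [TopologicalSpace W] (g : C(X, Z)) (h : C(Z, W)) :
    singMap (h.comp g) = singMap g ≫ singMap h := by
  rw [← Functor.map_comp]
  rfl

theorem singMap_id : singMap (ContinuousMap.id X) = 𝟙 (Sing X) :=
  TopCat.toSSet.map_id (TopCat.of X)

theorem sing_hom_ext {A : SSet.{u}} {f g : A ⟶ Sing X}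
    (h : ∀ {n : ℕ} (U : A _⦋n⦌) y, singEv (f.app (op ⦋n⦌) U) y = singEv (g.app (op ⦋n⦌) U) y) :
    f = g := by
  ext n U
  exact sing_ext (n := n.unop.len) (h (n := n.unop.len) U)

theorem stdSimplex_map_const {n p : ℕ} (a : Fin (p + 1)) (y : stdSimplex ℝ (Fin (n + 1))) :
    stdSimplex.map (SimplexCategory.const ⦋n⦌ ⦋p⦌ a).toOrderHom y = stdSimplex.vertex a := by
  refine stdSimplex.ext (funext fun j => ?_)
  rw [stdSimplex_map_apply]
  have h : ∑ l, y l = 1 := stdSimplex.sum_eq_one y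
  by_cases hj : j = a
  · subst hj
    refine (congrArg (fun s => ∑ l ∈ s, y l) (Finset.filter_true_of_mem fun l _ => rfl)).trans
      (h.trans ?_)
    exact (Pi.single_eq_same (M := fun _ => ℝ) j 1).symm
  · rw [Finset.filter_false_of_mem fun l _ h => hj h.symm, Finset.sum_empty]
    exact (Pi.single_eq_of_ne (M := fun _ => ℝ) hj 1).symm

/-- The map `Sing X × Δ[p] ⟶ Sing Z` given by a homotopy. -/
noncomputable def topParam {p : ℕ} (K : C(X × stdSimplex ℝ (Fin (p + 1)), Z)) :
    Param (Sing X) (Sing Z) p where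
  app {n} U σ := singMk (K.comp ((singEv U).prodMk ⟨_, stdSimplex.continuous_map σ.toOrderHom⟩))
  map_app {n m} θ U σ := sing_ext fun y => by
    rw [singEv_map, singEv_mk, singEv_mk]
    change K (singEv U _, stdSimplex.map _ (stdSimplex.map _ y)) = K (singEv U _, stdSimplex.map _ y)
    rw [stdSimplex.map_comp_apply]
    rfl

end SingularSimplices

end SerreSS

namespace SerreSS

open CategoryTheory Opposite Simplicial TensorProduct HomotopicalAlgebra SSet.modelCategoryQuillen

section Contraction

/-- `P` contracts to `x`, relatively to `x`. -/
def ContractsTo (P : Type*) [TopologicalSpace P] (x : P) : Prop :=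
  ∃ h : C(P × stdSimplex ℝ (Fin 2), P), (∀ y, h (y, stdSimplex.vertex 0) = y) ∧
    (∀ y, h (y, stdSimplex.vertex 1) = x) ∧ ∀ t, h (x, t) = x

theorem ContractsTo.of_convex {W : Type*} [AddCommGroup W] [Module ℝ W] [TopologicalSpace W]
    [ContinuousAdd W] [ContinuousSMul ℝ W] {s : Set W} (hs : Convex ℝ s) (x : s) :
    ContractsTo s x := by
  refine ⟨⟨fun z => ⟨z.2 0 • z.1.1 + z.2 1 • x.1, hs z.1.2 x.2 (z.2.2.1 0) (z.2.2.1 1)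
    (stdSimplex.add_eq_one z.2)⟩, ?_⟩, fun y => Subtype.ext ?_, fun y => Subtype.ext ?_,
    fun t => Subtype.ext ?_⟩
  · have h : ∀ i, Continuous fun z : s × stdSimplex ℝ (Fin 2) => z.2 i := fun i =>
      (continuous_coord i).comp continuous_snd
    exact Continuous.subtype_mk (((h 0).smul (continuous_subtype_val.comp continuous_fst)).add
      ((h 1).smul continuous_const)) _
  · change (Pi.single 0 1 : Fin 2 → ℝ) 0 • y.1 + (Pi.single 0 1 : Fin 2 → ℝ) 1 • x.1 = y.1
    simp
  · change (Pi.single 1 1 : Fin 2 → ℝ) 0 • y.1 + (Pi.single 1 1 : Fin 2 → ℝ) 1 • x.1 = x.1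
    simp
  · change t 0 • x.1 + t 1 • x.1 = x.1
    rw [← add_smul, stdSimplex.add_eq_one, one_smul]

theorem ContractsTo.prod {P Q : Type*} [TopologicalSpace P] [TopologicalSpace Q] {x : P} {y : Q}
    (hP : ContractsTo P x) (hQ : ContractsTo Q y) : ContractsTo (P × Q) (x, y) := by
  obtain ⟨h, h₀, h₁, h₂⟩ := hP
  obtain ⟨h', h₀', h₁', h₂'⟩ := hQ
  exact ⟨⟨fun z => (h (z.1.1, z.2), h' (z.1.2, z.2)), by fun_prop⟩,
    fun z => Prod.ext (h₀ _) (h₀' _), fun z => Prod.ext (h₁ _) (h₁' _),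
    fun t => Prod.ext (h₂ t) (h₂' t)⟩

theorem contractsTo_unitInterval (x : unitInterval) : ContractsTo unitInterval x :=
  .of_convex (convex_Icc 0 1) x

theorem contractsTo_stdSimplex {n : ℕ} (x : stdSimplex ℝ (Fin n)) :
    ContractsTo (stdSimplex ℝ (Fin n)) x :=
  .of_convex (convex_stdSimplex ℝ _) x

end Contraction

section Pullback

variable {E B : Type u} [TopologicalSpace E] [TopologicalSpace B] (π : C(E, B))
  {P Q : Type} [TopologicalSpace P] [TopologicalSpace Q]

/-- The pullback of `π` along a map. -/
abbrev Pullback (S : C(P, B)) : Type u := Subtype fun x : P × E => π x.2 = S x.1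

variable {π} in
/-- The inclusion of a fiber in a pullback. -/
def pullbackIncl {S : C(P, B)} (x : P) {b : B} (h : S x = b) : C(Fiber π b, Pullback π S) :=
  ⟨fun e => ⟨(x, e.1), by rw [e.2, h]⟩, by fun_prop⟩

/-- The map of pullbacks induced by a map. -/
def pullbackMap {S : C(P, B)} {S' : C(Q, B)} (g : C(Q, P)) (h : ∀ q, S (g q) = S' q) :
    C(Pullback π S', Pullback π S) :=
  ⟨fun z => ⟨(g z.1.1, z.1.2), by rw [z.2, h]⟩, by fun_prop⟩

theorem pullbackMap_incl {S : C(P, B)} {S' : C(Q, B)} (g : C(Q, P)) (h : ∀ q, S (g q) = S' q) (q : Q)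
    {b : B} (hq : S' q = b) : (pullbackMap π g h).comp (pullbackIncl q hq) =
      pullbackIncl (g q) ((h q).trans hq) := rfl

/-- The map from a pullback to the total space. -/
def pullbackSnd (S : C(P, B)) : C(Pullback π S, E) := ⟨fun z => z.1.2, by fun_prop⟩

variable {π}

/-- The map to a fiber given by a simplicial map to the total space. -/
noncomputable def liftFiber {A : SSet.{u}} (a : A ⟶ Sing E) {b : B}
    (h : ∀ {n : ℕ} (U : A _⦋n⦌) y, π (singEv (a.app (op ⦋n⦌) U) y) = b) : A ⟶ Sing (Fiber π b) where
  app n := TypeCat.ofHom fun U => singMk (n := n.unop.len)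
    ⟨fun y => ⟨singEv (n := n.unop.len) (a.app n U) y, h (n := n.unop.len) U y⟩, by fun_prop⟩
  naturality n m θ := by
    ext U
    refine sing_ext (n := m.unop.len) fun y => Subtype.ext ?_
    exact congrArg (fun W => singEv (n := m.unop.len) W y)
      (ConcreteCategory.congr_hom (a.naturality θ) U)

/-- The map to a fiber given by a simplicial map `A × Δ[p] ⟶ Sing E`. -/
noncomputable def Param.liftFiber {A : SSet.{u}} {p : ℕ} (H : Param A (Sing E) p) {b : B}
    (h : ∀ {n : ℕ} (U : A _⦋n⦌) (σ : ⦋n⦌ ⟶ ⦋p⦌) y, π (singEv (H.app U σ) y) = b) :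
    Param A (Sing (Fiber π b)) p where
  app {n} U σ := singMk ⟨fun y => ⟨singEv (H.app U σ) y, h U σ y⟩, by fun_prop⟩
  map_app {n m} θ U σ := sing_ext fun y => Subtype.ext
    (congrArg (fun W => singEv W y) (H.map_app θ U σ))

/-- The map to a pullback given by a map to the total space and a map to `P`. -/
noncomputable def Param.liftPullback {A : SSet.{u}} {p : ℕ} (H : Param A (Sing E) p) {S : C(P, B)}
    (g : ∀ {n : ℕ}, A _⦋n⦌ → (⦋n⦌ ⟶ ⦋p⦌) → C(stdSimplex ℝ (Fin (n + 1)), P))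
    (hg : ∀ {n m : ℕ} (θ : ⦋m⦌ ⟶ ⦋n⦌) (U : A _⦋n⦌) (σ : ⦋n⦌ ⟶ ⦋p⦌) y,
      g U σ (stdSimplex.map θ.toOrderHom y) = g (A.map θ.op U) (θ ≫ σ) y)
    (h : ∀ {n : ℕ} (U : A _⦋n⦌) (σ : ⦋n⦌ ⟶ ⦋p⦌) y, π (singEv (H.app U σ) y) = S (g U σ y)) :
    Param A (Sing (Pullback π S)) p where
  app {n} U σ := singMk ⟨fun y => ⟨(g U σ y, singEv (H.app U σ) y), h U σ y⟩, by fun_prop⟩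
  map_app {n m} θ U σ := sing_ext fun y => Subtype.ext (Prod.ext (hg θ U σ y)
    (congrArg (fun W => singEv W y) (H.map_app θ U σ)))

variable (k : Type v) [Field k]

/-- The inclusion of the fiber in the pullback to a contractible space is a homology isomorphism. -/
theorem bijective_pullbackIncl (hπ : IsSerreFibration π) {x : P} (hP : ContractsTo P x) {S : C(P, B)}
    {b : B} (h : S x = b) :
    Function.Bijective (homologyMap k (singMap (pullbackIncl (π := π) x h))) := by
  have := hπ.fibration
  obtain ⟨c, c₀, c₁, c₂⟩ := hP
  let K : C(Pullback π S × stdSimplex ℝ (Fin 2), B) := ⟨fun z => S (c (z.1.1.1, z.2)), by fun_prop⟩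
  obtain ⟨H, hH, hH₀⟩ := Param.exists_lift (f := singMap π) (singMap (pullbackSnd π S))
    (topParam K) (sing_hom_ext fun {n} U y => by
      refine (singEv U y).2.trans ?_
      change _ = S (c ((singEv U y).1.1, stdSimplex.map _ y))
      rw [stdSimplex_map_const, c₀])
  have hH : ∀ {n : ℕ} (U : (Sing (Pullback π S)) _⦋n⦌) (σ : ⦋n⦌ ⟶ ⦋1⦌) y,
      π (singEv (H.app U σ) y) = S (c ((singEv U y).1.1, stdSimplex.map σ.toOrderHom y)) :=
    fun {n} U σ y => congrArg (fun G : Param _ (Sing B) 1 => singEv (G.app U σ) y) hH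
  have hH₀ : ∀ {n : ℕ} (U : (Sing (Pullback π S)) _⦋n⦌) y,
      singEv (H.app U (SimplexCategory.const ⦋n⦌ ⦋1⦌ 0)) y = (singEv U y).1.2 := fun {n} U y =>
    congrArg (fun f : Sing (Pullback π S) ⟶ Sing E => singEv (f.app (op ⦋n⦌) U) y) hH₀
  let H' : Param (Sing (Pullback π S)) (Sing (Pullback π S)) 1 := H.liftPullback
    (fun U σ => ⟨fun y => c ((singEv U y).1.1, stdSimplex.map σ.toOrderHom y), by
      have := stdSimplex.continuous_map (S := ℝ) σ.toOrderHom
      fun_prop⟩)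
    (fun θ U σ y => by
      change c ((singEv U _).1.1, stdSimplex.map _ (stdSimplex.map _ y)) =
        c ((singEv U _).1.1, stdSimplex.map _ y)
      rw [stdSimplex.map_comp_apply]
      rfl) hH
  let r : Sing (Pullback π S) ⟶ Sing (Fiber π b) := liftFiber (H.vertex 1) fun {n} U y => by
    refine (hH U _ y).trans ?_
    rw [stdSimplex_map_const, c₁, h]
  have hr : r ≫ singMap (pullbackIncl x h) = H'.vertex 1 := sing_hom_ext fun {n} U y => by
    refine Subtype.ext (Prod.ext ?_ rfl)
    change x = c ((singEv U y).1.1, stdSimplex.map _ y)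
    rw [stdSimplex_map_const, c₁]
  have hr₀ : H'.vertex 0 = 𝟙 _ := sing_hom_ext fun {n} U y => by
    refine Subtype.ext (Prod.ext ?_ (hH₀ U y))
    change c ((singEv U y).1.1, stdSimplex.map _ y) = (singEv U y).1.1
    rw [stdSimplex_map_const, c₀]
  let H'' : Param (Sing (Fiber π b)) (Sing (Fiber π b)) 1 := Param.liftFiber
    (⟨fun {n} U σ => H.app ((singMap (pullbackIncl x h)).app (op ⦋n⦌) U) σ, fun θ U σ => H.map_app _ _ _⟩ :
      Param (Sing (Fiber π b)) (Sing E) 1) fun {n} U σ y => by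
        refine (hH _ σ y).trans ?_
        change S (c (x, _)) = b
        rw [c₂, h]
  have hj : singMap (pullbackIncl x h) ≫ r = H''.vertex 1 := rfl
  have hj₀ : H''.vertex 0 = 𝟙 _ := sing_hom_ext fun {n} U y => Subtype.ext (hH₀ _ y)
  constructor
  · refine Function.LeftInverse.injective (g := homologyMap k r) fun z => ?_
    rw [← homologyMap_comp, hj, Param.homologyMap_vertex_one, hj₀, homologyMap_id]
  · refine Function.RightInverse.surjective (g := homologyMap k r) fun z => ?_
    rw [← homologyMap_comp, hr, Param.homologyMap_vertex_one, hr₀, homologyMap_id]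

end Pullback

end SerreSS

namespace SerreSS

open CategoryTheory Opposite Simplicial TensorProduct

section Transport

variable {k : Type v} [Field k] {E B : Type u} [TopologicalSpace E] [TopologicalSpace B] {π : C(E, B)}
  (hπ : IsSerreFibration π) {P Q : Type} [TopologicalSpace P] [TopologicalSpace Q]

theorem homologyMap_pullbackMap {S : C(P, B)} {S' : C(Q, B)} (g : C(Q, P)) (h : ∀ q, S (g q) = S' q)
    (q : Q) {b : B} (hq : S' q = b) (z : FiberHomology k π b) :
    homologyMap k (singMap (pullbackMap π g h)) (homologyMap k (singMap (pullbackIncl q hq)) z) =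
      homologyMap k (singMap (pullbackIncl (g q) ((h q).trans hq))) z := by
  rw [← homologyMap_comp, ← singMap_comp, pullbackMap_incl]

include hπ

theorem homologyMap_incl_of_const {S : C(P, B)} (δ : C(unitInterval, P)) {b : B}
    (hδ : ∀ t, S (δ t) = b) (z : FiberHomology k π b) :
    homologyMap k (singMap (pullbackIncl (δ 0) (hδ 0))) z =
      homologyMap k (singMap (pullbackIncl (δ 1) (hδ 1))) z := by
  obtain ⟨S', hS'⟩ : ∃ S' : C(unitInterval, B), ∀ t, S' t = b := ⟨ContinuousMap.const _ b, fun _ => rfl⟩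
  have e : homologyMap k (singMap (pullbackIncl (π := π) 0 (hS' 0))) z =
      homologyMap k (singMap (pullbackIncl (π := π) 1 (hS' 1))) z := by
    obtain ⟨z', hz'⟩ := (bijective_pullbackIncl k hπ (contractsTo_unitInterval 0) (hS' 0)).2
      (homologyMap k (singMap (pullbackIncl (π := π) 1 (hS' 1))) z)
    let p : C(Pullback π S', Fiber π b) := ⟨fun z => ⟨z.1.2, z.2.trans (hS' _)⟩, by fun_prop⟩
    have hp : ∀ t (y : FiberHomology k π b), homologyMap k (singMap p)
        (homologyMap k (singMap (pullbackIncl t (hS' t))) y) = y := fun t y => by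
      rw [← homologyMap_comp, ← singMap_comp]
      exact (congrArg (fun f => homologyMap k f y) singMap_id).trans (homologyMap_id y)
    have := congrArg (homologyMap k (singMap p)) hz'
    rw [hp, hp] at this
    rw [← hz', this]
  have := congrArg (homologyMap k (singMap (pullbackMap π (S := S) (S' := S') δ
    fun t => (hδ t).trans (hS' t).symm))) e
  rwa [homologyMap_pullbackMap, homologyMap_pullbackMap] at this

theorem transport_of_pullback {S : C(P, B)} {x : P} (hP : ContractsTo P x) (δ : C(unitInterval, P))
    (hδ : δ 0 = x) {b b' : B} (γ : Path b b') (hγ : ∀ t, S (δ t) = γ t) {z : FiberHomology k π b}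
    {z' : FiberHomology k π b'}
    (h : homologyMap k (singMap (pullbackIncl (δ 0) ((hγ 0).trans γ.source))) z =
      homologyMap k (singMap (pullbackIncl (δ 1) ((hγ 1).trans γ.target))) z') :
    homologyMap k (singMap (sourceIncl π γ)) z = homologyMap k (singMap (targetIncl π γ)) z' := by
  let S' : C(unitInterval, B) := γ
  subst hδ
  have h₀ := bijective_pullbackIncl k hπ (contractsTo_unitInterval 0) (S := S') γ.source
  have h₁ := bijective_pullbackIncl k hπ hP (S := S) ((hγ 0).trans γ.source)
  have hinj : Function.Injective (homologyMap k (singMap (pullbackMap π (S := S) (S' := S') δ hγ))) := by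
    intro u v huv
    obtain ⟨u, rfl⟩ := h₀.2 u
    obtain ⟨v, rfl⟩ := h₀.2 v
    rw [homologyMap_pullbackMap, homologyMap_pullbackMap] at huv
    rw [h₁.1 huv]
  refine hinj ?_
  refine ((homologyMap_pullbackMap δ hγ 0 γ.source z).trans h).trans ?_
  exact (homologyMap_pullbackMap (S' := S') δ hγ 1 γ.target z').symm

theorem transport_of_homotopic {b b' : B} {γ γ' : Path b b'} (F : γ.Homotopy γ')
    {z : FiberHomology k π b} {z' : FiberHomology k π b'}
    (h : homologyMap k (singMap (sourceIncl π γ)) z = homologyMap k (singMap (targetIncl π γ)) z') :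
    homologyMap k (singMap (sourceIncl π γ')) z = homologyMap k (singMap (targetIncl π γ')) z' := by
  let S : C(unitInterval × unitInterval, B) := F.toContinuousMap
  let e₀ : C(unitInterval, unitInterval × unitInterval) := ⟨fun t => (0, t), by fun_prop⟩
  let e₁ : C(unitInterval, unitInterval × unitInterval) := ⟨fun t => (1, t), by fun_prop⟩
  let f₀ : C(unitInterval, unitInterval × unitInterval) := ⟨fun t => (t, 0), by fun_prop⟩
  let f₁ : C(unitInterval, unitInterval × unitInterval) := ⟨fun t => (t, 1), by fun_prop⟩
  refine transport_of_pullback hπ (S := S)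
    ((contractsTo_unitInterval 1).prod (contractsTo_unitInterval 0)) e₁ rfl γ'
    (fun t => F.apply_one t) ?_
  have h₀ := homologyMap_incl_of_const hπ (S := S) f₀ (b := b) (fun t => F.source t) z
  have h₁ := homologyMap_incl_of_const hπ (S := S) f₁ (b := b') (fun t => F.target t) z'
  refine h₀.symm.trans (Eq.trans ?_ h₁)
  have := congrArg (homologyMap k (singMap (pullbackMap π (S := S) (S' := (γ : C(unitInterval, B)))
    e₀ fun t => F.apply_zero t))) h
  exact (homologyMap_pullbackMap (S' := (γ : C(unitInterval, B))) e₀ (fun t => F.apply_zero t) 0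
    γ.source z).symm.trans (this.trans (homologyMap_pullbackMap (S' := (γ : C(unitInterval, B))) e₀
      (fun t => F.apply_zero t) 1 γ.target z'))

omit hπ in
theorem transport_trans {b b' b'' : B} {γ : Path b b'} {γ' : Path b' b''}
    {z : FiberHomology k π b} {z' : FiberHomology k π b'} {z'' : FiberHomology k π b''}
    (h : homologyMap k (singMap (sourceIncl π γ)) z = homologyMap k (singMap (targetIncl π γ)) z')
    (h' : homologyMap k (singMap (sourceIncl π γ')) z' =
      homologyMap k (singMap (targetIncl π γ')) z'') :
    homologyMap k (singMap (sourceIncl π (γ.trans γ'))) z =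
      homologyMap k (singMap (targetIncl π (γ.trans γ'))) z'' := by
  let S : C(unitInterval, B) := γ.trans γ'
  let g : C(unitInterval, unitInterval) := ⟨fun t => ⟨t / 2, by
    constructor <;> linarith [t.2.1, t.2.2]⟩, by fun_prop⟩
  let g' : C(unitInterval, unitInterval) := ⟨fun t => ⟨(1 + t) / 2, by
    constructor <;> linarith [t.2.1, t.2.2]⟩, by fun_prop⟩
  have hg : ∀ t, S (g t) = γ t := fun t => by
    refine (Path.trans_apply γ γ' (g t)).trans ?_
    have ht : ((g t : unitInterval) : ℝ) = t / 2 := rfl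
    rw [dif_pos (by rw [ht]; linarith [t.2.2])]
    congr 1
    exact Subtype.ext (by change 2 * ((t : ℝ) / 2) = t; ring)
  have hg' : ∀ t, S (g' t) = γ' t := fun t => by
    refine (Path.trans_apply γ γ' (g' t)).trans ?_
    have ht : ((g' t : unitInterval) : ℝ) = (1 + t) / 2 := rfl
    split_ifs with hle
    · have h0 : t = 0 := Subtype.ext (le_antisymm (by
        rw [ht] at hle
        change (t : ℝ) ≤ 0
        linarith) t.2.1)
      subst h0
      rw [γ'.source]
      refine (congrArg γ (Subtype.ext ?_)).trans γ.target
      change 2 * ((1 + (0 : ℝ)) / 2) = 1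
      norm_num
    · congr 1
      exact Subtype.ext (by change 2 * ((1 + (t : ℝ)) / 2) - 1 = t; ring)
  have h₁ := congrArg (homologyMap k (singMap (pullbackMap π (S := S)
    (S' := (γ : C(unitInterval, B))) g hg))) h
  have h₂ := congrArg (homologyMap k (singMap (pullbackMap π (S := S)
    (S' := (γ' : C(unitInterval, B))) g' hg'))) h'
  have h₁ := (homologyMap_pullbackMap (S' := (γ : C(unitInterval, B))) g hg 0 γ.source
    z).symm.trans (h₁.trans (homologyMap_pullbackMap (S' := (γ : C(unitInterval, B))) g hg 1
      γ.target z'))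
  have h₂ := (homologyMap_pullbackMap (S' := (γ' : C(unitInterval, B))) g' hg' 0 γ'.source
    z').symm.trans (h₂.trans (homologyMap_pullbackMap (S' := (γ' : C(unitInterval, B))) g' hg' 1
      γ'.target z''))
  have e₀ : g 0 = 0 := Subtype.ext (by change (0 : ℝ) / 2 = 0; norm_num)
  have e₁ : g' 1 = 1 := Subtype.ext (by change (1 + (1 : ℝ)) / 2 = 1; norm_num)
  have e₂ : g 1 = g' 0 := Subtype.ext (by change (1 : ℝ) / 2 = (1 + 0) / 2; norm_num)
  have aux : ∀ {x y : unitInterval} {b : B} (h : x = y) (hx : S x = b) (hy : S y = b)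
      (z : FiberHomology k π b), homologyMap k (singMap (pullbackIncl x hx)) z =
        homologyMap k (singMap (pullbackIncl y hy)) z := by
    rintro x _ b rfl hx hy z
    rfl
  exact (aux e₀.symm (γ.trans γ').source _ z).trans (h₁.trans ((aux e₂ _ _ z').trans (h₂.trans (aux e₁ _ (γ.trans γ').target z''))))

omit hπ in
theorem isTransport_iff {b b' : B} (γ : Path b b')
    (c : LinearMap.ker (chainDG k (Sing (Fiber π b))).d)
    (c' : LinearMap.ker (chainDG k (Sing (Fiber π b'))).d) :
    IsTransport k π γ c.1 c'.1 ↔ homologyMap k (singMap (sourceIncl π γ)) ((chainDG k _).cls c) =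
      homologyMap k (singMap (targetIncl π γ)) ((chainDG k _).cls c') := by
  rw [homologyMap_cls, homologyMap_cls, DG.cls_eq_iff]
  rfl

variable [SimplyConnectedSpace B] (b₀ : B)

variable (k) in
/-- The transport isomorphism. -/
noncomputable def transport (b : B) : FiberHomology k π b ≃ₗ[k] FiberHomology k π b₀ :=
  (LinearEquiv.ofBijective _ (bijective_pullbackIncl k hπ (contractsTo_unitInterval 0)
      (S := (PathConnectedSpace.somePath b b₀ : C(unitInterval, B))) (Path.source _))).trans
    (LinearEquiv.ofBijective _ (bijective_pullbackIncl k hπ (contractsTo_unitInterval 1)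
      (S := (PathConnectedSpace.somePath b b₀ : C(unitInterval, B))) (Path.target _))).symm

theorem transport_somePath {b : B} (z : FiberHomology k π b) :
    homologyMap k (singMap (sourceIncl π (PathConnectedSpace.somePath b b₀))) z =
      homologyMap k (singMap (targetIncl π (PathConnectedSpace.somePath b b₀)))
        (transport k hπ b₀ b z) :=
  ((LinearEquiv.ofBijective _ (bijective_pullbackIncl k hπ (contractsTo_unitInterval 1)
    (S := (PathConnectedSpace.somePath b b₀ : C(unitInterval, B))) (Path.target _))).apply_symm_apply
      _).symm

theorem transport_eq_iff {b : B} (γ : Path b b₀) {z : FiberHomology k π b}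
    {z' : FiberHomology k π b₀} :
    homologyMap k (singMap (sourceIncl π γ)) z = homologyMap k (singMap (targetIncl π γ)) z' ↔
      transport k hπ b₀ b z = z' := by
  constructor
  · intro h
    obtain ⟨F⟩ := SimplyConnectedSpace.paths_homotopic γ (PathConnectedSpace.somePath b b₀)
    have h := transport_of_homotopic hπ F h
    rw [transport_somePath hπ] at h
    exact (bijective_pullbackIncl k hπ (contractsTo_unitInterval 1)
      (S := (PathConnectedSpace.somePath b b₀ : C(unitInterval, B))) (Path.target _)).1 h
  · rintro rfl
    obtain ⟨F⟩ := SimplyConnectedSpace.paths_homotopic (PathConnectedSpace.somePath b b₀) γ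
    exact transport_of_homotopic hπ F (transport_somePath hπ b₀ z)

/-- Transport along the vertices of a simplex. -/
theorem transport_vertex {A : SSet.{u}} {p : ℕ} (H : Param A (Sing E) p) (V : (Sing B) _⦋p⦌)
    (hH : ∀ {n : ℕ} (U : A _⦋n⦌) (σ : ⦋n⦌ ⟶ ⦋p⦌),
      (singMap π).app (op ⦋n⦌) (H.app U σ) = (Sing B).map σ.op V) (a : Fin (p + 1)) {b b' : B}
    (h₀ : ∀ {n : ℕ} (U : A _⦋n⦌) y, π (singEv ((H.vertex 0).app (op ⦋n⦌) U) y) = b)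
    (h₁ : ∀ {n : ℕ} (U : A _⦋n⦌) y, π (singEv ((H.vertex a).app (op ⦋n⦌) U) y) = b')
    (hb : singEv V (stdSimplex.vertex 0) = b) (hb' : singEv V (stdSimplex.vertex a) = b')
    (z : (chainDG k A).Homology) :
    transport k hπ b₀ b' (homologyMap k (liftFiber (H.vertex a) h₁) z) =
      transport k hπ b₀ b (homologyMap k (liftFiber (H.vertex 0) h₀) z) := by
  let S : C(stdSimplex ℝ (Fin (p + 1)), B) := singEv V
  have hc : ∀ {n : ℕ} (σ : ⦋n⦌ ⟶ ⦋p⦌), Continuous (stdSimplex.map (S := ℝ) σ.toOrderHom) :=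
    fun σ => stdSimplex.continuous_map _
  let H' : Param A (Sing (Pullback π S)) p := H.liftPullback
    (fun U σ => ⟨fun y => stdSimplex.map σ.toOrderHom y, hc σ⟩)
    (fun θ U σ y => by
      change stdSimplex.map _ (stdSimplex.map _ y) = stdSimplex.map _ y
      rw [stdSimplex.map_comp_apply]
      rfl)
    (fun U σ y => congrArg (fun W => singEv W y) (hH U σ))
  have e : ∀ (a : Fin (p + 1)) {b : B}
      (h : ∀ {n : ℕ} (U : A _⦋n⦌) y, π (singEv ((H.vertex a).app (op ⦋n⦌) U) y) = b)
      (hb : S (stdSimplex.vertex a) = b), H'.vertex a =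
        liftFiber (H.vertex a) h ≫ singMap (pullbackIncl (stdSimplex.vertex a) hb) := by
    intro a b h hb
    refine sing_hom_ext fun {n} U y => Subtype.ext (Prod.ext ?_ rfl)
    exact stdSimplex_map_const a y
  have hz := LinearMap.congr_fun (H'.homologyMap_vertex (k := k) a) z
  rw [e a h₁ hb', e 0 h₀ hb, homologyMap_comp, homologyMap_comp] at hz
  let δ : C(unitInterval, stdSimplex ℝ (Fin (p + 1))) :=
    ⟨fun t => ⟨(1 - (t : ℝ)) • (stdSimplex.vertex (S := ℝ) (0 : Fin (p + 1))).1 +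
      (t : ℝ) • (stdSimplex.vertex (S := ℝ) a).1, convex_stdSimplex ℝ _ (Subtype.prop _)
        (Subtype.prop _) (by linarith [t.2.2]) t.2.1 (by ring)⟩, by fun_prop⟩
  have hδ₀ : δ 0 = stdSimplex.vertex 0 := Subtype.ext (by
    change (1 - (0 : ℝ)) • _ + (0 : ℝ) • _ = _
    rw [sub_zero, one_smul, zero_smul, add_zero])
  have hδ₁ : δ 1 = stdSimplex.vertex a := Subtype.ext (by
    change (1 - (1 : ℝ)) • _ + (1 : ℝ) • _ = _
    rw [sub_self, one_smul, zero_smul, zero_add])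
  let γ : Path b b' := ⟨S.comp δ, by
    change S (δ 0) = b
    rw [hδ₀, hb], by
    change S (δ 1) = b'
    rw [hδ₁, hb']⟩
  have aux : ∀ {x y : stdSimplex ℝ (Fin (p + 1))} {b : B} (h : x = y) (hx : S x = b) (hy : S y = b)
      (z : FiberHomology k π b), homologyMap k (singMap (pullbackIncl x hx)) z =
        homologyMap k (singMap (pullbackIncl y hy)) z := by
    rintro x _ b rfl hx hy z
    rfl
  have hγ := transport_of_pullback hπ (S := S) (contractsTo_stdSimplex (stdSimplex.vertex 0)) δ hδ₀ γ
    (fun t => rfl) ((aux hδ₀ _ hb _).trans (hz.symm.trans (aux hδ₁.symm hb' _ _)))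
  have hγ' := transport_trans hγ (transport_somePath hπ b₀ _)
  exact ((transport_eq_iff hπ b₀ _).1 hγ').symm

/-- Transport is compatible with the comultiplication. -/
theorem transport_comult {b : B} (c : LinearMap.ker (chainDG k (Sing (Fiber π b))).d)
    {ΔF : FiberHomology k π b₀ →ₗ[k] FiberHomology k π b₀ ⊗[k] FiberHomology k π b₀}
    (hΔ : ∀ x : LinearMap.ker (chainDG k (Sing (Fiber π b₀))).d, ΔF ((chainDG k _).cls x) =
      TensorProduct.map (chainDG k _).toHomology (chainDG k _).toHomology (chainComult k _ x.1)) :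
    TensorProduct.map ((transport k hπ b₀ b).toLinearMap ∘ₗ (chainDG k _).toHomology)
        ((transport k hπ b₀ b).toLinearMap ∘ₗ (chainDG k _).toHomology) (chainComult k _ c.1) =
      ΔF (transport k hπ b₀ b ((chainDG k _).cls c)) := by
  obtain ⟨c', hc'⟩ := (chainDG k (Sing (Fiber π b₀))).cls_surjective
    (transport k hπ b₀ b ((chainDG k _).cls c))
  let γ := PathConnectedSpace.somePath b b₀
  let s := singMap (sourceIncl π γ)
  let t := singMap (targetIncl π γ)
  have h := transport_somePath hπ b₀ ((chainDG k _).cls c)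
  rw [← hc', homologyMap_cls, homologyMap_cls, DG.cls_eq_iff] at h
  obtain ⟨w, hw⟩ := h
  let D := (TensorProduct.map (chainDG k (Sing (PathPullback π γ))).toHomology
    (chainDG k (Sing (PathPullback π γ))).toHomology) ∘ₗ chainComult k (Sing (PathPullback π γ))
  have e : D (chainMap k s c.1) = D (chainMap k t c'.1) := by
    rw [← sub_eq_zero, ← map_sub]
    refine (congrArg D hw.symm).trans ?_
    change TensorProduct.map _ _ (chainComult k _ (boundary k _ w)) = 0
    rw [← tensor_d_chainComult, DG.toHomology_tensor_d]
  have e := (toHomology_chainComult_chainMap s c.2).symm.trans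
    (e.trans (toHomology_chainComult_chainMap t c'.2))
  have hs : homologyMap k s = homologyMap k t ∘ₗ (transport k hπ b₀ b).toLinearMap :=
    LinearMap.ext fun z => transport_somePath hπ b₀ z
  rw [← hc', hΔ, TensorProduct.map_comp, LinearMap.comp_apply]
  rw [hs, TensorProduct.map_comp, LinearMap.comp_apply] at e
  have ht : Function.Bijective (homologyMap k t) := bijective_pullbackIncl k hπ
    (contractsTo_unitInterval 1) (S := (γ : C(unitInterval, B))) γ.target
  exact (TensorProduct.congr (LinearEquiv.ofBijective _ ht) (LinearEquiv.ofBijective _ ht)).injective e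

end Transport

end SerreSS

namespace SerreSS

open CategoryTheory Simplicial Opposite TensorProduct

section

variable {k : Type v} [Field k] {X Y Z : SSet.{u}}

theorem simplex_mem_chainGr_iff_cases {P : Submodule k (Chains k X)} {n : ℕ}
    (h : ∀ σ : X _⦋n⦌, simplex k σ ∈ P) {m : ℤ} (hm : m = n) : chainGr k X m ≤ P := fun x hx =>
  FDG.mem_of_supported (T := LinearMap.id) (fun s hs => by
    obtain ⟨l, σ⟩ := s
    obtain rfl : l = n := by
      have : (l : ℤ) = m := hs
      lia
    have := h σ.1
    rwa [simplex_of_nonDegenerate] at this) hx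

theorem eq_of_mem_chainGr {Q : Type*} [AddCommMonoid Q] [Module k Q] {n : ℕ}
    {T T' : Chains k X →ₗ[k] Q} (h : ∀ σ : X _⦋n⦌, T (simplex k σ) = T' (simplex k σ)) {m : ℤ}
    (hm : m = n) {x : Chains k X} (hx : x ∈ chainGr k X m) : T x = T' x :=
  LinearMap.mem_eqLocus.1 (simplex_mem_chainGr_iff_cases (P := LinearMap.eqLocus T T')
    (fun σ => LinearMap.mem_eqLocus.2 (h σ)) hm hx)

theorem chainPart_mem_chainGr (n : ℤ) (x : Chains k X) : chainPart k X n x ∈ chainGr k X n := by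
  refine FDG.mem_of_supported (T := chainPart k X n) (S := Set.univ) (fun s _ => ?_) (by simp)
  rw [chainPart, Finsupp.linearCombination_single, one_smul]
  split_ifs with h
  · exact Finsupp.single_mem_supported k _ h
  · exact zero_mem _

theorem boundary_chainPart (n : ℤ) (x : Chains k X) :
    boundary k X (chainPart k X n x) = chainPart k X (n - 1) (boundary k X x) := by
  refine chains_lhom_ext (f := boundary k X ∘ₗ chainPart k X n)
    (g := chainPart k X (n - 1) ∘ₗ boundary k X) (fun m σ => ?_) x
  have h := boundary_mem_chainGr (simplex_mem_chainGr (k := k) σ.1 (rfl : (m : ℤ) = m))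
  rw [LinearMap.comp_apply, LinearMap.comp_apply, chainPart_simplex, chainPart_of_mem h]
  by_cases hm : (m : ℤ) = n
  · rw [if_pos hm, if_pos (by lia)]
  · rw [if_neg hm, if_neg (by lia), map_zero]

theorem chainSgn_chainPart (n : ℤ) (x : Chains k X) :
    chainSgn k X (chainPart k X n x) = (n.negOnePow : ℤ) • chainPart k X n x :=
  chainSgn_of_mem (chainPart_mem_chainGr n x)

theorem chainPart_chainSgn (n : ℤ) (x : Chains k X) :
    chainPart k X n (chainSgn k X x) = (n.negOnePow : ℤ) • chainPart k X n x := by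
  rw [← chainSgn_chainPart]
  refine chains_lhom_ext (f := chainPart k X n ∘ₗ chainSgn k X)
    (g := chainSgn k X ∘ₗ chainPart k X n) (fun m σ => ?_) x
  rw [LinearMap.comp_apply, LinearMap.comp_apply, chainPart_simplex, chainSgn_simplex, map_zsmul,
    chainPart_simplex]
  split_ifs
  · rw [chainSgn_simplex]
  · rw [map_zero, smul_zero]

theorem chainPart_chainMap (f : X ⟶ Y) (n : ℤ) (x : Chains k X) :
    chainPart k Y n (chainMap k f x) = chainMap k f (chainPart k X n x) := by
  refine chains_lhom_ext (f := chainPart k Y n ∘ₗ chainMap k f)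
    (g := chainMap k f ∘ₗ chainPart k X n) (fun m σ => ?_) x
  rw [LinearMap.comp_apply, LinearMap.comp_apply, chainMap_simplex, chainPart_simplex,
    chainPart_simplex]
  split_ifs
  · rw [chainMap_simplex]
  · rw [map_zero]

theorem Param.ez_mem {A : SSet.{u}} {p : ℕ} (H : Param A X p) {m n : ℤ} (hn : m + p = n)
    {x : Chains k A} (hx : x ∈ chainGr k A m) : H.ez k x ∈ chainGr k X n :=
  FDG.mem_of_supported (T := H.ez k) (fun s hs => by
    have := H.ez_mem_chainGr (k := k) s.2.1
    rw [simplex_of_nonDegenerate] at this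
    have hs : (s.1 : ℤ) = m := hs
    have e : ((s.1 + p : ℕ) : ℤ) = n := by push_cast; lia
    rwa [e] at this) hx

/-! ### Chains of subcomplexes -/

variable (k) in
/-- The chains of a subcomplex. -/
def chainSub (T : X.Subcomplex) : Submodule k (Chains k X) :=
  Finsupp.supported k k (Set.ofPred fun s => s.2.1 ∈ T.obj (op ⦋s.1⦌))

theorem simplex_mem_chainSub {T : X.Subcomplex} {n : ℕ} {σ : X _⦋n⦌} (h : σ ∈ T.obj (op ⦋n⦌)) :
    simplex k σ ∈ chainSub k T :=
  simplex_mem_supported (Q := fun s => s.2.1 ∈ T.obj (op ⦋s.1⦌)) fun _ => h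

theorem apply_mem_of_mem_chainSub {M : Type*} [AddCommMonoid M] [Module k M] {T : X.Subcomplex}
    {S : Chains k X →ₗ[k] M} {P : Submodule k M}
    (h : ∀ {n : ℕ} (σ : X _⦋n⦌), σ ∈ T.obj (op ⦋n⦌) → S (simplex k σ) ∈ P) {x : Chains k X}
    (hx : x ∈ chainSub k T) : S x ∈ P :=
  FDG.mem_of_supported (T := S) (fun s hs => by
    have := h s.2.1 hs
    rwa [simplex_of_nonDegenerate] at this) hx

theorem eq_of_mem_chainSub {M : Type*} [AddCommMonoid M] [Module k M] {T : X.Subcomplex}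
    {S S' : Chains k X →ₗ[k] M}
    (h : ∀ {n : ℕ} (σ : X _⦋n⦌), σ ∈ T.obj (op ⦋n⦌) → S (simplex k σ) = S' (simplex k σ))
    {x : Chains k X} (hx : x ∈ chainSub k T) : S x = S' x :=
  FDG.eq_of_supported (T := S) (T' := S') (fun s hs => by
    have := h s.2.1 hs
    rwa [simplex_of_nonDegenerate] at this) hx

theorem chainMap_mem_chainSub {T : X.Subcomplex} {T' : Y.Subcomplex} {f : X ⟶ Y}
    (h : ∀ {n : ℕ} (σ : X _⦋n⦌), σ ∈ T.obj (op ⦋n⦌) → f.app (op ⦋n⦌) σ ∈ T'.obj (op ⦋n⦌))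
    {x : Chains k X} (hx : x ∈ chainSub k T) : chainMap k f x ∈ chainSub k T' :=
  apply_mem_of_mem_chainSub (fun σ hσ => by
    rw [chainMap_simplex]
    exact simplex_mem_chainSub (h σ hσ)) hx

theorem boundary_mem_chainSub {T : X.Subcomplex} {x : Chains k X} (hx : x ∈ chainSub k T) :
    boundary k X x ∈ chainSub k T :=
  apply_mem_of_mem_chainSub (fun {n} σ hσ => by
    rw [boundary_simplex]
    rcases n with _ | n
    · rw [faceSum_zero]
      exact zero_mem _
    · rw [faceSum_succ]
      exact Submodule.sum_mem _ fun i _ => zsmul_mem (simplex_mem_chainSub (T.map _ hσ)) _) hx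

theorem chainSgn_mem_chainSub {T : X.Subcomplex} {x : Chains k X} (hx : x ∈ chainSub k T) :
    chainSgn k X x ∈ chainSub k T :=
  apply_mem_of_mem_chainSub (fun σ hσ => by
    rw [chainSgn_simplex]
    exact zsmul_mem (simplex_mem_chainSub hσ) _) hx

theorem ChainFamily.ev_mem_chainSub {P : Type w} [Preorder P] (e : ChainFamily P X)
    {T : X.Subcomplex} (h : ∀ {n : ℕ} (c : Fin (n + 1) →o P), e.app c ∈ T.obj (op ⦋n⦌))
    (x : List P →₀ k) : e.ev k x ∈ chainSub k T := by
  refine FDG.mem_of_supported (T := e.ev k) (S := Set.univ) (fun l _ => ?_) (by simp)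
  rw [ev_single]
  rcases l with _ | ⟨v, l⟩
  · exact zero_mem _
  · rw [evList]
    split_ifs
    · exact simplex_mem_chainSub (h _)
    · exact zero_mem _

theorem Param.ez_mem_chainSub {A : SSet.{u}} {p : ℕ} (H : Param A X p) {T : A.Subcomplex}
    {T' : X.Subcomplex} (h : ∀ {n : ℕ} (U : A _⦋n⦌) (σ : ⦋n⦌ ⟶ ⦋p⦌), U ∈ T.obj (op ⦋n⦌) →
      H.app U σ ∈ T'.obj (op ⦋n⦌)) {x : Chains k A} (hx : x ∈ chainSub k T) :
    H.ez k x ∈ chainSub k T' :=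
  apply_mem_of_mem_chainSub (fun σ hσ => by
    rw [ez_simplex]
    exact ChainFamily.ev_mem_chainSub _ (fun c => h _ _ (T.map _ hσ)) _) hx

/-! ### Restriction of chains along a monomorphism -/

open Classical in
variable (k) in
/-- The restriction of chains along a monomorphism: the simplices which are not in the image are
sent to zero. -/
noncomputable def chainRestrict (i : X ⟶ Y) : Chains k Y →ₗ[k] Chains k X :=
  Finsupp.linearCombination k fun s =>
    if h : ∃ z, i.app (op ⦋s.1⦌) z = s.2.1 then simplex k h.choose else 0

theorem chainRestrict_simplex_app (i : X ⟶ Y) [Mono i] {n : ℕ} (σ : X _⦋n⦌) :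
    chainRestrict k i (simplex k (i.app (op ⦋n⦌) σ)) = simplex k σ := by
  by_cases hσ : σ ∈ X.nonDegenerate n
  · have hσ' := (SSet.nonDegenerate_iff_of_mono i σ).2 hσ
    have h : ∃ z, i.app (op ⦋n⦌) z = i.app (op ⦋n⦌) σ := ⟨σ, rfl⟩
    have hi : Function.Injective (i.app (op ⦋n⦌)) :=
      (mono_iff_injective _).1 inferInstance
    rw [simplex_of_nonDegenerate ⟨_, hσ'⟩, chainRestrict, Finsupp.linearCombination_single, one_smul]
    exact (dif_pos h).trans (congrArg _ (hi h.choose_spec))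
  · have hσ' := fun h => hσ ((SSet.nonDegenerate_iff_of_mono i σ).1 h)
    rw [simplex, dif_neg hσ', map_zero, simplex, dif_neg hσ]

theorem chainRestrict_simplex_of_notMem (i : X ⟶ Y) {n : ℕ} {σ : Y _⦋n⦌}
    (h : ∀ z, i.app (op ⦋n⦌) z ≠ σ) : chainRestrict k i (simplex k σ) = 0 := by
  by_cases hσ : σ ∈ Y.nonDegenerate n
  · rw [simplex_of_nonDegenerate ⟨σ, hσ⟩, chainRestrict, Finsupp.linearCombination_single, one_smul]
    exact dif_neg fun ⟨z, hz⟩ => h z hz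
  · rw [simplex, dif_neg hσ, map_zero]

theorem chainRestrict_chainMap (i : X ⟶ Y) [Mono i] (x : Chains k X) :
    chainRestrict k i (chainMap k i x) = x :=
  chains_lhom_ext (f := chainRestrict k i ∘ₗ chainMap k i) (g := LinearMap.id) (fun n σ => by
    rw [LinearMap.comp_apply, chainMap_simplex, chainRestrict_simplex_app]
    rfl) x

theorem chainMap_injective (i : X ⟶ Y) [Mono i] : Function.Injective (chainMap k i) :=
  Function.LeftInverse.injective (chainRestrict_chainMap i)

theorem chainRestrict_mem_chainGr (i : X ⟶ Y) [Mono i] {n : ℤ} {x : Chains k Y}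
    (hx : x ∈ chainGr k Y n) : chainRestrict k i x ∈ chainGr k X n :=
  FDG.mem_of_supported (T := chainRestrict k i) (fun s hs => by
    obtain ⟨m, σ⟩ := s
    rw [← simplex_of_nonDegenerate]
    by_cases h : ∃ z, i.app (op ⦋m⦌) z = σ.1
    · obtain ⟨z, hz⟩ := h
      rw [← hz, chainRestrict_simplex_app]
      exact simplex_mem_chainGr _ hs
    · rw [chainRestrict_simplex_of_notMem i fun z hz => h ⟨z, hz⟩]
      exact zero_mem _) hx

/-! ### The boundary of `φ` -/

theorem phi_boundary (f : X ⟶ Y) (q : ℕ) (x : Chains k X) : phi k f q (boundary k X x) =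
    TensorProduct.map (boundary k X) LinearMap.id (phi k f (q + 1) x) +
      ((-1) ^ q : ℤ) • TensorProduct.map LinearMap.id (boundary k Y) (phi k f q x) := by
  rw [phi_eq, phi_eq, phi_eq, ← tensor_d_chainComult]
  induction chainComult k X x with
  | zero => simp
  | add z w hz hw => simp only [map_add, hz, hw, smul_add]; abel
  | tmul a b =>
    have e : (((q : ℤ).negOnePow : ℤˣ) : ℤ) = (-1) ^ q := by
      rw [Int.negOnePow_def, zpow_natCast, Units.val_pow_eq_pow_val, Units.val_neg, Units.val_one]
    rw [DG.tensor_d_tmul, map_add, TensorProduct.map_tmul, TensorProduct.map_tmul,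
      TensorProduct.map_tmul, TensorProduct.map_tmul, TensorProduct.map_tmul, TensorProduct.map_tmul,
      boundary_chainPart, boundary_chainMap, LinearMap.id_apply, LinearMap.id_apply,
      TensorProduct.smul_tmul', ← e, ← chainPart_chainSgn, Nat.cast_succ, add_sub_cancel_right]
    rfl

theorem simplex_face_congr (f : X ⟶ Y) {n i l l' : ℕ} (σ : X _⦋n⦌) (h : i + l ≤ n) (e : l = l') :
    simplex k (f.app (op ⦋l⦌) (face σ i l h)) =
      simplex k (f.app (op ⦋l'⦌) (face σ i l' (e ▸ h))) := by
  subst e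
  rfl

theorem phi_simplex (f : X ⟶ Y) {p q : ℕ} (σ : X _⦋q + p⦌) : phi k f q (simplex k σ) =
    simplex k (face σ 0 q (by lia)) ⊗ₜ simplex k (f.app (op ⦋p⦌) (face σ q p le_rfl)) := by
  rw [phi_eq, chainComult_simplex, map_sum]
  simp only [TensorProduct.map_tmul, chainPart_simplex, chainMap_simplex, Nat.cast_inj]
  rw [Finset.sum_eq_single (⟨q, by lia⟩ : Fin (q + p + 1)), if_pos rfl,
    simplex_face_congr f σ _ (show q + p - q = p by lia)]
  · intro j _ hj
    rw [if_neg (fun h => hj (Fin.ext h)), TensorProduct.zero_tmul]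
  · exact fun h => absurd (Finset.mem_univ _) h

/-- The contraction of the right factor with a linear form. -/
noncomputable def contractRight {M N : Type*} [AddCommGroup M] [Module k M] [AddCommGroup N]
    [Module k N] (l : N →ₗ[k] k) : M ⊗[k] N →ₗ[k] M :=
  (TensorProduct.rid k M).toLinearMap ∘ₗ TensorProduct.map LinearMap.id l

theorem contractRight_tmul {M N : Type*} [AddCommGroup M] [Module k M] [AddCommGroup N]
    [Module k N] (l : N →ₗ[k] k) (x : M) (y : N) : contractRight l (x ⊗ₜ y) = l y • x := by
  simp [contractRight]

theorem contractRight_phi_boundary (f : X ⟶ Y) (q : ℕ) (l : Chains k Y →ₗ[k] k) (x : Chains k X) :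
    contractRight l (phi k f q (boundary k X x)) =
      boundary k X (contractRight l (phi k f (q + 1) x)) +
        ((-1) ^ q : ℤ) • contractRight (l ∘ₗ boundary k Y) (phi k f q x) := by
  rw [phi_boundary, map_add, map_zsmul]
  congr 1
  · induction phi k f (q + 1) x with
    | zero => simp
    | add z w hz hw => simp only [map_add, hz, hw]
    | tmul a b => simp [contractRight_tmul]
  · congr 1
    induction phi k f q x with
    | zero => simp
    | add z w hz hw => simp only [map_add, hz, hw]
    | tmul a b => simp [contractRight_tmul]

end

end SerreSS

namespace SerreSS

open CategoryTheory Simplicial Opposite TensorProduct HomotopicalAlgebra SSet.modelCategoryQuillen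

theorem map_map_apply {X : SSet.{u}} {n m l : ℕ} (θ : ⦋m⦌ ⟶ ⦋n⦌) (η : ⦋l⦌ ⟶ ⦋m⦌) (σ : X _⦋n⦌) :
    X.map η.op (X.map θ.op σ) = X.map (η ≫ θ).op σ := by
  rw [op_comp, X.map_comp]
  rfl

section

variable {X Y : SSet.{u}} {f : X ⟶ Y} {I : Type u} {p : ℕ}

/-- The pullback of `f` to the disjoint union of simplices `V i` of the base. -/
def SimplexPullback (f : X ⟶ Y) {I : Type u} {p : ℕ} (V : I → Y _⦋p⦌) : SSet.{u} where
  obj n := { z : X.obj n × I × (n.unop ⟶ ⦋p⦌) // f.app n z.1 = Y.map z.2.2.op (V z.2.1) }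
  map {n m} θ := TypeCat.ofHom fun z => ⟨(X.map θ z.1.1, z.1.2.1, θ.unop ≫ z.1.2.2),
    (app_map (n := n.unop.len) (m := m.unop.len) f θ.unop z.1.1).trans
      ((congrArg (Y.map θ) z.2).trans
        (map_map_apply (n := p) (m := n.unop.len) (l := m.unop.len) z.1.2.2 θ.unop _))⟩
  map_id n := by
    ext z : 3
    apply Subtype.ext
    apply Prod.ext
    · exact ConcreteCategory.congr_hom (X.map_id n) z.1.1
    · exact Prod.ext rfl (Category.id_comp z.1.2.2)
  map_comp θ η := by
    ext z : 3
    apply Subtype.ext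
    apply Prod.ext
    · exact ConcreteCategory.congr_hom (X.map_comp θ η) z.1.1
    · exact Prod.ext rfl (Category.assoc η.unop θ.unop z.1.2.2)

namespace SimplexPullback

variable (V : I → Y _⦋p⦌)

/-- The simplex of the pullback given by `α` over `s^* V i`. -/
def mk {n : ℕ} (α : X _⦋n⦌) (i : I) (s : ⦋n⦌ ⟶ ⦋p⦌)
    (h : f.app (op ⦋n⦌) α = Y.map s.op (V i)) : (SimplexPullback f V) _⦋n⦌ := ⟨(α, i, s), h⟩

variable {V}

/-- The component in `Δ[p]`. -/
def base {n : ℕ} (z : (SimplexPullback f V) _⦋n⦌) : ⦋n⦌ ⟶ ⦋p⦌ := z.1.2.2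

/-- The index of the simplex. -/
def index {n : ℕ} (z : (SimplexPullback f V) _⦋n⦌) : I := z.1.2.1

/-- The component in the total space. -/
def total {n : ℕ} (z : (SimplexPullback f V) _⦋n⦌) : X _⦋n⦌ := z.1.1

theorem app_total {n : ℕ} (z : (SimplexPullback f V) _⦋n⦌) :
    f.app (op ⦋n⦌) (total z) = Y.map (base z).op (V (index z)) := z.2

theorem ext {n : ℕ} {z z' : (SimplexPullback f V) _⦋n⦌} (h₁ : total z = total z')
    (h₂ : index z = index z') (h₃ : base z = base z') : z = z' :=
  Subtype.ext (Prod.ext h₁ (Prod.ext h₂ h₃))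

variable (f V) in
/-- The projection to the total space. -/
def fst : SimplexPullback f V ⟶ X where
  app n := TypeCat.ofHom fun z => total (n := n.unop.len) z
  naturality n m θ := by ext z; rfl

variable (f V) in
/-- The projection to `Δ[p]`. -/
def snd : SimplexPullback f V ⟶ Δ[p] where
  app n := TypeCat.ofHom fun z => SSet.stdSimplex.objEquiv.symm (base (n := n.unop.len) z)
  naturality n m θ := by ext z; rfl

/-- The map induced by a map `Δ[p'] ⟶ Δ[p]`. -/
def push {p' : ℕ} (η : ⦋p'⦌ ⟶ ⦋p⦌) :
    SimplexPullback f (fun i => Y.map η.op (V i)) ⟶ SimplexPullback f V where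
  app n := TypeCat.ofHom fun z => mk (n := n.unop.len) V (total z) (index z) (base z ≫ η)
    ((app_total z).trans (map_map_apply _ _ _))
  naturality n m θ := by
    ext z
    refine ext (n := m.unop.len) rfl rfl (Category.assoc _ _ _)

theorem base_push {p' : ℕ} (η : ⦋p'⦌ ⟶ ⦋p⦌) {n : ℕ}
    (z : (SimplexPullback f (fun i => Y.map η.op (V i))) _⦋n⦌) :
    base ((push η).app (op ⦋n⦌) z) = base z ≫ η := rfl

theorem mem_range_push {p' : ℕ} {η : ⦋p'⦌ ⟶ ⦋p⦌} {n : ℕ} {z : (SimplexPullback f V) _⦋n⦌}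
    {s : ⦋n⦌ ⟶ ⦋p'⦌} (h : s ≫ η = base z) : ∃ z', (push η).app (op ⦋n⦌) z' = z :=
  ⟨mk _ (total z) (index z) s ((app_total z).trans (by rw [map_map_apply, h])), ext rfl rfl h⟩

instance {p' : ℕ} (η : ⦋p'⦌ ⟶ ⦋p⦌) [Mono η] :
    Mono (push (f := f) (V := V) η) := by
  rw [NatTrans.mono_iff_mono_app]
  intro n
  rw [mono_iff_injective]
  intro z z' h
  refine ext (n := n.unop.len) ?_ ?_ ((cancel_mono η).1 ?_)
  · exact congrArg (total (V := V) (n := n.unop.len)) h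
  · exact congrArg (index (V := V) (n := n.unop.len)) h
  · exact congrArg (base (V := V) (n := n.unop.len)) h

/-- The subcomplex of the simplices whose component in `Δ[p]` lies in a sieve. -/
def sub (f : X ⟶ Y) (V : I → Y _⦋p⦌) (R : ∀ n : ℕ, (⦋n⦌ ⟶ ⦋p⦌) → Prop)
    (hR : ∀ {n m : ℕ} (θ : ⦋m⦌ ⟶ ⦋n⦌) s, R n s → R m (θ ≫ s)) :
    (SimplexPullback f V).Subcomplex where
  obj n := Set.ofPred fun z => R n.unop.len (base (n := n.unop.len) z)
  map {n m} θ _ hz := hR (n := n.unop.len) (m := m.unop.len) θ.unop _ hz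

variable (f V) in
/-- The part over the boundary of `Δ[p]`. -/
def bdry : (SimplexPullback f V).Subcomplex :=
  sub f V (fun _ s => ∃ j, ∀ l, s.toOrderHom l ≠ j) fun _ _ ⟨j, h⟩ => ⟨j, fun _ => h _⟩

variable (f V) in
/-- The part over the last horn of `Δ[p]`. -/
def lastHorn : (SimplexPullback f V).Subcomplex :=
  sub f V (fun _ s => ∃ j ≠ Fin.last p, ∀ l, s.toOrderHom l ≠ j)
    fun _ _ ⟨j, hj, h⟩ => ⟨j, hj, fun _ => h _⟩

variable (f V) in
/-- The part over the initial vertex of `Δ[p]`. -/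
def initial : (SimplexPullback f V).Subcomplex :=
  sub f V (fun _ s => ∀ l, s.toOrderHom l = 0) fun _ _ h _ => h _

theorem mem_bdry {n : ℕ} {z : (SimplexPullback f V) _⦋n⦌} :
    z ∈ (bdry f V).obj (op ⦋n⦌) ↔ ∃ j, ∀ l, (base z).toOrderHom l ≠ j := Iff.rfl

theorem mem_lastHorn {n : ℕ} {z : (SimplexPullback f V) _⦋n⦌} :
    z ∈ (lastHorn f V).obj (op ⦋n⦌) ↔ ∃ j ≠ Fin.last p, ∀ l, (base z).toOrderHom l ≠ j := Iff.rfl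

theorem mem_initial {n : ℕ} {z : (SimplexPullback f V) _⦋n⦌} :
    z ∈ (initial f V).obj (op ⦋n⦌) ↔ ∀ l, (base z).toOrderHom l = 0 := Iff.rfl

/-- The contraction of `Δ[p]` to its last vertex. -/
def contractLast {n p : ℕ} (s : ⦋n⦌ ⟶ ⦋p⦌) (τ : ⦋n⦌ ⟶ ⦋1⦌) : ⦋n⦌ ⟶ ⦋p⦌ :=
  SimplexCategory.Hom.mk ⟨fun l => if τ.toOrderHom l = 0 then s.toOrderHom l else Fin.last p,
    fun l m h => by
      dsimp only
      by_cases h₁ : τ.toOrderHom m = 0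
      · rw [if_pos h₁, if_pos (le_antisymm ((τ.toOrderHom.monotone h).trans h₁.le) (Fin.zero_le _))]
        exact s.toOrderHom.monotone h
      · rw [if_neg h₁]
        exact Fin.le_last _⟩

theorem contractLast_apply {n p : ℕ} (s : ⦋n⦌ ⟶ ⦋p⦌) (τ : ⦋n⦌ ⟶ ⦋1⦌) (l : Fin (n + 1)) :
    (contractLast s τ).toOrderHom l =
      if τ.toOrderHom l = 0 then s.toOrderHom l else Fin.last p := rfl

theorem comp_contractLast {n m p : ℕ} (θ : ⦋m⦌ ⟶ ⦋n⦌) (s : ⦋n⦌ ⟶ ⦋p⦌) (τ : ⦋n⦌ ⟶ ⦋1⦌) :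
    θ ≫ contractLast s τ = contractLast (θ ≫ s) (θ ≫ τ) := rfl

theorem contractLast_zero {n p : ℕ} (s : ⦋n⦌ ⟶ ⦋p⦌) :
    contractLast s (SimplexCategory.const ⦋n⦌ ⦋1⦌ 0) = s :=
  SimplexCategory.Hom.ext _ _ (OrderHom.ext _ _ (funext fun _ => by
    rw [contractLast_apply]
    exact if_pos rfl))

theorem exists_contraction [Fibration f] (V : I → Y _⦋p⦌) :
    ∃ H : Param (SimplexPullback f V) (SimplexPullback f V) 1, H.vertex 0 = 𝟙 _ ∧
      ∀ {n : ℕ} (z : (SimplexPullback f V) _⦋n⦌) (τ : ⦋n⦌ ⟶ ⦋1⦌),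
        base (H.app z τ) = contractLast (base z) τ := by
  let P : Param (SimplexPullback f V) Y 1 :=
    ⟨fun z τ => Y.map (contractLast (base z) τ).op (V (index z)), fun θ z τ => by
      rw [map_map_apply, comp_contractLast]
      rfl⟩
  obtain ⟨H, h₁, h₀⟩ := Param.exists_lift (f := f) (fst f V) P (by
    ext n z
    refine (app_total (n := n.unop.len) z).trans ?_
    change _ = Y.map (contractLast (base (n := n.unop.len) z) _).op _
    rw [contractLast_zero])
  have h : ∀ {n : ℕ} (z : (SimplexPullback f V) _⦋n⦌) (τ : ⦋n⦌ ⟶ ⦋1⦌),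
      f.app (op ⦋n⦌) (H.app z τ) = Y.map (contractLast (base z) τ).op (V (index z)) :=
    fun z τ => congrArg (fun P : Param (SimplexPullback f V) Y 1 => P.app z τ) h₁
  refine ⟨⟨fun z τ => mk V (H.app z τ) (index z) (contractLast (base z) τ) (h z τ),
    fun θ z τ => ext (H.map_app θ z τ) rfl rfl⟩, ?_, fun z τ => rfl⟩
  ext n z
  induction n using Opposite.rec with | op n
  induction n using SimplexCategory.rec with | _ n
  exact ext (ConcreteCategory.congr_hom (NatTrans.congr_app h₀ (op ⦋n⦌)) z) rfl
    (contractLast_zero _)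

variable {k : Type v} [Field k]

/-- The chains modulo the part over the last horn are acyclic. -/
theorem exists_sub_boundary_mem_lastHorn [Fibration f] (V : I → Y _⦋p + 1⦌)
    {x : Chains k (SimplexPullback f V)}
    (hx : boundary k _ x ∈ chainSub k (lastHorn f V)) :
    ∃ y, x - boundary k _ y ∈ chainSub k (lastHorn f V) := by
  obtain ⟨H, h₀, hH⟩ := exists_contraction (f := f) V
  refine ⟨-H.ez k (chainSgn k _ x), ?_⟩
  rw [map_neg, H.boundary_ez_one, h₀, chainMap_id, sub_neg_eq_add, add_left_comm, add_sub_cancel]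
  refine add_mem (neg_mem (H.ez_mem_chainSub (fun z τ hz => ?_) (chainSgn_mem_chainSub hx))) ?_
  · obtain ⟨j, hj, hz⟩ := mem_lastHorn.1 hz
    refine mem_lastHorn.2 ⟨j, hj, fun l => ?_⟩
    rw [hH, contractLast_apply]
    split_ifs
    exacts [hz l, hj.symm]
  · refine chainMap_mem_chainSub (T := ⊤) (fun z _ => ?_) 
      ((Finsupp.mem_supported _ _).2 fun _ _ => trivial)
    refine mem_lastHorn.2 ⟨0, (Fin.last_pos).ne, fun l => ?_⟩
    rw [H.vertex_app, hH, contractLast_apply]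
    exact (if_neg (by decide : ¬ ((1 : Fin 2) = 0))).trans_ne Fin.last_pos.ne'


end SimplexPullback

end

end SerreSS

namespace SerreSS

open CategoryTheory Simplicial Opposite TensorProduct HomotopicalAlgebra SSet.modelCategoryQuillen

section

variable {k : Type v} [Field k] {X : SSet.{u}}

open Classical in
theorem simplex_apply {n : ℕ} (σ : X _⦋n⦌) (τ : X.nonDegenerate n) :
    (simplex k σ : Chains k X) ⟨n, τ⟩ = if σ = τ.1 then 1 else 0 := by
  by_cases h : σ ∈ X.nonDegenerate n
  · rw [simplex_of_nonDegenerate ⟨σ, h⟩, Finsupp.single_apply]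
    refine if_congr ⟨fun e => ?_, fun e => ?_⟩ rfl rfl
    · exact congrArg Subtype.val (eq_of_heq (Sigma.mk.inj e).2)
    · subst e
      rfl
  · rw [simplex, dif_neg h, if_neg fun e : σ = τ.1 => h (e ▸ τ.2)]
    rfl

theorem apply_eq_zero_of_mem_chainGr {n : ℕ} {m : ℤ} {x : Chains k X} (hx : x ∈ chainGr k X m)
    (τ : X.nonDegenerate n) (h : (n : ℤ) ≠ m) : x ⟨n, τ⟩ = 0 :=
  (Finsupp.mem_supported' _ _).1 hx ⟨n, τ⟩ h

variable (k) in
/-- The coefficient of a nondegenerate simplex. -/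
noncomputable def coeffAt {n : ℕ} (τ : X.nonDegenerate n) : Chains k X →ₗ[k] k :=
  Finsupp.lapply (⟨n, τ⟩ : Σ n : ℕ, X.nonDegenerate n)

open Classical in
theorem coeffAt_simplex {n : ℕ} (σ : X _⦋n⦌) (τ : X.nonDegenerate n) :
    coeffAt k τ (simplex k σ) = if σ = τ.1 then 1 else 0 := simplex_apply σ τ

theorem coeffAt_of_mem {n : ℕ} {m : ℤ} {x : Chains k X} (hx : x ∈ chainGr k X m)
    (τ : X.nonDegenerate n) (h : (n : ℤ) ≠ m) : coeffAt k τ x = 0 :=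
  apply_eq_zero_of_mem_chainGr hx τ h

/-- A map `⦋m⦌ ⟶ ⦋p⦌` as a simplex of `Δ[p]`. -/
def stdNonDegenerate {m p : ℕ} (η : ⦋m⦌ ⟶ ⦋p⦌) [Mono η] : (Δ[p] : SSet.{u}).nonDegenerate m :=
  ⟨SSet.stdSimplex.objEquiv.symm η,
    (SSet.stdSimplex.objEquiv_symm_mem_nonDegenerate_iff_mono η).2 inferInstance⟩

theorem coeffAt_boundary_top (p : ℕ) (x : Chains k (Δ[p] : SSet.{u})) :
    coeffAt k (stdNonDegenerate (𝟙 ⦋p⦌)) (boundary k _ x) = 0 := by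
  refine chains_lhom_ext (f := coeffAt k (stdNonDegenerate (𝟙 ⦋p⦌)) ∘ₗ boundary k _) (g := 0)
    (fun m σ => ?_) x
  rw [LinearMap.comp_apply, LinearMap.zero_apply]
  refine coeffAt_of_mem (boundary_mem_chainGr (simplex_mem_chainGr σ.1 rfl)) _ fun h => ?_
  have := (SSet.stdSimplex.mem_nonDegenerate_iff_mono σ.1).1 σ.2
  have := SimplexCategory.len_le_of_mono (SSet.stdSimplex.objEquiv σ.1)
  dsimp only at this
  lia

theorem coeffAt_boundary_last (p : ℕ) (x : Chains k (Δ[p + 1] : SSet.{u})) :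
    coeffAt k (stdNonDegenerate (SimplexCategory.δ (Fin.last (p + 1)))) (boundary k _ x) =
      ((-1) ^ (p + 1) : ℤ) • coeffAt k (stdNonDegenerate (𝟙 ⦋p + 1⦌)) x := by
  refine chains_lhom_ext
    (f := coeffAt k (stdNonDegenerate (SimplexCategory.δ (Fin.last (p + 1)))) ∘ₗ boundary k _)
    (g := ((-1) ^ (p + 1) : ℤ) • coeffAt k (stdNonDegenerate (𝟙 ⦋p + 1⦌))) (fun m σ => ?_) x
  rw [LinearMap.comp_apply, LinearMap.smul_apply]
  by_cases hm : m = p + 1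
  · subst hm
    have := (SSet.stdSimplex.mem_nonDegenerate_iff_mono σ.1).1 σ.2
    have hσ : σ.1 = SSet.stdSimplex.objEquiv.symm (𝟙 ⦋p + 1⦌) := by
      rw [Equiv.eq_symm_apply]
      exact SimplexCategory.eq_id_of_mono (SSet.stdSimplex.objEquiv σ.1)
    rw [hσ, boundary_simplex, faceSum_succ, map_sum, coeffAt_simplex]
    refine Eq.trans ?_ (congrArg _ (if_pos rfl)).symm
    rw [Finset.sum_eq_single (Fin.last (p + 1))]
    · rw [map_zsmul, coeffAt_simplex, if_pos, Fin.val_last]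
      exact congrArg SSet.stdSimplex.objEquiv.symm
        (Category.comp_id (SimplexCategory.δ (Fin.last (p + 1))))
    · intro j _ hj
      rw [map_zsmul, coeffAt_simplex, if_neg, smul_zero]
      intro h
      have h' : SimplexCategory.δ j ≫ 𝟙 _ = SimplexCategory.δ (Fin.last (p + 1)) :=
        SSet.stdSimplex.objEquiv.symm.injective h
      rw [Category.comp_id] at h'
      refine hj (Fin.succAbove_left_injective (funext fun l => ?_))
      exact congrArg (fun θ => (SimplexCategory.Hom.toOrderHom θ) l) h'
    · exact fun h => absurd (Finset.mem_univ _) h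
  · rw [coeffAt_of_mem (boundary_mem_chainGr (simplex_mem_chainGr σ.1 rfl)) _ (by lia),
      coeffAt_of_mem (simplex_mem_chainGr σ.1 rfl) _ (by lia), smul_zero]

end

namespace SimplexPullback

variable {k : Type v} [Field k] {X Y : SSet.{u}} {f : X ⟶ Y} {I : Type u} {p : ℕ} {V : I → Y _⦋p⦌}

variable (k f V) in
/-- The map `α ↦ α ∘ [0, …, q]` on the simplices of dimension `q + m` such that `α ∘ [q, …, q + m]` lies
over `η`. -/
noncomputable def front {m : ℕ} (η : ⦋m⦌ ⟶ ⦋p⦌) [Mono η] (q : ℕ) :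
    Chains k (SimplexPullback f V) →ₗ[k] Chains k (SimplexPullback f V) :=
  contractRight (coeffAt k (stdNonDegenerate η)) ∘ₗ phi k (snd f V) q

open Classical in
theorem front_simplex {m q : ℕ} (η : ⦋m⦌ ⟶ ⦋p⦌) [Mono η] (z : (SimplexPullback f V) _⦋q + m⦌) :
    front k f V η q (simplex k z) = if SimplexCategory.subinterval q m le_rfl ≫ base z = η then
      simplex k (face z 0 q (by lia)) else 0 := by
  rw [front, LinearMap.comp_apply, phi_simplex, contractRight_tmul, coeffAt_simplex]
  have : (snd f V).app (op ⦋m⦌) (face z q m le_rfl) = (stdNonDegenerate η).1 ↔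
      SimplexCategory.subinterval q m le_rfl ≫ base z = η :=
    SSet.stdSimplex.objEquiv.symm.injective.eq_iff
  by_cases h : SimplexCategory.subinterval q m le_rfl ≫ base z = η
  · rw [if_pos h]
    exact (congrArg (· • _) (if_pos (this.2 h))).trans (one_smul _ _)
  · rw [if_neg h]
    exact (congrArg (· • _) (if_neg fun e => h (this.1 e))).trans (zero_smul _ _)

theorem front_boundary_top (q : ℕ) (x : Chains k (SimplexPullback f V)) :
    front k f V (𝟙 ⦋p⦌) q (boundary k _ x) = boundary k _ (front k f V (𝟙 ⦋p⦌) (q + 1) x) := by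
  have h : coeffAt k (stdNonDegenerate.{u} (𝟙 ⦋p⦌)) ∘ₗ boundary k _ = 0 :=
    LinearMap.ext (coeffAt_boundary_top p)
  rw [front, LinearMap.comp_apply, contractRight_phi_boundary, h, front, LinearMap.comp_apply]
  simp [contractRight]

theorem front_boundary_last {V : I → Y _⦋p + 1⦌} (q : ℕ) (x : Chains k (SimplexPullback f V)) :
    front k f V (SimplexCategory.δ (Fin.last (p + 1))) q (boundary k _ x) =
      boundary k _ (front k f V (SimplexCategory.δ (Fin.last (p + 1))) (q + 1) x) +
        ((-1) ^ (q + p + 1) : ℤ) • front k f V (𝟙 ⦋p + 1⦌) q x := by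
  have h : coeffAt k (stdNonDegenerate.{u} (SimplexCategory.δ (Fin.last (p + 1)))) ∘ₗ boundary k _ =
      ((-1) ^ (p + 1) : ℤ) • coeffAt k (stdNonDegenerate (𝟙 ⦋p + 1⦌)) :=
    LinearMap.ext (coeffAt_boundary_last p)
  rw [front, LinearMap.comp_apply, contractRight_phi_boundary, h, front, LinearMap.comp_apply, front,
    LinearMap.comp_apply, add_assoc q, pow_add _ q, mul_smul]
  congr 2
  induction phi k (snd f V) q x with
  | zero => simp
  | add z w hz hw => simp only [map_add, hz, hw, smul_add]
  | tmul a b => rw [contractRight_tmul, contractRight_tmul, LinearMap.smul_apply, smul_assoc]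

theorem front_mem_initial {m q : ℕ} {η : ⦋m⦌ ⟶ ⦋p⦌} [Mono η] (hη : η.toOrderHom 0 = 0) {n : ℤ}
    (hn : n = (q + m : ℕ)) {x : Chains k (SimplexPullback f V)} (hx : x ∈ chainGr k _ n) :
    front k f V η q x ∈ chainSub k (initial f V) ⊓ chainGr k _ q := by
  refine Submodule.mem_comap.1 (simplex_mem_chainGr_iff_cases
    (P := (chainSub k (initial f V) ⊓ chainGr k _ q).comap (front k f V η q)) (fun z => ?_) hn hx)
  rw [Submodule.mem_comap, front_simplex]
  split_ifs with h
  · refine ⟨simplex_mem_chainSub (mem_initial.2 fun l => ?_), simplex_mem_chainGr _ rfl⟩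
    refine le_antisymm ?_ (Fin.zero_le _)
    have h₀ := congrArg (fun θ => (SimplexCategory.Hom.toOrderHom θ) 0) h
    refine le_trans ((base z).toOrderHom.monotone ?_) (h₀.trans hη).le
    rw [Fin.le_def]
    change (l : ℕ) + 0 ≤ 0 + q
    have := l.is_le
    simp only [SimplexCategory.len_mk] at this
    lia
  · exact zero_mem _

theorem front_eq_zero {m q : ℕ} {η : ⦋m⦌ ⟶ ⦋p⦌} [Mono η] {T : (SimplexPullback f V).Subcomplex}
    (hT : ∀ z ∈ T.obj (op ⦋q + m⦌), SimplexCategory.subinterval q m le_rfl ≫ base z ≠ η)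
    {x : Chains k (SimplexPullback f V)} (hx : x ∈ chainSub k T) {n : ℤ} (hn : n = (q + m : ℕ))
    (hx' : x ∈ chainGr k _ n) : front k f V η q x = 0 :=
  FDG.eq_of_supported (S := Set.ofPred (fun s : Σ n : ℕ, (SimplexPullback f V).nonDegenerate n =>
      s.2.1 ∈ T.obj (op ⦋s.1⦌)) ∩ Set.ofPred fun s => (s.1 : ℤ) = n)
    (T := front k f V η q) (T' := 0) (fun s hs => by
      obtain ⟨l, z⟩ := s
      obtain ⟨h₁, h₂⟩ := hs
      obtain rfl : l = q + m := by
        have : (l : ℤ) = n := h₂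
        lia
      rw [← simplex_of_nonDegenerate, front_simplex, if_neg (hT _ h₁), LinearMap.zero_apply])
    (by
      rw [Finsupp.supported_inter]
      exact ⟨hx, hx'⟩)

theorem front_push {p' m q : ℕ} (η : ⦋p'⦌ ⟶ ⦋p⦌) [Mono η] (ζ : ⦋m⦌ ⟶ ⦋p'⦌) [Mono ζ]
    {ξ : ⦋m⦌ ⟶ ⦋p⦌} [Mono ξ] (hξ : ζ ≫ η = ξ) {n : ℤ} (hn : n = (q + m : ℕ)) {x : Chains k (SimplexPullback f (fun i => Y.map η.op (V i)))}
    (hx : x ∈ chainGr k _ n) :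
    front k f V ξ q (chainMap k (push η) x) = chainMap k (push η) (front k f _ ζ q x) :=
  eq_of_mem_chainGr (T := front k f V ξ q ∘ₗ chainMap k (push η))
    (T' := chainMap k (push η) ∘ₗ front k f _ ζ q) (fun z => by
      rw [LinearMap.comp_apply, LinearMap.comp_apply, chainMap_simplex, front_simplex, front_simplex,
        base_push, ← hξ, ← Category.assoc, if_congr (cancel_mono η) rfl rfl, apply_ite (chainMap k (push η)),
        chainMap_simplex, map_zero, app_face]) hn hx

end SimplexPullback

end SerreSS

namespace SerreSS

open CategoryTheory Simplicial Opposite TensorProduct HomotopicalAlgebra SSet.modelCategoryQuillen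

namespace SimplexPullback

variable {k : Type v} [Field k] {X Y : SSet.{u}} {f : X ⟶ Y} {I : Type u} {p : ℕ}

/-- The restriction to the last face. -/
abbrev lastFace (V : I → Y _⦋p + 1⦌) (i : I) : Y _⦋p⦌ :=
  Y.map (SimplexCategory.δ (Fin.last (p + 1))).op (V i)

/-- The inclusion of the part over the last face. -/
abbrev lastIncl (V : I → Y _⦋p + 1⦌) : SimplexPullback f (lastFace V) ⟶ SimplexPullback f V :=
  push (SimplexCategory.δ (Fin.last (p + 1)))

variable {V : I → Y _⦋p + 1⦌}

theorem exists_factor_last {n : ℕ} {s : ⦋n⦌ ⟶ ⦋p + 1⦌} (h : ∀ l, s.toOrderHom l ≠ Fin.last (p + 1)) :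
    ∃ s' : ⦋n⦌ ⟶ ⦋p⦌, s' ≫ SimplexCategory.δ (Fin.last (p + 1)) = s := by
  refine ⟨SimplexCategory.Hom.mk ⟨fun l => (s.toOrderHom l).castPred (h l), fun l m hl =>
    Fin.castPred_le_castPred_iff.2 (s.toOrderHom.monotone hl)⟩, ?_⟩
  refine SimplexCategory.Hom.ext _ _ (OrderHom.ext _ _ (funext fun l => ?_))
  change (Fin.last (p + 1)).succAbove ((s.toOrderHom l).castPred (h l)) = _
  rw [Fin.succAbove_last, Fin.castSucc_castPred]

theorem delta_last_apply {n : ℕ} (s : ⦋n⦌ ⟶ ⦋p⦌) (l : Fin (n + 1)) :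
    (s ≫ SimplexCategory.δ (Fin.last (p + 1))).toOrderHom l = (s.toOrderHom l).castSucc := by
  change (Fin.last (p + 1)).succAbove (s.toOrderHom l) = _
  rw [Fin.succAbove_last]

theorem sub_push_restrict_mem {x : Chains k (SimplexPullback f V)} (hx : x ∈ chainSub k (bdry f V)) :
    x - chainMap k (lastIncl V) (chainRestrict k (lastIncl V) x) ∈ chainSub k (lastHorn f V) := by
  refine apply_mem_of_mem_chainSub
    (S := LinearMap.id - chainMap k (lastIncl V) ∘ₗ chainRestrict k (lastIncl V)) (fun {n} z hz => ?_) hx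
  rw [LinearMap.sub_apply, LinearMap.comp_apply, LinearMap.id_apply]
  by_cases h : ∃ z', (lastIncl V).app (op ⦋n⦌) z' = z
  · obtain ⟨z', rfl⟩ := h
    rw [chainRestrict_simplex_app, chainMap_simplex, sub_self]
    exact zero_mem _
  · rw [chainRestrict_simplex_of_notMem _ fun z' hz' => h ⟨z', hz'⟩, map_zero, sub_zero]
    obtain ⟨j, hj⟩ := mem_bdry.1 hz
    refine simplex_mem_chainSub (mem_lastHorn.2 ⟨j, ?_, hj⟩)
    rintro rfl
    obtain ⟨s, hs⟩ := exists_factor_last hj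
    exact h (mem_range_push hs)

theorem push_bdry_mem {x : Chains k (SimplexPullback f (lastFace V))}
    (hx : x ∈ chainSub k (bdry f (lastFace V))) :
    chainMap k (lastIncl V) x ∈ chainSub k (lastHorn f V) :=
  chainMap_mem_chainSub (fun z hz => by
    obtain ⟨j, hj⟩ := mem_bdry.1 hz
    refine mem_lastHorn.2 ⟨j.castSucc, (Fin.castSucc_lt_last j).ne, fun l hl => hj l ?_⟩
    rw [base_push, delta_last_apply] at hl
    exact Fin.castSucc_injective _ hl) hx

theorem push_mem_bdry (x : Chains k (SimplexPullback f (lastFace V))) :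
    chainMap k (lastIncl V) x ∈ chainSub k (bdry f V) :=
  chainMap_mem_chainSub (T := ⊤) (fun z _ => mem_bdry.2 ⟨Fin.last (p + 1), fun l => by
    rw [base_push, delta_last_apply]
    exact (Fin.castSucc_lt_last _).ne⟩) ((Finsupp.mem_supported _ _).2 fun _ _ => trivial)

theorem restrict_lastHorn_mem {x : Chains k (SimplexPullback f V)}
    (hx : x ∈ chainSub k (lastHorn f V)) :
    chainRestrict k (lastIncl V) x ∈ chainSub k (bdry f (lastFace V)) :=
  apply_mem_of_mem_chainSub (fun {n} z hz => by
    by_cases h : ∃ z', (lastIncl V).app (op ⦋n⦌) z' = z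
    · obtain ⟨z', rfl⟩ := h
      rw [chainRestrict_simplex_app]
      obtain ⟨j, hj, hz⟩ := mem_lastHorn.1 hz
      refine simplex_mem_chainSub (mem_bdry.2 ⟨j.castPred hj, fun l hl => hz l ?_⟩)
      rw [base_push, delta_last_apply, hl, Fin.castSucc_castPred]
    · rw [chainRestrict_simplex_of_notMem _ fun z' hz' => h ⟨z', hz'⟩]
      exact zero_mem _) hx

theorem lastHorn_le_bdry : chainSub k (lastHorn f V) ≤ chainSub k (bdry f V) :=
  Finsupp.supported_mono fun _ ⟨j, _, h⟩ => ⟨j, h⟩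

theorem exists_push_eq_of_mem_initial {x : Chains k (SimplexPullback f V)}
    (hx : x ∈ chainSub k (initial f V)) :
    chainMap k (lastIncl V) (chainRestrict k (lastIncl V) x) = x ∧
      chainRestrict k (lastIncl V) x ∈ chainSub k (initial f (lastFace V)) := by
  have key : ∀ {n : ℕ} (z : (SimplexPullback f V) _⦋n⦌), z ∈ (initial f V).obj (op ⦋n⦌) →
      ∃ z' ∈ (initial f (lastFace V)).obj (op ⦋n⦌), (lastIncl V).app (op ⦋n⦌) z' = z := by
    intro n z hz
    have hz := mem_initial.1 hz
    obtain ⟨s, hs⟩ := exists_factor_last (s := base z) fun l => (hz l).trans_ne Fin.last_pos.ne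
    obtain ⟨z', rfl⟩ := mem_range_push hs
    refine ⟨z', mem_initial.2 fun l => ?_, rfl⟩
    have := hz l
    rw [base_push, delta_last_apply] at this
    exact Fin.castSucc_injective _ this
  constructor
  · refine eq_of_mem_chainSub (S := chainMap k (lastIncl V) ∘ₗ chainRestrict k (lastIncl V))
      (S' := LinearMap.id) (fun {n} z hz => ?_) hx
    obtain ⟨z', -, rfl⟩ := key z hz
    rw [LinearMap.comp_apply, chainRestrict_simplex_app, chainMap_simplex]
    rfl
  · refine apply_mem_of_mem_chainSub (fun {n} z hz => ?_) hx
    obtain ⟨z', hz', rfl⟩ := key z hz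
    rw [chainRestrict_simplex_app]
    exact simplex_mem_chainSub hz'

/-- A relative cycle whose restriction to the fibers over the initial vertices is a boundary is a relative
boundary. -/
theorem exists_sub_boundary_mem_bdry [Fibration f] {p : ℕ} (V : I → Y _⦋p⦌) {q : ℕ} {n : ℤ}
    (hn : n = (q + p : ℕ)) {x b : Chains k (SimplexPullback f V)} (hx : x ∈ chainGr k _ n)
    (hd : boundary k _ x ∈ chainSub k (bdry f V)) (hb : b ∈ chainSub k (initial f V))
    (hxb : front k f V (𝟙 _) q x = boundary k _ b) :
    ∃ y, x - boundary k _ y ∈ chainSub k (bdry f V) := by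
  induction p generalizing n with
  | zero =>
    refine ⟨b, ?_⟩
    have h : front k f V (𝟙 ⦋0⦌) q x = x := eq_of_mem_chainGr (T := front k f V (𝟙 ⦋0⦌) q)
      (T' := LinearMap.id) (fun z => by
        rw [front_simplex, if_pos (Subsingleton.elim _ _)]
        exact congrArg _ (face_zero_self z)) hn hx
    rw [← hxb, h, sub_self]
    exact zero_mem _
  | succ p ih =>
    set v := chainRestrict k (lastIncl V) (boundary k _ x) with hv
    set w := boundary k _ x - chainMap k (lastIncl V) v with hw
    have hwΛ : w ∈ chainSub k (lastHorn f V) := sub_push_restrict_mem hd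
    have hd' : boundary k _ x = chainMap k (lastIncl V) v + w := by rw [hw, add_sub_cancel]
    have hdx := boundary_mem_chainGr hx
    have hvg : v ∈ chainGr k _ (n - 1) := chainRestrict_mem_chainGr _ hdx
    have hn' : n - 1 = (q + p : ℕ) := by push_cast at hn ⊢; lia
    have hwg : w ∈ chainGr k _ (n - 1) := sub_mem hdx (chainMap_mem_chainGr _ hvg)
    -- `v` is a relative cycle
    have hdv : boundary k _ v ∈ chainSub k (bdry f (lastFace V)) := by
      have h := congrArg (boundary k _) hd'
      rw [boundary_boundary, map_add, boundary_chainMap, eq_comm, add_eq_zero_iff_eq_neg] at h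
      rw [← chainRestrict_chainMap (lastIncl V) (boundary k _ v), h]
      exact restrict_lastHorn_mem (neg_mem (boundary_mem_chainSub hwΛ))
    -- its restriction to the fibers is a boundary
    have hw₀ : front k f V (SimplexCategory.δ (Fin.last (p + 1))) q w = 0 := by
      refine front_eq_zero (fun z hz h => ?_) hwΛ hn' hwg
      obtain ⟨j, hj, hz⟩ := mem_lastHorn.1 hz
      refine hz ((SimplexCategory.subinterval q p le_rfl).toOrderHom (j.castPred hj)) ?_
      have := congrArg (fun θ => (SimplexCategory.Hom.toOrderHom θ) (j.castPred hj)) h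
      refine this.trans ?_
      change (Fin.last (p + 1)).succAbove (j.castPred hj) = j
      rw [Fin.succAbove_last, Fin.castSucc_castPred]
    set b' := front k f V (SimplexCategory.δ (Fin.last (p + 1))) (q + 1) x +
      ((-1) ^ (q + p + 1) : ℤ) • b with hb'
    have hb'₀ : b' ∈ chainSub k (initial f V) := by
      refine add_mem (front_mem_initial ?_ (n := n) (by push_cast at hn ⊢; lia) hx).1 (zsmul_mem hb _)
      change (Fin.last (p + 1)).succAbove (0 : Fin (p + 1)) = 0
      rw [Fin.succAbove_last, Fin.castSucc_zero]
    obtain ⟨h₁, h₂⟩ := exists_push_eq_of_mem_initial hb'₀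
    obtain ⟨y, hy⟩ := ih (lastFace V) hn' hvg hdv h₂ (by
      apply chainMap_injective (k := k) (lastIncl V)
      have := front_push (V := V) (SimplexCategory.δ (Fin.last (p + 1))) (𝟙 ⦋p⦌) (Category.id_comp _) hn' hvg
      rw [← boundary_chainMap, h₁, hb', map_add, map_zsmul, ← hxb, ← front_boundary_last, hd', map_add,
        hw₀, add_zero]
      exact this.symm)
    have hz : boundary k _ (x - chainMap k (lastIncl V) y) ∈ chainSub k (lastHorn f V) := by
      rw [map_sub, hd', boundary_chainMap, add_sub_right_comm, ← map_sub]
      exact add_mem (push_bdry_mem hy) hwΛ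
    obtain ⟨y', hy'⟩ := exists_sub_boundary_mem_lastHorn V hz
    refine ⟨y', ?_⟩
    have := add_mem (lastHorn_le_bdry hy') (push_mem_bdry y)
    rwa [sub_right_comm, sub_add_cancel] at this

end SimplexPullback

end SerreSS

namespace SerreSS

open CategoryTheory Simplicial Opposite TensorProduct HomotopicalAlgebra SSet.modelCategoryQuillen

section

variable {k : Type v} [Field k] {X Y : SSet.{u}} {f : X ⟶ Y}

theorem apply_mem_of_mem_supported {M : Type*} [AddCommMonoid M] [Module k M]
    {Q : (Σ n : ℕ, X.nonDegenerate n) → Prop} {P : Submodule k M} (T : Chains k X →ₗ[k] M)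
    (h : ∀ (n : ℕ) (σ : X.nonDegenerate n), Q ⟨n, σ⟩ → T (simplex k σ.1) ∈ P) {x : Chains k X}
    (hx : x ∈ Finsupp.supported k k (Set.ofPred Q)) : T x ∈ P :=
  FDG.mem_of_supported (fun s hs => by
    have := h s.1 s.2 hs
    rwa [simplex_of_nonDegenerate] at this) hx

theorem overSkeleton_iff {n m : ℕ} {α : X _⦋n⦌} (s : ⦋n⦌ ⟶ ⦋m⦌) [Epi s] (V : Y.nonDegenerate m)
    (h : f.app (op ⦋n⦌) α = Y.map s.op V.1) (p : ℤ) : OverSkeleton f p α ↔ (m : ℤ) ≤ p := by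
  refine ⟨fun ⟨m', s', β, hs', hm', h'⟩ => ?_, fun hp => ⟨m, s, V.1, inferInstance, hp, h⟩⟩
  obtain ⟨l, t, ht, W, hW⟩ := Y.exists_nonDegenerate β
  have := Y.unique_nonDegenerate_dim _ s V h (s' ≫ t) W (by rw [h', hW, map_map_apply])
  have := SimplexCategory.len_le_of_epi t
  dsimp only at this
  lia

theorem exists_base (f : X ⟶ Y) {n : ℕ} (α : X _⦋n⦌) : ∃ (m : ℕ) (s : ⦋n⦌ ⟶ ⦋m⦌) (_ : Epi s)
    (V : Y.nonDegenerate m), f.app (op ⦋n⦌) α = Y.map s.op V.1 := by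
  obtain ⟨m, s, hs, V, hV⟩ := Y.exists_nonDegenerate (f.app (op ⦋n⦌) α)
  exact ⟨m, s, hs, V, hV⟩

/-- The dimension of the nondegenerate simplex of the base over which `α` lies. -/
noncomputable def baseDim (f : X ⟶ Y) {n : ℕ} (α : X _⦋n⦌) : ℕ := (exists_base f α).choose

theorem overSkeleton_iff_baseDim_le {n : ℕ} (α : X _⦋n⦌) (p : ℤ) :
    OverSkeleton f p α ↔ (baseDim f α : ℤ) ≤ p := by
  obtain ⟨s, hs, V, hV⟩ := (exists_base f α).choose_spec
  exact overSkeleton_iff s V hV p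

theorem isBased_serreFDG (f : X ⟶ Y) :
    FDG.IsBased (serreFDG k f) (fun s => (baseDim f s.2.1 : ℤ)) (fun s => (s.1 : ℤ)) where
  gr_eq _ := rfl
  filt_eq p := congrArg (Finsupp.supported k k)
    (Set.ext fun s => overSkeleton_iff_baseDim_le s.2.1 p)

theorem mem_serreFilt_of_lt {p : ℤ} {n : ℤ} (h : n ≤ p) {x : Chains k X} (hx : x ∈ chainGr k X n) :
    x ∈ serreFilt k f p := by
  refine (Finsupp.supported_mono ?_ : chainGr k X n ≤ serreFilt k f p) hx
  intro s (hs : (s.1 : ℤ) = n)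
  exact ⟨s.1, 𝟙 _, f.app _ s.2.1, inferInstance, by lia,
    (Param.map_id_apply (f.app (op ⦋s.1⦌) s.2.1)).symm⟩

theorem serreFilt_eq_zero {p : ℤ} (hp : p < 0) {x : Chains k X} (hx : x ∈ serreFilt k f p) :
    x = 0 := by
  have : x ∈ Finsupp.supported k k (∅ : Set (Σ n : ℕ, X.nonDegenerate n)) := by
    refine Finsupp.supported_mono ?_ hx
    rintro s ⟨m, -, -, -, hm, -⟩
    exact absurd hm (by lia)
  simpa using this

theorem chainPart_mem_serreFilt {p n : ℤ} {x : Chains k X} (hx : x ∈ serreFilt k f p) :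
    chainPart k X n x ∈ serreFilt k f p := by
  refine supported_induction (Q := fun s => OverSkeleton f p s.2.1) (chainPart k X n)
    (fun m σ hs => ?_) x hx
  rw [chainPart_simplex]
  split_ifs
  · exact simplex_mem_serreFilt hs
  · exact zero_mem _

theorem phi_eq_zero_of_lower {p q : ℕ} {n : ℤ} (hn : n = (q + p : ℕ)) {x : Chains k X}
    (hx : x ∈ serreFilt k f ((p : ℤ) - 1)) (hx' : x ∈ chainGr k X n) : phi k f q x = 0 :=
  FDG.eq_of_supported (S := Set.ofPred (fun s : Σ n : ℕ, X.nonDegenerate n =>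
      OverSkeleton f ((p : ℤ) - 1) s.2.1) ∩ Set.ofPred fun s => (s.1 : ℤ) = n)
    (T := phi k f q) (T' := 0) (fun s hs => by
      obtain ⟨l, α⟩ := s
      obtain ⟨h₁, h₂⟩ := hs
      obtain rfl : l = q + p := by
        have : (l : ℤ) = n := h₂
        lia
      obtain ⟨m, s, β, hs, hm, h⟩ := OverSkeleton.map h₁ (SimplexCategory.subinterval q p le_rfl)
      rw [← simplex_of_nonDegenerate, phi_simplex, simplex_of_degenerate (σ := f.app _ (face _ q p _)),
        TensorProduct.tmul_zero, LinearMap.zero_apply]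
      exact ⟨m, by lia, s, β, h.symm⟩)
    (by
      rw [Finsupp.supported_inter]
      exact ⟨hx, hx'⟩)

end

namespace SimplexPullback

variable {k : Type v} [Field k] {X Y : SSet.{u}} {f : X ⟶ Y} {p : ℕ}

variable (f p) in
/-- The pullback of `f` to the disjoint union of the nondegenerate `p`-simplices of the base. -/
abbrev Cells : SSet.{u} := SimplexPullback f (Subtype.val : Y.nonDegenerate p → Y _⦋p⦌)

theorem eq_of_total_eq {n : ℕ} {z z' : (Cells f p) _⦋n⦌} (h : total z = total z')
    (hz : Epi (base z)) : z = z' := by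
  have h₁ := app_total z
  have h₂ : f.app (op ⦋n⦌) (total z) = _ := (congrArg _ h).trans (app_total z')
  exact ext h (Y.unique_nonDegenerate_simplex _ (base z) _ h₁ (base z') _ h₂)
    (Y.unique_nonDegenerate_map _ (base z) _ h₁ (base z') _ h₂)

theorem epi_base_or_mem_bdry {n : ℕ} (z : (Cells f p) _⦋n⦌) :
    Epi (base z) ∨ z ∈ (bdry f (Subtype.val : Y.nonDegenerate p → Y _⦋p⦌)).obj (op ⦋n⦌) := by
  rw [SimplexCategory.epi_iff_surjective, mem_bdry, Function.Surjective, or_iff_not_imp_left]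
  push Not
  exact id

theorem overSkeleton_total {n : ℕ} (z : (Cells f p) _⦋n⦌) : OverSkeleton f p (total z) := by
  have : OverSkeleton (𝟙 Y) p (Y.map (base z).op (index z).1) :=
    OverSkeleton.map (f := 𝟙 Y) ⟨p, 𝟙 _, (index z).1, inferInstance, le_rfl,
      (Param.map_id_apply (index z).1).symm⟩ (base z)
  obtain ⟨m, s, β, hs, hm, h⟩ := this
  exact ⟨m, s, β, hs, hm, (app_total z).trans h⟩

theorem overSkeleton_total_of_mem_bdry {n : ℕ} {z : (Cells f p) _⦋n⦌}
    (hz : z ∈ (bdry f (Subtype.val : Y.nonDegenerate p → Y _⦋p⦌)).obj (op ⦋n⦌)) :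
    OverSkeleton f ((p : ℤ) - 1) (total z) := by
  obtain ⟨j, hj⟩ := mem_bdry.1 hz
  rcases p with _ | p
  · exact absurd (Subsingleton.elim (α := Fin 1) _ _) (hj 0)
  · obtain ⟨i, s, hs⟩ := SimplexCategory.eq_comp_δ_of_not_surjective (base z) fun h => by
      obtain ⟨l, hl⟩ := h j
      exact hj l hl
    have : OverSkeleton (𝟙 Y) (((p + 1 : ℕ) : ℤ) - 1)
        (Y.map s.op (Y.map (SimplexCategory.δ i).op (index z).1)) :=
      OverSkeleton.map (f := 𝟙 Y) ⟨p, 𝟙 _, Y.map (SimplexCategory.δ i).op (index z).1, inferInstance,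
        by push_cast; lia, (Param.map_id_apply (Y.map (SimplexCategory.δ i).op (index z).1)).symm⟩ s
    rw [map_map_apply, ← hs] at this
    obtain ⟨m, s, β, hs, hm, h⟩ := this
    exact ⟨m, s, β, hs, hm, (app_total z).trans h⟩

variable (k f p) in
open Classical in
/-- The chain map from the chains over the `p`-skeleton to the chains of the cells. -/
noncomputable def toCells : Chains k X →ₗ[k] Chains k (Cells f p) :=
  Finsupp.linearCombination k fun s =>
    if h : ∃ z : (Cells f p) _⦋s.1⦌, total z = s.2.1 ∧ Epi (base z) then simplex k h.choose else 0

theorem toCells_simplex_total {n : ℕ} (z : (Cells f p) _⦋n⦌) [hz : Epi (base z)] :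
    toCells k f p (simplex k (total z)) = simplex k z := by
  by_cases h : total z ∈ X.nonDegenerate n
  · rw [simplex_of_nonDegenerate ⟨_, h⟩, toCells, Finsupp.linearCombination_single, one_smul]
    have H : ∃ z' : (Cells f p) _⦋n⦌, total z' = total z ∧ Epi (base z') := ⟨z, rfl, hz⟩
    refine (dif_pos H).trans (congrArg _ ?_)
    exact eq_of_total_eq H.choose_spec.1 H.choose_spec.2
  · have h' := (X.mem_degenerate_iff_notMem_nonDegenerate _).2 h
    rw [simplex_of_degenerate h', map_zero, simplex_of_degenerate]
    rcases n with _ | n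
    · rw [SSet.degenerate_zero] at h'
      exact h'.elim
    · rw [SSet.degenerate_eq_iUnion_range_σ] at h'
      obtain ⟨i, α, hα⟩ := Set.mem_iUnion.1 h'
      obtain ⟨l, t, ht, W, hW⟩ := exists_base f α
      have h₁ := app_total z
      have h₂ : f.app (op ⦋n + 1⦌) (total z) = Y.map (SimplexCategory.σ i ≫ t).op W.1 := by
        rw [← hα, ← map_map_apply, ← hW]
        exact app_map f _ α
      obtain rfl := Y.unique_nonDegenerate_dim _ (base z) _ h₁ (SimplexCategory.σ i ≫ t) _ h₂
      refine ⟨n, Nat.lt_succ_self n, SimplexCategory.σ i, mk _ α W t hW, ?_⟩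
      exact (eq_of_total_eq hα.symm hz).symm

theorem toCells_simplex_eq_zero {n : ℕ} {α : X _⦋n⦌}
    (h : ∀ z : (Cells f p) _⦋n⦌, Epi (base z) → total z ≠ α) : toCells k f p (simplex k α) = 0 := by
  by_cases hα : α ∈ X.nonDegenerate n
  · rw [simplex_of_nonDegenerate ⟨_, hα⟩, toCells, Finsupp.linearCombination_single, one_smul]
    exact dif_neg fun ⟨z, hz, hz'⟩ => h z hz' hz
  · rw [simplex, dif_neg hα, map_zero]

theorem toCells_of_lower {x : Chains k X} (hx : x ∈ serreFilt k f ((p : ℤ) - 1)) :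
    toCells k f p x = 0 := by
  refine (Submodule.mem_bot k).1 (apply_mem_of_mem_supported (P := ⊥)
    (Q := fun s => OverSkeleton f ((p : ℤ) - 1) s.2.1) (toCells k f p) (fun n α hα => ?_) hx)
  rw [Submodule.mem_bot]
  refine toCells_simplex_eq_zero fun z hz h => ?_
  have := (overSkeleton_iff (base z) (index z) (h ▸ app_total z) _).1 hα
  lia

theorem sub_fst_toCells_mem {x : Chains k X} (hx : x ∈ serreFilt k f p) :
    x - chainMap k (fst f _) (toCells k f p x) ∈ serreFilt k f ((p : ℤ) - 1) := by
  refine supported_induction (Q := fun s => OverSkeleton f p s.2.1)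
    (LinearMap.id - chainMap k (fst f _) ∘ₗ toCells k f p) (fun n α hα => ?_) x hx
  rw [LinearMap.sub_apply, LinearMap.comp_apply, LinearMap.id_apply]
  obtain ⟨m, s, hs, V, hV⟩ := exists_base f α.1
  have hm := (overSkeleton_iff s V hV _).1 hα
  by_cases h : m = p
  · subst h
    have := toCells_simplex_total (k := k) (mk (Subtype.val : Y.nonDegenerate m → Y _⦋m⦌) α.1 V s hV)
      (hz := hs)
    rw [show simplex k α.1 = simplex k (total (mk (Subtype.val : Y.nonDegenerate m → Y _⦋m⦌) α.1 V s hV))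
      from rfl, this, chainMap_simplex]
    change simplex k α.1 - simplex k α.1 ∈ _
    rw [sub_self]
    exact zero_mem _
  · have : OverSkeleton f ((p : ℤ) - 1) α.1 := (overSkeleton_iff s V hV _).2 (by lia)
    rw [toCells_of_lower (simplex_mem_serreFilt this), map_zero, sub_zero]
    exact simplex_mem_serreFilt this

theorem sub_toCells_fst_mem (z : Chains k (Cells f p)) :
    z - toCells k f p (chainMap k (fst f _) z) ∈ chainSub k (bdry f _) := by
  refine apply_mem_of_mem_chainSub (T := ⊤) (S := LinearMap.id - toCells k f p ∘ₗ chainMap k (fst f _))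
    (fun {n} z _ => ?_) ((Finsupp.mem_supported _ _).2 fun _ _ => trivial)
  rw [LinearMap.sub_apply, LinearMap.comp_apply, LinearMap.id_apply, chainMap_simplex]
  rcases epi_base_or_mem_bdry z with h | h
  · rw [show (fst f _).app (op ⦋n⦌) z = total z from rfl, toCells_simplex_total z, sub_self]
    exact zero_mem _
  · rw [show (fst f _).app (op ⦋n⦌) z = total z from rfl,
      toCells_of_lower (simplex_mem_serreFilt (overSkeleton_total_of_mem_bdry h)), sub_zero]
    exact simplex_mem_chainSub h

theorem fst_mem (z : Chains k (Cells f p)) : chainMap k (fst f _) z ∈ serreFilt k f p := by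
  refine apply_mem_of_mem_chainSub (T := ⊤) (fun {n} z _ => ?_)
    ((Finsupp.mem_supported _ _).2 fun _ _ => trivial)
  rw [chainMap_simplex]
  exact simplex_mem_serreFilt (overSkeleton_total z)

theorem fst_mem_of_mem_bdry {z : Chains k (Cells f p)} (hz : z ∈ chainSub k (bdry f _)) :
    chainMap k (fst f _) z ∈ serreFilt k f ((p : ℤ) - 1) := by
  refine apply_mem_of_mem_chainSub (fun {n} z hz => ?_) hz
  rw [chainMap_simplex]
  exact simplex_mem_serreFilt (overSkeleton_total_of_mem_bdry hz)

theorem toCells_mem_chainGr {n : ℤ} {x : Chains k X} (hx : x ∈ chainGr k X n) :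
    toCells k f p x ∈ chainGr k _ n := by
  refine apply_mem_of_mem_supported (Q := fun s => (s.1 : ℤ) = n) (toCells k f p) (fun m α hm => ?_) hx
  by_cases h : ∃ z : (Cells f p) _⦋m⦌, total z = α.1 ∧ Epi (base z)
  · obtain ⟨z, hz, hz'⟩ := h
    rw [← hz, toCells_simplex_total]
    exact simplex_mem_chainGr _ hm
  · rw [toCells_simplex_eq_zero fun z hz' hz => h ⟨z, hz, hz'⟩]
    exact zero_mem _

variable (k f p) in
/-- The map `(α, V, s) ↦ α ⊗ V`. -/
noncomputable def totalTmulIndex : Chains k (Cells f p) →ₗ[k] Chains k X ⊗[k] Chains k Y :=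
  Finsupp.linearCombination k fun s => simplex k (total s.2.1) ⊗ₜ simplex k (index s.2.1).1

theorem totalTmulIndex_simplex {n : ℕ} (z : (Cells f p) _⦋n⦌) :
    totalTmulIndex k f p (simplex k z) = simplex k (total z) ⊗ₜ simplex k (index z).1 := by
  by_cases h : z ∈ (Cells f p).nonDegenerate n
  · rw [simplex_of_nonDegenerate ⟨z, h⟩, totalTmulIndex, Finsupp.linearCombination_single, one_smul]
  · obtain ⟨m, hm, θ, z', rfl⟩ := ((Cells f p).mem_degenerate_iff_notMem_nonDegenerate _).2 h
    rw [simplex, dif_neg h, map_zero, simplex_of_degenerate, TensorProduct.zero_tmul]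
    exact ⟨m, hm, θ, total z', rfl⟩

theorem phi_fst {q : ℕ} {n : ℤ} (hn : n = (q + p : ℕ)) {z : Chains k (Cells f p)}
    (hz : z ∈ chainGr k _ n) :
    phi k f q (chainMap k (fst f _) z) = totalTmulIndex k f p (front k f _ (𝟙 _) q z) := by
  refine eq_of_mem_chainGr (T := phi k f q ∘ₗ chainMap k (fst f _))
    (T' := totalTmulIndex k f p ∘ₗ front k f _ (𝟙 _) q) (fun z => ?_) hn hz
  rw [LinearMap.comp_apply, LinearMap.comp_apply, chainMap_simplex, phi_simplex, front_simplex]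
  have e : f.app (op ⦋p⦌) (face (total z) q p le_rfl) =
      Y.map (SimplexCategory.subinterval q p le_rfl ≫ base z).op (index z).1 := by
    rw [app_face, app_total]
    exact map_map_apply _ _ _
  change simplex k (face (total z) 0 q _) ⊗ₜ simplex k (f.app (op ⦋p⦌) (face (total z) q p le_rfl)) = _
  split_ifs with h
  · rw [totalTmulIndex_simplex, e, h, Param.map_id_apply]
    rfl
  · rw [map_zero, simplex_of_degenerate (σ := f.app (op ⦋p⦌) _), TensorProduct.tmul_zero]
    rw [e, Y.mem_degenerate_iff_notMem_nonDegenerate]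
    intro hn
    have := Y.mono_of_nonDegenerate ⟨_, hn⟩ _ (index z).1 rfl
    exact h (SimplexCategory.eq_id_of_mono _)

end SimplexPullback

end SerreSS

namespace SerreSS

open CategoryTheory Simplicial Opposite TensorProduct HomotopicalAlgebra SSet.modelCategoryQuillen

namespace SimplexPullback

variable {k : Type v} [Field k] {X Y : SSet.{u}} {f : X ⟶ Y} {p : ℕ}
  {A : Y.nonDegenerate p → SSet.{u}} (a : ∀ V, A V ⟶ X)
  (ha : ∀ (V : Y.nonDegenerate p) {n : ℕ} (U : X _⦋n⦌),
    InFiber f U V.1 ↔ ∃ u : (A V) _⦋n⦌, (a V).app (op ⦋n⦌) u = U)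

/-- The inclusion of the fiber over the initial vertex of `V`. -/
def fiberCell (V : Y.nonDegenerate p) : A V ⟶ Cells f p where
  app n := TypeCat.ofHom fun u => mk (n := n.unop.len) _ ((a V).app n u) V
    (SimplexCategory.const ⦋n.unop.len⦌ ⦋p⦌ 0) ((ha V (n := n.unop.len) _).2 ⟨u, rfl⟩)
  naturality n m θ := by
    ext u
    exact ext (n := m.unop.len)
      (app_map (n := n.unop.len) (m := m.unop.len) (a V) θ.unop u) rfl rfl

instance [∀ V, Mono (a V)] (V : Y.nonDegenerate p) : Mono (fiberCell a ha V) := by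
  rw [NatTrans.mono_iff_mono_app]
  intro n
  rw [mono_iff_injective]
  intro u u' h
  have hi : Function.Injective ((a V).app n) := (mono_iff_injective _).1 inferInstance
  exact hi (congrArg (total (n := n.unop.len)) h)

theorem exists_fiberCell_eq {n : ℕ} {z : (Cells f p) _⦋n⦌}
    (hz : z ∈ (initial f (Subtype.val : Y.nonDegenerate p → Y _⦋p⦌)).obj (op ⦋n⦌)) :
    ∃ u, (fiberCell a ha (index z)).app (op ⦋n⦌) u = z := by
  have hb : base z = SimplexCategory.const ⦋n⦌ ⦋p⦌ 0 :=
    SimplexCategory.Hom.ext _ _ (OrderHom.ext _ _ (funext (mem_initial.1 hz)))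
  obtain ⟨u, hu⟩ := (ha (index z) (total z)).1 (by rw [InFiber, app_total, hb])
  exact ⟨u, ext hu rfl hb.symm⟩

theorem fiberCell_mem_initial (V : Y.nonDegenerate p) (x : Chains k (A V)) :
    chainMap k (fiberCell a ha V) x ∈ chainSub k (initial f _) :=
  chainMap_mem_chainSub (T := ⊤) (fun _ _ => mem_initial.2 fun _ => rfl)
    ((Finsupp.mem_supported _ _).2 fun _ _ => trivial)

theorem restrict_fiberCell_of_ne {V V' : Y.nonDegenerate p} (h : V' ≠ V) (x : Chains k (A V')) :
    chainRestrict k (fiberCell a ha V) (chainMap k (fiberCell a ha V') x) = 0 :=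
  chains_lhom_ext (f := chainRestrict k (fiberCell a ha V) ∘ₗ chainMap k (fiberCell a ha V')) (g := 0)
    (fun n u => by
      rw [LinearMap.comp_apply, chainMap_simplex, chainRestrict_simplex_of_notMem, LinearMap.zero_apply]
      exact fun z hz => h (congrArg index hz).symm) x

theorem restrict_fiberCell_boundary [∀ V, Mono (a V)] (V : Y.nonDegenerate p) {c : Chains k (Cells f p)}
    (hc : c ∈ chainSub k (initial f _)) :
    chainRestrict k (fiberCell a ha V) (boundary k _ c) =
      boundary k _ (chainRestrict k (fiberCell a ha V) c) := by
  refine eq_of_mem_chainSub (S := chainRestrict k (fiberCell a ha V) ∘ₗ boundary k _)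
    (S' := boundary k _ ∘ₗ chainRestrict k (fiberCell a ha V)) (fun {n} z hz => ?_) hc
  obtain ⟨u, hu⟩ := exists_fiberCell_eq a ha hz
  rw [LinearMap.comp_apply, LinearMap.comp_apply, ← hu, ← chainMap_simplex, boundary_chainMap]
  by_cases h : index z = V
  · subst h
    rw [chainRestrict_chainMap, chainRestrict_chainMap]
  · rw [restrict_fiberCell_of_ne a ha h, restrict_fiberCell_of_ne a ha h, map_zero]

theorem exists_eq_sum_fiberCell [∀ V, Mono (a V)] {c : Chains k (Cells f p)}
    (hc : c ∈ chainSub k (initial f _)) : ∃ T : Finset (Y.nonDegenerate p),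
      c = ∑ V ∈ T, chainMap k (fiberCell a ha V) (chainRestrict k (fiberCell a ha V) c) := by
  classical
  obtain ⟨T, hT⟩ : ∃ T : Finset (Y.nonDegenerate p), ∀ s ∈ c.support, index s.2.1 ∈ T :=
    ⟨c.support.image fun s => index s.2.1, fun s hs => Finset.mem_image.2 ⟨s, hs, rfl⟩⟩
  have key : ∀ (n : ℕ) (z : (Cells f p) _⦋n⦌), z ∈ (initial f _).obj (op ⦋n⦌) → index z ∈ T →
      simplex k z = ∑ V ∈ T, chainMap k (fiberCell a ha V)
        (chainRestrict k (fiberCell a ha V) (simplex k z)) := by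
    intro n z hz hzT
    obtain ⟨u, hu⟩ := exists_fiberCell_eq a ha hz
    have hu' : simplex k z = chainMap k (fiberCell a ha (index z)) (simplex k u) := by
      rw [chainMap_simplex, hu]
    rw [Finset.sum_eq_single_of_mem _ hzT, hu', chainRestrict_chainMap]
    intro V _ hV
    rw [hu', restrict_fiberCell_of_ne a ha hV.symm, map_zero]
  refine ⟨T, ?_⟩
  have := FDG.eq_of_supported (k := k) (T := LinearMap.id)
    (S := Set.ofPred fun s => s.2.1 ∈ (initial f Subtype.val).obj (op ⦋s.1⦌) ∧ index s.2.1 ∈ T)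
    (T' := ∑ V ∈ T, chainMap k (fiberCell a ha V) ∘ₗ chainRestrict k (fiberCell a ha V))
    (fun s hs => by
      rw [LinearMap.id_apply, LinearMap.sum_apply, ← simplex_of_nonDegenerate]
      exact key _ _ hs.1 hs.2) (x := c) ((Finsupp.mem_supported _ _).2 fun s hs =>
      ⟨(Finsupp.mem_supported _ _).1 hc hs, hT s hs⟩)
  rw [LinearMap.sum_apply] at this
  exact this

theorem totalTmulIndex_fiberCell (V : Y.nonDegenerate p) (x : Chains k (A V)) :
    totalTmulIndex k f p (chainMap k (fiberCell a ha V) x) = chainMap k (a V) x ⊗ₜ simplex k V.1 :=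
  chains_lhom_ext (f := totalTmulIndex k f p ∘ₗ chainMap k (fiberCell a ha V))
    (g := (TensorProduct.mk k _ _).flip (simplex k V.1) ∘ₗ chainMap k (a V)) (fun n u => by
      rw [LinearMap.comp_apply, LinearMap.comp_apply, chainMap_simplex, chainMap_simplex,
        totalTmulIndex_simplex]
      rfl) x

end SimplexPullback

open SimplexPullback in
/-- The image under `φ` of a chain of filtration `p` consists of chains of the fibers over the initial
vertices. If the chain is a cycle modulo lower filtration, then these are cycles; if they are boundaries,
then the chain is a boundary modulo lower filtration. -/
theorem exists_phi_eq_sum {k : Type v} [Field k] {X Y : SSet.{u}} {f : X ⟶ Y} [Fibration f] {p q : ℕ}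
    {A : Y.nonDegenerate p → SSet.{u}} (a : ∀ V, A V ⟶ X) [∀ V, Mono (a V)]
    (ha : ∀ (V : Y.nonDegenerate p) {n : ℕ} (U : X _⦋n⦌),
      InFiber f U V.1 ↔ ∃ u : (A V) _⦋n⦌, (a V).app (op ⦋n⦌) u = U)
    {x : Chains k X} (hx : x ∈ (serreFDG k f).deg p (p + q)) :
    ∃ (T : Finset (Y.nonDegenerate p)) (c : ∀ V, Chains k (A V)),
      (∀ V, c V ∈ chainGr k _ q) ∧
      phi k f q x = ∑ V ∈ T, chainMap k (a V) (c V) ⊗ₜ simplex k V.1 ∧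
      (x ∈ (serreFDG k f).Z 1 (p, q) → (∀ V, boundary k _ (c V) = 0) ∧
        ((∀ V ∈ T, ∃ b, boundary k _ b = c V) → ∃ y ∈ (serreFDG k f).deg p (p + q + 1),
          x - boundary k X y ∈ (serreFDG k f).deg (p - 1) (p + q))) := by
  obtain ⟨hxf, hxg⟩ := hx
  change x ∈ serreFilt k f p at hxf
  change x ∈ chainGr k X (p + q) at hxg
  have hn : (p + q : ℤ) = (q + p : ℕ) := by push_cast; ring
  set z := toCells k f p x with hz
  have hzg : z ∈ chainGr k _ (p + q) := toCells_mem_chainGr hxg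
  have hxz : x - chainMap k (fst f _) z ∈ serreFilt k f ((p : ℤ) - 1) := sub_fst_toCells_mem hxf
  have hxzg : x - chainMap k (fst f _) z ∈ chainGr k X (p + q) :=
    sub_mem hxg (chainMap_mem_chainGr _ hzg)
  set c := front k f Subtype.val (𝟙 ⦋p⦌) q z with hc
  obtain ⟨hci, hcg⟩ := front_mem_initial (q := q) (η := 𝟙 ⦋p⦌) rfl hn hzg
  rw [← hc] at hci hcg
  obtain ⟨T, hT⟩ := exists_eq_sum_fiberCell a ha hci
  refine ⟨T, fun V => chainRestrict k (fiberCell a ha V) c, fun V =>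
    chainRestrict_mem_chainGr _ hcg, ?_, fun hxZ => ?_⟩
  · have h := phi_eq_zero_of_lower hn hxz hxzg
    rw [map_sub, sub_eq_zero] at h
    rw [h, phi_fst hn hzg, ← hc]
    conv_lhs => rw [hT, map_sum]
    exact Finset.sum_congr rfl fun V _ => totalTmulIndex_fiberCell a ha V _
  have hdf : boundary k X x ∈ serreFilt k f (p - 1) := hxZ.2.1
  have hdz : boundary k _ z ∈ chainSub k (bdry f _) := by
    have h₁ : chainMap k (fst f _) (boundary k _ z) ∈ serreFilt k f ((p : ℤ) - 1) := by
      rw [← boundary_chainMap, ← sub_sub_cancel x (chainMap k (fst f _) z), map_sub]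
      exact sub_mem hdf (boundary_mem_serreFilt hxz)
    have h₂ := sub_toCells_fst_mem (boundary k _ z)
    rwa [toCells_of_lower h₁, sub_zero] at h₂
  have hdc : boundary k _ c = 0 := by
    rcases q with _ | q
    · have h := boundary_mem_chainGr hcg
      refine (Submodule.mem_bot k).1 (FDG.mem_of_supported (T := LinearMap.id) (P := ⊥) (fun s hs => ?_) h)
      have hs : (s.1 : ℤ) = ((0 : ℕ) : ℤ) - 1 := hs
      exact absurd hs (by push_cast; lia)
    · rw [hc, ← front_boundary_top]
      refine front_eq_zero (fun z hz h => ?_) hdz (n := p + q) (by push_cast; ring) ?_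
      · obtain ⟨j, hj⟩ := mem_bdry.1 hz
        exact hj _ (congrArg (fun θ => (SimplexCategory.Hom.toOrderHom θ) j) h)
      · have := boundary_mem_chainGr hzg
        rwa [Nat.cast_succ, ← add_assoc, add_sub_cancel_right] at this
  refine ⟨fun V => ?_, fun hb => ?_⟩
  · rw [← restrict_fiberCell_boundary a ha V hci, hdc, map_zero]
  · choose! b hb using hb
    obtain ⟨y, hy⟩ := exists_sub_boundary_mem_bdry (f := f) Subtype.val hn hzg hdz
      (b := ∑ V ∈ T, chainMap k (fiberCell a ha V) (b V))
      (Submodule.sum_mem _ fun V _ => fiberCell_mem_initial a ha V _) (by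
        rw [← hc, map_sum]
        conv_lhs => rw [hT]
        refine Finset.sum_congr rfl fun V hV => ?_
        rw [boundary_chainMap, hb V hV])
    have hy' := add_mem hxz (fst_mem_of_mem_bdry hy)
    rw [map_sub, sub_add_sub_cancel, ← boundary_chainMap] at hy'
    refine ⟨chainPart k X (p + q + 1) (chainMap k (fst f _) y),
      ⟨chainPart_mem_serreFilt (fst_mem y), chainPart_mem_chainGr _ _⟩, ?_⟩
    have h := chainPart_mem_serreFilt (n := p + q) hy'
    rw [map_sub, chainPart_of_mem hxg, if_pos rfl] at h
    rw [boundary_chainPart, add_sub_cancel_right]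
    exact ⟨h, sub_mem hxg (chainPart_mem_chainGr _ _)⟩

end SerreSS

namespace SerreSS

open CategoryTheory Simplicial Opposite TensorProduct

section HomologyPart

variable {k : Type v} [Field k] {X Y : SSet.{u}}

variable (k X) in
/-- The projection to the homology in degree `q`. -/
noncomputable def homologyPart (q : ℤ) :
    (chainDG k X).Homology →ₗ[k] (chainDG k X).Homology :=
  Submodule.mapQ _ _
    ((chainPart k X q).restrict (p := LinearMap.ker (chainDG k X).d)
      (q := LinearMap.ker (chainDG k X).d) fun x (hx : boundary k X x = 0) => by
        change boundary k X (chainPart k X q x) = 0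
        rw [boundary_chainPart, hx, map_zero])
    (by
      rintro ⟨x, hx⟩ ⟨y, hy⟩
      change boundary k X y = x at hy
      refine ⟨chainPart k X (q + 1) y, ?_⟩
      change boundary k X (chainPart k X (q + 1) y) = chainPart k X q x
      rw [boundary_chainPart, hy, add_sub_cancel_right])

theorem chainPart_mem_ker (q : ℤ) (x : LinearMap.ker (chainDG k X).d) :
    chainPart k X q x.1 ∈ LinearMap.ker (chainDG k X).d := by
  change boundary k X (chainPart k X q x.1) = 0
  rw [boundary_chainPart, show boundary k X x.1 = 0 from x.2, map_zero]

theorem homologyPart_cls (q : ℤ) (x : LinearMap.ker (chainDG k X).d) :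
    homologyPart k X q ((chainDG k X).cls x) =
      (chainDG k X).cls ⟨chainPart k X q x.1, chainPart_mem_ker q x⟩ := rfl

theorem homologyPart_cls_of_mem {q : ℤ} {x : LinearMap.ker (chainDG k X).d}
    (hx : x.1 ∈ chainGr k X q) : homologyPart k X q ((chainDG k X).cls x) = (chainDG k X).cls x := by
  rw [homologyPart_cls]
  congr 1
  exact Subtype.ext ((chainPart_of_mem hx).trans (if_pos rfl))

theorem homologyPart_homologyMap (f : X ⟶ Y) (q : ℤ) (z : (chainDG k X).Homology) :
    homologyPart k Y q (homologyMap k f z) = homologyMap k f (homologyPart k X q z) := by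
  obtain ⟨x, rfl⟩ := (chainDG k X).cls_surjective z
  rw [homologyMap_cls, homologyPart_cls, homologyPart_cls, homologyMap_cls]
  congr 1
  exact Subtype.ext (chainPart_chainMap f q x.1)

theorem chainPart_chainPart (p q : ℤ) (x : Chains k X) :
    chainPart k X p (chainPart k X q x) = if q = p then chainPart k X q x else 0 :=
  chainPart_of_mem (chainPart_mem_chainGr q x)

theorem chainPart_neg {q : ℤ} (hq : q < 0) (x : Chains k X) : chainPart k X q x = 0 :=
  chains_lhom_ext (f := chainPart k X q) (g := 0)
    (fun n σ => by rw [chainPart_simplex, if_neg (by lia), LinearMap.zero_apply]) x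

theorem homologyPart_neg {q : ℤ} (hq : q < 0) (z : (chainDG k X).Homology) :
    homologyPart k X q z = 0 := by
  obtain ⟨x, rfl⟩ := (chainDG k X).cls_surjective z
  rw [homologyPart_cls, DG.cls_eq_zero_iff]
  exact ⟨0, by rw [map_zero]; exact (chainPart_neg hq _).symm⟩

theorem homologyPart_homologyPart (p q : ℤ) (z : (chainDG k X).Homology) :
    homologyPart k X p (homologyPart k X q z) = if q = p then homologyPart k X q z else 0 := by
  obtain ⟨x, rfl⟩ := (chainDG k X).cls_surjective z
  rw [homologyPart_cls, homologyPart_cls]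
  split_ifs with h
  · congr 1
    exact Subtype.ext ((chainPart_chainPart p q x.1).trans (if_pos h))
  · rw [DG.cls_eq_zero_iff]
    exact ⟨0, by rw [map_zero]; exact ((chainPart_chainPart p q x.1).trans (if_neg h)).symm⟩

theorem homologySgn_homologyPart (q : ℤ) (z : (chainDG k X).Homology) :
    (chainDG k X).homologySgn (homologyPart k X q z) =
      (q.negOnePow : ℤ) • homologyPart k X q z := by
  obtain ⟨x, rfl⟩ := (chainDG k X).cls_surjective z
  rw [homologyPart_cls, ← map_zsmul]
  change (chainDG k X).cls _ = _
  congr 1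
  exact Subtype.ext (chainSgn_chainPart q x.1)

theorem exists_sum_chainPart (x : Chains k X) :
    ∃ S : Finset ℤ, ∑ q ∈ S, chainPart k X q x = x := by
  classical
  obtain ⟨S, hS⟩ : ∃ S : Finset ℤ, ∀ s ∈ x.support, (s.1 : ℤ) ∈ S :=
    ⟨x.support.image fun s => (s.1 : ℤ), fun s hs => Finset.mem_image.2 ⟨s, hs, rfl⟩⟩
  refine ⟨S, ?_⟩
  have := FDG.eq_of_supported (k := k) (S := x.support)
    (T := ∑ q ∈ S, chainPart k X q) (T' := LinearMap.id)
    (fun s hs => by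
      rw [LinearMap.sum_apply, Finset.sum_eq_single_of_mem (s.1 : ℤ) (hS s hs), ← simplex_of_nonDegenerate, chainPart_simplex, if_pos rfl]
      · rfl
      · intro q _ hq
        rw [← simplex_of_nonDegenerate, chainPart_simplex, if_neg hq.symm])
    (x := x) ((Finsupp.mem_supported _ _).2 le_rfl)
  rw [LinearMap.sum_apply] at this
  exact this

theorem exists_sum_homologyPart (z : (chainDG k X).Homology) :
    ∃ S : Finset ℤ, ∑ q ∈ S, homologyPart k X q z = z := by
  obtain ⟨x, rfl⟩ := (chainDG k X).cls_surjective z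
  obtain ⟨S, hS⟩ := exists_sum_chainPart x.1
  refine ⟨S, ?_⟩
  simp_rw [homologyPart_cls]
  rw [← map_sum]
  congr 1
  exact Subtype.ext (by rw [AddSubmonoidClass.coe_finsetSum]; exact hS)

/-! ### The bigrading of `C(Y) ⊗ H(X)` -/

variable (k X Y) in
/-- The projection to the component of bidegree `(p, q)`. -/
noncomputable def bidegreePart (i : ℤ × ℤ) : Chains k Y ⊗[k] (chainDG k X).Homology →ₗ[k]
    Chains k Y ⊗[k] (chainDG k X).Homology :=
  TensorProduct.map (chainPart k Y i.1) (homologyPart k X i.2)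

theorem bidegreePart_bidegreePart (i j : ℤ × ℤ) (x) :
    bidegreePart k X Y i (bidegreePart k X Y j x) = if j = i then bidegreePart k X Y j x else 0 := by
  induction x with
  | zero => simp
  | add x y hx hy =>
    simp only [map_add, hx, hy]
    split_ifs
    · rfl
    · exact add_zero 0
  | tmul a b =>
    rw [bidegreePart, bidegreePart, TensorProduct.map_tmul, TensorProduct.map_tmul,
      chainPart_chainPart, homologyPart_homologyPart]
    by_cases h₁ : j.1 = i.1
    · by_cases h₂ : j.2 = i.2
      · rw [if_pos h₁, if_pos h₂, if_pos (Prod.ext h₁ h₂)]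
      · rw [if_neg h₂, if_neg fun h => h₂ (congrArg Prod.snd h), TensorProduct.tmul_zero]
    · rw [if_neg h₁, if_neg fun h => h₁ (congrArg Prod.fst h), TensorProduct.zero_tmul]

theorem bidegreePart_eq_zero {i : ℤ × ℤ} (hi : i.1 < 0 ∨ i.2 < 0) (x) :
    bidegreePart k X Y i x = 0 := by
  induction x with
  | zero => simp
  | add x y hx hy => rw [map_add, hx, hy, add_zero]
  | tmul a b =>
    rw [bidegreePart, TensorProduct.map_tmul]
    rcases hi with hi | hi
    · rw [chainPart_neg hi, TensorProduct.zero_tmul]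
    · rw [homologyPart_neg hi, TensorProduct.tmul_zero]

theorem exists_sum_bidegreePart (x) :
    ∃ S : Finset (ℤ × ℤ), ∑ i ∈ S, bidegreePart k X Y i x = x := by
  classical
  have mono : ∀ x (S S' : Finset (ℤ × ℤ)), S ⊆ S' → ∑ i ∈ S, bidegreePart k X Y i x = x →
      ∑ i ∈ S', bidegreePart k X Y i x = x := by
    intro x S S' hS h
    refine Eq.trans (Finset.sum_subset hS fun i _ hi => ?_).symm h
    rw [← h, map_sum]
    exact Finset.sum_eq_zero fun j hj => (bidegreePart_bidegreePart i j x).trans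
      (if_neg fun e : j = i => hi (e ▸ hj))
  have hadd : ∀ x y, (∃ S : Finset (ℤ × ℤ), ∑ i ∈ S, bidegreePart k X Y i x = x) →
      (∃ S : Finset (ℤ × ℤ), ∑ i ∈ S, bidegreePart k X Y i y = y) →
      ∃ S : Finset (ℤ × ℤ), ∑ i ∈ S, bidegreePart k X Y i (x + y) = x + y := by
    rintro x y ⟨S, hS⟩ ⟨S', hS'⟩
    refine ⟨S ∪ S', ?_⟩
    simp_rw [map_add]
    rw [Finset.sum_add_distrib, mono x S _ Finset.subset_union_left hS,
      mono y S' _ Finset.subset_union_right hS']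
  have hsum : ∀ {ι : Type} (T : Finset ι) (g : ι → Chains k Y ⊗[k] (chainDG k X).Homology),
      (∀ t ∈ T, ∃ S : Finset (ℤ × ℤ), ∑ i ∈ S, bidegreePart k X Y i (g t) = g t) →
      ∃ S : Finset (ℤ × ℤ), ∑ i ∈ S, bidegreePart k X Y i (∑ t ∈ T, g t) = ∑ t ∈ T, g t := by
    intro ι T g h
    induction T using Finset.induction_on with
    | empty => exact ⟨∅, by simp⟩
    | insert t T ht ih =>
      rw [Finset.sum_insert ht]
      exact hadd _ _ (h t (Finset.mem_insert_self _ _))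
        (ih fun t ht => h t (Finset.mem_insert_of_mem ht))
  induction x with
  | zero => exact ⟨∅, by simp⟩
  | add x y hx hy => exact hadd x y hx hy
  | tmul a b =>
    obtain ⟨S, hS⟩ := exists_sum_chainPart a
    obtain ⟨S', hS'⟩ := exists_sum_homologyPart b
    rw [← hS, ← hS', TensorProduct.sum_tmul]
    refine hsum _ _ fun p _ => ?_
    rw [TensorProduct.tmul_sum]
    refine hsum _ _ fun q _ => ⟨{(p, q)}, ?_⟩
    rw [Finset.sum_singleton, bidegreePart, TensorProduct.map_tmul, chainPart_chainPart, if_pos rfl,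
      homologyPart_homologyPart, if_pos rfl]

end HomologyPart

end SerreSS

namespace SerreSS

open CategoryTheory Simplicial Opposite TensorProduct

section Fibers

variable {k : Type v} [Field k] {E B : Type u} [TopologicalSpace E] [TopologicalSpace B] {π : C(E, B)}

instance mono_singMap_fiberIncl (b : B) : Mono (singMap (fiberIncl π b)) := by
  rw [NatTrans.mono_iff_mono_app]
  intro n
  rw [mono_iff_injective]
  intro U U' h
  refine sing_ext (n := n.unop.len) fun y => Subtype.ext ?_
  exact congrArg (fun W => singEv (n := n.unop.len) W y) h

theorem singEv_map_const {p n : ℕ} (V : (Sing B) _⦋p⦌) (a : Fin (p + 1)) (y) :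
    singEv ((Sing B).map (SimplexCategory.const ⦋n⦌ ⦋p⦌ a).op V) y =
      singEv V (stdSimplex.vertex a) := by
  rw [singEv_map]
  exact congrArg (singEv V) (stdSimplex_map_const a y)

theorem inFiber_singMap_iff {p n : ℕ} (V : (Sing B) _⦋p⦌) (U : (Sing E) _⦋n⦌) :
    InFiber (singMap π) U V ↔ ∃ u : (Sing (Fiber π (initialVertex V))) _⦋n⦌,
      (singMap (fiberIncl π _)).app (op ⦋n⦌) u = U := by
  constructor
  · intro h
    have h' : ∀ y, π (singEv U y) = initialVertex V := fun y =>
      (congrArg (fun W => singEv W y) h).trans (singEv_map_const V 0 y)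
    exact ⟨singMk ⟨fun y => ⟨singEv U y, h' y⟩, by fun_prop⟩, sing_ext fun y => rfl⟩
  · rintro ⟨u, rfl⟩
    exact sing_ext fun y => (singEv u y).2.trans (singEv_map_const V 0 y).symm

namespace Param

variable {A : SSet.{u}} {p : ℕ} (H : Param A (Sing E) p) {V : (Sing B) _⦋p⦌}
  (hH : ∀ {n : ℕ} (U : A _⦋n⦌) (σ : ⦋n⦌ ⟶ ⦋p⦌),
    (singMap π).app (op ⦋n⦌) (H.app U σ) = (Sing B).map σ.op V)

include hH in
theorem proj_vertex (a : Fin (p + 1)) {n : ℕ} (U : A _⦋n⦌) (y) :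
    π (singEv ((H.vertex a).app (op ⦋n⦌) U) y) = singEv V (stdSimplex.vertex a) :=
  (congrArg (fun W => singEv W y) (hH U (SimplexCategory.const _ _ a))).trans
    (singEv_map_const V a y)

/-- The map to the fiber over the vertex `a` of `V` given by a map `A × Δ[p] ⟶ Sing E` over `V`. -/
noncomputable def toFiber (a : Fin (p + 1)) :
    A ⟶ Sing (Fiber π (singEv V (stdSimplex.vertex a))) :=
  SerreSS.liftFiber (H.vertex a) (H.proj_vertex hH a)

theorem chainMap_toFiber (a : Fin (p + 1)) (c : Chains k A) :
    chainMap k (singMap (fiberIncl π _)) (chainMap k (H.toFiber hH a) c) =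
      chainMap k (H.vertex a) c := by
  rw [← chainMap_comp]
  rfl

end Param

variable (hπ : IsSerreFibration π) [SimplyConnectedSpace B] (b₀ : B)

/-- The linear map extending to all chains the map that transports the class of a cycle of the fiber
over `b` to the fiber over `b₀`. -/
noncomputable def transportClass (b : B) :
    Chains k (Sing (Fiber π b)) →ₗ[k] FiberHomology k π b₀ :=
  (transport k hπ b₀ b).toLinearMap ∘ₗ (chainDG k _).toHomology

theorem transportClass_cycle {b : B} (c : LinearMap.ker (chainDG k (Sing (Fiber π b))).d) :
    transportClass hπ b₀ b c.1 = transport k hπ b₀ b ((chainDG k _).cls c) :=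
  congrArg (transport k hπ b₀ b) ((chainDG k _).toHomology_cycle c)

theorem transportClass_boundary {b : B} (c : Chains k (Sing (Fiber π b))) :
    transportClass hπ b₀ b (boundary k _ c) = 0 :=
  (congrArg (transport k hπ b₀ b) ((chainDG k _).toHomology_d c)).trans (map_zero _)

theorem homologyPart_transport {b : B} (q : ℤ) (z : FiberHomology k π b) :
    homologyPart k _ q (transport k hπ b₀ b z) = transport k hπ b₀ b (homologyPart k _ q z) := by
  refine ((transport_eq_iff hπ b₀ (PathConnectedSpace.somePath b b₀)).1 ?_).symm
  rw [← homologyPart_homologyMap, ← homologyPart_homologyMap, transport_somePath hπ]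

theorem homologyPart_transportClass {b : B} {q : ℤ} {c : Chains k (Sing (Fiber π b))}
    (hc : c ∈ chainGr k _ q) (hd : boundary k _ c = 0) :
    homologyPart k _ q (transportClass hπ b₀ b c) = transportClass hπ b₀ b c := by
  rw [transportClass_cycle hπ b₀ ⟨c, hd⟩, homologyPart_transport,
    homologyPart_cls_of_mem (x := ⟨c, hd⟩) hc]

theorem transportClass_restrict {A : SSet.{u}} {p p' : ℕ} (H : Param A (Sing E) p)
    {V : (Sing B) _⦋p⦌} (hH : ∀ {n : ℕ} (U : A _⦋n⦌) (σ : ⦋n⦌ ⟶ ⦋p⦌),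
      (singMap π).app (op ⦋n⦌) (H.app U σ) = (Sing B).map σ.op V) (η : ⦋p'⦌ ⟶ ⦋p⦌)
    (hH' : ∀ {n : ℕ} (U : A _⦋n⦌) (σ : ⦋n⦌ ⟶ ⦋p'⦌), (singMap π).app (op ⦋n⦌) ((H.restrict η).app U σ) =
      (Sing B).map σ.op ((Sing B).map η.op V))
    {c : Chains k A} (hc : boundary k A c = 0) :
    transportClass hπ b₀ _ (chainMap k ((H.restrict η).toFiber hH' 0) c) =
      transportClass hπ b₀ _ (chainMap k (H.toFiber hH 0) c) := by
  have e : singEv V (stdSimplex.vertex (η.toOrderHom 0)) =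
      singEv ((Sing B).map η.op V) (stdSimplex.vertex 0) := by
    rw [singEv_map, stdSimplex.map_vertex]
  have e' : H.vertex (η.toOrderHom 0) = (H.restrict η).vertex 0 := by
    ext n U
    refine congrArg (H.app (n := n.unop.len) U) (SimplexCategory.Hom.ext _ _ ?_)
    rfl
  have h := transport_vertex hπ b₀ H V hH (η.toOrderHom 0) (H.proj_vertex hH 0)
    (b' := singEv ((Sing B).map η.op V) (stdSimplex.vertex 0))
    (fun U y => (H.proj_vertex hH _ U y).trans e) rfl e ((chainDG k A).toHomology c)
  rw [← toHomology_chainMap _ _ hc, ← toHomology_chainMap _ _ hc] at h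
  exact h

theorem Param.proj_restrict {A X Y : SSet.{u}} {f : X ⟶ Y} {p p' : ℕ} {H : Param A X p} {V : Y _⦋p⦌}
    (hH : ∀ {n : ℕ} (U : A _⦋n⦌) (σ : ⦋n⦌ ⟶ ⦋p⦌), f.app (op ⦋n⦌) (H.app U σ) = Y.map σ.op V)
    (η : ⦋p'⦌ ⟶ ⦋p⦌) {n : ℕ} (U : A _⦋n⦌) (σ : ⦋n⦌ ⟶ ⦋p'⦌) :
    f.app (op ⦋n⦌) ((H.restrict η).app U σ) = Y.map σ.op (Y.map η.op V) :=
  (hH U (σ ≫ η)).trans (by rw [map_map_apply])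

/-- The identification of the homology of `C(B; C(F))` with `C(B) ⊗ H(F)`. -/
noncomputable def coeffMap (q : ℕ) : Chains k (Sing E) ⊗[k] Chains k (Sing B) →ₗ[k]
    Chains k (Sing B) ⊗[k] FiberHomology k π b₀ :=
  TensorProduct.lift <| LinearMap.flip <| Finsupp.linearCombination k fun V =>
    ((-1) ^ (q * V.1) : ℤ) • (TensorProduct.mk k _ _ (simplex k V.2.1) ∘ₗ
      transportClass hπ b₀ (initialVertex V.2.1) ∘ₗ chainRestrict k (singMap (fiberIncl π _)))

theorem coeffMap_tmul {p : ℕ} (q : ℕ) (V : (Sing B) _⦋p⦌)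
    (c : Chains k (Sing (Fiber π (initialVertex V)))) :
    coeffMap hπ b₀ q (chainMap k (singMap (fiberIncl π _)) c ⊗ₜ simplex k V) =
      ((-1) ^ (q * p) : ℤ) • (simplex k V ⊗ₜ transportClass hπ b₀ _ c) := by
  by_cases hV : V ∈ (Sing B).nonDegenerate p
  · rw [coeffMap, TensorProduct.lift.tmul, LinearMap.flip_apply]
    conv_lhs => rw [simplex_of_nonDegenerate ⟨V, hV⟩]
    rw [Finsupp.linearCombination_single, one_smul, LinearMap.smul_apply, LinearMap.comp_apply,
      LinearMap.comp_apply, chainRestrict_chainMap]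
    rfl
  · rw [simplex_of_degenerate ((SSet.mem_degenerate_iff_notMem_nonDegenerate _ _).2 hV),
      TensorProduct.tmul_zero, map_zero, TensorProduct.zero_tmul, smul_zero]

theorem coeffMap_phi_ez {A : SSet.{u}} {p : ℕ} (H : Param A (Sing E) p) {V : (Sing B) _⦋p⦌}
    (hH : ∀ {n : ℕ} (U : A _⦋n⦌) (σ : ⦋n⦌ ⟶ ⦋p⦌),
      (singMap π).app (op ⦋n⦌) (H.app U σ) = (Sing B).map σ.op V) {q : ℕ} {c : Chains k A}
    (hc : c ∈ chainGr k A q) : coeffMap hπ b₀ q (phi k (singMap π) q (H.ez k c)) =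
      ((-1) ^ (q * p) : ℤ) •
        (simplex k V ⊗ₜ transportClass hπ b₀ _ (chainMap k (H.toFiber hH 0) c)) := by
  rw [H.phi_ez _ hH hc]
  exact (congrArg (fun z => coeffMap hπ b₀ q (z ⊗ₜ simplex k V)) (H.chainMap_toFiber hH 0 c).symm).trans
    (coeffMap_tmul hπ b₀ q V (chainMap k (H.toFiber hH 0) c))

theorem coeffMap_of_coeffRel {p q : ℕ} {z : (Chains k (Sing E) ⊗[k] Chains k (Sing B)) ×
    (Chains k (Sing B) ⊗[k] FiberHomology k π b₀)} (hz : z ∈ coeffRel k π b₀ p q) :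
    coeffMap hπ b₀ q z.1 = z.2 := by
  have h := Submodule.span_le (p := LinearMap.eqLocus
    (coeffMap hπ b₀ q ∘ₗ LinearMap.fst k _ (Chains k (Sing B) ⊗[k] FiberHomology k π b₀))
    (LinearMap.snd k _ _)).2 ?_ hz
  · exact h
  rintro _ ⟨V, γ, c, c', -, hγ, rfl⟩
  refine (coeffMap_tmul hπ b₀ q V.1 c.1).trans ?_
  rw [transportClass_cycle, (transport_eq_iff hπ b₀ γ).1 ((isTransport_iff γ c c').1 hγ), mul_comm]
  rfl

theorem mem_coeffRel {p q : ℕ} (V : (Sing B).nonDegenerate p)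
    {c : Chains k (Sing (Fiber π (initialVertex V.1)))} (hc : c ∈ chainGr k _ q)
    (hd : boundary k _ c = 0) :
    (chainMap k (singMap (fiberIncl π _)) c ⊗ₜ[k] simplex k V.1,
      ((-1) ^ (p * q) : ℤ) • (simplex k V.1 ⊗ₜ[k] transportClass hπ b₀ _ c)) ∈
        coeffRel k π b₀ p q := by
  obtain ⟨c', hc'⟩ := (chainDG k (Sing (Fiber π b₀))).cls_surjective (transportClass hπ b₀ _ c)
  refine Submodule.subset_span ⟨V, PathConnectedSpace.somePath _ _, ⟨c, hd⟩, c', hc, ?_, by rw [hc']⟩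
  rw [isTransport_iff _ ⟨c, hd⟩ c', transport_eq_iff hπ b₀, hc',
    transportClass_cycle hπ b₀ ⟨c, hd⟩]

end Fibers

end SerreSS

namespace SerreSS

open CategoryTheory Simplicial Opposite TensorProduct

section Filtration

variable {k : Type v} [Field k] {X Y A : SSet.{u}} {f : X ⟶ Y}

variable (f) in
/-- The subcomplex of the simplices lying over the `p`-skeleton. -/
def overSkeletonSubcomplex (p : ℤ) : X.Subcomplex where
  obj n := Set.ofPred fun α => OverSkeleton (n := n.unop.len) f p α
  map {_ m} θ _ hα := OverSkeleton.map (l := m.unop.len) hα θ.unop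

theorem overSkeleton_of_eq {n p : ℕ} {α : X _⦋n⦌} {V : Y _⦋p⦌} {σ : ⦋n⦌ ⟶ ⦋p⦌}
    (h : f.app (op ⦋n⦌) α = Y.map σ.op V) : OverSkeleton f p α := by
  obtain ⟨m, s, β, hs, hm, h'⟩ := OverSkeleton.map (f := 𝟙 Y) (α := V) (p := p) ⟨p, 𝟙 _, V,
    inferInstance, le_rfl, (Param.map_id_apply V).symm⟩ σ
  exact ⟨m, s, β, hs, hm, h.trans h'⟩

variable {p : ℕ} {H : Param A X p} {V : Y _⦋p⦌}
  (hH : ∀ {n : ℕ} (U : A _⦋n⦌) (σ : ⦋n⦌ ⟶ ⦋p⦌), f.app (op ⦋n⦌) (H.app U σ) = Y.map σ.op V)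

include hH in
theorem Param.ez_mem_deg {m n : ℤ} (hn : m + p = n) {x : Chains k A} (hx : x ∈ chainGr k A m) :
    H.ez k x ∈ (serreFDG k f).deg p n :=
  ⟨H.ez_mem_chainSub (T := ⊤) (T' := overSkeletonSubcomplex f p)
    (fun U σ _ => overSkeleton_of_eq (hH U σ)) ((Finsupp.mem_supported _ _).2 fun _ _ => trivial),
    H.ez_mem hn hx⟩

include hH in
theorem Param.ez_mem_Z {q : ℕ} {x : Chains k A} (hx : x ∈ chainGr k A q) (hd : boundary k A x = 0) :
    H.ez k x ∈ (serreFDG k f).Z 1 (p, q) := by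
  refine ⟨ez_mem_deg hH (add_comm _ _) hx, ?_⟩
  refine Submodule.mem_comap.2 ?_
  change boundary k X (H.ez k x) ∈ _
  rcases p with _ | p
  · rw [boundary_ez_zero, hd, map_zero]
    exact zero_mem _
  · rw [boundary_ez, hd, map_zero, zero_add]
    refine Submodule.sum_mem _ fun j _ => zsmul_mem ?_ _
    rw [chainSgn_of_mem hx, map_zsmul]
    refine zsmul_mem (FDG.deg_le _ (by push_cast; lia) rfl (ez_mem_deg (Param.proj_restrict hH _)
      (n := ((p + 1 : ℕ) : ℤ) + q - 1) (by push_cast; lia) hx)) _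

end Filtration

section Theta

variable {k : Type v} [Field k] {E B : Type u} [TopologicalSpace E] [TopologicalSpace B] {π : C(E, B)}
  (hπ : IsSerreFibration π) [SimplyConnectedSpace B] (b₀ : B)

/-- The composition of `φ` with the identification of the homology of `C(B; C(F))` with
`C(B) ⊗ H(F)`. -/
noncomputable def serreTheta (q : ℕ) : Chains k (Sing E) →ₗ[k]
    Chains k (Sing B) ⊗[k] FiberHomology k π b₀ :=
  coeffMap hπ b₀ q ∘ₗ phi k (singMap π) q

theorem serreTheta_lower {p q : ℕ} {x : Chains k (Sing E)}
    (hx : x ∈ (serreFDG k (singMap π)).deg (p - 1) (p + q)) : serreTheta hπ b₀ q x = 0 := by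
  rw [serreTheta, LinearMap.comp_apply, phi_eq_zero_of_lower (p := p) (by push_cast; ring) hx.1 hx.2,
    map_zero]

theorem serreTheta_boundary {p q : ℕ} {x : Chains k (Sing E)}
    (hx : x ∈ (serreFDG k (singMap π)).deg p (p + q + 1)) :
    serreTheta hπ b₀ q (boundary k _ x) = 0 := by
  have := hπ.fibration
  have hx' : x ∈ (serreFDG k (singMap π)).deg p (p + (q + 1 : ℕ)) :=
    FDG.deg_le _ le_rfl (by push_cast; ring) hx
  obtain ⟨T, c, -, h, -⟩ := exists_phi_eq_sum (fun V : (Sing B).nonDegenerate p =>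
    singMap (fiberIncl π (initialVertex V.1))) (fun V _ U => inFiber_singMap_iff V.1 U) hx'
  rw [serreTheta, LinearMap.comp_apply, phi_boundary,
    phi_eq_zero_of_lower (p := p + 1) (q := q) (n := p + q + 1) (by push_cast; ring)
      (by push_cast; rw [add_sub_cancel_right]; exact hx.1) hx.2, map_zero, smul_zero, add_zero, h,
    map_sum, map_sum]
  refine Finset.sum_eq_zero fun V _ => ?_
  rw [TensorProduct.map_tmul, boundary_chainMap, LinearMap.id_apply]
  refine (coeffMap_tmul hπ b₀ q V.1 (boundary k _ (c V))).trans ?_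
  rw [transportClass_boundary, TensorProduct.tmul_zero, smul_zero]

theorem serreTheta_ez {A : SSet.{u}} {p : ℕ} (H : Param A (Sing E) p) {V : (Sing B) _⦋p⦌}
    (hH : ∀ {n : ℕ} (U : A _⦋n⦌) (σ : ⦋n⦌ ⟶ ⦋p⦌),
      (singMap π).app (op ⦋n⦌) (H.app U σ) = (Sing B).map σ.op V) {q : ℕ} {c : Chains k A}
    (hc : c ∈ chainGr k A q) : serreTheta hπ b₀ q (H.ez k c) = ((-1) ^ (q * p) : ℤ) •
      (simplex k V ⊗ₜ transportClass hπ b₀ _ (chainMap k (H.toFiber hH 0) c)) :=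
  coeffMap_phi_ez hπ b₀ H hH hc

theorem serreTheta_boundary_ez {A : SSet.{u}} {p : ℕ} (H : Param A (Sing E) (p + 1))
    {V : (Sing B) _⦋p + 1⦌} (hH : ∀ {n : ℕ} (U : A _⦋n⦌) (σ : ⦋n⦌ ⟶ ⦋p + 1⦌),
      (singMap π).app (op ⦋n⦌) (H.app U σ) = (Sing B).map σ.op V) {q : ℕ} {c : Chains k A}
    (hc : c ∈ chainGr k A q) (hd : boundary k A c = 0) :
    serreTheta hπ b₀ q (boundary k _ (H.ez k c)) =
      (coeffDG k π b₀).d (serreTheta hπ b₀ q (H.ez k c)) := by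
  rw [H.boundary_ez, hd, map_zero, zero_add, chainSgn_of_mem hc, serreTheta_ez hπ b₀ H hH hc, map_sum,
    map_zsmul]
  change _ = _ • (boundary k (Sing B) (simplex k V) ⊗ₜ[k] _)
  rw [boundary_simplex, faceSum_succ, TensorProduct.sum_tmul, Finset.smul_sum]
  refine Finset.sum_congr rfl fun j _ => ?_
  rw [map_zsmul, map_zsmul, map_zsmul]
  have h := (serreTheta_ez hπ b₀ (H.face j) (Param.proj_restrict hH (SimplexCategory.δ j)) hc).trans
    (congrArg (fun z => ((-1) ^ (q * p) : ℤ) •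
      (simplex k ((Sing B).map (SimplexCategory.δ j).op V) ⊗ₜ[k] z))
      (transportClass_restrict hπ b₀ H hH (SimplexCategory.δ j) _ hd))
  rw [h, smul_smul, smul_smul, ← TensorProduct.smul_tmul', smul_smul]
  have e : ((-1) ^ (j : ℕ) * (((q : ℤ).negOnePow : ℤ) * (-1) ^ (q * p)) : ℤ) =
      (-1) ^ (q * (p + 1)) * (-1) ^ (j : ℕ) := by
    rw [Int.negOnePow_def, zpow_natCast]
    push_cast
    ring
  exact congrArg (· • _) ((mul_assoc _ _ _).trans e)

end Theta

end SerreSS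

namespace SerreSS

open CategoryTheory Simplicial Opposite TensorProduct

theorem eq_zero_of_sum_simplex_tmul {k : Type v} [Field k] {Y : SSet.{u}} {p : ℕ} {Q : Type*}
    [AddCommGroup Q] [Module k Q] {T : Finset (Y.nonDegenerate p)} {h : Y.nonDegenerate p → Q}
    (hT : ∑ V ∈ T, simplex k V.1 ⊗ₜ[k] h V = 0) {V : Y.nonDegenerate p} (hV : V ∈ T) : h V = 0 := by
  have := congrArg ((TensorProduct.lid k Q).toLinearMap ∘ₗ LinearMap.rTensor Q (Finsupp.lapply ⟨p, V⟩)) hT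
  rw [map_sum, map_zero, Finset.sum_eq_single_of_mem V hV] at this
  · rw [LinearMap.comp_apply, LinearMap.rTensor_tmul, simplex_of_nonDegenerate] at this
    simpa using this
  · intro V' _ hne
    rw [LinearMap.comp_apply, LinearMap.rTensor_tmul, simplex_of_nonDegenerate, Finsupp.lapply_apply,
      Finsupp.single_eq_of_ne (by
        intro e
        obtain ⟨-, e⟩ := Sigma.mk.inj_iff.1 e
        exact hne (eq_of_heq e).symm)]
    simp

section Theta

variable {k : Type v} [Field k] {E B : Type u} [TopologicalSpace E] [TopologicalSpace B] {π : C(E, B)}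

/-- The map `Sing F × Δ[p] ⟶ Sing E` given by a lift system for the fiber `F` over `V(∗)`. -/
noncomputable def LiftSystem.fiberParam (L : LiftSystem (singMap π)) {p : ℕ} (V : (Sing B) _⦋p⦌) :
    Param (Sing (Fiber π (initialVertex V))) (Sing E) p :=
  L.param V (singMap (fiberIncl π _)) fun U => (inFiber_singMap_iff V _).2 ⟨U, rfl⟩

theorem LiftSystem.proj_fiberParam (L : LiftSystem (singMap π)) {p : ℕ} (V : (Sing B) _⦋p⦌) {n : ℕ}
    (U : (Sing (Fiber π (initialVertex V))) _⦋n⦌) (σ : ⦋n⦌ ⟶ ⦋p⦌) :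
    (singMap π).app (op ⦋n⦌) ((L.fiberParam V).app U σ) = (Sing B).map σ.op V :=
  L.proj_G _ _ _ _ _

theorem LiftSystem.chainMap_toFiber (L : LiftSystem (singMap π)) {p : ℕ} (V : (Sing B) _⦋p⦌)
    (c : Chains k (Sing (Fiber π (initialVertex V)))) :
    chainMap k ((L.fiberParam V).toFiber (L.proj_fiberParam V) 0) c = c :=
  chainMap_injective (singMap (fiberIncl π (initialVertex V)))
    ((Param.chainMap_toFiber _ _ 0 c).trans
      (congrArg (fun a => chainMap k a c) (LiftSystem.vertex_param (L := L)
        (ha := fun U => (inFiber_singMap_iff V _).2 ⟨U, rfl⟩))))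

variable (hπ : IsSerreFibration π) [SimplyConnectedSpace B] (b₀ : B)

theorem exists_serreTheta_eq_sum {p q : ℕ} {x : Chains k (Sing E)}
    (hx : x ∈ (serreFDG k (singMap π)).Z 1 (p, q)) :
    ∃ (T : Finset ((Sing B).nonDegenerate p))
      (c : ∀ V : (Sing B).nonDegenerate p, Chains k (Sing (Fiber π (initialVertex V.1)))),
      (∀ V, c V ∈ chainGr k _ q) ∧ (∀ V, boundary k _ (c V) = 0) ∧
      phi k (singMap π) q x =
        ∑ V ∈ T, chainMap k (singMap (fiberIncl π _)) (c V) ⊗ₜ simplex k V.1 ∧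
      serreTheta hπ b₀ q x =
        ((-1) ^ (q * p) : ℤ) • ∑ V ∈ T, simplex k V.1 ⊗ₜ transportClass hπ b₀ _ (c V) ∧
      ((∀ V ∈ T, transportClass hπ b₀ _ (c V) = 0) →
        ∃ y ∈ (serreFDG k (singMap π)).deg p (p + q + 1),
          x - boundary k _ y ∈ (serreFDG k (singMap π)).deg (p - 1) (p + q)) := by
  have := hπ.fibration
  obtain ⟨T, c, hc, h, h'⟩ := exists_phi_eq_sum (fun V : (Sing B).nonDegenerate p =>
    singMap (fiberIncl π (initialVertex V.1))) (fun V _ U => inFiber_singMap_iff V.1 U) hx.1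
  obtain ⟨hd, h'⟩ := h' hx
  refine ⟨T, c, hc, hd, h, ?_, fun h₀ => h' fun V hV => ?_⟩
  · rw [serreTheta, LinearMap.comp_apply, h, map_sum, Finset.smul_sum]
    exact Finset.sum_congr rfl fun V _ => coeffMap_tmul hπ b₀ q V.1 (c V)
  · have := h₀ V hV
    rw [transportClass_cycle hπ b₀ ⟨c V, hd V⟩, LinearEquiv.map_eq_zero_iff, DG.cls_eq_zero_iff] at this
    exact this

theorem serreTheta_injective {p q : ℕ} {x : Chains k (Sing E)}
    (hx : x ∈ (serreFDG k (singMap π)).Z 1 (p, q)) (h : serreTheta hπ b₀ q x = 0) :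
    ∃ y ∈ (serreFDG k (singMap π)).deg p (p + q + 1),
      x - boundary k _ y ∈ (serreFDG k (singMap π)).deg (p - 1) (p + q) := by
  obtain ⟨T, c, -, -, -, e, h'⟩ := exists_serreTheta_eq_sum hπ b₀ hx
  refine h' fun V hV => eq_zero_of_sum_simplex_tmul (k := k) (T := T) (h := fun V => transportClass hπ b₀ _ (c V)) ?_ hV
  rw [h] at e
  have := congrArg (((-1) ^ (q * p) : ℤ) • ·) e
  simp only [smul_zero, smul_smul, ← mul_pow] at this
  simpa using this.symm

theorem serreTheta_fiberParam (L : LiftSystem (singMap π)) {p q : ℕ} (V : (Sing B) _⦋p⦌)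
    {c : Chains k (Sing (Fiber π (initialVertex V)))} (hc : c ∈ chainGr k _ q) :
    serreTheta hπ b₀ q ((L.fiberParam V).ez k c) =
      ((-1) ^ (q * p) : ℤ) • (simplex k V ⊗ₜ transportClass hπ b₀ _ c) :=
  (serreTheta_ez hπ b₀ (L.fiberParam V) (L.proj_fiberParam _) hc).trans
    (congrArg (fun z => ((-1) ^ (q * p) : ℤ) • (simplex k V ⊗ₜ[k] transportClass hπ b₀ _ z))
      (L.chainMap_toFiber V c))

theorem exists_serreTheta_eq {p q : ℕ} (V : (Sing B) _⦋p⦌) (z : FiberHomology k π b₀) :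
    ∃ y ∈ (serreFDG k (singMap π)).Z 1 (p, q),
      serreTheta hπ b₀ q y = simplex k V ⊗ₜ homologyPart k _ q z := by
  have := hπ.fibration
  obtain ⟨L⟩ := nonempty_liftSystem (singMap π)
  obtain ⟨z, rfl⟩ := (transport k hπ b₀ (initialVertex V)).surjective z
  obtain ⟨c, rfl⟩ := (chainDG k _).cls_surjective z
  have hc := chainPart_mem_ker (q : ℤ) c
  refine ⟨((-1) ^ (q * p) : ℤ) • (L.fiberParam V).ez k (chainPart k _ q c.1), zsmul_mem
    (Param.ez_mem_Z (L.proj_fiberParam _) (chainPart_mem_chainGr _ _) hc) _, ?_⟩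
  rw [map_zsmul, serreTheta_fiberParam hπ b₀ L V (chainPart_mem_chainGr _ _), smul_smul, ← mul_pow,
    homologyPart_transport, homologyPart_cls, transportClass_cycle hπ b₀ ⟨_, hc⟩]
  simp

theorem bidegreePart_serreTheta {p q : ℕ} {x : Chains k (Sing E)}
    (hx : x ∈ (serreFDG k (singMap π)).Z 1 (p, q)) :
    bidegreePart k _ _ (p, q) (serreTheta hπ b₀ q x) = serreTheta hπ b₀ q x := by
  obtain ⟨T, c, hc, hd, -, e, -⟩ := exists_serreTheta_eq_sum hπ b₀ hx
  rw [e, map_zsmul, map_sum]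
  congr 1
  refine Finset.sum_congr rfl fun V _ => ?_
  rw [bidegreePart, TensorProduct.map_tmul, homologyPart_transportClass hπ b₀ (hc V) (hd V),
    chainPart_simplex, if_pos rfl]

theorem serreTheta_boundary_Z {p q : ℕ} {x : Chains k (Sing E)}
    (hx : x ∈ (serreFDG k (singMap π)).Z 1 ((p + 1 : ℕ), q)) :
    serreTheta hπ b₀ q (boundary k _ x) = (coeffDG k π b₀).d (serreTheta hπ b₀ q x) := by
  have := hπ.fibration
  obtain ⟨L⟩ := nonempty_liftSystem (singMap π)
  obtain ⟨T, c, hc, hd, -, e, -⟩ := exists_serreTheta_eq_sum hπ b₀ hx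
  have hy : ∑ V ∈ T, (L.fiberParam V.1).ez k (c V) ∈
      (serreFDG k (singMap π)).Z 1 ((p + 1 : ℕ), q) :=
    Submodule.sum_mem _ fun V _ => Param.ez_mem_Z (L.proj_fiberParam _) (hc V) (hd V)
  have hθ : serreTheta hπ b₀ q (∑ V ∈ T, (L.fiberParam V.1).ez k (c V)) = serreTheta hπ b₀ q x := by
    rw [e, map_sum, Finset.smul_sum]
    exact Finset.sum_congr rfl fun V _ => serreTheta_fiberParam hπ b₀ L V.1 (hc V)
  obtain ⟨w, -, hw⟩ := serreTheta_injective hπ b₀ (sub_mem hx hy) (by rw [map_sub, hθ, sub_self])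
  have h₀ := serreTheta_boundary hπ b₀ (p := p) (q := q)
    (FDG.deg_le _ (by push_cast; lia) (by push_cast; lia) hw)
  rw [map_sub, show boundary k _ (boundary k _ w) = 0 from (chainDG k (Sing E)).d_d w] at h₀
  rw [show ∀ z : Chains k (Sing E), z - 0 = z from fun z => sub_zero z, map_sub, map_sub, sub_eq_zero] at h₀
  rw [h₀, ← hθ, map_sum, map_sum, map_sum, map_sum]
  exact Finset.sum_congr rfl fun V _ =>
    serreTheta_boundary_ez hπ b₀ _ (L.proj_fiberParam _) (hc V) (hd V)

end Theta

end SerreSS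

namespace SerreSS

open CategoryTheory Simplicial Opposite TensorProduct

section SerreComparison

variable {k : Type v} [Field k] {E B : Type u} [TopologicalSpace E] [TopologicalSpace B] {π : C(E, B)}

theorem bidegree_cases {P : ℤ × ℤ → Prop} (h : ∀ p q : ℕ, P (p, q))
    (h₁ : ∀ i : ℤ × ℤ, i.1 < 0 → P i) (h₂ : ∀ i : ℤ × ℤ, i.2 < 0 → P i) (i : ℤ × ℤ) : P i := by
  obtain ⟨p, q⟩ := i
  by_cases hp : p < 0
  · exact h₁ _ hp
  by_cases hq : q < 0
  · exact h₂ _ hq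
  lift p to ℕ using by lia
  lift q to ℕ using by lia
  exact h p q

theorem serreDeg_eq_zero {p n : ℤ} (hp : p < 0) {x : Chains k (Sing E)}
    (hx : x ∈ (serreFDG k (singMap π)).deg p n) : x = 0 := serreFilt_eq_zero hp hx.1

theorem coeffDG_d_bidegreePart (b₀ : B) (p q : ℤ) (x : Chains k (Sing B) ⊗[k] FiberHomology k π b₀) :
    (coeffDG k π b₀).d (bidegreePart k _ _ (p, q) x) =
      bidegreePart k _ _ (p - 1, q) ((coeffDG k π b₀).d x) := by
  induction x with
  | zero => simp
  | add x y hx hy => simp only [map_add, hx, hy]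
  | tmul a b =>
    change boundary k (Sing B) (chainPart k _ p a) ⊗ₜ[k] homologyPart k _ q b = _
    rw [boundary_chainPart]
    rfl

theorem coeffDG_sgn_bidegreePart (b₀ : B) (i : ℤ × ℤ) (x : Chains k (Sing B) ⊗[k] FiberHomology k π b₀) :
    (coeffDG k π b₀).sgn (bidegreePart k _ _ i x) =
      ((i.1 + i.2).negOnePow : ℤ) • bidegreePart k _ _ i x := by
  induction x with
  | zero => simp
  | add x y hx hy => simp only [map_add, hx, hy, smul_add]
  | tmul a b =>
    change chainSgn k (Sing B) (chainPart k _ i.1 a) ⊗ₜ[k]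
      (chainDG k _).homologySgn (homologyPart k _ i.2 b) =
        _ • (chainPart k _ i.1 a ⊗ₜ[k] homologyPart k _ i.2 b)
    rw [chainSgn_chainPart, homologySgn_homologyPart, Int.negOnePow_add, Units.val_mul, mul_smul,
      TensorProduct.smul_tmul', TensorProduct.smul_tmul', ← TensorProduct.smul_tmul, smul_comm]

variable (hπ : IsSerreFibration π) [SimplyConnectedSpace B] (b₀ : B)

/-- The comparison map in bidegree `i`. -/
noncomputable def bigradedTheta (i : ℤ × ℤ) : Chains k (Sing E) →ₗ[k]
    Chains k (Sing B) ⊗[k] FiberHomology k π b₀ :=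
  if 0 ≤ i.2 then serreTheta hπ b₀ i.2.toNat else 0

theorem bigradedTheta_natCast (p : ℤ) (q : ℕ) :
    bigradedTheta (k := k) hπ b₀ (p, (q : ℤ)) = serreTheta hπ b₀ q := if_pos (Int.natCast_nonneg q)

theorem bigradedTheta_neg {i : ℤ × ℤ} (hi : i.2 < 0) : bigradedTheta (k := k) hπ b₀ i = 0 :=
  if_neg (by lia)

theorem exists_bigradedTheta_eq : ∀ i (x : Chains k (Sing B) ⊗[k] FiberHomology k π b₀),
    ∃ y ∈ (serreFDG k (singMap π)).Z 1 i, bigradedTheta hπ b₀ i y = bidegreePart k _ _ i x := by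
  refine bidegree_cases (fun p q x => ?_) (fun i hi x => ?_) (fun i hi x => ?_)
  · rw [bigradedTheta_natCast]
    change bidegreePart k _ _ ((p : ℤ), (q : ℤ)) x ∈
      ((serreFDG k (singMap π)).Z 1 (p, q)).map (serreTheta hπ b₀ q)
    induction x with
    | zero => rw [map_zero]; exact zero_mem _
    | add x y hx hy => rw [map_add]; exact add_mem hx hy
    | tmul a b =>
      refine apply_mem_of_mem_chainSub (T := ⊤) (P := ((serreFDG k (singMap π)).Z 1 (p, q)).map
          (serreTheta hπ b₀ q)) (S := bidegreePart k _ _ ((p : ℤ), (q : ℤ)) ∘ₗ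
          (TensorProduct.mk k _ _).flip b) (fun {n} V _ => ?_)
        ((Finsupp.mem_supported _ _).2 fun _ _ => trivial)
      change chainPart k _ (p : ℤ) (simplex k V) ⊗ₜ[k] homologyPart k _ q b ∈ _
      rw [chainPart_simplex]
      split_ifs with h
      · obtain rfl : n = p := by exact_mod_cast h
        exact exists_serreTheta_eq hπ b₀ V b
      · rw [TensorProduct.zero_tmul]
        exact zero_mem _
  · exact ⟨0, zero_mem _, by rw [map_zero, bidegreePart_eq_zero (Or.inl hi)]⟩
  · exact ⟨0, zero_mem _, by rw [map_zero, bidegreePart_eq_zero (Or.inr hi)]⟩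

theorem bidegreePart_bigradedTheta : ∀ i, ∀ x ∈ (serreFDG k (singMap π)).Z 1 i,
    bidegreePart k _ _ i (bigradedTheta hπ b₀ i x) = bigradedTheta hπ b₀ i x := by
  refine bidegree_cases (fun p q x hx => ?_) (fun i hi x hx => ?_) (fun i hi x hx => ?_)
  · rw [bigradedTheta_natCast]
    exact bidegreePart_serreTheta hπ b₀ hx
  · rw [serreDeg_eq_zero hi hx.1, map_zero, map_zero]
  · rw [bigradedTheta_neg hπ b₀ hi, LinearMap.zero_apply, map_zero]

/-- The comparison of the Serre spectral sequence with `C(B) ⊗ H(F)`. -/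
noncomputable def serreComparison :
    Comparison (serreFDG k (singMap π)) (coeffDG k π b₀) where
  e := bidegreePart k _ _
  θ := bigradedTheta hπ b₀
  e_ne i j x h := (bidegreePart_bidegreePart i j x).trans (if_neg h.symm)
  e_sum := exists_sum_bidegreePart
  d_e := coeffDG_d_bidegreePart b₀
  θ_lower := by
    refine bidegree_cases (fun p q x hx => ?_) (fun i hi x hx => ?_) (fun i hi x hx => ?_)
    · rw [bigradedTheta_natCast]
      exact serreTheta_lower hπ b₀ hx
    · rw [serreDeg_eq_zero (by lia) hx, map_zero]
    · rw [bigradedTheta_neg hπ b₀ hi, LinearMap.zero_apply]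
  θ_d := by
    refine bidegree_cases (fun p q x hx => ?_) (fun i hi x hx => ?_) (fun i hi x hx => ?_)
    · rw [bigradedTheta_natCast]
      exact serreTheta_boundary hπ b₀ hx
    · rw [serreDeg_eq_zero hi hx, map_zero, map_zero]
    · rw [bigradedTheta_neg hπ b₀ hi, LinearMap.zero_apply]
  e_θ := bidegreePart_bigradedTheta hπ b₀
  θ_d_Z p q x hx := by
    obtain hq | hq := lt_or_ge q 0
    · rw [bigradedTheta_neg hπ b₀ (by exact hq), bigradedTheta_neg hπ b₀ (by exact hq),
        LinearMap.zero_apply, LinearMap.zero_apply, map_zero]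
    lift q to ℕ using hq
    obtain hp | hp := lt_or_ge 0 p
    · obtain ⟨p, rfl⟩ : ∃ p' : ℕ, p = (p' + 1 : ℕ) := ⟨p.toNat - 1, by lia⟩
      rw [bigradedTheta_natCast, bigradedTheta_natCast]
      exact serreTheta_boundary_Z hπ b₀ hx
    · rw [serreDeg_eq_zero (by dsimp; lia) hx.2, map_zero, ← bidegreePart_bigradedTheta hπ b₀ _ x hx,
        coeffDG_d_bidegreePart, bidegreePart_eq_zero (Or.inl (by dsimp; lia))]
  θ_sgn i x hx := by
    rw [(serreFDG k (singMap π)).sgn_gr _ x hx.1.2, map_zsmul,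
      ← bidegreePart_bigradedTheta hπ b₀ _ x hx, coeffDG_sgn_bidegreePart]
  θ_injective := by
    refine bidegree_cases (fun p q x hx h => ?_) (fun i hi x hx _ => ?_) (fun i hi x hx _ => ?_)
    · rw [bigradedTheta_natCast] at h
      exact serreTheta_injective hπ b₀ hx h
    · rw [serreDeg_eq_zero hi hx.1]
      exact ⟨0, zero_mem _, by rw [map_zero, sub_zero]; exact zero_mem _⟩
    · refine ⟨0, zero_mem _, ?_⟩
      rw [map_zero, sub_zero]
      exact ⟨mem_serreFilt_of_lt (by lia) hx.1.2, hx.1.2⟩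
  θ_surjective := exists_bigradedTheta_eq hπ b₀

end SerreComparison

end SerreSS

namespace SerreSS

open CategoryTheory Simplicial Opposite TensorProduct

section Comult

variable {k : Type v} [Field k] {X Y : SSet.{u}} {f : X ⟶ Y}

theorem chainComult_simplex_antidiagonal {n : ℕ} (σ : X _⦋n⦌) : chainComult k X (simplex k σ) =
    ∑ i : Finset.HasAntidiagonal.antidiagonal n,
      simplex k (face σ 0 i.1.1 (by have := Finset.HasAntidiagonal.mem_antidiagonal.1 i.2; lia)) ⊗ₜ
        simplex k (face σ i.1.1 i.1.2
          (by have := Finset.HasAntidiagonal.mem_antidiagonal.1 i.2; lia)) := by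
  rw [chainComult_simplex]
  refine Fintype.sum_bijective (fun j : Fin (n + 1) =>
    (⟨((j : ℕ), n - j), Finset.HasAntidiagonal.mem_antidiagonal.2 (by dsimp only; lia)⟩ :
      Finset.HasAntidiagonal.antidiagonal n)) ⟨fun i j h => ?_, fun i => ?_⟩ _ _ fun j => rfl
  · exact Fin.ext (congrArg (fun x => x.1.1) h)
  · obtain ⟨⟨a, b⟩, h⟩ := i
    obtain rfl := Finset.HasAntidiagonal.mem_antidiagonal.1 h
    exact ⟨⟨a, by dsimp only; lia⟩, Subtype.ext (Prod.ext rfl (by dsimp only; lia))⟩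

theorem OverSkeleton.mono {p p' : ℤ} (hp : p ≤ p') {n : ℕ} {α : X _⦋n⦌} (h : OverSkeleton f p α) :
    OverSkeleton f p' α := by
  obtain ⟨m, s, β, hs, hm, h⟩ := h
  exact ⟨m, s, β, hs, hm.trans hp, h⟩

theorem OverSkeleton.exists_face {p : ℤ} {n : ℕ} {α : X _⦋n⦌} (h : OverSkeleton f p α) (j : ℕ)
    (hj : j ≤ n) : ∃ a : ℕ, OverSkeleton f a (face α 0 j (by lia)) ∧
      OverSkeleton f (p - a) (face α j (n - j) (by lia)) := by
  obtain ⟨m, s, β, hs, hm, h⟩ := h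
  set a : Fin (m + 1) := s.toOrderHom ⟨j, by lia⟩ with ha
  have ham := a.is_le
  have face_eq : ∀ {l : ℕ} (θ : ⦋l⦌ ⟶ ⦋n⦌), f.app (op ⦋l⦌) (X.map θ.op α) = Y.map (θ ≫ s).op β :=
    fun θ => by rw [app_map, h, map_map_apply]
  refine ⟨a, ?_, OverSkeleton.mono (p := (m - a : ℕ)) (by lia) ?_⟩
  · let t : ⦋j⦌ ⟶ ⦋(a : ℕ)⦌ := SimplexCategory.mkHom
      ⟨fun i => ⟨s.toOrderHom ⟨i, by lia⟩, Nat.lt_succ_of_le (s.toOrderHom.monotone (Fin.mk_le_mk.2 i.is_le))⟩,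
        fun i i' hi => s.toOrderHom.monotone (Fin.mk_le_mk.2 hi)⟩
    refine overSkeleton_of_eq (V := face β 0 a (by lia)) (σ := t) ((face_eq _).trans ?_)
    rw [face, map_map_apply]
    refine congrArg (fun θ => Y.map (Quiver.Hom.op θ) β) (SimplexCategory.Hom.ext _ _ (OrderHom.ext _ _ (funext fun i => Fin.ext ?_)))
    rfl
  · let t : ⦋n - j⦌ ⟶ ⦋m - (a : ℕ)⦌ := SimplexCategory.mkHom
      ⟨fun i => ⟨(s.toOrderHom ⟨j + i, by lia⟩ : ℕ) - a, by lia⟩,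
        fun i i' hi => Fin.mk_le_mk.2 (Nat.sub_le_sub_right
          (s.toOrderHom.monotone (Fin.mk_le_mk.2 (by have := Fin.le_def.1 hi; lia))) _)⟩
    refine overSkeleton_of_eq (V := face β a (m - a) (by lia)) (σ := t) ((face_eq _).trans ?_)
    rw [face, map_map_apply]
    refine congrArg (fun θ => Y.map (Quiver.Hom.op θ) β) (SimplexCategory.Hom.ext _ _ (OrderHom.ext _ _ (funext fun i => Fin.ext ?_)))
    change (s.toOrderHom ⟨i + j, _⟩ : ℕ) = ((s.toOrderHom ⟨j + i, _⟩ : ℕ) - a) + a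
    rw [Nat.sub_add_cancel (s.toOrderHom.monotone (Fin.mk_le_mk.2 (by lia)))]
    simp only [add_comm]

theorem chainComult_mem_deg {p n : ℤ} {x : Chains k X} (hx : x ∈ (serreFDG k f).deg p n) :
    chainComult k X x ∈ ((serreFDG k f).tensor (serreFDG k f)).deg p n := by
  refine ⟨?_, ?_⟩
  · refine apply_mem_of_mem_supported (Q := fun s => OverSkeleton f p s.2.1) (chainComult k X)
      (fun m α hα => ?_) hx.1
    rw [chainComult_simplex]
    refine Submodule.sum_mem _ fun j _ => ?_
    obtain ⟨a, h₁, h₂⟩ := hα.exists_face j j.is_le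
    exact tmul_mem_iSup (a : ℤ) (p - a) (by lia) (simplex_mem_serreFilt h₁)
      (simplex_mem_serreFilt h₂)
  · refine apply_mem_of_mem_supported (Q := fun s => (s.1 : ℤ) = n) (chainComult k X)
      (fun m α hm => ?_) hx.2
    rw [chainComult_simplex]
    exact Submodule.sum_mem _ fun j _ => tmul_mem_iSup (j : ℤ) ((m - j : ℕ) : ℤ)
      (by have := j.is_le; have : (m : ℤ) = n := hm; lia)
      (simplex_mem_chainGr _ rfl) (simplex_mem_chainGr _ rfl)

end Comult

section Coeff

variable {k : Type v} [Field k] {X : SSet.{u}} {Γ : Type w} [AddCommGroup Γ] [Module k Γ]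
  (s : Γ →ₗ[k] Γ)

theorem twist_simplex (a : Chains k X) {n : ℕ} (σ : X _⦋n⦌) (c d : Γ) :
    twist k X s ((a ⊗ₜ simplex k σ) ⊗ₜ (c ⊗ₜ d)) = (a ⊗ₜ (s ^ n) c) ⊗ₜ (simplex k σ ⊗ₜ d) := by
  have key : ∀ b : Chains k X, twist k X s ((a ⊗ₜ b) ⊗ₜ (c ⊗ₜ d)) =
      (TensorProduct.tensorTensorTensorAssoc k (Chains k X) Γ (Chains k X) Γ).symm
        ((a ⊗ₜ signedSwap k X s (b ⊗ₜ c)) ⊗ₜ d) := fun b => rfl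
  rw [key, signedSwap, TensorProduct.lift.tmul]
  by_cases h : σ ∈ X.nonDegenerate n
  · rw [simplex_of_nonDegenerate ⟨σ, h⟩, Finsupp.linearCombination_single, one_smul]
    rfl
  · rw [simplex, dif_neg h, map_zero, LinearMap.zero_apply, TensorProduct.tmul_zero,
      TensorProduct.zero_tmul, TensorProduct.zero_tmul, TensorProduct.tmul_zero, map_zero]

theorem twist_of_mem (a : Chains k X) {n : ℕ} {b : Chains k X} (hb : b ∈ chainGr k X n) (c d : Γ) :
    twist k X s ((a ⊗ₜ b) ⊗ₜ (c ⊗ₜ d)) = (a ⊗ₜ (s ^ n) c) ⊗ₜ (b ⊗ₜ d) :=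
  eq_of_mem_chainGr (T := twist k X s ∘ₗ (TensorProduct.mk k _ _).flip (c ⊗ₜ d) ∘ₗ
      TensorProduct.mk k _ _ a)
    (T' := TensorProduct.mk k _ _ (a ⊗ₜ (s ^ n) c) ∘ₗ (TensorProduct.mk k _ _).flip d)
    (fun σ => twist_simplex s a σ c d) rfl hb

theorem coeffComult_simplex_tmul (ΔΓ : Γ →ₗ[k] Γ ⊗[k] Γ) {n : ℕ} (σ : X _⦋n⦌) (h : Γ) :
    coeffComult k X s ΔΓ (simplex k σ ⊗ₜ h) = ∑ i : Finset.HasAntidiagonal.antidiagonal n,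
      TensorProduct.map
        (TensorProduct.mk k _ _ (simplex k (face σ 0 i.1.1
          (by have := Finset.HasAntidiagonal.mem_antidiagonal.1 i.2; lia))) ∘ₗ s ^ i.1.2)
        (TensorProduct.mk k _ _ (simplex k (face σ i.1.1 i.1.2
          (by have := Finset.HasAntidiagonal.mem_antidiagonal.1 i.2; lia)))) (ΔΓ h) := by
  rw [coeffComult, LinearMap.comp_apply, TensorProduct.map_tmul, chainComult_simplex_antidiagonal,
    TensorProduct.sum_tmul, map_sum]
  refine Finset.sum_congr rfl fun i _ => ?_
  induction ΔΓ h with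
  | zero => simp
  | add x y hx hy => rw [TensorProduct.tmul_add, map_add, map_add, hx, hy]
  | tmul c d => exact twist_simplex s _ _ c d

theorem tensor_d_twist_comult {M : Type*} [AddCommGroup M] [Module k M] (A : DG k M)
    (hs : ∀ x, s (s x) = x) (D : M →ₗ[k] M ⊗[k] M)
    (hD : ∀ x, (A.tensor A).d (D x) = D (A.d x)) (ΔΓ : Γ →ₗ[k] Γ ⊗[k] Γ)
    (tw : (M ⊗[k] M) ⊗[k] (Γ ⊗[k] Γ) →ₗ[k] (M ⊗[k] Γ) ⊗[k] (M ⊗[k] Γ)) {S : Set M}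
    (hS : Submodule.span k S = ⊤)
    (h : ∀ b ∈ S, ∃ n : ℕ, ∀ a c d, tw ((a ⊗ₜ b) ⊗ₜ (c ⊗ₜ d)) = (a ⊗ₜ (s ^ n) c) ⊗ₜ (b ⊗ₜ d) ∧
      tw ((a ⊗ₜ A.d b) ⊗ₜ (c ⊗ₜ d)) = (a ⊗ₜ s ((s ^ n) c)) ⊗ₜ (A.d b ⊗ₜ d)) (x : M ⊗[k] Γ) :
    ((A.coeff s hs).tensor (A.coeff s hs)).d ((tw ∘ₗ TensorProduct.map D ΔΓ) x) =
      (tw ∘ₗ TensorProduct.map D ΔΓ) ((A.coeff s hs).d x) := by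
  have key : ∀ (w : M ⊗[k] M) (y : Γ ⊗[k] Γ),
      ((A.coeff s hs).tensor (A.coeff s hs)).d (tw (w ⊗ₜ y)) = tw ((A.tensor A).d w ⊗ₜ y) := by
    intro w y
    induction w with
    | zero => simp
    | add w w' h h' => rw [TensorProduct.add_tmul, map_add, map_add, h, h', map_add,
        TensorProduct.add_tmul, map_add]
    | tmul a b =>
      induction y with
      | zero => simp
      | add y y' h h' => rw [TensorProduct.tmul_add, map_add, map_add, h, h', TensorProduct.tmul_add,
          map_add]
      | tmul c d =>
        have hb : b ∈ Submodule.span k S := hS ▸ Submodule.mem_top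
        induction hb using Submodule.span_induction with
        | zero => simp
        | add b b' _ _ hb hb' => simp only [TensorProduct.tmul_add, TensorProduct.add_tmul, map_add,
            hb, hb']
        | smul r b _ hb => simp only [TensorProduct.tmul_smul, ← TensorProduct.smul_tmul', map_smul,
            hb]
        | mem b hb =>
          obtain ⟨n, hn⟩ := h b hb
          rw [(hn _ _ _).1, DG.tensor_d_tmul, DG.tensor_d_tmul, TensorProduct.add_tmul, map_add,
            (hn _ _ _).1, (hn _ _ _).2]
          rfl
  induction x with
  | zero => simp
  | add x y hx hy => simp only [map_add, hx, hy]
  | tmul a h =>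
    refine (key (D a) (ΔΓ h)).trans ?_
    rw [hD]
    rfl

theorem span_simplex : Submodule.span k
    (Set.ofPred fun x : Chains k X => ∃ (n : ℕ) (σ : X _⦋n⦌), x = simplex k σ) = ⊤ := by
  rw [eq_top_iff]
  intro x _
  exact apply_mem_of_mem_chainSub (T := ⊤) (S := LinearMap.id)
    (P := Submodule.span k _) (fun {n} σ _ => Submodule.subset_span (by exact ⟨n, σ, rfl⟩)) ((Finsupp.mem_supported _ _).2 fun _ _ => trivial)

theorem exists_isHomologyComult_coeffComult (hs : ∀ x, s (s x) = x) (ΔΓ : Γ →ₗ[k] Γ ⊗[k] Γ) :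
    ∃ Δ, ((chainDG k X).coeff s hs).IsHomologyComult (coeffComult k X s ΔΓ) Δ := by
  obtain ⟨Δ, h, -⟩ := ((chainDG k X).coeff s hs).exists_isHomologyComult (coeffComult k X s ΔΓ)
    (tensor_d_twist_comult s (chainDG k X) hs (chainComult k X) tensor_d_chainComult ΔΓ (twist k X s)
      span_simplex (by
        rintro _ ⟨n, σ, rfl⟩
        refine ⟨n, fun a c d => ⟨twist_simplex s a σ c d, ?_⟩⟩
        change twist k X s ((a ⊗ₜ boundary k X (simplex k σ)) ⊗ₜ (c ⊗ₜ d)) =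
          (a ⊗ₜ s ((s ^ n) c)) ⊗ₜ (boundary k X (simplex k σ) ⊗ₜ d)
        rcases n with _ | n
        · rw [boundary_simplex, faceSum_zero]
          simp
        · have h := boundary_mem_chainGr (simplex_mem_chainGr (k := k) σ rfl)
          rw [Nat.cast_succ, add_sub_cancel_right] at h
          rw [twist_of_mem s a h, pow_succ']
          change _ = (a ⊗ₜ[k] s (s ((s ^ n) c))) ⊗ₜ[k] _
          rw [hs]))
  exact ⟨Δ, h⟩

end Coeff

end SerreSS

namespace SerreSS

open CategoryTheory Simplicial Opposite TensorProduct

section Signs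

variable {k : Type v} [Field k] {X Y : SSet.{u}}

theorem chainSgn_pow_simplex (m : ℕ) {n : ℕ} (σ : X _⦋n⦌) :
    (chainSgn k X ^ m) (simplex k σ) = ((-1) ^ (n * m) : k) • simplex k σ := by
  induction m with
  | zero => simp
  | succ m ih =>
    rw [pow_succ']
    change chainSgn k X ((chainSgn k X ^ m) (simplex k σ)) = _
    rw [ih, map_smul, chainSgn_simplex, ← Int.cast_smul_eq_zsmul k, smul_smul, mul_add, pow_add,
      mul_one]
    push_cast
    rfl

theorem exists_boundary_eq_chainSgn_pow (m : ℕ) (x : Chains k X) :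
    ∃ y, boundary k X y = (chainSgn k X ^ m) (boundary k X x) := by
  induction m with
  | zero => exact ⟨x, rfl⟩
  | succ m ih =>
    obtain ⟨y, hy⟩ := ih
    refine ⟨-chainSgn k X y, ?_⟩
    have h : boundary k X (chainSgn k X y) = -chainSgn k X (boundary k X y) := (chainDG k X).d_sgn y
    rw [map_neg, h, neg_neg, hy, pow_succ']
    rfl

theorem homologySgn_homologyMap (f : X ⟶ Y) (z : (chainDG k X).Homology) :
    (chainDG k Y).homologySgn (homologyMap k f z) = homologyMap k f ((chainDG k X).homologySgn z) := by
  obtain ⟨x, rfl⟩ := (chainDG k X).cls_surjective z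
  change (chainDG k Y).cls _ = (chainDG k Y).cls _
  congr 1
  exact Subtype.ext (chainSgn_chainMap f x.1)

theorem chainSgn_mem_ker {x : Chains k X} (hx : boundary k X x = 0) :
    boundary k X (chainSgn k X x) = 0 := by
  have h : boundary k X (chainSgn k X x) = -chainSgn k X (boundary k X x) := (chainDG k X).d_sgn x
  rw [h, hx, map_zero, neg_zero]

end Signs

section FiberClass

variable {k : Type v} [Field k] {E B : Type u} [TopologicalSpace E] [TopologicalSpace B] {π : C(E, B)}
  (hπ : IsSerreFibration π) [SimplyConnectedSpace B] (b₀ : B)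

theorem homologySgn_transport {b : B} (z : FiberHomology k π b) :
    fiberSgn k π b₀ (transport k hπ b₀ b z) = transport k hπ b₀ b (fiberSgn k π b z) := by
  refine ((transport_eq_iff hπ b₀ (PathConnectedSpace.somePath b b₀)).1 ?_).symm
  rw [← homologySgn_homologyMap, ← homologySgn_homologyMap, transport_somePath hπ]

variable {A : SSet.{u}} {p : ℕ} (H : Param A (Sing E) p) {V : (Sing B) _⦋p⦌}
  (hH : ∀ {n : ℕ} (U : A _⦋n⦌) (σ : ⦋n⦌ ⟶ ⦋p⦌),
    (singMap π).app (op ⦋n⦌) (H.app U σ) = (Sing B).map σ.op V)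

/-- The linear map extending to all chains the map from the cycles of `A` to the homology of the fiber
over `b₀` given by a map `A × Δ[p] ⟶ Sing E` over a simplex of the base. -/
noncomputable def Param.fiberClass : Chains k A →ₗ[k] FiberHomology k π b₀ :=
  transportClass hπ b₀ _ ∘ₗ chainMap k (H.toFiber hH 0)

namespace Param

theorem fiberClass_boundary (c : Chains k A) : H.fiberClass hπ b₀ hH (boundary k A c) = 0 := by
  rw [fiberClass, LinearMap.comp_apply, ← boundary_chainMap, transportClass_boundary]

theorem fiberClass_chainSgn_pow (m : ℕ) {c : Chains k A} (hc : boundary k A c = 0) :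
    H.fiberClass hπ b₀ hH ((chainSgn k A ^ m) c) =
      (fiberSgn k π b₀ ^ m) (H.fiberClass hπ b₀ hH c) := by
  have key : ∀ {c : Chains k A}, boundary k A c = 0 → H.fiberClass hπ b₀ hH (chainSgn k A c) =
      fiberSgn k π b₀ (H.fiberClass hπ b₀ hH c) := fun {c} hc => by
    have hd := chainMap_mem_ker (H.toFiber hH 0) hc
    rw [fiberClass, LinearMap.comp_apply, LinearMap.comp_apply, ← chainSgn_chainMap,
      transportClass_cycle hπ b₀ ⟨_, hd⟩, transportClass_cycle hπ b₀ ⟨_, chainSgn_mem_ker hd⟩,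
      homologySgn_transport]
    rfl
  induction m generalizing c with
  | zero => rfl
  | succ m ih =>
    rw [pow_succ, pow_succ]
    change H.fiberClass hπ b₀ hH ((chainSgn k A ^ m) (chainSgn k A c)) =
      (fiberSgn k π b₀ ^ m) (fiberSgn k π b₀ (H.fiberClass hπ b₀ hH c))
    rw [ih (chainSgn_mem_ker hc), key hc]

theorem serreTheta_ez {q : ℕ} {c : Chains k A} (hc : c ∈ chainGr k A q) :
    serreTheta hπ b₀ q (H.ez k c) =
      simplex k V ⊗ₜ H.fiberClass hπ b₀ hH (((-1) ^ (q * p) : k) • c) := by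
  rw [SerreSS.serreTheta_ez hπ b₀ H hH hc, map_smul, TensorProduct.tmul_smul,
    ← Int.cast_smul_eq_zsmul k]
  push_cast
  rfl

/-- The maps `A × Δ[p'] ⟶ Sing E` given by two faces of `Δ[p]` have the same effect on homology, also on
cycles of the tensor product. -/
theorem map_fiberClass_restrict {p₁ p₂ : ℕ} (η₁ : ⦋p₁⦌ ⟶ ⦋p⦌) (η₂ : ⦋p₂⦌ ⟶ ⦋p⦌) (m : ℕ)
    {w : Chains k A ⊗[k] Chains k A} (hw : ((chainDG k A).tensor (chainDG k A)).d w = 0) :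
    TensorProduct.map
        ((H.restrict η₁).fiberClass hπ b₀ (Param.proj_restrict hH η₁) ∘ₗ (chainSgn k A ^ m))
        ((H.restrict η₂).fiberClass hπ b₀ (Param.proj_restrict hH η₂)) w =
      TensorProduct.map ((fiberSgn k π b₀ ^ m) ∘ₗ H.fiberClass hπ b₀ hH)
        (H.fiberClass hπ b₀ hH) w := by
  have res : ∀ {p' : ℕ} (η : ⦋p'⦌ ⟶ ⦋p⦌) {c : Chains k A}, boundary k A c = 0 →
      (H.restrict η).fiberClass hπ b₀ (Param.proj_restrict hH η) c = H.fiberClass hπ b₀ hH c :=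
    fun η _ hc => transportClass_restrict hπ b₀ H hH η _ hc
  have hz : ∀ F G : Chains k A →ₗ[k] FiberHomology k π b₀, (∀ x, F (boundary k A x) = 0) →
      (∀ x, G (boundary k A x) = 0) → ∀ w,
        TensorProduct.map F G (((chainDG k A).tensor (chainDG k A)).d w) = 0 := by
    intro F G hF hG w
    induction w with
    | zero => simp only [map_zero]
    | add x y hx hy => rw [map_add, map_add, hx, hy, add_zero]
    | tmul x y =>
      rw [DG.tensor_d_tmul, map_add]
      change F (boundary k A x) ⊗ₜ[k] G y + F (chainSgn k A x) ⊗ₜ[k] G (boundary k A y) = 0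
      rw [hF, hG, TensorProduct.zero_tmul, TensorProduct.tmul_zero, add_zero]
  refine sub_eq_zero.1 ((chainDG k A).eq_zero_of_tensor_cycle (chainDG k A)
    (TensorProduct.map ((H.restrict η₁).fiberClass hπ b₀ (Param.proj_restrict hH η₁) ∘ₗ
        (chainSgn k A ^ m)) ((H.restrict η₂).fiberClass hπ b₀ (Param.proj_restrict hH η₂)) -
      TensorProduct.map ((fiberSgn k π b₀ ^ m) ∘ₗ H.fiberClass hπ b₀ hH)
        (H.fiberClass hπ b₀ hH)) (fun w => ?_) (fun x hx y hy => ?_) hw)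
  · rw [LinearMap.sub_apply, hz _ _ (fun x => ?_) (fun x => ?_), hz _ _ (fun x => ?_) (fun x => ?_),
      sub_zero]
    · rw [LinearMap.comp_apply, fiberClass_boundary, map_zero]
    · rw [fiberClass_boundary]
    · obtain ⟨y, hy⟩ := exists_boundary_eq_chainSgn_pow m x
      rw [LinearMap.comp_apply, ← hy, fiberClass_boundary]
    · rw [fiberClass_boundary]
  · rw [LinearMap.sub_apply, TensorProduct.map_tmul, TensorProduct.map_tmul, sub_eq_zero,
      LinearMap.comp_apply, LinearMap.comp_apply, fiberClass_chainSgn_pow hπ b₀ _ _ m hx, res η₁ hx,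
      res η₂ hy]

end Param

end FiberClass

end SerreSS

namespace SerreSS

open CategoryTheory Simplicial Opposite TensorProduct

section TopComult

variable {k : Type v} [Field k] {E B : Type u} [TopologicalSpace E] [TopologicalSpace B] {π : C(E, B)}
  (hπ : IsSerreFibration π) [SimplyConnectedSpace B] (b₀ : B)

/-- The map induced by the comparison maps on the tensor products of elements of total filtration
degree `p`. -/
noncomputable abbrev serreTop (p : ℤ) : Chains k (Sing E) ⊗[k] Chains k (Sing E) →ₗ[k]
    (Chains k (Sing B) ⊗[k] FiberHomology k π b₀) ⊗[k]
      (Chains k (Sing B) ⊗[k] FiberHomology k π b₀) :=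
  (serreComparison hπ b₀).topMap (fun s => (baseDim (singMap π) s.2.1 : ℤ)) (fun s => (s.1 : ℤ)) p

variable {A : SSet.{u}} {p : ℕ} (H : Param A (Sing E) p) {V : (Sing B) _⦋p⦌}
  (hH : ∀ {n : ℕ} (U : A _⦋n⦌) (σ : ⦋n⦌ ⟶ ⦋p⦌),
    (singMap π).app (op ⦋n⦌) (H.app U σ) = (Sing B).map σ.op V)

theorem serreTop_ez_tmul {p₁ p₂ : ℕ} (hp : p₁ + p₂ = p) {H₁ : Param A (Sing E) p₁}
    {H₂ : Param A (Sing E) p₂} {V₁ : (Sing B) _⦋p₁⦌} {V₂ : (Sing B) _⦋p₂⦌}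
    (h₁ : ∀ {n : ℕ} (U : A _⦋n⦌) (σ : ⦋n⦌ ⟶ ⦋p₁⦌),
      (singMap π).app (op ⦋n⦌) (H₁.app U σ) = (Sing B).map σ.op V₁)
    (h₂ : ∀ {n : ℕ} (U : A _⦋n⦌) (σ : ⦋n⦌ ⟶ ⦋p₂⦌),
      (singMap π).app (op ⦋n⦌) (H₂.app U σ) = (Sing B).map σ.op V₂) {q₁ q₂ : ℕ} {x y : Chains k A}
    (hx : x ∈ chainGr k A q₁) (hy : y ∈ chainGr k A q₂) :
    serreTop hπ b₀ p (H₁.ez k x ⊗ₜ H₂.ez k y) =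
      (simplex k V₁ ⊗ₜ H₁.fiberClass hπ b₀ h₁ (((-1) ^ (q₁ * p₁) : k) • x)) ⊗ₜ
        (simplex k V₂ ⊗ₜ H₂.fiberClass hπ b₀ h₂ (((-1) ^ (q₂ * p₂) : k) • y)) := by
  refine ((serreComparison hπ b₀).top_tmul (isBased_serreFDG _) ((p₁ : ℤ), (q₁ : ℤ))
    ((p₂ : ℤ), (q₂ : ℤ)) (by dsimp only; lia) (Param.ez_mem_deg h₁ (add_comm _ _) hx)
    (Param.ez_mem_deg h₂ (add_comm _ _) hy)).trans ?_
  change bigradedTheta hπ b₀ _ _ ⊗ₜ[k] bigradedTheta hπ b₀ _ _ = _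
  rw [bigradedTheta_natCast, bigradedTheta_natCast, H₁.serreTheta_ez hπ b₀ h₁ hx,
    H₂.serreTheta_ez hπ b₀ h₂ hy]

/-- The contribution of `V ∘ [0, …, j₁] ⊗ V ∘ [j₁, …, p]` to the coproduct of the products with a
simplex `V` of the base. -/
noncomputable def faceTerm {j₁ j₂ : ℕ} (hj : j₁ + j₂ = p) :
    Chains k A ⊗[k] Chains k A →ₗ[k] (Chains k (Sing B) ⊗[k] FiberHomology k π b₀) ⊗[k]
      (Chains k (Sing B) ⊗[k] FiberHomology k π b₀) :=
  TensorProduct.map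
    (TensorProduct.mk k _ _ (simplex k (face V 0 j₁ (by lia))) ∘ₗ
      (H.restrict (SimplexCategory.subinterval 0 j₁ (by lia))).fiberClass hπ b₀
        (Param.proj_restrict hH (SimplexCategory.subinterval 0 j₁ (by lia))) ∘ₗ (chainSgn k A ^ j₂))
    (TensorProduct.mk k _ _ (simplex k (face V j₁ j₂ (by lia))) ∘ₗ
      (H.restrict (SimplexCategory.subinterval j₁ j₂ (by lia))).fiberClass hπ b₀
        (Param.proj_restrict hH (SimplexCategory.subinterval j₁ j₂ (by lia))))

theorem neg_one_pow_mul_face_sign (i₁ i₂ j₁ j₂ : ℕ) :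
    ((-1 : k) ^ (j₁ * i₂)) * ((-1) ^ (i₂ * j₂) * (-1) ^ (i₁ * j₁)) =
      (-1) ^ ((i₁ + i₂) * (j₁ + j₂)) * (-1) ^ (i₁ * j₂) := by
  have e : ((-1 : k) ^ (i₁ * j₂)) * (-1) ^ (i₁ * j₂) = 1 := by rw [← mul_pow]; simp
  have h : (i₁ + i₂) * (j₁ + j₂) = i₁ * j₁ + i₁ * j₂ + (j₁ * i₂ + i₂ * j₂) := by ring
  rw [h, pow_add, pow_add, pow_add]
  linear_combination (-((-1 : k) ^ (i₁ * j₁) * (-1) ^ (j₁ * i₂) * (-1) ^ (i₂ * j₂))) * e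

theorem faceTerm_simplex {i₁ i₂ j₁ j₂ : ℕ} (hj : j₁ + j₂ = p) (U₁ : A _⦋i₁⦌) (U₂ : A _⦋i₂⦌) :
    ((-1) ^ (j₁ * i₂) : k) • serreTop hπ b₀ p
        ((H.restrict (SimplexCategory.subinterval 0 j₁ (by lia))).ez k (simplex k U₁) ⊗ₜ
          (H.restrict (SimplexCategory.subinterval j₁ j₂ (by lia))).ez k (simplex k U₂)) =
      ((-1) ^ ((i₁ + i₂) * p) : k) • faceTerm hπ b₀ H hH hj (simplex k U₁ ⊗ₜ simplex k U₂) := by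
  have h := serreTop_ez_tmul hπ b₀ hj
    (Param.proj_restrict hH (SimplexCategory.subinterval 0 j₁ (by lia)))
    (Param.proj_restrict hH (SimplexCategory.subinterval j₁ j₂ (by lia)))
    (simplex_mem_chainGr (k := k) U₁ rfl) (simplex_mem_chainGr U₂ rfl)
  refine (congrArg (((-1) ^ (j₁ * i₂) : k) • ·) h).trans ?_
  rw [faceTerm, TensorProduct.map_tmul, LinearMap.comp_apply, LinearMap.comp_apply,
    LinearMap.comp_apply, chainSgn_pow_simplex]
  simp only [map_smul, TensorProduct.tmul_smul, ← TensorProduct.smul_tmul', smul_smul]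
  subst hj
  rw [neg_one_pow_mul_face_sign]
  rfl

theorem serreTop_chainComult_ez_simplex {q : ℕ} (U : A _⦋q⦌) :
    serreTop hπ b₀ p (chainComult k _ (H.ez k (simplex k U))) =
      ∑ j : Finset.HasAntidiagonal.antidiagonal p,
        ((-1) ^ (q * p) : k) •
          faceTerm hπ b₀ H hH (Finset.HasAntidiagonal.mem_antidiagonal.1 j.2)
            (chainComult k A (simplex k U)) := by
  rw [Param.chainComult_ez, Finset.sum_comm, map_sum]
  refine Finset.sum_congr rfl fun j _ => ?_
  rw [chainComult_simplex_antidiagonal, map_sum, map_sum, Finset.smul_sum]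
  refine Finset.sum_congr rfl fun i _ => ?_
  have hi := Finset.HasAntidiagonal.mem_antidiagonal.1 i.2
  rw [← Int.cast_smul_eq_zsmul k, map_smul, Int.cast_pow, Int.cast_neg, Int.cast_one]
  refine (faceTerm_simplex hπ b₀ H hH (Finset.HasAntidiagonal.mem_antidiagonal.1 j.2) _ _).trans ?_
  exact congrArg (fun m : ℕ => ((-1) ^ (m * p) : k) • faceTerm hπ b₀ H hH _ _) hi

theorem serreTop_chainComult_ez {q : ℕ} {c : Chains k A} (hc : c ∈ chainGr k A q) :
    serreTop hπ b₀ p (chainComult k _ (H.ez k c)) =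
      ∑ j : Finset.HasAntidiagonal.antidiagonal p,
        faceTerm hπ b₀ H hH (Finset.HasAntidiagonal.mem_antidiagonal.1 j.2)
          (chainComult k A (((-1) ^ (q * p) : k) • c)) := by
  have key := eq_of_mem_chainGr (T := serreTop hπ b₀ p ∘ₗ chainComult k _ ∘ₗ H.ez k)
    (T' := ∑ j : Finset.HasAntidiagonal.antidiagonal p,
        (((-1) ^ (q * p) : k) • faceTerm hπ b₀ H hH
          (Finset.HasAntidiagonal.mem_antidiagonal.1 j.2)) ∘ₗ chainComult k A) (fun U => ?_) rfl hc
  · rw [LinearMap.sum_apply] at key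
    refine key.trans (Finset.sum_congr rfl fun j _ => ?_)
    rw [map_smul, map_smul]
    rfl
  · rw [LinearMap.sum_apply]
    exact serreTop_chainComult_ez_simplex hπ b₀ H hH U

end TopComult

end SerreSS

namespace SerreSS

open CategoryTheory Simplicial Opposite TensorProduct

section TopComult

variable {k : Type v} [Field k] {E B : Type u} [TopologicalSpace E] [TopologicalSpace B] {π : C(E, B)}
  (hπ : IsSerreFibration π) [SimplyConnectedSpace B] (b₀ : B)

theorem faceTerm_cycle {A : SSet.{u}} {p : ℕ} (H : Param A (Sing E) p) {V : (Sing B) _⦋p⦌}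
    (hH : ∀ {n : ℕ} (U : A _⦋n⦌) (σ : ⦋n⦌ ⟶ ⦋p⦌),
      (singMap π).app (op ⦋n⦌) (H.app U σ) = (Sing B).map σ.op V) {j₁ j₂ : ℕ} (hj : j₁ + j₂ = p)
    {w : Chains k A ⊗[k] Chains k A} (hw : ((chainDG k A).tensor (chainDG k A)).d w = 0) :
    faceTerm hπ b₀ H hH hj w =
      TensorProduct.map
        (TensorProduct.mk k _ _ (simplex k (face V 0 j₁ (by lia))) ∘ₗ (fiberSgn k π b₀) ^ j₂)
        (TensorProduct.mk k _ _ (simplex k (face V j₁ j₂ (by lia))))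
        (TensorProduct.map (H.fiberClass hπ b₀ hH) (H.fiberClass hπ b₀ hH) w) := by
  rw [faceTerm, TensorProduct.map_comp, LinearMap.comp_apply,
    H.map_fiberClass_restrict hπ b₀ hH _ _ _ hw, TensorProduct.map_map, TensorProduct.map_map]
  rfl

theorem serreTop_chainComult_fiberParam (L : LiftSystem (singMap π)) {p q : ℕ} (V : (Sing B) _⦋p⦌)
    {c : Chains k (Sing (Fiber π (initialVertex V)))} (hc : c ∈ chainGr k _ q)
    (hd : boundary k _ c = 0)
    {ΔF : FiberHomology k π b₀ →ₗ[k] FiberHomology k π b₀ ⊗[k] FiberHomology k π b₀}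
    (hΔ : ∀ x : LinearMap.ker (chainDG k (Sing (Fiber π b₀))).d, ΔF ((chainDG k _).cls x) =
      TensorProduct.map (chainDG k _).toHomology (chainDG k _).toHomology (chainComult k _ x.1)) :
    serreTop hπ b₀ p (chainComult k _ ((L.fiberParam V).ez k c)) =
      coeffComult k (Sing B) (fiberSgn k π b₀) ΔF (serreTheta hπ b₀ q ((L.fiberParam V).ez k c)) := by
  have hf : (L.fiberParam V).fiberClass hπ b₀ (L.proj_fiberParam V) =
      transportClass (k := k) hπ b₀ (initialVertex V) :=
    LinearMap.ext fun c => by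
      change transportClass hπ b₀ (initialVertex V)
        (chainMap k ((L.fiberParam V).toFiber (L.proj_fiberParam V) 0) c) = _
      exact congrArg (fun z => transportClass hπ b₀ (initialVertex V) z) (L.chainMap_toFiber V c)
  have hd' : boundary k (Sing (Fiber π (initialVertex V))) (((-1) ^ (q * p) : k) • c) = 0 := by rw [map_smul, hd, smul_zero]
  have hw := (tensor_d_chainComult (((-1) ^ (q * p) : k) • c)).trans
    ((congrArg (chainComult k _) hd').trans (map_zero _))
  rw [serreTop_chainComult_ez hπ b₀ _ (L.proj_fiberParam V) hc,
    Param.serreTheta_ez hπ b₀ _ (L.proj_fiberParam V) hc, coeffComult_simplex_tmul, hf]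
  refine Finset.sum_congr rfl fun j _ => ?_
  rw [faceTerm_cycle hπ b₀ _ _ _ hw, hf]
  congr 1
  exact (transport_comult hπ b₀ ⟨_, hd'⟩ hΔ).trans
    (congrArg ΔF (transportClass_cycle hπ b₀ ⟨_, hd'⟩).symm)

end TopComult

end SerreSS

namespace SerreSS

open CategoryTheory Simplicial Opposite TensorProduct

section SecondPage

variable {k : Type v} [Field k] {E B : Type u} [TopologicalSpace E] [TopologicalSpace B] {π : C(E, B)}
  (hπ : IsSerreFibration π) [SimplyConnectedSpace B] (b₀ : B)

theorem serreComparison_θ (p q : ℕ) :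
    (serreComparison (k := k) hπ b₀).θ (p, q) = serreTheta hπ b₀ q := bigradedTheta_natCast hπ b₀ p q

theorem phi_mem_coeffRel {p q : ℕ} {x : Chains k (Sing E)}
    (hx : x ∈ (serreFDG k (singMap π)).num 2 (p, q)) :
    (phi k (singMap π) q x, serreTheta hπ b₀ q x) ∈ coeffRel k π b₀ p q := by
  obtain ⟨y, hy, -, hxy⟩ := (serreComparison hπ b₀).θ_num (p, q) hx
  obtain ⟨T, c, hc, hd, hφ, hθ, -⟩ :=
    exists_serreTheta_eq_sum hπ b₀ (Comparison.Z_two_le (p, q) hy)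
  have h₀ := phi_eq_zero_of_lower (f := singMap π) (q := q) (by dsimp; lia) hxy.1 hxy.2
  rw [map_sub, sub_eq_zero] at h₀
  have h : serreTheta hπ b₀ q x = serreTheta hπ b₀ q y := congrArg (coeffMap hπ b₀ q) h₀
  rw [h₀, h, hφ, hθ, Finset.smul_sum, prod_mk_sum]
  refine Submodule.sum_mem _ fun V _ => ?_
  rw [mul_comm q p]
  exact mem_coeffRel hπ b₀ V (hc V) (hd V)

theorem isInducedByPhi_of_pageCls {Φ : (serreFDG k (singMap π)).E 2 →ₗ[k] (coeffDG k π b₀).Homology}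
    (hΦ : ∀ i (x : (serreFDG k (singMap π)).num 2 i), Φ ((serreFDG k (singMap π)).pageCls 2 i x) =
      (coeffDG k π b₀).cls ⟨(serreComparison hπ b₀).θ i x.1, (serreComparison hπ b₀).d_θ i x.2⟩) :
    IsInducedByPhi k π b₀ Φ := by
  refine fun p q x => ⟨⟨_, phi_mem_coeffRel hπ b₀ x.2⟩, fun ξ hξ => ?_⟩
  obtain rfl : (serreComparison hπ b₀).θ (p, q) x.1 = ξ :=
    (LinearMap.congr_fun (serreComparison_θ hπ b₀ p q) x.1).trans (coeffMap_of_coeffRel hπ b₀ hξ)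
  exact ⟨_, hΦ _ x⟩

theorem psi_of_coeffRel (L : LiftSystem (singMap π)) {p q : ℕ}
    {z : (Chains k (Sing E) ⊗[k] Chains k (Sing B)) ×
      (Chains k (Sing B) ⊗[k] FiberHomology k π b₀)} (hz : z ∈ coeffRel k π b₀ p q) :
    psi k L z.1 ∈ (serreFDG k (singMap π)).Z 1 (p, q) ∧ serreTheta hπ b₀ q (psi k L z.1) = z.2 := by
  have hψ : ∀ (V : (Sing B).nonDegenerate p) (c : Chains k (Sing (Fiber π (initialVertex V.1)))),
      psi k L (chainMap k (singMap (fiberIncl π _)) c ⊗ₜ simplex k V.1) = (L.fiberParam V.1).ez k c :=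
    fun V c => LiftSystem.psi_eq_ez (ha := fun U => (inFiber_singMap_iff V.1 _).2 ⟨U, rfl⟩) V.2 c
  induction hz using Submodule.span_induction with
  | zero => exact ⟨by rw [Prod.fst_zero, map_zero]; exact zero_mem _,
      by rw [Prod.fst_zero, map_zero, map_zero]; rfl⟩
  | add x y _ _ hx hy =>
    rw [Prod.fst_add, map_add, map_add, hx.2, hy.2]
    exact ⟨add_mem hx.1 hy.1, rfl⟩
  | smul a x _ hx =>
    rw [Prod.smul_fst, map_smul, map_smul, hx.2]
    exact ⟨Submodule.smul_mem _ a hx.1, rfl⟩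
  | mem z h =>
    have hz := coeffMap_of_coeffRel hπ b₀ (Submodule.subset_span h)
    obtain ⟨V, γ, c, c', hc, hγ, rfl⟩ := h
    dsimp only at hz ⊢
    rw [hψ]
    refine ⟨Param.ez_mem_Z (L.proj_fiberParam _) hc c.2, ?_⟩
    rw [serreTheta_fiberParam hπ b₀ L V.1 hc, ← hz, coeffMap_tmul]

theorem isInducedByPsi_of_pageCls {Φ : (serreFDG k (singMap π)).E 2 ≃ₗ[k] (coeffDG k π b₀).Homology}
    (hΦ : ∀ i (x : (serreFDG k (singMap π)).num 2 i), Φ ((serreFDG k (singMap π)).pageCls 2 i x) =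
      (coeffDG k π b₀).cls ⟨(serreComparison hπ b₀).θ i x.1, (serreComparison hπ b₀).d_θ i x.2⟩)
    (L : LiftSystem (singMap π)) : IsInducedByPsi k π b₀ L Φ.symm.toLinearMap := by
  intro p q z ξ hz h
  obtain ⟨hZ, hθ⟩ := psi_of_coeffRel hπ b₀ L hz
  obtain rfl : (serreComparison hπ b₀).θ (p, q) (psi k L z) = ξ :=
    (LinearMap.congr_fun (serreComparison_θ hπ b₀ p q) _).trans hθ
  exact ⟨(serreComparison hπ b₀).mem_num_of_d_θ (p, q) hZ h, Φ.symm_apply_eq.2 (hΦ _ ⟨_, _⟩).symm⟩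

end SecondPage

end SerreSS

namespace SerreSS

open CategoryTheory Simplicial Opposite TensorProduct

section ComparisonComult

variable {k : Type v} [Field k] {ι : Type w} {N : Type w'} [AddCommGroup N] [Module k N]
  {A : FDG k (ι →₀ k)} {W : DG k N} (c : Comparison A W) {wt dg : ι → ℤ} (hA : A.IsBased wt dg)

include hA in
/-- The comultiplications of the second page and of the homology correspond to each other at the classes
of those elements on which the maps inducing them do. -/
theorem Comparison.map_comult_eq {Φ : A.E 2 ≃ₗ[k] W.Homology}
    (hΦ : ∀ i (x : A.num 2 i), Φ (A.pageCls 2 i x) = W.cls ⟨c.θ i x.1, c.d_θ i x.2⟩)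
    {D : (ι →₀ k) →ₗ[k] (ι →₀ k) ⊗[k] (ι →₀ k)} {D' : N →ₗ[k] N ⊗[k] N}
    {Δ : A.E 2 →ₗ[k] A.E 2 ⊗[k] A.E 2} {Δ' : W.Homology →ₗ[k] W.Homology ⊗[k] W.Homology}
    (hΔ : A.IsPageComult 2 D Δ) (hΔ' : W.IsHomologyComult D' Δ') {i : ℤ × ℤ} (x : A.num 2 i)
    {y : ι →₀ k} (hy : y ∈ A.num 2 i) (hxy : c.θ i y = c.θ i x)
    (h : c.topMap wt dg i.1 (D y) = D' (c.θ i y)) :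
    TensorProduct.map Φ.toLinearMap Φ.toLinearMap (Δ (A.pageCls 2 i x)) =
      Δ' (Φ (A.pageCls 2 i x)) := by
  have e : A.pageCls 2 i x = A.pageCls 2 i ⟨y, hy⟩ := by
    refine Φ.injective ?_
    rw [hΦ, hΦ]
    congr 1
    exact Subtype.ext hxy.symm
  obtain ⟨h₁, e₁⟩ := hΔ i ⟨y, hy⟩
  obtain ⟨h₂, e₂⟩ := c.homologyCross_map hA (Φ := Φ.toLinearMap) hΦ i _ _ e₁
  obtain ⟨h₃, e₃⟩ := hΔ' ⟨c.θ i y, c.d_θ i hy⟩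
  rw [e, hΦ]
  refine (W.homologyCross_bijective W).1 (e₂.trans (Eq.trans ?_ e₃.symm))
  congr 1
  exact Subtype.ext h

end ComparisonComult

section SecondPageExt

variable {k : Type v} [Field k] {E B : Type u} [TopologicalSpace E] [TopologicalSpace B] {π : C(E, B)}

theorem serrePageCls_eq_zero {i : ℤ × ℤ} (hi : i.1 < 0 ∨ i.2 < 0)
    (x : (serreFDG k (singMap π)).num 2 i) : (serreFDG k (singMap π)).pageCls 2 i x = 0 := by
  refine (serreFDG k (singMap π)).pageCls_eq_zero ?_
  have hx : x.1 ∈ (serreFDG k (singMap π)).deg i.1 (i.1 + i.2) := (serreFDG k (singMap π)).num_le 2 i x.2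
  rcases hi with hi | hi
  · rw [serreDeg_eq_zero hi hx]
    exact zero_mem _
  · exact Submodule.mem_sup_right ⟨mem_serreFilt_of_lt (by lia) hx.2, hx.2⟩

theorem serrePage_lhom_ext {P : Type w} [AddCommMonoid P] [Module k P]
    {F G : (serreFDG k (singMap π)).E 2 →ₗ[k] P}
    (h : ∀ (p q : ℕ) (x : (serreFDG k (singMap π)).num 2 (p, q)),
      F ((serreFDG k (singMap π)).pageCls 2 (p, q) x) =
        G ((serreFDG k (singMap π)).pageCls 2 (p, q) x)) : F = G := by
  have hneg : ∀ i : ℤ × ℤ, (i.1 < 0 ∨ i.2 < 0) → ∀ x : (serreFDG k (singMap π)).num 2 i,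
      F ((serreFDG k (singMap π)).pageCls 2 i x) = G ((serreFDG k (singMap π)).pageCls 2 i x) :=
    fun i hi x => by rw [serrePageCls_eq_zero hi, F.map_zero, G.map_zero]
  have h : ∀ (i : ℤ × ℤ) (x : (serreFDG k (singMap π)).num 2 i),
      F ((serreFDG k (singMap π)).pageCls 2 i x) = G ((serreFDG k (singMap π)).pageCls 2 i x) :=
    bidegree_cases h (fun i hi => hneg i (Or.inl hi)) fun i hi => hneg i (Or.inr hi)
  refine LinearMap.ext fun x => (serreFDG k (singMap π)).pageCls_induction
    (P := fun x => F x = G x) x ?_ h fun x y hx hy => ?_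
  · rw [F.map_zero, G.map_zero]
  · rw [F.map_add, G.map_add, hx, hy]

end SecondPageExt

section SecondPage

variable {k : Type v} [Field k] {E B : Type u} [TopologicalSpace E] [TopologicalSpace B] {π : C(E, B)}
  (hπ : IsSerreFibration π) [SimplyConnectedSpace B] (b₀ : B)

/-- Every class of the second page has a representative that is a sum of products of cycles of fibers
with simplices of the base. -/
theorem exists_sum_fiberParam (L : LiftSystem (singMap π)) {p q : ℕ} {x : Chains k (Sing E)}
    (hx : x ∈ (serreFDG k (singMap π)).num 2 (p, q)) :
    ∃ (T : Finset ((Sing B).nonDegenerate p))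
      (c : ∀ V : (Sing B).nonDegenerate p, Chains k (Sing (Fiber π (initialVertex V.1)))),
      (∀ V, c V ∈ chainGr k _ q) ∧ (∀ V, boundary k _ (c V) = 0) ∧
      ∑ V ∈ T, (L.fiberParam V.1).ez k (c V) ∈ (serreFDG k (singMap π)).num 2 (p, q) ∧
      serreTheta hπ b₀ q (∑ V ∈ T, (L.fiberParam V.1).ez k (c V)) = serreTheta hπ b₀ q x := by
  obtain ⟨y, hy, e, -⟩ := (serreComparison hπ b₀).θ_num (p, q) hx
  obtain ⟨T, c, hc, hd, -, hθ, -⟩ :=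
    exists_serreTheta_eq_sum hπ b₀ (Comparison.Z_two_le (p, q) hy)
  have hZ : ∑ V ∈ T, (L.fiberParam V.1).ez k (c V) ∈ (serreFDG k (singMap π)).Z 1 (p, q) :=
    Submodule.sum_mem _ fun V _ => Param.ez_mem_Z (L.proj_fiberParam _) (hc V) (hd V)
  have h := (serreComparison hπ b₀).d_θ (p, q) hx
  rw [serreComparison_θ] at e h
  have hT : serreTheta hπ b₀ q (∑ V ∈ T, (L.fiberParam V.1).ez k (c V)) = serreTheta hπ b₀ q x := by
    rw [e, hθ, map_sum, Finset.smul_sum]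
    exact Finset.sum_congr rfl fun V _ => serreTheta_fiberParam hπ b₀ L V.1 (hc V)
  refine ⟨T, c, hc, hd, (serreComparison hπ b₀).mem_num_of_d_θ (p, q) hZ ?_, hT⟩
  rw [serreComparison_θ, hT, h]

theorem map_comult_eq (L : LiftSystem (singMap π))
    {Φ : (serreFDG k (singMap π)).E 2 ≃ₗ[k] (coeffDG k π b₀).Homology}
    (hΦ : ∀ i (x : (serreFDG k (singMap π)).num 2 i), Φ ((serreFDG k (singMap π)).pageCls 2 i x) =
      (coeffDG k π b₀).cls ⟨(serreComparison hπ b₀).θ i x.1, (serreComparison hπ b₀).d_θ i x.2⟩)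
    {ΔF : FiberHomology k π b₀ →ₗ[k] FiberHomology k π b₀ ⊗[k] FiberHomology k π b₀}
    (hΔ : ∀ x : LinearMap.ker (chainDG k (Sing (Fiber π b₀))).d, ΔF ((chainDG k _).cls x) =
      TensorProduct.map (chainDG k _).toHomology (chainDG k _).toHomology (chainComult k _ x.1))
    {ΔBF : (coeffDG k π b₀).Homology →ₗ[k]
        (coeffDG k π b₀).Homology ⊗[k] (coeffDG k π b₀).Homology}
    (hΔBF : (coeffDG k π b₀).IsHomologyComult (coeffComult k (Sing B) (fiberSgn k π b₀) ΔF) ΔBF)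
    {Δ2 : (serreFDG k (singMap π)).E 2 →ₗ[k]
        (serreFDG k (singMap π)).E 2 ⊗[k] (serreFDG k (singMap π)).E 2}
    (hΔ2 : (serreFDG k (singMap π)).IsPageComult 2 (chainComult k (Sing E)) Δ2) :
    TensorProduct.map Φ.toLinearMap Φ.toLinearMap ∘ₗ Δ2 = ΔBF ∘ₗ Φ.toLinearMap := by
  refine serrePage_lhom_ext fun p q x => ?_
  have key : ∃ y ∈ (serreFDG k (singMap π)).num 2 (p, q),
      serreTheta hπ b₀ q y = serreTheta hπ b₀ q x.1 ∧ serreTop hπ b₀ p (chainComult k _ y) =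
        coeffComult k (Sing B) (fiberSgn k π b₀) ΔF (serreTheta hπ b₀ q y) := by
    obtain ⟨T, c, hc, hd, hy, hθ⟩ := exists_sum_fiberParam hπ b₀ L x.2
    refine ⟨_, hy, hθ, ?_⟩
    simp only [map_sum]
    exact Finset.sum_congr rfl fun V _ =>
      serreTop_chainComult_fiberParam hπ b₀ L V.1 (hc V) (hd V) hΔ
  rw [← serreComparison_θ] at key
  exact key.elim fun y hy => (serreComparison hπ b₀).map_comult_eq (isBased_serreFDG _) hΦ hΔ2 hΔBF x
    hy.1 hy.2.1 hy.2.2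

end SecondPage

end SerreSS

theorem mainTheorem2 {k : Type v} [Field k] {E B : Type u} [TopologicalSpace E] [TopologicalSpace B]
    (π : C(E, B)) (hπ : IsSerreFibration π) [SimplyConnectedSpace B] (b₀ : B) :
    -- the Künneth isomorphisms through which the three comultiplications are defined
    Function.Bijective ((chainDG k (Sing (Fiber π b₀))).homologyCross
      (chainDG k (Sing (Fiber π b₀)))) ∧
    Function.Bijective ((coeffDG k π b₀).homologyCross (coeffDG k π b₀)) ∧
    Function.Bijective ((serreFDG k (singMap π)).pageCross (serreFDG k (singMap π)) 2) ∧
    Nonempty (LiftSystem (singMap π)) ∧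
    ∃ (ΔF : FiberHomology k π b₀ →ₗ[k] FiberHomology k π b₀ ⊗[k] FiberHomology k π b₀)
      (ΔBF : (coeffDG k π b₀).Homology →ₗ[k]
        (coeffDG k π b₀).Homology ⊗[k] (coeffDG k π b₀).Homology)
      (Δ2 : (serreFDG k (singMap π)).E 2 →ₗ[k]
        (serreFDG k (singMap π)).E 2 ⊗[k] (serreFDG k (singMap π)).E 2)
      (Φ : (serreFDG k (singMap π)).E 2 ≃ₗ[k] (coeffDG k π b₀).Homology),
      -- the comultiplication of `H_*(F)`
      (chainDG k (Sing (Fiber π b₀))).IsHomologyComult (chainComult k (Sing (Fiber π b₀))) ΔF ∧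
      -- the comultiplication of `H_*(B; H_*(F))`
      (coeffDG k π b₀).IsHomologyComult (coeffComult k (Sing B) (fiberSgn k π b₀) ΔF) ΔBF ∧
      -- the comultiplication of the page `E²`
      (serreFDG k (singMap π)).IsPageComult 2 (chainComult k (Sing E)) Δ2 ∧
      -- the identification of `E²` with `H_*(B; H_*(F))`
      IsInducedByPhi k π b₀ Φ.toLinearMap ∧
      -- `∇² = (φ ⊗ φ) ∘ Δ² ∘ ψ` is the comultiplication of `H_*(B; H_*(F))`
      ∀ L : LiftSystem (singMap π), ∃ Ψ : (coeffDG k π b₀).Homology →ₗ[k]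
          (serreFDG k (singMap π)).E 2,
        IsInducedByPsi k π b₀ L Ψ ∧ Φ.toLinearMap ∘ₗ Ψ = LinearMap.id ∧
        TensorProduct.map Φ.toLinearMap Φ.toLinearMap ∘ₗ Δ2 ∘ₗ Ψ = ΔBF := by
  have := hπ.fibration
  have hK : Function.Bijective ((serreFDG k (singMap π)).pageCross (serreFDG k (singMap π)) 2) :=
    FDG.pageCross_bijective (isBased_serreFDG _) (isBased_serreFDG _) 2
  refine ⟨DG.homologyCross_bijective _ _, DG.homologyCross_bijective _ _, hK,
    nonempty_liftSystem (singMap π), ?_⟩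
  refine ((chainDG k (Sing (Fiber π b₀))).exists_isHomologyComult
    (chainComult k _) tensor_d_chainComult).elim fun ΔF hF => ?_
  refine (exists_isHomologyComult_coeffComult (X := Sing B) (fiberSgn k π b₀)
    ((chainDG k (Sing (Fiber π b₀))).homologySgn_sgn) ΔF).elim fun ΔBF hBF => ?_
  refine (FDG.exists_isPageComult 2 hK (chainComult k (Sing E)) tensor_d_chainComult
    fun _ _ _ hx => chainComult_mem_deg hx).elim fun Δ2 h2 => ?_
  refine (serreComparison (k := k) hπ b₀).exists_equiv.elim fun Φ hΦ => ?_
  refine ⟨ΔF, ΔBF, Δ2, Φ, hF.1, hBF, h2, isInducedByPhi_of_pageCls hπ b₀ hΦ, fun L =>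
    ⟨Φ.symm.toLinearMap, isInducedByPsi_of_pageCls hπ b₀ hΦ L, LinearMap.ext Φ.apply_symm_apply,
      LinearMap.ext fun x => (LinearMap.congr_fun (map_comult_eq hπ b₀ L hΦ hF.2 hBF h2) _).trans
        (congrArg ΔBF (Φ.apply_symm_apply x))⟩⟩
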